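/- **Setting.** Let $\mathbf T^3=(\mathbf R/\mathbf Z)^3$, $\mu>0$, $\nu\in\mathbf C$, and let $\{\rho_m\}_{m\ge -1}$ be a dyadic partition of unity: $\rho_m:\mathbf R^3\to[0,1]$ smooth and radial, $\operatorname{supp}\rho_{-1}\subset B(0,\frac43)$, $\operatorname{supp}\rho_0\subset B(0,\frac83)\setminus B(0,\frac34)$, $\rho_m=\rho_0(2^{-m}\cdot)$ for $m\ge0$, $\sum_{m\ge-1}\rho_m=1$. With $e_k(x)=e^{2\pi i k\cdot x}$ put $\Delta_m f=\sum_{k\in\mathbf Z^3}\rho_m(k)\hat f(k)e_k$. For $\alpha\in\mathbf R$, $\mathcal C^\alpha$ is the completion (inside the distributions) of $C^\infty(\mathbf T^3,\mathbf C)$ under $\|f\|_{\mathcal C^\alpha}=\sup_{m\ge-1}2^{m\alpha}\|\Delta_m f\|_{L^\infty}$. Put $$f\prec g=\sum_{m_1+2\le m_2}\Delta_{m_1}f\,\Delta_{m_2}g,\quad f\succ g=g\prec f,\quad f\odot g=\sum_{|m_1-m_2|\le1}\Delta_{m_1}f\,\Delta_{m_2}g,\quad fg=f\prec g+f\odot g+f\succ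 g,$$ and let $R$ be the continuous extension of $R(f,g,h)=(f\prec g)\odot h-f(g\odot h)$ from smooth functions to $\mathcal C^\alpha\times\mathcal C^\beta\times\mathcal C^\gamma$ ($0<\alpha<1$, $\beta+\gamma<0<\alpha+\beta+\gamma$). Let $P_t=e^{t\{(i+\mu)\triangle-1\}}$ and $I(u_0,f)_t=P_tu_0+\int_0^tP_{t-s}f_s\,ds$. **Path spaces.** For $T>0$: $C_T\mathcal C^\alpha$ is the space of continuous $u:[0,T]\to\mathcal C^\alpha$ with the supremum norm; $C^\delta_T\mathcal C^\alpha$ that of the $\delta$-Hölder continuous ones, with the seminorm $\sup_{0\le s<t\le T}\|u_t-u_s\|_{\mathcal C^\alpha}/|t-s|^\delta$; $\mathcal E^\eta_T\mathcal C^\alpha$ and $\mathcal E^{\eta,\delta}_T\mathcal C^\alpha$ consist of the continuous $u:(0,T]\to\mathcal C^\alpha$ with finite $\sup_{0<t\le T}t^\eta\|u_t\|_{\mathcal C^\alpha}$, respectively $\sup_{0<s<t\le T}s^\eta\|u_t-u_s\|_{\mathcal C^\alpha}/|t-s|^\delta$. Put $\mathcal L^{\alpha,\delta}_T=C_T\mathcal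 C^\alpha\cap C^\delta_T\mathcal C^{\alpha-2\delta}$ and $\mathcal L^{\eta,\alpha,\delta}_T=\mathcal E^\eta_T\mathcal C^\alpha\cap C_T\mathcal C^{\alpha-2\eta}\cap\mathcal E^{\eta,\delta}_T\mathcal C^{\alpha-2\delta}$; intersections and products carry the sum of the norms. For $0<\kappa<\kappa'<1/18$ let $$\mathcal D^{\kappa,\kappa'}_T=\mathcal L_T^{\frac56-\kappa',\,1-\kappa',\,1-\frac12\kappa'}\times\mathcal L_T^{1-\kappa'+\kappa,\,\frac32-2\kappa',\,1-\kappa'}.$$ **Driving vectors.** $\mathcal X^\kappa_T$ is the set of vectors $X$ with components $Z=X^{A}\in C_T\mathcal C^{-\frac12-\kappa}$; $X^{AA},X^{AB}\in C_T\mathcal C^{-1-\kappa}$; $X^{IAA},X^{IAB}\in C_T\mathcal C^{1-\kappa}$; $W=X^{IAAB}\in\mathcal L_T^{\frac12-\kappa,\frac14-\frac12\kappa}$; $X^{IAAB,A},X^{IAAB,B},X^{IAA,AB},X^{IAA,BB},X^{IAB,AB},X^{IAB,BB}\in C_T\mathcal C^{-\kappa}$; $X^{IAAB,AB},X^{IAAB,BB}\in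 C_T\mathcal C^{-\frac12-\kappa}$, such that $I(X^{IAA}_0,X^{AA})=X^{IAA}$ and $I(X^{IAB}_0,X^{AB})=X^{IAB}$ on $[0,T]$. Its norm is the sum of the norms of the components. Define $$WZ=W\prec Z+W\succ Z+X^{IAAB,A},\qquad W\bar Z=W\prec\bar Z+W\succ\bar Z+X^{IAAB,B},\qquad \bar WZ=\overline{W\bar Z},$$ $$W^2\bar Z=2WX^{IAAB,B}+R(W,\bar Z,W)+(W\prec\bar Z)\prec W+(W\prec\bar Z)\succ W+W(W\succ\bar Z),$$ $$W\bar WZ=\bar WX^{IAAB,A}+W\overline{X^{IAAB,B}}+R(\bar W,Z,W)+(\bar W\prec Z)\prec W+(\bar W\prec Z)\succ W+W(\bar W\succ Z).$$ **The system.** Let $v_0\in\mathcal C^{-\frac23+\kappa'}$, $w_0\in\mathcal C^{-\frac12-2\kappa}$, $(v,w)\in\mathcal D_T^{\kappa,\kappa'}$, $u=v+w$. Set $$F(v,w)=-\nu\{2(-\nu W+u)\prec X^{AB}+(-\bar\nu\bar W+\bar u)\prec X^{AA}\},\qquad \mathcal M^1(v,w)=I(v_0,F(v,w)),$$ $$\mathrm{com}=\mathcal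 M^1(v,w)+\nu\{2(-\nu W+u)\prec X^{IAB}+(-\bar\nu\bar W+\bar u)\prec X^{IAA}\},$$ $G=G_1+\dots+G_8$ with - $G_1=-\nu u^2\bar u$, $\quad G_2=-\nu\{u^2(\bar Z-\bar\nu\bar W)+2u\bar u(Z-\nu W)\}$, - $G_3=-\nu\{u(2\nu\bar\nu W\bar W-2\nu W\bar Z-2\bar\nu\bar WZ-4\nu X^{IAB,AB}-\bar\nu\overline{X^{IAA,BB}})+\bar u(\nu^2W^2-2\nu WZ-2\bar\nu\overline{X^{IAB,BB}}-2\nu X^{IAA,AB})\}+(\nu+1)u$, - $G_4=-\nu\{-\nu^2\bar\nu W^2\bar W+\nu^2W^2\bar Z+2\nu\bar\nu W\bar WZ+4\nu^2WX^{IAB,AB}+4\nu^2R(W,X^{IAB},X^{AB})+2\bar\nu^2\bar W\overline{X^{IAB,BB}}+2\bar\nu^2R(\bar W,\overline{X^{IAB}},X^{AA})+2\nu\bar\nu\bar WX^{IAA,AB}+2\nu\bar\nu R(\bar W,X^{IAA},X^{AB})+\nu\bar\nu W\overline{X^{IAA,BB}}+\nu\bar\nu R(W,\overline{X^{IAA}},X^{AA})-2\nu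 X^{IAAB,AB}-2\nu W\succ X^{AB}-\bar\nu\overline{X^{IAAB,BB}}-\bar\nu\bar W\succ X^{AA}\}+(\nu+1)(Z-\nu W)$, - $G_5=-\nu\{-4\nu R(u,X^{IAB},X^{AB})-2\nu R(\bar u,X^{IAA},X^{AB})-2\bar\nu R(\bar u,\overline{X^{IAB}},X^{AA})-\bar\nu R(u,\overline{X^{IAA}},X^{AA})\}$, - $G_6=-\nu\{2\,\mathrm{com}\odot X^{AB}+\overline{\mathrm{com}}\odot X^{AA}\}$, $\quad G_7=-\nu\{2w\odot X^{AB}+\bar w\odot X^{AA}\}$, $\quad G_8=-\nu\{2u\succ X^{AB}+\bar u\succ X^{AA}\}$, and $\mathcal M^2(v,w)=I(w_0,G(v,w))$. A solution on $[0,T]$ with data $(v_0,w_0,X)$ is a pair $(v,w)\in\mathcal D^{\kappa,\kappa'}_T$ with $(v,w)=(\mathcal M^1(v,w),\mathcal M^2(v,w))$ on $[0,T]$. **Theorem.** Let $0<\kappa<\kappa'<1/18$. There is a continuous function $\tilde T_*:\mathcal C^{-\frac23+\kappa'}\times\mathcal C^{-\frac12-2\kappa}\times\mathcal X_1^\kappa\to(0,1]$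 such that: 1. For all $(v_0,w_0)\in\mathcal C^{-\frac23+\kappa'}\times\mathcal C^{-\frac12-2\kappa}$ and $X\in\mathcal X_1^\kappa$, with $T_*=\tilde T_*(v_0,w_0,X)$, there is a unique solution $(v,w)\in\mathcal D^{\kappa,\kappa'}_{T_*}$ on $[0,T_*]$ with data $(v_0,w_0,X)$, and $$\|(v,w)\|_{\mathcal D^{\kappa,\kappa'}_{T_*}}\le C\,(1+\|v_0\|_{\mathcal C^{-\frac23+\kappa'}}+\|w_0\|_{\mathcal C^{-\frac12-2\kappa}}),$$ where $C>0$ depends only on $\mu,\nu,\kappa,\kappa'$, the fixed partition of unity, $T_*$ and $\|X\|_{\mathcal X_1^\kappa}$. 2. If $(v_0^{(n)},w_0^{(n)})\to(v_0,w_0)$ in $\mathcal C^{-\frac23+\kappa'}\times\mathcal C^{-\frac12-2\kappa}$ and $X^{(n)}\to X$ in $\mathcal X_1^\kappa$, and $(v^{(n)},w^{(n)})$, $(v,w)$ are the corresponding solutions on $[0,\tilde T_*(v_0^{(n)},w_0^{(n)},X^{(n)})]$ and $[0,T_*]$, $T_*=\tilde T_*(v_0,w_0,X)$, then for every $0<t<T_*$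 $$\lim_{n\to\infty}\|(v^{(n)},w^{(n)})-(v,w)\|_{\mathcal D_t^{\kappa,\kappa'}}=0.$$ (For all large $n$ the $n$-th solution is defined on $[0,t]$.) -/

import Mathlib

open scoped ENNReal ContDiff Topology ComplexConjugate

noncomputable section

namespace CGL

/-! ### Distributions on the torus `(ℝ/ℤ)³`, dyadic partitions of unity, Besov-Hölder spaces -/

/-- Points of the lattice `ℤ³`. -/
abbrev Freq := Fin 3 → ℤ

/-- The torus `(ℝ/ℤ)³`. -/
abbrev Torus := UnitAddTorus (Fin 3)

/-- The lattice point `k` as a point of `ℝ³` with its Euclidean norm. -/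
def toR (k : Freq) : EuclideanSpace ℝ (Fin 3) := WithLp.toLp 2 (fun i => (k i : ℝ))

/-- A distribution on the torus is represented by the family `(a k)` of its Fourier coefficients,
i.e. `a` stands for `∑ k, a k e_k` with `e_k x = exp (2 π i k ⋅ x)`. -/
abbrev Distr := Freq → ℂ

/-- A path of distributions, indexed by time. Only the values on the time interval under
consideration matter. -/
abbrev Path := ℝ → Distr

/-- A dyadic partition of unity `χ_{-1} = low`, `χ_m = ann (2^{-m} ·)` for `m ≥ 0`. -/
structure DyadicPartition where
  low : EuclideanSpace ℝ (Fin 3) → ℝ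
  ann : EuclideanSpace ℝ (Fin 3) → ℝ
  low_smooth : ContDiff ℝ ∞ low
  ann_smooth : ContDiff ℝ ∞ ann
  low_radial : ∀ x y, ‖x‖ = ‖y‖ → low x = low y
  ann_radial : ∀ x y, ‖x‖ = ‖y‖ → ann x = ann y
  low_mem : ∀ x, low x ∈ Set.Icc (0 : ℝ) 1
  ann_mem : ∀ x, ann x ∈ Set.Icc (0 : ℝ) 1
  low_supp : tsupport low ⊆ Metric.ball 0 (4 / 3)
  ann_supp : tsupport ann ⊆ Metric.ball 0 (8 / 3) \ Metric.ball 0 (3 / 4)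
  sum_eq_one : ∀ x, HasSum (fun m : ℕ => ann (((2 : ℝ) ^ m)⁻¹ • x)) (1 - low x)

/-- The element of the partition of unity with label `m = n - 1 ≥ -1`. The natural number `n`
always stands for the label `m = n - 1`. -/
def DyadicPartition.weight (χ : DyadicPartition) : ℕ → EuclideanSpace ℝ (Fin 3) → ℝ
  | 0 => χ.low
  | n + 1 => fun x => χ.ann (((2 : ℝ) ^ n)⁻¹ • x)

/-- Littlewood-Paley block `Δ_m a` (`m = n - 1`) as a (finite) Fourier series. -/
def block (χ : DyadicPartition) (n : ℕ) (a : Distr) : Distr :=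
  fun k => (χ.weight n (toR k) : ℂ) * a k

/-- The block `Δ_m a` (`m = n - 1`) as a function on the torus; the sum has finitely many nonzero
terms. -/
def blockFun (χ : DyadicPartition) (n : ℕ) (a : Distr) (x : Torus) : ℂ :=
  ∑' k : Freq, block χ n a k * UnitAddTorus.mFourier k x

/-- The Besov-Hölder norm `sup_{m ≥ -1} 2^{mα} ‖Δ_m a‖_{L^∞}`, with values in `[0,∞]`. -/
def bnorm (χ : DyadicPartition) (α : ℝ) (a : Distr) : ℝ≥0∞ :=
  ⨆ n : ℕ, ENNReal.ofReal ((2 : ℝ) ^ (((n : ℝ) - 1) * α)) * ⨆ x : Torus, ‖blockFun χ n a x‖ₑ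

/-- Smooth complex functions on the torus. -/
def IsSmooth (f : Torus → ℂ) : Prop :=
  ContDiff ℝ ∞ (fun x : Fin 3 → ℝ => f (fun i => (x i : UnitAddCircle)))

/-- Membership in `C^α`, the completion of the smooth functions under `bnorm α`, realized inside the
space of distributions as the closure of the smooth functions. -/
def MemC (χ : DyadicPartition) (α : ℝ) (a : Distr) : Prop :=
  ∀ ε : ℝ, 0 < ε → ∃ f : Torus → ℂ, IsSmooth f ∧
    bnorm χ α (a - UnitAddTorus.mFourierCoeff f) ≤ ENNReal.ofReal ε

/-! ### Elementary facts on the norm -/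

lemma finite_freq (R : ℝ) : {k : Freq | ‖toR k‖ < R}.Finite := by
  refine (Set.finite_Icc (fun _ : Fin 3 => -⌈R⌉) (fun _ => ⌈R⌉)).subset ?_
  intro k hk
  have h : ∀ i, |(k i : ℝ)| ≤ R := fun i => by
    have h1 : ‖(toR k) i‖ ≤ ‖toR k‖ := PiLp.norm_apply_le (toR k) i
    have h2 : (toR k) i = (k i : ℝ) := rfl
    rw [h2, Real.norm_eq_abs] at h1
    exact h1.trans (le_of_lt hk)
  refine ⟨fun i => ?_, fun i => ?_⟩
  · have h1 := (abs_le.1 (h i)).1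
    have h2 := Int.le_ceil R
    have h3 : ((-⌈R⌉ : ℤ) : ℝ) ≤ (k i : ℝ) := by push_cast; linarith
    exact_mod_cast h3
  · have h1 := (abs_le.1 (h i)).2
    have h2 := Int.le_ceil R
    have h3 : (k i : ℝ) ≤ ((⌈R⌉ : ℤ) : ℝ) := by linarith
    exact_mod_cast h3

lemma weight_eq_zero (χ : DyadicPartition) (n : ℕ) (x : EuclideanSpace ℝ (Fin 3))
    (hx : 2 ^ n * (8 / 3) ≤ ‖x‖) : χ.weight n x = 0 := by
  cases n with
  | zero =>
    refine image_eq_zero_of_notMem_tsupport fun h => ?_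
    have h1 := χ.low_supp h
    rw [mem_ball_zero_iff] at h1
    norm_num at hx
    linarith
  | succ n =>
    refine image_eq_zero_of_notMem_tsupport (f := χ.ann) fun h => ?_
    have h1 := (χ.ann_supp h).1
    rw [mem_ball_zero_iff, norm_smul, norm_inv, norm_pow, Real.norm_eq_abs, abs_two,
      inv_mul_lt_iff₀ (by positivity)] at h1
    have h2 : (0 : ℝ) < 2 ^ n := by positivity
    rw [pow_succ] at hx
    nlinarith

lemma summable_block (χ : DyadicPartition) (n : ℕ) (a : Distr) (x : Torus) :
    Summable (fun k : Freq => block χ n a k * UnitAddTorus.mFourier k x) := by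
  refine summable_of_hasFiniteSupport ((finite_freq (2 ^ n * (8 / 3))).subset ?_)
  intro k hk
  by_contra h
  simp only [Set.mem_ofPred_eq, not_lt] at h
  exact hk (by simp [block, weight_eq_zero χ n _ h])

lemma blockFun_add (χ : DyadicPartition) (n : ℕ) (a b : Distr) (x : Torus) :
    blockFun χ n (a + b) x = blockFun χ n a x + blockFun χ n b x := by
  unfold blockFun
  rw [← (summable_block χ n a x).tsum_add (summable_block χ n b x)]
  refine tsum_congr fun k => ?_
  simp only [block, Pi.add_apply]
  ring

lemma blockFun_neg (χ : DyadicPartition) (n : ℕ) (a : Distr) (x : Torus) :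
    blockFun χ n (-a) x = -blockFun χ n a x := by
  unfold blockFun
  rw [← tsum_neg]
  refine tsum_congr fun k => ?_
  simp only [block, Pi.neg_apply]
  ring

lemma bnorm_zero (χ : DyadicPartition) (α : ℝ) : bnorm χ α 0 = 0 := by
  simp [bnorm, blockFun, block]

lemma bnorm_neg (χ : DyadicPartition) (α : ℝ) (a : Distr) : bnorm χ α (-a) = bnorm χ α a := by
  simp [bnorm, blockFun_neg]

lemma bnorm_add_le (χ : DyadicPartition) (α : ℝ) (a b : Distr) :
    bnorm χ α (a + b) ≤ bnorm χ α a + bnorm χ α b := by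
  unfold bnorm
  refine iSup_le fun n => ?_
  refine le_trans ?_ (add_le_add
    (le_iSup (fun n : ℕ => ENNReal.ofReal ((2 : ℝ) ^ (((n : ℝ) - 1) * α)) *
      ⨆ x : Torus, ‖blockFun χ n a x‖ₑ) n)
    (le_iSup (fun n : ℕ => ENNReal.ofReal ((2 : ℝ) ^ (((n : ℝ) - 1) * α)) *
      ⨆ x : Torus, ‖blockFun χ n b x‖ₑ) n))
  rw [← mul_add]
  refine mul_le_mul_right (iSup_le fun x => ?_) _
  rw [blockFun_add]
  exact (enorm_add_le _ _).trans (add_le_add (le_iSup (fun x => ‖blockFun χ n a x‖ₑ) x)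
    (le_iSup (fun x => ‖blockFun χ n b x‖ₑ) x))

/-- The space `C^α`. -/
def CSpace (χ : DyadicPartition) (α : ℝ) : Type := {a : Distr // MemC χ α a}

/-- The metric of `C^α` is the one of the norm `bnorm α`. -/
instance (χ : DyadicPartition) (α : ℝ) : PseudoEMetricSpace (CSpace χ α) where
  edist a b := bnorm χ α (a.1 - b.1)
  edist_self a := by simp [bnorm_zero]
  edist_comm a b := by rw [← bnorm_neg, neg_sub]
  edist_triangle a b c := by
    have h := bnorm_add_le χ α (a.1 - b.1) (b.1 - c.1)
    rwa [sub_add_sub_cancel] at h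

/-! ### Products, paraproducts and the commutator -/

/-- Complex conjugation of distributions. -/
def bar (a : Distr) : Distr := fun k => conj (a (-k))

/-- Fourier coefficients of a product: convolution. It is only applied to blocks, whose Fourier
coefficients have finite support. -/
def conv (a b : Distr) : Distr := fun k => ∑' j : Freq, a j * b (k - j)

/-- The paraproduct `a ≺ b = ∑_{m₁ + 2 ≤ m₂} Δ_{m₁} a Δ_{m₂} b`. The paraproduct `a ≻ b` is
`para χ b a`. -/
def para (χ : DyadicPartition) (a b : Distr) : Distr :=
  fun k => ∑' p : {p : ℕ × ℕ // p.1 + 2 ≤ p.2}, conv (block χ p.1.1 a) (block χ p.1.2 b) k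

/-- The resonant product `a ⊙ b = ∑_{|m₁ - m₂| ≤ 1} Δ_{m₁} a Δ_{m₂} b`. -/
def reso (χ : DyadicPartition) (a b : Distr) : Distr :=
  fun k => ∑' p : {p : ℕ × ℕ // p.1 ≤ p.2 + 1 ∧ p.2 ≤ p.1 + 1},
    conv (block χ p.1.1 a) (block χ p.1.2 b) k

/-- The product `a b = a ≺ b + a ⊙ b + a ≻ b`. -/
def prod (χ : DyadicPartition) (a b : Distr) : Distr := para χ a b + reso χ a b + para χ b a

/-- `R(a,b,c) = (a ≺ b) ⊙ c - a (b ⊙ c)` for smooth `a, b, c`. -/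
def commSmooth (χ : DyadicPartition) (a b c : Distr) : Distr :=
  reso χ (para χ a b) c - prod χ a (reso χ b c)

/-- The smooth approximation `∑_{m ≤ N - 2} Δ_m a`, i.e. the sum of the first `N` blocks. -/
def trunc (χ : DyadicPartition) (N : ℕ) (a : Distr) : Distr := ∑ n ∈ Finset.range N, block χ n a

/-- The continuous extension of the commutator `R` to Besov-Hölder spaces, evaluated along the smooth
approximations `trunc χ N`, which converge to the identity on every `C^α`. -/
def comm (χ : DyadicPartition) (a b c : Distr) : Distr :=
  fun k => Filter.limUnder Filter.atTop
    (fun N : ℕ => commSmooth χ (trunc χ N a) (trunc χ N b) (trunc χ N c) k)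

/-! ### The semigroup -/

/-- `P_t a` for the semigroup `P_t = exp (t ((i + μ) Δ - 1))`. -/
def heat (μ t : ℝ) (a : Distr) : Distr :=
  fun k => Complex.exp (-((t : ℂ) * ((Complex.I + (μ : ℂ)) *
    ((4 * Real.pi ^ 2 * ‖toR k‖ ^ 2 : ℝ) : ℂ) + 1))) * a k

/-- `I(u₀,f)_t = P_t u₀ + ∫_0^t P_{t-s} f_s ds`, as an integral of distributions. -/
def duhamel (μ : ℝ) (u₀ : Distr) (f : Path) : Path :=
  fun t k => heat μ t u₀ k + ∫ s in (0 : ℝ)..t, heat μ (t - s) (f s) k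

/-! ### Spaces of paths -/

/-- Continuity of a path of elements of `C^α` on the set `S` of times. -/
def ContPath (χ : DyadicPartition) (S : Set ℝ) (α : ℝ) (u : Path) : Prop :=
  (∀ t ∈ S, MemC χ α (u t)) ∧
    ∀ t ∈ S, Filter.Tendsto (fun s => bnorm χ α (u s - u t)) (𝓝[S] t) (𝓝 0)

/-- The norm of `C_T C^α`. -/
def supNorm (χ : DyadicPartition) (T α : ℝ) (u : Path) : ℝ≥0∞ :=
  ⨆ t ∈ Set.Icc (0 : ℝ) T, bnorm χ α (u t)

/-- The seminorm of `C_T^δ C^α`. -/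
def holderNorm (χ : DyadicPartition) (T δ α : ℝ) (u : Path) : ℝ≥0∞ :=
  ⨆ (s : ℝ) (t : ℝ) (_ : 0 ≤ s ∧ s < t ∧ t ≤ T),
    bnorm χ α (u t - u s) / ENNReal.ofReal ((t - s) ^ δ)

/-- The norm of `E_T^η C^α`. -/
def expNorm (χ : DyadicPartition) (T η α : ℝ) (u : Path) : ℝ≥0∞ :=
  ⨆ t ∈ Set.Ioc (0 : ℝ) T, ENNReal.ofReal (t ^ η) * bnorm χ α (u t)

/-- The norm of `E_T^{η,δ} C^α`. -/
def expHolderNorm (χ : DyadicPartition) (T η δ α : ℝ) (u : Path) : ℝ≥0∞ :=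
  ⨆ (s : ℝ) (t : ℝ) (_ : 0 < s ∧ s < t ∧ t ≤ T),
    ENNReal.ofReal (s ^ η) * (bnorm χ α (u t - u s) / ENNReal.ofReal ((t - s) ^ δ))

/-- `u ∈ C_T C^α`. -/
def MemSup (χ : DyadicPartition) (T α : ℝ) (u : Path) : Prop := ContPath χ (Set.Icc 0 T) α u

/-- `u ∈ C_T^δ C^α`. -/
def MemHolder (χ : DyadicPartition) (T δ α : ℝ) (u : Path) : Prop :=
  (∀ t ∈ Set.Icc (0 : ℝ) T, MemC χ α (u t)) ∧ holderNorm χ T δ α u < ⊤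

/-- `u ∈ E_T^η C^α`. -/
def MemExp (χ : DyadicPartition) (T η α : ℝ) (u : Path) : Prop :=
  ContPath χ (Set.Ioc 0 T) α u ∧ expNorm χ T η α u < ⊤

/-- `u ∈ E_T^{η,δ} C^α`. -/
def MemExpHolder (χ : DyadicPartition) (T η δ α : ℝ) (u : Path) : Prop :=
  ContPath χ (Set.Ioc 0 T) α u ∧ expHolderNorm χ T η δ α u < ⊤

/-- `u ∈ L_T^{α,δ} = C_T C^α ∩ C_T^δ C^{α-2δ}`. -/
def MemL (χ : DyadicPartition) (T α δ : ℝ) (u : Path) : Prop :=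
  MemSup χ T α u ∧ MemHolder χ T δ (α - 2 * δ) u

/-- `u ∈ L_T^{η,α,δ} = E_T^η C^α ∩ C_T C^{α-2η} ∩ E_T^{η,δ} C^{α-2δ}`. -/
def MemLExp (χ : DyadicPartition) (T η α δ : ℝ) (u : Path) : Prop :=
  MemExp χ T η α u ∧ MemSup χ T (α - 2 * η) u ∧ MemExpHolder χ T η δ (α - 2 * δ) u

/-- The norm of `L_T^{η,α,δ}`. -/
def lExpNorm (χ : DyadicPartition) (T η α δ : ℝ) (u : Path) : ℝ≥0∞ :=
  expNorm χ T η α u + supNorm χ T (α - 2 * η) u + expHolderNorm χ T η δ (α - 2 * δ) u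

/-- `(v,w) ∈ D_T^{κ,κ'}`. -/
def MemD (χ : DyadicPartition) (κ κ' T : ℝ) (v w : Path) : Prop :=
  MemLExp χ T (5 / 6 - κ') (1 - κ') (1 - κ' / 2) v ∧
    MemLExp χ T (1 - κ' + κ) (3 / 2 - 2 * κ') (1 - κ') w

/-- The norm of `D_T^{κ,κ'}`. -/
def dNorm (χ : DyadicPartition) (κ κ' T : ℝ) (v w : Path) : ℝ≥0∞ :=
  lExpNorm χ T (5 / 6 - κ') (1 - κ') (1 - κ' / 2) v +
    lExpNorm χ T (1 - κ' + κ) (3 / 2 - 2 * κ') (1 - κ') w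

/-! ### Driving vectors -/

/-- Labels of the components of a driving vector. Formally `A` stands for `Z`, `AA` for `Z²`, `AB`
for `Z Z̄`, a leading `I` for the integration `I`, and `o` separates the factors of a resonant
product (with `B` for `Z̄`, `BB` for `Z̄²`). -/
inductive Label
  | A | AA | AB | IAA | IAB | IAAB
  | IAABoA | IAABoB | IAAoAB | IAAoBB | IABoAB | IABoBB
  | IAABoAB | IAABoBB
  deriving DecidableEq

instance : Fintype Label where
  elems := {.A, .AA, .AB, .IAA, .IAB, .IAAB, .IAABoA, .IAABoB, .IAAoAB, .IAAoBB, .IABoAB, .IABoBB,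
    .IAABoAB, .IAABoBB}
  complete τ := by cases τ <;> decide

/-- Regularities of the components. -/
def Label.reg (κ : ℝ) : Label → ℝ
  | .A => -1 / 2 - κ
  | .AA => -1 - κ
  | .AB => -1 - κ
  | .IAA => 1 - κ
  | .IAB => 1 - κ
  | .IAAB => 1 / 2 - κ
  | .IAABoA => -κ
  | .IAABoB => -κ
  | .IAAoAB => -κ
  | .IAAoBB => -κ
  | .IABoAB => -κ
  | .IABoBB => -κ
  | .IAABoAB => -1 / 2 - κ
  | .IAABoBB => -1 / 2 - κ

/-- `X` is a driving vector on `[0,T]`. -/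
def IsDriver (χ : DyadicPartition) (μ κ T : ℝ) (X : Label → Path) : Prop :=
  (∀ τ, MemSup χ T (τ.reg κ) (X τ)) ∧
  MemL χ T (1 / 2 - κ) (1 / 4 - κ / 2) (X .IAAB) ∧
  (∀ t ∈ Set.Icc (0 : ℝ) T, duhamel μ (X .IAA 0) (X .AA) t = X .IAA t) ∧
  (∀ t ∈ Set.Icc (0 : ℝ) T, duhamel μ (X .IAB 0) (X .AB) t = X .IAB t)

/-- The norm of driving vectors: the sum of the norms of the components, the one of the component
`IAAB` being the norm of `L_T^{1/2-κ,1/4-κ/2}`. -/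
def driverNorm (χ : DyadicPartition) (κ T : ℝ) (X : Label → Path) : ℝ≥0∞ :=
  (∑ τ, supNorm χ T (τ.reg κ) (X τ)) +
    holderNorm χ T (1 / 4 - κ / 2) (1 / 2 - κ - 2 * (1 / 4 - κ / 2)) (X .IAAB)

lemma supNorm_add_le (χ : DyadicPartition) (T α : ℝ) (u v : Path) :
    supNorm χ T α (u + v) ≤ supNorm χ T α u + supNorm χ T α v :=
  iSup₂_le fun t ht => (bnorm_add_le χ α (u t) (v t)).trans
    (add_le_add (le_iSup₂ (f := fun t (_ : t ∈ Set.Icc (0 : ℝ) T) => bnorm χ α (u t)) t ht)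
      (le_iSup₂ (f := fun t (_ : t ∈ Set.Icc (0 : ℝ) T) => bnorm χ α (v t)) t ht))

lemma holderNorm_add_le (χ : DyadicPartition) (T δ α : ℝ) (u v : Path) :
    holderNorm χ T δ α (u + v) ≤ holderNorm χ T δ α u + holderNorm χ T δ α v := by
  refine iSup_le fun s => iSup_le fun t => iSup_le fun h => ?_
  have h1 : (u + v) t - (u + v) s = (u t - u s) + (v t - v s) := by
    simp only [Pi.add_apply]; abel
  have key : ∀ w : Path, bnorm χ α (w t - w s) / ENNReal.ofReal ((t - s) ^ δ) ≤
      holderNorm χ T δ α w := fun w => le_iSup_of_le s (le_iSup_of_le t (le_iSup_of_le h le_rfl))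
  rw [h1]
  refine le_trans (ENNReal.div_le_div_right (bnorm_add_le χ α _ _) _) ?_
  rw [ENNReal.add_div]
  exact add_le_add (key u) (key v)

lemma driverNorm_add_le (χ : DyadicPartition) (κ T : ℝ) (X Y : Label → Path) :
    driverNorm χ κ T (X + Y) ≤ driverNorm χ κ T X + driverNorm χ κ T Y := by
  unfold driverNorm
  refine (add_le_add (Finset.sum_le_sum fun τ _ => supNorm_add_le χ T (τ.reg κ) (X τ) (Y τ))
    (holderNorm_add_le χ T _ _ (X .IAAB) (Y .IAAB))).trans (le_of_eq ?_)
  rw [Finset.sum_add_distrib]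
  abel

lemma driverNorm_neg (χ : DyadicPartition) (κ T : ℝ) (X : Label → Path) :
    driverNorm χ κ T (-X) = driverNorm χ κ T X := by
  have h1 : ∀ (α : ℝ) (u : Path), supNorm χ T α (-u) = supNorm χ T α u := fun α u => by
    simp [supNorm, bnorm_neg]
  have h2 : ∀ (δ α : ℝ) (u : Path), holderNorm χ T δ α (-u) = holderNorm χ T δ α u :=
    fun δ α u => by
      have h3 : ∀ s t, (-u) t - (-u) s = -(u t - u s) := fun s t => by
        simp only [Pi.neg_apply]; abel
      simp only [holderNorm, h3, bnorm_neg]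
  simp [driverNorm, h1, h2]

lemma driverNorm_zero (χ : DyadicPartition) (κ T : ℝ) : driverNorm χ κ T 0 = 0 := by
  simp [driverNorm, supNorm, holderNorm, bnorm_zero]

/-- The space of driving vectors on `[0,T]`. Two elements that agree on `[0,T]` have distance zero. -/
def Driver (χ : DyadicPartition) (μ κ T : ℝ) : Type :=
  {X : Label → Path // IsDriver χ μ κ T X}

/-- The metric on driving vectors is the one of the norm. -/
instance (χ : DyadicPartition) (μ κ T : ℝ) : PseudoEMetricSpace (Driver χ μ κ T) where
  edist X Y := driverNorm χ κ T (X.1 - Y.1)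
  edist_self X := by simp [driverNorm_zero]
  edist_comm X Y := by rw [← driverNorm_neg, neg_sub]
  edist_triangle X Y Z := by
    have h := driverNorm_add_le χ κ T (X.1 - Y.1) (Y.1 - Z.1)
    rwa [sub_add_sub_cancel] at h

/-! ### The system

In this part `x` is the value of a driving vector at some time, `Z = x A`, `W = x IAAB`, and `u` is
the value of `v + w` at that time. -/

/-- `F(v,w)`. -/
def F (χ : DyadicPartition) (ν : ℂ) (x : Label → Distr) (u : Distr) : Distr :=
  -ν • ((2 : ℂ) • para χ (-ν • x .IAAB + u) (x .AB)
    + para χ (-conj ν • bar (x .IAAB) + bar u) (x .AA))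

/-- The product `W Z`. -/
def WZ (χ : DyadicPartition) (x : Label → Distr) : Distr :=
  para χ (x .IAAB) (x .A) + para χ (x .A) (x .IAAB) + x .IAABoA

/-- The product `W Z̄`; the product `W̄ Z` is its complex conjugate. -/
def WZbar (χ : DyadicPartition) (x : Label → Distr) : Distr :=
  para χ (x .IAAB) (bar (x .A)) + para χ (bar (x .A)) (x .IAAB) + x .IAABoB

/-- The product `W² Z̄`. -/
def WWZbar (χ : DyadicPartition) (x : Label → Distr) : Distr :=
  (2 : ℂ) • prod χ (x .IAAB) (x .IAABoB)
    + comm χ (x .IAAB) (bar (x .A)) (x .IAAB)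
    + (para χ (para χ (x .IAAB) (bar (x .A))) (x .IAAB)
      + para χ (x .IAAB) (para χ (x .IAAB) (bar (x .A))))
    + prod χ (x .IAAB) (para χ (bar (x .A)) (x .IAAB))

/-- The product `W W̄ Z`. -/
def WWbarZ (χ : DyadicPartition) (x : Label → Distr) : Distr :=
  prod χ (bar (x .IAAB)) (x .IAABoA)
    + prod χ (x .IAAB) (bar (x .IAABoB))
    + comm χ (bar (x .IAAB)) (x .A) (x .IAAB)
    + (para χ (para χ (bar (x .IAAB)) (x .A)) (x .IAAB)
      + para χ (x .IAAB) (para χ (bar (x .IAAB)) (x .A)))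
    + prod χ (x .IAAB) (para χ (x .A) (bar (x .IAAB)))

def G1 (χ : DyadicPartition) (ν : ℂ) (u : Distr) : Distr :=
  -ν • prod χ (prod χ u u) (bar u)

def G2 (χ : DyadicPartition) (ν : ℂ) (x : Label → Distr) (u : Distr) : Distr :=
  -ν • (prod χ (prod χ u u) (bar (x .A) - conj ν • bar (x .IAAB))
    + (2 : ℂ) • prod χ (prod χ u (bar u)) (x .A - ν • x .IAAB))

def G3 (χ : DyadicPartition) (ν : ℂ) (x : Label → Distr) (u : Distr) : Distr :=
  -ν • (prod χ u
        ((2 * ν * conj ν) • prod χ (x .IAAB) (bar (x .IAAB))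
          - (2 * ν) • WZbar χ x
          - (2 * conj ν) • bar (WZbar χ x)
          - (4 * ν) • x .IABoAB
          - conj ν • bar (x .IAAoBB))
      + prod χ (bar u)
        (ν ^ 2 • prod χ (x .IAAB) (x .IAAB)
          - (2 * ν) • WZ χ x
          - (2 * conj ν) • bar (x .IABoBB)
          - (2 * ν) • x .IAAoAB))
    + (ν + 1) • u

def G4 (χ : DyadicPartition) (ν : ℂ) (x : Label → Distr) : Distr :=
  -ν • (-(ν ^ 2 * conj ν) • prod χ (prod χ (x .IAAB) (x .IAAB)) (bar (x .IAAB))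
      + ν ^ 2 • WWZbar χ x
      + (2 * ν * conj ν) • WWbarZ χ x
      + (4 * ν ^ 2) • prod χ (x .IAAB) (x .IABoAB)
      + (4 * ν ^ 2) • comm χ (x .IAAB) (x .IAB) (x .AB)
      + (2 * conj ν ^ 2) • prod χ (bar (x .IAAB)) (bar (x .IABoBB))
      + (2 * conj ν ^ 2) • comm χ (bar (x .IAAB)) (bar (x .IAB)) (x .AA)
      + (2 * ν * conj ν) • prod χ (bar (x .IAAB)) (x .IAAoAB)
      + (2 * ν * conj ν) • comm χ (bar (x .IAAB)) (x .IAA) (x .AB)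
      + (ν * conj ν) • prod χ (x .IAAB) (bar (x .IAAoBB))
      + (ν * conj ν) • comm χ (x .IAAB) (bar (x .IAA)) (x .AA)
      - (2 * ν) • x .IAABoAB
      - (2 * ν) • para χ (x .AB) (x .IAAB)
      - conj ν • bar (x .IAABoBB)
      - conj ν • para χ (x .AA) (bar (x .IAAB)))
    + (ν + 1) • (x .A - ν • x .IAAB)

def G5 (χ : DyadicPartition) (ν : ℂ) (x : Label → Distr) (u : Distr) : Distr :=
  -ν • (-(4 * ν) • comm χ u (x .IAB) (x .AB)
      - (2 * ν) • comm χ (bar u) (x .IAA) (x .AB)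
      - (2 * conj ν) • comm χ (bar u) (bar (x .IAB)) (x .AA)
      - conj ν • comm χ u (bar (x .IAA)) (x .AA))

/-- `c` is the value of `com(v,w)`. -/
def G6 (χ : DyadicPartition) (ν : ℂ) (x : Label → Distr) (c : Distr) : Distr :=
  -ν • ((2 : ℂ) • reso χ c (x .AB) + reso χ (bar c) (x .AA))

/-- `w` is the value of the second unknown. -/
def G7 (χ : DyadicPartition) (ν : ℂ) (x : Label → Distr) (w : Distr) : Distr :=
  -ν • ((2 : ℂ) • reso χ w (x .AB) + reso χ (bar w) (x .AA))

def G8 (χ : DyadicPartition) (ν : ℂ) (x : Label → Distr) (u : Distr) : Distr :=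
  -ν • ((2 : ℂ) • para χ (x .AB) u + para χ (x .AA) (bar u))

/-- The first component of the map `M`. -/
def M1 (χ : DyadicPartition) (μ : ℝ) (ν : ℂ) (v₀ : Distr) (X : Label → Path) (v w : Path) : Path :=
  duhamel μ v₀ (fun s => F χ ν (fun τ => X τ s) (v s + w s))

/-- `com(v,w)`. -/
def com (χ : DyadicPartition) (μ : ℝ) (ν : ℂ) (v₀ : Distr) (X : Label → Path) (v w : Path) : Path :=
  fun t => M1 χ μ ν v₀ X v w t
    + ν • ((2 : ℂ) • para χ (-ν • X .IAAB t + v t + w t) (X .IAB t)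
      + para χ (-conj ν • bar (X .IAAB t) + bar (v t) + bar (w t)) (X .IAA t))

/-- `G(v,w) = G₁(v,w) + ⋯ + G₈(v,w)`. -/
def G (χ : DyadicPartition) (μ : ℝ) (ν : ℂ) (v₀ : Distr) (X : Label → Path) (v w : Path) : Path :=
  fun t =>
    G1 χ ν (v t + w t)
    + G2 χ ν (fun τ => X τ t) (v t + w t)
    + G3 χ ν (fun τ => X τ t) (v t + w t)
    + G4 χ ν (fun τ => X τ t)
    + G5 χ ν (fun τ => X τ t) (v t + w t)
    + G6 χ ν (fun τ => X τ t) (com χ μ ν v₀ X v w t)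
    + G7 χ ν (fun τ => X τ t) (w t)
    + G8 χ ν (fun τ => X τ t) (v t + w t)

/-- The second component of the map `M`. -/
def M2 (χ : DyadicPartition) (μ : ℝ) (ν : ℂ) (v₀ w₀ : Distr) (X : Label → Path) (v w : Path) :
    Path :=
  duhamel μ w₀ (G χ μ ν v₀ X v w)

/-- `(v,w) ∈ D_T^{κ,κ'}` solves the system `(v,w) = M(v,w)` on `[0,T]`. -/
def IsSolution (χ : DyadicPartition) (μ : ℝ) (ν : ℂ) (κ κ' T : ℝ) (v₀ w₀ : Distr)
    (X : Label → Path) (v w : Path) : Prop :=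
  MemD χ κ κ' T v w ∧
  (∀ t ∈ Set.Icc (0 : ℝ) T, v t = M1 χ μ ν v₀ X v w t) ∧
  (∀ t ∈ Set.Icc (0 : ℝ) T, w t = M2 χ μ ν v₀ w₀ X v w t)

end CGL

end

/-!
The system is solved by a contraction argument for the map `M = (M¹, M²)` in a ball of
`D_T^{κ,κ'}`, for a time `T` that depends only on the size of the data.

*Bounds.* All estimates are expressed through `Bd χ α a K`, which says that the Littlewood-Paley
blocks of `a` are bounded by `K 2^{-αn}`. The products are estimated from scratch for Fourier
coefficients: a Fourier multiplier whose symbol is a dilated Schwartz function is an average of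
translates, so it is bounded on `L^∞`, and its commutator with a Lipschitz function gains one power of
the frequency (`exists_schwartz_mult_bound`). This gives the bounds for paraproducts and resonant products, for
the smoothing of the semigroup (`exists_heat_bd`), for the commutator of the semigroup with a
paraproduct (`exists_heatComm_bd`), and for `R` (`exists_comm_bound`); the latter is first proved for
trigonometric polynomials and then extended along truncations. The predicate `Est` bounds two
families of distributions together with their difference, so that boundedness and Lipschitz
continuity of the nonlinearities are obtained in one pass (`estT_F`, `estT_nonlinear`).

*The term `com`.* Both terms of `com` have regularity below `1`, which does not suffice for the
resonant product with `X^{AB}` and `X^{AA}`. With `f = -νW + v + w`, the constraints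
`X^{IAB} = I(X^{IAB}_0, X^{AB})` and `X^{IAA} = I(X^{IAA}_0, X^{AA})` allow `com` to be rewritten
(`Dat.com_eq`) as `P_t v₀` plus remainders `f_t ≺ I(y,x)_t - I(0, f ≺ x)_t`. Such a remainder is a
boundary term `f_t ≺ P_t y` plus the integral over `s < t` of
`(f_t - f_s) ≺ P_{t-s} x_s - [P_{t-s}, f_s ≺] x_s`; the time regularity of `f` and the commutator
estimate make it an element of `C^{1+2κ}` (`estT_com`).

*Contraction.* Then `F` is bounded in `C^{-1-κ}` with weight `t^{-(5/6-κ')}` and `G` in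
`C^{-1/2-2κ}` with weight `t^{-(1-κ'+κ)}`. The Schauder estimate (`exists_heatInt_lb`) bounds the
mild integrals in `D_T^{κ,κ'}` with a positive power of the length of the interval on which the
forcing does not vanish (`exists_map_db`). On short intervals this yields a solution by Picard
iteration and Lipschitz dependence on the data (`exists_local_solution`). Uniqueness holds among all
solutions, whatever their size, as two solutions that agree up to time `τ` agree up to `τ + h` with
`h` depending only on their norms (`Data.IsFixed.unique`).

*Existence time.* An admissible time is available for each integer bound on the size of the data,
and the admissible times for given data form an interval; a partition of unity on the space of data
selects a continuous one (`exists_continuous_time`). If data converge, the solutions on `[0,t]`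
eventually belong to one common ball, because they agree there with the solutions found by the
contraction, and the Lipschitz estimate applies.
-/

noncomputable section

namespace CGL
open MeasureTheory FourierTransform SchwartzMap UnitAddTorus

/-! ### Trigonometric polynomials and Fourier multipliers -/

/-- The Euclidean space `ℝ³`. -/
abbrev Space := EuclideanSpace ℝ (Fin 3)

/-- The value at `x` of the Fourier series with coefficients `a`. -/
def ev (a : Distr) (x : Torus) : ℂ := ∑' k : Freq, a k * mFourier k x

/-- `a` is a trigonometric polynomial. -/
def FinSupp (a : Distr) : Prop := (Function.support a).Finite

/-- The sup norm of the trigonometric polynomial `a` is at most `K`. -/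
def SupLE (a : Distr) (K : ℝ) : Prop := ∀ x, ‖ev a x‖ ≤ K

/-- The projection `ℝ³ → (ℝ/ℤ)³`. -/
def toT (y : Space) : Torus := fun i => ((y i : ℝ) : UnitAddCircle)

/-- `a` is Lipschitz on the torus with constant `L`. -/
def LipLE (a : Distr) (L : ℝ) : Prop := ∀ x y, ‖ev a (x - toT y) - ev a x‖ ≤ L * ‖y‖

/-- The Fourier multiplier with symbol `m`. -/
def mult (m : Freq → ℂ) (a : Distr) : Distr := fun k => m k * a k

lemma blockFun_eq_ev (χ : DyadicPartition) (n : ℕ) (a : Distr) (x : Torus) :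
    blockFun χ n a x = ev (block χ n a) x := rfl

lemma ev_eq_sum {a : Distr} {S : Finset Freq} (h : ∀ k, a k ≠ 0 → k ∈ S) (x : Torus) :
    ev a x = ∑ k ∈ S, a k * mFourier k x :=
  tsum_eq_sum fun k hk => by
    have : a k = 0 := by by_contra h'; exact hk (h k h')
    simp [this]

lemma FinSupp.ev_eq {a : Distr} (h : FinSupp a) (x : Torus) :
    ev a x = ∑ k ∈ h.toFinset, a k * mFourier k x :=
  ev_eq_sum (fun _ hk => (Set.Finite.mem_toFinset h).2 hk) x

lemma FinSupp.of_subset {a : Distr} {s : Set Freq} (hs : s.Finite) (h : ∀ k, a k ≠ 0 → k ∈ s) :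
    FinSupp a := hs.subset fun k hk => h k hk

lemma FinSupp.add {a b : Distr} (ha : FinSupp a) (hb : FinSupp b) : FinSupp (a + b) :=
  FinSupp.of_subset (ha.union hb) fun k hk => by
    by_contra h
    simp only [Set.mem_union, Function.mem_support, not_or, not_not] at h
    exact hk (by simp [h.1, h.2])

lemma FinSupp.neg {a : Distr} (ha : FinSupp a) : FinSupp (-a) :=
  FinSupp.of_subset ha fun k hk => by simpa using hk

lemma FinSupp.sub {a b : Distr} (ha : FinSupp a) (hb : FinSupp b) : FinSupp (a - b) := by
  rw [sub_eq_add_neg]; exact ha.add hb.neg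

lemma finSupp_zero : FinSupp 0 := by simp [FinSupp]

lemma FinSupp.sum {ι : Type*} {s : Finset ι} {f : ι → Distr} (h : ∀ i ∈ s, FinSupp (f i)) :
    FinSupp (∑ i ∈ s, f i) := by
  classical
  induction s using Finset.induction_on with
  | empty => simpa using finSupp_zero
  | insert i s hi ih =>
    rw [Finset.sum_insert hi]
    exact (h i (by simp)).add (ih fun j hj => h j (by simp [hj]))

lemma FinSupp.mult {a : Distr} (ha : FinSupp a) (m : Freq → ℂ) : FinSupp (mult m a) :=
  FinSupp.of_subset ha fun k hk => by
    intro h; exact hk (by simp [CGL.mult, h])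

lemma FinSupp.smul {a : Distr} (ha : FinSupp a) (c : ℂ) : FinSupp (c • a) :=
  FinSupp.of_subset ha fun k hk h => hk (by simp [h])

lemma FinSupp.summable {a : Distr} (ha : FinSupp a) (x : Torus) :
    Summable fun k => a k * mFourier k x :=
  summable_of_hasFiniteSupport (ha.subset fun k hk h => hk (by simp [h]))

lemma ev_add {a b : Distr} (ha : FinSupp a) (hb : FinSupp b) (x : Torus) :
    ev (a + b) x = ev a x + ev b x := by
  unfold ev
  rw [← (ha.summable x).tsum_add (hb.summable x)]
  exact tsum_congr fun k => by simp [add_mul]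

lemma ev_neg (a : Distr) (x : Torus) : ev (-a) x = -ev a x := by
  unfold ev
  rw [← tsum_neg]
  exact tsum_congr fun k => by simp

lemma ev_sub {a b : Distr} (ha : FinSupp a) (hb : FinSupp b) (x : Torus) :
    ev (a - b) x = ev a x - ev b x := by
  rw [sub_eq_add_neg, ev_add ha hb.neg, ev_neg, sub_eq_add_neg]

lemma ev_smul (c : ℂ) (a : Distr) (x : Torus) : ev (c • a) x = c * ev a x := by
  unfold ev
  rw [← tsum_mul_left]
  exact tsum_congr fun k => by simp [mul_assoc]

@[simp] lemma ev_zero (x : Torus) : ev 0 x = 0 := by simp [ev]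

lemma ev_sum {ι : Type*} {s : Finset ι} {f : ι → Distr} (h : ∀ i ∈ s, FinSupp (f i)) (x : Torus) :
    ev (∑ i ∈ s, f i) x = ∑ i ∈ s, ev (f i) x := by
  classical
  induction s using Finset.induction_on with
  | empty => simp
  | insert i s hi ih =>
    rw [Finset.sum_insert hi, Finset.sum_insert hi, ev_add (h i (by simp))
      (FinSupp.sum fun j hj => h j (by simp [hj])), ih fun j hj => h j (by simp [hj])]

lemma SupLE.nonneg {a : Distr} {K : ℝ} (h : SupLE a K) : 0 ≤ K := (norm_nonneg _).trans (h 0)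

lemma SupLE.mono {a : Distr} {K K' : ℝ} (h : SupLE a K) (hK : K ≤ K') : SupLE a K' :=
  fun x => (h x).trans hK

lemma SupLE.add {a b : Distr} {K L : ℝ} (ha : FinSupp a) (hb : FinSupp b) (h : SupLE a K)
    (h' : SupLE b L) : SupLE (a + b) (K + L) := fun x => by
  rw [ev_add ha hb]; exact (norm_add_le _ _).trans (add_le_add (h x) (h' x))

lemma SupLE.neg {a : Distr} {K : ℝ} (h : SupLE a K) : SupLE (-a) K := fun x => by
  rw [ev_neg, norm_neg]; exact h x

lemma SupLE.sub {a b : Distr} {K L : ℝ} (ha : FinSupp a) (hb : FinSupp b) (h : SupLE a K)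
    (h' : SupLE b L) : SupLE (a - b) (K + L) := by
  rw [sub_eq_add_neg]; exact h.add ha hb.neg h'.neg

lemma SupLE.smul {a : Distr} {K : ℝ} (c : ℂ) (h : SupLE a K) : SupLE (c • a) (‖c‖ * K) := fun x => by
  rw [ev_smul, norm_mul]; exact mul_le_mul_of_nonneg_left (h x) (norm_nonneg _)

lemma SupLE.sum {ι : Type*} {s : Finset ι} {f : ι → Distr} {K : ι → ℝ}
    (hf : ∀ i ∈ s, FinSupp (f i)) (h : ∀ i ∈ s, SupLE (f i) (K i)) :
    SupLE (∑ i ∈ s, f i) (∑ i ∈ s, K i) := fun x => by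
  rw [ev_sum hf]
  exact (norm_sum_le _ _).trans (Finset.sum_le_sum fun i hi => h i hi x)

lemma supLE_zero : SupLE 0 0 := fun x => by simp

/-! #### Products -/

lemma conv_eq_sum {a b : Distr} {S : Finset Freq} (h : ∀ k, a k ≠ 0 → k ∈ S) (k : Freq) :
    conv a b k = ∑ j ∈ S, a j * b (k - j) :=
  tsum_eq_sum fun j hj => by
    have : a j = 0 := by by_contra h'; exact hj (h j h')
    simp [this]

lemma conv_ne_zero {a b : Distr} {k : Freq} (h : conv a b k ≠ 0) :
    ∃ j, a j ≠ 0 ∧ b (k - j) ≠ 0 := by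
  by_contra h'
  push Not at h'
  refine h ?_
  have : ∀ j, a j * b (k - j) = 0 := fun j => by
    by_cases hj : a j = 0
    · simp [hj]
    · simp [h' j hj]
  simp [conv, this]

lemma FinSupp.conv {a b : Distr} (ha : FinSupp a) (hb : FinSupp b) : FinSupp (conv a b) := by
  refine FinSupp.of_subset (ha.image2 (fun j l => j + l) hb) fun k hk => ?_
  obtain ⟨j, h1, h2⟩ := conv_ne_zero hk
  exact ⟨j, h1, k - j, h2, by simp⟩

lemma ev_conv {a b : Distr} (ha : FinSupp a) (hb : FinSupp b) (x : Torus) :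
    ev (conv a b) x = ev a x * ev b x := by
  classical
  set S := ha.toFinset
  set U := hb.toFinset
  set V := Finset.image₂ (fun j l => j + l) S U
  have hS : ∀ k, a k ≠ 0 → k ∈ S := fun k hk => (Set.Finite.mem_toFinset ha).2 hk
  have hU : ∀ k, b k ≠ 0 → k ∈ U := fun k hk => (Set.Finite.mem_toFinset hb).2 hk
  have hV : ∀ k, CGL.conv a b k ≠ 0 → k ∈ V := fun k hk => by
    obtain ⟨j, h1, h2⟩ := conv_ne_zero hk
    exact Finset.mem_image₂.2 ⟨j, hS j h1, k - j, hU _ h2, by simp⟩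
  rw [ev_eq_sum hV]
  simp_rw [conv_eq_sum hS, Finset.sum_mul]
  rw [Finset.sum_comm, ev_eq_sum hS, Finset.sum_mul]
  refine Finset.sum_congr rfl fun j hj => ?_
  have h2 : ∑ k ∈ V, a j * b (k - j) * mFourier k x
      = ∑' k, a j * b (k - j) * mFourier k x := by
    refine (tsum_eq_sum fun k hk => ?_).symm
    have : b (k - j) = 0 := by
      by_contra h
      exact hk (Finset.mem_image₂.2 ⟨j, hj, k - j, hU _ h, by simp⟩)
    simp [this]
  rw [h2, ev, ← tsum_mul_left, ← (Equiv.subRight j).tsum_eq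
    (fun k => a j * mFourier j x * (b k * mFourier k x))]
  refine tsum_congr fun k => ?_
  have h3 : mFourier k x = mFourier j x * mFourier (k - j) x := by
    rw [← mFourier_add, add_sub_cancel]
  simp only [Equiv.subRight_apply]
  rw [h3]
  ring

lemma SupLE.conv {a b : Distr} {K L : ℝ} (ha : FinSupp a) (hb : FinSupp b) (h : SupLE a K)
    (h' : SupLE b L) : SupLE (conv a b) (K * L) := fun x => by
  rw [ev_conv ha hb, norm_mul]
  exact mul_le_mul (h x) (h' x) (norm_nonneg _) h.nonneg

/-- The Haar probability measure on the circle, the normalization used by `mFourierCoeff`. -/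
local instance circleMeasureSpace : MeasureSpace UnitAddCircle := ⟨AddCircle.haarAddCircle⟩

/-- The Haar measure on the circle is a probability measure. -/
local instance isProbabilityMeasure_circle : IsProbabilityMeasure (volume : Measure UnitAddCircle) :=
  inferInstanceAs (IsProbabilityMeasure AddCircle.haarAddCircle)

lemma integral_mFourier_mul (j k : Freq) :
    ∫ x : Torus, mFourier (-k) x * mFourier j x = if k = j then 1 else 0 := by
  have h := orthonormal_iff_ite.1 (orthonormal_mFourier (d := Fin 3)) k j
  rw [ContinuousMap.inner_toLp] at h
  rw [← h]
  refine integral_congr_ae (Filter.Eventually.of_forall fun x => ?_)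
  simp only [mFourier_neg]
  ring

lemma mFourierCoeff_ev {a : Distr} (ha : FinSupp a) (k : Freq) : mFourierCoeff (ev a) k = a k := by
  have h2 : ev a = fun x => ∑ j ∈ Set.Finite.toFinset ha, a j * mFourier j x := funext ha.ev_eq
  have h3 : ∀ x, mFourier (-k) x • ev a x
      = ∑ j ∈ Set.Finite.toFinset ha, a j * (mFourier (-k) x * mFourier j x) := fun x => by
    rw [h2]
    simp only [smul_eq_mul, Finset.mul_sum]
    exact Finset.sum_congr rfl fun j _ => by ring
  have h4 : mFourierCoeff (ev a) k = ∫ x : Torus, mFourier (-k) x • ev a x := rfl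
  rw [h4]
  simp_rw [h3]
  rw [integral_finsetSum _ fun j _ => by
    refine (Continuous.integrable_of_hasCompactSupport (by fun_prop)
      (HasCompactSupport.of_compactSpace _))]
  simp_rw [integral_const_mul, integral_mFourier_mul]
  simp only [mul_ite, mul_one, mul_zero, Finset.sum_ite_eq]
  by_cases hk : a k = 0
  · simp [hk]
  · rw [if_pos ((Set.Finite.mem_toFinset ha).2 hk)]

/-- The coefficients of a trigonometric polynomial are bounded by its sup norm. -/
lemma SupLE.norm_coeff_le {a : Distr} {K : ℝ} (ha : FinSupp a) (h : SupLE a K) (k : Freq) :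
    ‖a k‖ ≤ K := by
  rw [← mFourierCoeff_ev ha k]
  have h4 : mFourierCoeff (ev a) k = ∫ x : Torus, mFourier (-k) x • ev a x := rfl
  rw [h4]
  refine (norm_integral_le_of_norm_le_const (C := K) (Filter.Eventually.of_forall fun x => ?_)).trans
    (by simp)
  have h5 : ‖mFourier (-k) x‖ ≤ 1 :=
    ((mFourier (-k)).norm_coe_le_norm x).trans_eq mFourier_norm
  rw [norm_smul]
  calc ‖mFourier (-k) x‖ * ‖ev a x‖ ≤ 1 * K :=
        mul_le_mul h5 (h x) (norm_nonneg _) zero_le_one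
    _ = K := one_mul K

/-! #### Averages of translates -/

lemma norm_mFourier_apply (k : Freq) (x : Torus) : ‖mFourier k x‖ = 1 := by
  simp only [mFourier, fourier_apply, ContinuousMap.coe_mk, norm_prod]
  exact Finset.prod_eq_one fun i _ => Circle.norm_coe _

lemma mFourier_sub (k : Freq) (x y : Torus) :
    mFourier k (x - y) = mFourier k x * mFourier (-k) y := by
  simp only [mFourier, ContinuousMap.coe_mk, ← Finset.prod_mul_distrib]
  refine Finset.prod_congr rfl fun i _ => ?_
  simp only [fourier_apply, Pi.sub_apply, Pi.neg_apply, neg_smul, sub_eq_add_neg]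
  rw [smul_add, smul_neg, AddCircle.toCircle_add, Circle.coe_mul]

lemma mFourier_toT (k : Freq) (y : Space) :
    mFourier k (toT y) = Complex.exp (2 * Real.pi * Complex.I * (inner ℝ (toR k) y : ℝ)) := by
  simp only [mFourier, ContinuousMap.coe_mk, toT, fourier_coe_apply]
  rw [← Complex.exp_sum]
  congr 1
  rw [PiLp.inner_apply, Complex.ofReal_sum, Finset.mul_sum]
  refine Finset.sum_congr rfl fun i _ => ?_
  simp [toR]
  ring

lemma continuous_ev {a : Distr} (ha : FinSupp a) : Continuous (ev a) := by
  rw [show ev a = _ from funext ha.ev_eq]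
  fun_prop

lemma continuous_toT : Continuous toT := by
  unfold toT
  refine continuous_pi fun i => ?_
  exact (AddCircle.continuous_mk' 1).comp (by fun_prop)

/-- A multiplier whose symbol is a dilated Schwartz function is the average of translates against a
Schwartz function. -/
lemma ev_mult_schwartz (Φ : 𝓢(Space, ℂ)) (r : ℝ) {a : Distr} (ha : FinSupp a) (x : Torus) :
    ev (mult (fun k => Φ (r • toR k)) a) x = ∫ y, (𝓕⁻ Φ) y * ev a (x - toT (r • y)) := by
  have h1 : ∀ k y, mFourier k (x - toT (r • y))
      = mFourier k x * Complex.exp (((-2 * Real.pi * inner ℝ y (r • toR k) : ℝ) : ℂ) * Complex.I) := by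
    intro k y
    rw [mFourier_sub, mFourier_neg, mFourier_toT, ← Complex.exp_conj]
    congr 2
    simp only [map_mul, Complex.conj_ofReal, Complex.conj_I, map_ofNat]
    rw [inner_smul_right, inner_smul_right, real_inner_comm]
    push_cast
    ring
  have h2 : ∀ k, Φ (r • toR k)
      = ∫ y, Complex.exp (((-2 * Real.pi * inner ℝ y (r • toR k) : ℝ) : ℂ) * Complex.I) * (𝓕⁻ Φ) y := by
    intro k
    have h := FourierTransform.fourier_fourierInv_eq (F := 𝓢(Space, ℂ)) Φ
    have h' := congrArg (fun f : 𝓢(Space, ℂ) => f (r • toR k)) h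
    rw [← h', SchwartzMap.fourier_coe, Real.fourier_eq']
    simp only [smul_eq_mul]
  have h3 : ∀ y, (𝓕⁻ Φ) y * ev a (x - toT (r • y)) = ∑ k ∈ Set.Finite.toFinset ha, a k * mFourier k x *
      (Complex.exp (((-2 * Real.pi * inner ℝ y (r • toR k) : ℝ) : ℂ) * Complex.I) * (𝓕⁻ Φ) y) := by
    intro y
    rw [ha.ev_eq, Finset.mul_sum]
    refine Finset.sum_congr rfl fun k _ => ?_
    rw [h1]; ring
  simp_rw [h3]
  rw [integral_finsetSum]
  · rw [ev_eq_sum (S := Set.Finite.toFinset ha)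
      (fun k hk => (Set.Finite.mem_toFinset ha).2 fun h => hk (by simp [mult, h]))]
    refine Finset.sum_congr rfl fun k _ => ?_
    rw [integral_const_mul, ← h2, mult]
    ring
  · intro k _
    refine Integrable.const_mul ?_ _
    refine Integrable.bdd_mul (c := 1) (SchwartzMap.integrable _) ?_ ?_
    · exact Continuous.aestronglyMeasurable (by fun_prop)
    · refine Filter.Eventually.of_forall fun y => ?_
      rw [Complex.norm_exp_ofReal_mul_I]

/-- Dilated Schwartz multipliers are bounded uniformly in the dilation, and their commutators with
the multiplication by a Lipschitz function gain a factor `r`. -/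
lemma exists_schwartz_mult_bound (Φ : 𝓢(Space, ℂ)) : ∃ C : ℝ, 0 ≤ C ∧ ∀ r : ℝ, 0 ≤ r →
    (∀ a K, FinSupp a → SupLE a K → SupLE (mult (fun k => Φ (r • toR k)) a) (C * K)) ∧
    (∀ f g L K, FinSupp f → FinSupp g → LipLE f L → SupLE g K →
      SupLE (mult (fun k => Φ (r • toR k)) (conv f g) - conv f (mult (fun k => Φ (r • toR k)) g))
        (C * r * L * K)) := by
  set k0 : 𝓢(Space, ℂ) := 𝓕⁻ Φ with hk0
  have i0 : Integrable (fun y => ‖k0 y‖) := k0.integrable.norm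
  have i1 : Integrable (fun y => ‖y‖ * ‖k0 y‖) := by
    simpa using k0.integrable_pow_mul (volume) 1
  set C0 := ∫ y, ‖k0 y‖
  set C1 := ∫ y, ‖y‖ * ‖k0 y‖
  have hC0 : 0 ≤ C0 := integral_nonneg fun y => norm_nonneg _
  have hC1 : 0 ≤ C1 := integral_nonneg fun y => by positivity
  have hint : ∀ (a : Distr) (r : ℝ) (x : Torus), FinSupp a →
      Integrable (fun y => k0 y * ev a (x - toT (r • y))) := by
    intro a r x ha
    obtain ⟨M, hM⟩ := (isCompact_range (continuous_ev ha)).isBounded.exists_norm_le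
    refine Integrable.mul_bdd (c := M) k0.integrable ?_
      (Filter.Eventually.of_forall fun y => hM _ ⟨_, rfl⟩)
    refine Continuous.aestronglyMeasurable ((continuous_ev ha).comp ?_)
    exact continuous_const.sub (continuous_toT.comp (by fun_prop))
  refine ⟨C0 + C1, by positivity, fun r hr => ⟨fun a K ha h x => ?_, fun f g L K hf hg hL h x => ?_⟩⟩
  · rw [ev_mult_schwartz Φ r ha]
    have hK := h.nonneg
    refine (norm_integral_le_of_norm_le (i0.mul_const K) (Filter.Eventually.of_forall fun y => ?_)).trans
      ?_
    · rw [norm_mul]; exact mul_le_mul_of_nonneg_left (h _) (norm_nonneg _)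
    · rw [integral_mul_const]; nlinarith [mul_nonneg hC1 hK]
  · have hK := h.nonneg
    have hL0 : 0 ≤ L := by
      have h2 := (norm_nonneg _).trans (hL 0 (EuclideanSpace.single 0 1))
      simpa using h2
    rw [ev_sub ((hf.conv hg).mult _) (hf.conv (hg.mult _)), ev_conv hf (hg.mult _),
      ev_mult_schwartz Φ r hg, ev_mult_schwartz Φ r (hf.conv hg), ← integral_const_mul,
      ← integral_sub (hint _ r x (hf.conv hg)) ((hint g r x hg).const_mul _)]
    refine (norm_integral_le_of_norm_le (i1.mul_const (r * L * K))
      (Filter.Eventually.of_forall fun y => ?_)).trans ?_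
    · rw [ev_conv hf hg]
      have h3 : k0 y * (ev f (x - toT (r • y)) * ev g (x - toT (r • y)))
          - ev f x * (k0 y * ev g (x - toT (r • y)))
          = (ev f (x - toT (r • y)) - ev f x) * (k0 y * ev g (x - toT (r • y))) := by ring
      rw [h3, norm_mul, norm_mul]
      have h4 := hL x (r • y)
      rw [norm_smul, Real.norm_eq_abs, abs_of_nonneg hr] at h4
      have h5 := mul_le_mul h4 (mul_le_mul_of_nonneg_left (h (x - toT (r • y))) (norm_nonneg (k0 y)))
        (by positivity) (by positivity)
      refine h5.trans (le_of_eq (by ring))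
    · rw [integral_mul_const]
      have : 0 ≤ C0 * (r * L * K) := by positivity
      nlinarith

end CGL

namespace CGL
open MeasureTheory FourierTransform SchwartzMap UnitAddTorus

/-! ### Gaussian and compactly supported symbols -/

lemma exp_decay_aux {c : ℝ} (hc : 0 < c) (k : ℕ) :
    ∃ C : ℝ, ∀ s : ℝ, 0 ≤ s → (1 + s) ^ k * Real.exp (-c * s ^ 2) ≤ C := by
  have h1 : Filter.Tendsto (fun s : ℝ => (1 + s) ^ k * Real.exp (-c * s ^ 2)) Filter.atTop (𝓝 0) := by
    have h2 : Filter.Tendsto (fun s : ℝ => (Real.exp c) * ((1 + s) ^ k * Real.exp (-c * (1 + s))))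
        Filter.atTop (𝓝 0) := by
      have h3 := Real.tendsto_pow_mul_exp_neg_atTop_nhds_zero k
      have h4 := (h3.comp ((Filter.tendsto_id.const_mul_atTop hc).comp
        (Filter.tendsto_atTop_add_const_left _ (1:ℝ) Filter.tendsto_id)))
      have h5 := (h4.const_mul ((c ^ k)⁻¹ * Real.exp c))
      simp only [mul_zero] at h5
      refine h5.congr fun s => ?_
      simp only [Function.comp, id, mul_pow]
      have : c ^ k ≠ 0 := by positivity
      rw [show -(c * (1 + s)) = -c * (1 + s) by ring]
      field_simp
    refine squeeze_zero' ?_ ?_ h2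
    · filter_upwards [Filter.eventually_ge_atTop 0] with s hs
      positivity
    · filter_upwards [Filter.eventually_ge_atTop 1] with s hs
      have : Real.exp (-c * s ^ 2) ≤ Real.exp c * Real.exp (-c * (1 + s)) := by
        rw [← Real.exp_add]
        apply Real.exp_le_exp.2
        nlinarith [mul_nonneg hc.le (sub_nonneg.2 hs), mul_nonneg (mul_nonneg hc.le (sub_nonneg.2 hs)) (by linarith : (0:ℝ) ≤ s)]
      calc (1 + s) ^ k * Real.exp (-c * s ^ 2)
          ≤ (1 + s) ^ k * (Real.exp c * Real.exp (-c * (1 + s))) :=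
            mul_le_mul_of_nonneg_left this (by positivity)
        _ = _ := by ring
  have h6 : ∃ S : ℝ, ∀ s ≥ S, (1 + s) ^ k * Real.exp (-c * s ^ 2) ≤ 1 :=
    Filter.eventually_atTop.1 (h1.eventually (eventually_le_nhds zero_lt_one))
  obtain ⟨S, hS⟩ := h6
  obtain ⟨M, hM⟩ := (isCompact_Icc (a := (0:ℝ)) (b := S)).exists_bound_of_continuousOn
    (f := fun s : ℝ => (1 + s) ^ k * Real.exp (-c * s ^ 2)) (by fun_prop)
  refine ⟨max 1 M, fun s hs => ?_⟩
  rcases le_total S s with h | h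
  · exact (hS s h).trans (le_max_left _ _)
  · exact (le_abs_self _).trans ((hM s ⟨hs, h⟩).trans (le_max_right _ _))

/-- The Gaussian `exp (-z ‖x‖²)`. -/
def gauss (z : ℂ) (x : Space) : ℂ := Complex.exp (-z * ((‖x‖ ^ 2 : ℝ) : ℂ))

lemma norm_gauss (z : ℂ) (x : Space) : ‖gauss z x‖ = Real.exp (-z.re * ‖x‖ ^ 2) := by
  rw [gauss, Complex.norm_exp]
  congr 1
  rw [Complex.re_mul_ofReal, Complex.neg_re]

lemma hasFDerivAt_gauss (z : ℂ) (x : Space) :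
    HasFDerivAt (gauss z) ((-(2 * z) * gauss z x) • (Complex.ofRealCLM ∘L (innerSL ℝ x))) x := by
  have h1 : HasFDerivAt (fun x : Space => ‖x‖ ^ 2) (2 • (innerSL ℝ x)) x :=
    (hasStrictFDerivAt_norm_sq x).hasFDerivAt
  have h2 := (Complex.ofRealCLM.hasFDerivAt.comp x h1)
  have h3 := ((h2.const_mul (-z)).cexp)
  refine h3.congr_fderiv ?_
  ext v
  simp [gauss]
  ring

lemma contDiff_gauss (z : ℂ) : ContDiff ℝ ∞ (gauss z) := by
  unfold gauss
  have h1 : ContDiff ℝ ∞ (fun x : Space => ((‖x‖ ^ 2 : ℝ) : ℂ)) :=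
    Complex.ofRealCLM.contDiff.comp (contDiff_norm_sq ℝ)
  exact (contDiff_const.mul h1).cexp

/-- All derivatives of the product of a Gaussian and a function of temperate growth decay rapidly:
the derivative of such a product is again one. -/
lemma gauss_smul_decay {z : ℂ} (hz : 0 < z.re) (n : ℕ) : ∀ (F : Type) [NormedAddCommGroup F]
    [NormedSpace ℂ F] (g : Space → F), g.HasTemperateGrowth → ∀ k : ℕ,
    ∃ C : ℝ, ∀ x, ‖x‖ ^ k * ‖iteratedFDeriv ℝ n (fun x => gauss z x • g x) x‖ ≤ C := by
  induction n with
  | zero =>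
    intro F _ _ g hg k
    obtain ⟨m, C, hC⟩ := hg.2 0
    obtain ⟨D, hD⟩ := exp_decay_aux hz (k + m)
    have hC0 : 0 ≤ C := by
      have h := (norm_nonneg _).trans (hC 0)
      simpa using h
    refine ⟨D * C, fun x => ?_⟩
    have h1 := hC x
    rw [norm_iteratedFDeriv_zero] at h1 ⊢
    rw [norm_smul, norm_gauss]
    have h2 := hD ‖x‖ (norm_nonneg x)
    have h3 : ‖x‖ ^ k ≤ (1 + ‖x‖) ^ k := pow_le_pow_left₀ (norm_nonneg x) (by linarith) k
    calc ‖x‖ ^ k * (Real.exp (-z.re * ‖x‖ ^ 2) * ‖g x‖)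
        ≤ (1 + ‖x‖) ^ k * (Real.exp (-z.re * ‖x‖ ^ 2) * (C * (1 + ‖x‖) ^ m)) := by gcongr
      _ = ((1 + ‖x‖) ^ (k + m) * Real.exp (-z.re * ‖x‖ ^ 2)) * C := by rw [pow_add]; ring
      _ ≤ D * C := mul_le_mul_of_nonneg_right h2 hC0
  | succ n ih =>
    intro F _ _ g hg k
    have hg' : (fderiv ℝ g).HasTemperateGrowth := by
      refine ⟨hg.1.fderiv_right (by simp), fun j => ?_⟩
      obtain ⟨m, C, hC⟩ := hg.2 (j + 1)
      exact ⟨m, C, fun x => by rw [norm_iteratedFDeriv_fderiv]; exact hC x⟩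
    have hq : (fun x : Space => (innerSL ℝ x).smulRight (g x)).HasTemperateGrowth := by
      have h := (ContinuousLinearMap.smulRightL ℝ Space F).bilinear_hasTemperateGrowth
        (f := fun x : Space => innerSL ℝ x) (g := g) (innerSL ℝ (E := Space)).hasTemperateGrowth hg
      exact h
    have hG : (fun x => fderiv ℝ g x + (-(2 * z)) • (innerSL ℝ x).smulRight (g x)).HasTemperateGrowth :=
      hg'.add ((Function.HasTemperateGrowth.const (-(2 * z))).smul hq)
    obtain ⟨C, hC⟩ := ih _ _ hG k
    refine ⟨C, fun x => ?_⟩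
    have h1 : fderiv ℝ (fun x => gauss z x • g x) = fun x => gauss z x •
        (fderiv ℝ g x + (-(2 * z)) • (innerSL ℝ x).smulRight (g x)) := by
      funext x
      have h2 := (hasFDerivAt_gauss z x).smul
        ((hg.1.differentiable (by simp)) x).hasFDerivAt
      refine h2.fderiv.trans ?_
      ext v
      change gauss z x • fderiv ℝ g x v + ((-(2 * z) * gauss z x) * ((inner ℝ x v : ℝ) : ℂ)) • g x
        = gauss z x • (fderiv ℝ g x v + (-(2 * z)) • ((inner ℝ x v : ℝ) • g x))
      rw [← Complex.coe_smul (inner ℝ x v) (g x)]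
      module
    rw [← norm_iteratedFDeriv_fderiv, h1]
    exact hC x

/-- The Schwartz function `exp (-z ‖x‖²) g x`. -/
def gaussMul {z : ℂ} (hz : 0 < z.re) (g : Space → ℂ) (hg : g.HasTemperateGrowth) : 𝓢(Space, ℂ) where
  toFun x := gauss z x • g x
  smooth' := (contDiff_gauss z).smul hg.1
  decay' k n := gauss_smul_decay hz n ℂ g hg k

/-- A smooth cutoff: `1` on the ball of radius `2`. -/
def bump2 : ContDiffBump (0 : Space) := ⟨2, 3, by norm_num, by norm_num⟩

/-- A smooth cutoff near the origin. -/
def bumpSmall : ContDiffBump (0 : Space) := ⟨1 / 48, 1 / 24, by norm_num, by norm_num⟩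

/-- Cutting off a smooth function away from the ball of radius `2` gives a Schwartz function. -/
lemma exists_schwartz_eq_on_ball (g : Space → ℂ) (hg : ContDiff ℝ ∞ g) :
    ∃ Φ : 𝓢(Space, ℂ), ∀ x, ‖x‖ ≤ 2 → Φ x = g x := by
  have h1 : HasCompactSupport (fun x => (bump2 x : ℂ) * g x) := by
    refine HasCompactSupport.mul_right ?_
    exact bump2.hasCompactSupport.comp_left (g := Complex.ofReal) (by simp)
  have h2 : ContDiff ℝ ∞ (fun x => (bump2 x : ℂ) * g x) :=
    (Complex.ofRealCLM.contDiff.comp bump2.contDiff).mul hg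
  refine ⟨h1.toSchwartzMap h2, fun x hx => ?_⟩
  have h3 : bump2 x = 1 := bump2.one_of_mem_closedBall (by simpa [bump2] using hx)
  simp [h3]

/-- A Schwartz function equal to `‖x‖⁻⁴` on the annulus `1/24 ≤ ‖x‖ ≤ 2`. -/
lemma exists_schwartz_inv_norm : ∃ Φ : 𝓢(Space, ℂ), ∀ x, 1 / 24 ≤ ‖x‖ → ‖x‖ ≤ 2 →
    Φ x = ((‖x‖ ^ 4)⁻¹ : ℝ) := by
  have h : ContDiff ℝ ∞ (fun x : Space => (((1 - bumpSmall x) * (‖x‖ ^ 4)⁻¹ : ℝ) : ℂ)) := by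
    refine Complex.ofRealCLM.contDiff.comp ?_
    rw [contDiff_iff_contDiffAt]
    intro x
    by_cases hx : x = 0
    · subst hx
      refine (contDiffAt_const (c := (0:ℝ))).congr_of_eventuallyEq ?_
      filter_upwards [Metric.closedBall_mem_nhds (0 : Space) (show (0:ℝ) < 1 / 48 by norm_num)] with y hy
      have : bumpSmall y = 1 := bumpSmall.one_of_mem_closedBall hy
      change (1 - bumpSmall y) * _ = 0
      rw [this]
      ring
    · refine (contDiffAt_const.sub bumpSmall.contDiffAt).mul (ContDiffAt.inv ?_ (by positivity))
      have h4 : (fun x : Space => ‖x‖ ^ 4) = fun x => (‖x‖ ^ 2) ^ 2 := by funext x; ring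
      rw [h4]
      exact ((contDiff_norm_sq ℝ).pow 2).contDiffAt
  obtain ⟨Φ, hΦ⟩ := exists_schwartz_eq_on_ball _ h
  refine ⟨Φ, fun x h1 h2 => ?_⟩
  rw [hΦ x h2]
  have : bumpSmall x = 0 := bumpSmall.zero_of_le_dist (by simpa [bumpSmall] using h1)
  simp [this]

end CGL

namespace CGL
open MeasureTheory FourierTransform SchwartzMap UnitAddTorus

/-! ### Littlewood-Paley blocks and the semigroup on a dyadic frequency range -/

/-- The dyadic weight `2^{αn}`. -/
def dyad (α : ℝ) (n : ℕ) : ℝ := (2 : ℝ) ^ (α * n)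

lemma dyad_pos (α : ℝ) (n : ℕ) : 0 < dyad α n := Real.rpow_pos_of_pos two_pos _

lemma dyad_add (α β : ℝ) (n : ℕ) : dyad (α + β) n = dyad α n * dyad β n := by
  rw [dyad, add_mul, Real.rpow_add two_pos]; rfl

lemma dyad_index_add (α : ℝ) (m n : ℕ) : dyad α (m + n) = dyad α m * dyad α n := by
  rw [dyad, Nat.cast_add, mul_add, Real.rpow_add two_pos]; rfl

lemma dyad_mono {α β : ℝ} (h : α ≤ β) (n : ℕ) : dyad α n ≤ dyad β n :=
  Real.rpow_le_rpow_of_exponent_le one_le_two (mul_le_mul_of_nonneg_right h n.cast_nonneg)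

@[simp] lemma dyad_zero_right (α : ℝ) : dyad α 0 = 1 := by simp [dyad]

lemma dyad_one (n : ℕ) : dyad 1 n = 2 ^ n := by simp [dyad]

lemma dyad_neg (α : ℝ) (n : ℕ) : dyad (-α) n = (dyad α n)⁻¹ := by
  rw [dyad, neg_mul, Real.rpow_neg two_pos.le]; rfl

lemma dyad_index_mono {α : ℝ} (hα : 0 ≤ α) {m n : ℕ} (h : m ≤ n) : dyad α m ≤ dyad α n :=
  Real.rpow_le_rpow_of_exponent_le one_le_two (mul_le_mul_of_nonneg_left (by exact_mod_cast h) hα)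

lemma dyad_index_anti {α : ℝ} (hα : α ≤ 0) {m n : ℕ} (h : m ≤ n) : dyad α n ≤ dyad α m :=
  Real.rpow_le_rpow_of_exponent_le one_le_two
    (mul_le_mul_of_nonpos_left (by exact_mod_cast h) hα)

lemma dyad_eq_pow (α : ℝ) (n : ℕ) : dyad α n = ((2 : ℝ) ^ α) ^ n := by
  rw [dyad, Real.rpow_mul two_pos.le, Real.rpow_natCast]

lemma four_pow_rpow (n : ℕ) (θ : ℝ) : ((4 : ℝ) ^ n) ^ (-θ) = dyad (-(2 * θ)) n := by
  rw [dyad, show (4 : ℝ) ^ n = 2 ^ (2 * (n : ℝ)) by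
    rw [Real.rpow_mul two_pos.le, Real.rpow_natCast]; norm_num, ← Real.rpow_mul two_pos.le]
  congr 1; ring

/-- The spectrum of `b` lies in the ball of radius `2 ⋅ 2^n`, and, for `n ≠ 0`, in the annulus
`2^n / 24 ≤ |k| < 2 ⋅ 2^n`. -/
def SpecIn (n : ℕ) (b : Distr) : Prop :=
  ∀ k, b k ≠ 0 → ‖toR k‖ < 2 * 2 ^ n ∧ (n ≠ 0 → (2 : ℝ) ^ n / 24 ≤ ‖toR k‖)

/-- The spectrum of `b` lies in the open ball of radius `r`. -/
def SpecBall (r : ℝ) (b : Distr) : Prop := ∀ k, b k ≠ 0 → ‖toR k‖ < r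

lemma SpecBall.finSupp {r : ℝ} {b : Distr} (h : SpecBall r b) : FinSupp b :=
  FinSupp.of_subset (finite_freq r) h

lemma SpecIn.specBall {n : ℕ} {b : Distr} (h : SpecIn n b) : SpecBall (2 * 2 ^ n) b :=
  fun k hk => (h k hk).1

section HeatSymbol
variable {μ : ℝ}

/-- The coefficient of `|k|²` in the exponent of the semigroup. -/
def heatCoef (μ : ℝ) : ℂ := (Complex.I + μ) * ((4 * Real.pi ^ 2 : ℝ) : ℂ)

lemma heatCoef_re (hμ : 0 < μ) : 0 < (heatCoef μ).re := by
  rw [heatCoef, Complex.re_mul_ofReal]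
  simp
  positivity

lemma heat_eq_gauss (μ : ℝ) {t : ℝ} (ht : 0 ≤ t) (b : Distr) : heat μ t b =
    ((Real.exp (-t) : ℝ) : ℂ) • mult (fun k => gauss (heatCoef μ) (Real.sqrt t • toR k)) b := by
  funext k
  simp only [heat, Pi.smul_apply, smul_eq_mul, mult, gauss, norm_smul, heatCoef, mul_pow,
    Real.norm_eq_abs, sq_abs, Real.sq_sqrt ht]
  rw [← mul_assoc, Complex.ofReal_exp, ← Complex.exp_add]
  congr 2
  push_cast
  ring

lemma exists_heat_bound (hμ : 0 < μ) : ∃ C : ℝ, 0 ≤ C ∧ ∀ t : ℝ, 0 ≤ t →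
    (∀ b K, FinSupp b → SupLE b K → SupLE (heat μ t b) (C * K)) ∧
    (∀ f g L K, FinSupp f → FinSupp g → LipLE f L → SupLE g K →
      SupLE (heat μ t (conv f g) - conv f (heat μ t g)) (C * Real.sqrt t * L * K)) := by
  obtain ⟨C, hC, h⟩ := exists_schwartz_mult_bound
    (gaussMul (heatCoef_re hμ) (fun _ => 1) (Function.HasTemperateGrowth.const 1))
  have hΦ : ∀ x, gaussMul (heatCoef_re hμ) (fun _ => 1) (Function.HasTemperateGrowth.const 1) x
      = gauss (heatCoef μ) x := fun x => by
    change gauss _ x • (1 : ℂ) = _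
    simp
  simp only [hΦ] at h
  refine ⟨C, hC, fun t ht => ⟨fun b K hb hK => ?_, fun f g L K hf hg hL hK => ?_⟩⟩
  · have h1 := ((h _ (Real.sqrt_nonneg t)).1 b K hb hK).smul ((Real.exp (-t) : ℝ) : ℂ)
    rw [← heat_eq_gauss μ ht] at h1
    refine h1.mono ?_
    rw [Complex.norm_real, Real.norm_eq_abs, abs_of_pos (Real.exp_pos _)]
    have : 0 ≤ C * K := mul_nonneg hC hK.nonneg
    have h2 : Real.exp (-t) ≤ 1 := Real.exp_le_one_iff.2 (by linarith)
    nlinarith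
  · have h1 := ((h _ (Real.sqrt_nonneg t)).2 f g L K hf hg hL hK).smul ((Real.exp (-t) : ℝ) : ℂ)
    have h3 : ((Real.exp (-t) : ℝ) : ℂ) • (mult (fun k => gauss (heatCoef μ) (√t • toR k)) (conv f g)
        - conv f (mult (fun k => gauss (heatCoef μ) (√t • toR k)) g))
        = heat μ t (conv f g) - conv f (heat μ t g) := by
      rw [smul_sub, ← heat_eq_gauss μ ht, heat_eq_gauss μ ht g]
      congr 1
      funext k
      simp only [Pi.smul_apply, conv, smul_eq_mul, ← tsum_mul_left]
      exact tsum_congr fun j => by ring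
    rw [h3] at h1
    refine h1.mono ?_
    rw [Complex.norm_real, Real.norm_eq_abs, abs_of_pos (Real.exp_pos _)]
    have h2 : Real.exp (-t) ≤ 1 := Real.exp_le_one_iff.2 (by linarith)
    have h5 := ((h _ (Real.sqrt_nonneg t)).2 f g L K hf hg hL hK).nonneg
    nlinarith

lemma conv_smul_right (c : ℂ) (a b : Distr) : conv a (c • b) = c • conv a b := by
  funext k
  simp only [Pi.smul_apply, conv, smul_eq_mul, ← tsum_mul_left]
  exact tsum_congr fun j => by ring

lemma FinSupp.heat {b : Distr} (hb : FinSupp b) (t : ℝ) : FinSupp (heat μ t b) := hb.mult _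

lemma conv_sub_right {a : Distr} (ha : FinSupp a) (b c : Distr) :
    conv a (b - c) = conv a b - conv a c := by
  funext k
  have hS : ∀ k, a k ≠ 0 → k ∈ Set.Finite.toFinset ha := fun k hk => (Set.Finite.mem_toFinset ha).2 hk
  simp only [Pi.sub_apply, conv_eq_sum hS, ← Finset.sum_sub_distrib]
  exact Finset.sum_congr rfl fun j _ => by ring

/-- Decay of the semigroup on an annulus, with the corresponding gain for its commutator with the
multiplication by a Lipschitz function: on the annulus the symbol is
`λ⁻² (√t k)⁴ exp(- z t |k|²) (2⁻ⁿ k)⁻⁴` with `λ = 4ⁿ t`. -/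
lemma exists_heat_annulus_bound (hμ : 0 < μ) : ∃ C : ℝ, 0 ≤ C ∧ ∀ (t : ℝ) (n : ℕ), 0 < t → n ≠ 0 →
    (∀ b K, SpecIn n b → SupLE b K → SupLE (heat μ t b) (C * (t * 4 ^ n) ^ (-2 : ℝ) * K)) ∧
    (∀ f g L K, FinSupp f → SpecIn n g → SpecIn n (conv f g) → LipLE f L → SupLE g K →
      SupLE (heat μ t (conv f g) - conv f (heat μ t g))
        (C * (t * 4 ^ n) ^ (-2 : ℝ) * (√t + (2 ^ n)⁻¹) * L * K)) := by
  have hT : (fun x : Space => ((‖x‖ ^ 4 : ℝ) : ℂ)).HasTemperateGrowth := by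
    have h1 : (fun x : Space => ((‖x‖ ^ 2) ^ 2 : ℝ)).HasTemperateGrowth :=
      (Function.hasTemperateGrowth_norm_sq Space).pow 2
    have h2 := Function.Complex.hasTemperateGrowth_ofReal.comp h1
    refine (show (fun x : Space => ((‖x‖ ^ 4 : ℝ) : ℂ)) = Complex.ofReal ∘
      fun x : Space => ((‖x‖ ^ 2) ^ 2 : ℝ) by funext x; simp [← pow_mul]) ▸ h2
  obtain ⟨C1, hC1, h1⟩ := exists_schwartz_mult_bound (gaussMul (heatCoef_re hμ) _ hT)
  obtain ⟨Ψ, hΨ⟩ := exists_schwartz_inv_norm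
  obtain ⟨C2, hC2, h2⟩ := exists_schwartz_mult_bound Ψ
  have hΦ : ∀ x, gaussMul (heatCoef_re hμ) _ hT x = gauss (heatCoef μ) x * ((‖x‖ ^ 4 : ℝ) : ℂ) :=
    fun x => rfl
  simp only [hΦ] at h1
  refine ⟨C1 * C2, by positivity, fun t n ht hn => ?_⟩
  set l : ℝ := (t * 4 ^ n) ^ (-2 : ℝ) with hl
  have hl0 : 0 < l := by positivity
  have hl' : l = (t * 4 ^ n)⁻¹ ^ 2 := by
    rw [hl, Real.rpow_neg (by positivity), ← Real.inv_rpow (by positivity)]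
    norm_cast
  set A : Distr → Distr := mult (fun k => gauss (heatCoef μ) (√t • toR k) * ((‖√t • toR k‖ ^ 4 : ℝ) : ℂ))
    with hA
  set B : Distr → Distr := mult (fun k => Ψ (((2:ℝ) ^ n)⁻¹ • toR k)) with hB
  set c : ℂ := ((Real.exp (-t) * l : ℝ) : ℂ) with hc
  have hcn : ‖c‖ ≤ l := by
    rw [hc, Complex.norm_real, Real.norm_eq_abs, abs_of_pos (by positivity)]
    have h2 : Real.exp (-t) ≤ 1 := Real.exp_le_one_iff.2 (by linarith)
    nlinarith
  have key : ∀ b, SpecIn n b → heat μ t b = c • A (B b) := by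
    intro b hb
    rw [heat_eq_gauss μ ht.le]
    funext k
    by_cases hk : b k = 0
    · simp [hA, hB, mult, hk]
    obtain ⟨h3, h4⟩ := hb k hk
    have h4 := h4 hn
    have hp : (0:ℝ) < 2 ^ n := by positivity
    have hk0 : 0 < ‖toR k‖ := lt_of_lt_of_le (by positivity) h4
    have h5 : Ψ (((2:ℝ) ^ n)⁻¹ • toR k) = (((((2:ℝ) ^ n)⁻¹ * ‖toR k‖) ^ 4)⁻¹ : ℝ) := by
      rw [hΨ]
      · rw [norm_smul, norm_inv, norm_pow, Real.norm_two]
      · rw [norm_smul, norm_inv, norm_pow, Real.norm_two, le_inv_mul_iff₀ hp]; linarith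
      · rw [norm_smul, norm_inv, norm_pow, Real.norm_two, inv_mul_le_iff₀ hp]; linarith
    simp only [hA, hB, Pi.smul_apply, smul_eq_mul, mult]
    rw [h5, norm_smul, Real.norm_eq_abs, abs_of_nonneg (Real.sqrt_nonneg t), hc, hl']
    have h6 : (√t * ‖toR k‖) ^ 4 = t ^ 2 * ‖toR k‖ ^ 4 := by
      rw [mul_pow, show √t ^ 4 = (√t ^ 2) ^ 2 by ring, Real.sq_sqrt ht.le]
    have h7 : (t * 4 ^ n)⁻¹ ^ 2 * ((√t * ‖toR k‖) ^ 4 * ((((2:ℝ) ^ n)⁻¹ * ‖toR k‖) ^ 4)⁻¹) = 1 := by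
      rw [h6, show (4:ℝ) ^ n = (2 ^ n) ^ 2 by rw [← pow_mul, mul_comm, pow_mul]; norm_num]
      field_simp
    have h8 : ((((t * 4 ^ n)⁻¹ ^ 2 : ℝ) : ℂ) * ((((√t * ‖toR k‖) ^ 4 : ℝ) : ℂ) *
        ((((((2:ℝ) ^ n)⁻¹ * ‖toR k‖) ^ 4)⁻¹ : ℝ) : ℂ))) = 1 := by
      rw [← Complex.ofReal_mul, ← Complex.ofReal_mul, h7, Complex.ofReal_one]
    rw [Complex.ofReal_mul]
    linear_combination (-((Real.exp (-t) : ℝ) : ℂ) * gauss (heatCoef μ) (√t • toR k) * b k) * h8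
  have hr : (0:ℝ) ≤ ((2:ℝ) ^ n)⁻¹ := by positivity
  refine ⟨fun b K hb hK => ?_, fun f g L K hf hg hfg hL hK => ?_⟩
  · rw [key b hb]
    have hb' := hb.specBall.finSupp
    have h3 := (h2 _ hr).1 b K hb' hK
    have h4 := (h1 _ (Real.sqrt_nonneg t)).1 _ _ (hb'.mult _) h3
    refine (h4.smul c).mono ?_
    calc ‖c‖ * (C1 * (C2 * K)) ≤ l * (C1 * (C2 * K)) := mul_le_mul_of_nonneg_right hcn h4.nonneg
      _ = C1 * C2 * l * K := by ring
  · have hg' := hg.specBall.finSupp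
    have hBg : FinSupp (B g) := hg'.mult _
    have e1 : heat μ t (conv f g) - conv f (heat μ t g)
        = c • (A (B (conv f g) - conv f (B g)) + (A (conv f (B g)) - conv f (A (B g)))) := by
      rw [key _ hfg, key _ hg, conv_smul_right, ← smul_sub]
      congr 1
      funext k
      simp only [hA, mult, Pi.add_apply, Pi.sub_apply]
      ring
    have h3 := (h2 _ hr).2 f g L K hf hg' hL hK
    have f3 : FinSupp (B (conv f g) - conv f (B g)) := ((hf.conv hg').mult _).sub (hf.conv hBg)
    have h4 := (h1 _ (Real.sqrt_nonneg t)).1 _ _ f3 h3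
    have h5 := (h1 _ (Real.sqrt_nonneg t)).2 f (B g) L _ hf hBg hL ((h2 _ hr).1 g K hg' hK)
    have h6 := (h4.add (f3.mult _) (((hf.conv hBg).mult _).sub (hf.conv (hBg.mult _))) h5)
    rw [e1]
    refine (h6.smul c).mono ?_
    refine (mul_le_mul_of_nonneg_right hcn h6.nonneg).trans (le_of_eq ?_)
    ring

lemma LipLE.nonneg {f : Distr} {L : ℝ} (h : LipLE f L) : 0 ≤ L := by
  have h2 := (norm_nonneg _).trans (h 0 (EuclideanSpace.single 0 1))
  simpa using h2

/-- The smoothing effect of the semigroup on a dyadic frequency range. -/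
lemma exists_heat_spec_bound (hμ : 0 < μ) : ∃ C : ℝ, 0 ≤ C ∧ ∀ (t : ℝ) (n : ℕ), 0 < t → t ≤ 1 →
    (∀ b K θ, 0 ≤ θ → θ ≤ 2 → SpecIn n b → SupLE b K →
      SupLE (heat μ t b) (C * t ^ (-θ) * dyad (-(2 * θ)) n * K)) ∧
    (∀ f g L K θ, 0 ≤ θ → θ ≤ 3 / 2 → FinSupp f → SpecIn n g → SpecIn n (conv f g) →
      LipLE f L → SupLE g K →
      SupLE (heat μ t (conv f g) - conv f (heat μ t g))
        (C * t ^ (-θ) * dyad (-(2 * θ) - 1) n * L * K)) := by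
  obtain ⟨C1, hC1, h1⟩ := exists_heat_bound hμ
  obtain ⟨C2, hC2, h2⟩ := exists_heat_annulus_bound hμ
  refine ⟨C1 + 2 * C2, by positivity, fun t n ht ht1 => ?_⟩
  set l : ℝ := t * 4 ^ n with hl
  have hl0 : 0 < l := by positivity
  have hlθ : ∀ θ : ℝ, t ^ (-θ) * dyad (-(2 * θ)) n = l ^ (-θ) := fun θ => by
    rw [hl, Real.mul_rpow ht.le (by positivity), four_pow_rpow]
  have hsq : √t = √l * dyad (-1) n := by
    rw [hl, Real.sqrt_mul ht.le, dyad_neg, dyad_one,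
      show (4:ℝ) ^ n = (2 ^ n) ^ 2 by rw [← pow_mul, mul_comm, pow_mul]; norm_num,
      Real.sqrt_sq (by positivity)]
    field_simp
  have hd : ((2:ℝ) ^ n)⁻¹ = dyad (-1) n := by rw [dyad_neg, dyad_one]
  have hd0 := dyad_pos (-1) n
  rcases le_or_gt l 1 with hl1 | hl1
  · have hθ : ∀ θ : ℝ, 0 ≤ θ → 1 ≤ l ^ (-θ) := fun θ h =>
      Real.one_le_rpow_of_pos_of_le_one_of_nonpos hl0 hl1 (by linarith)
    refine ⟨fun b K θ h0 _ hb hK => ?_, fun f g L K θ h0 _ hf hg _ hL hK => ?_⟩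
    · refine ((h1 t ht.le).1 b K hb.specBall.finSupp hK).mono ?_
      rw [mul_assoc (C1 + 2 * C2), hlθ]
      have hK0 := hK.nonneg
      calc C1 * K ≤ (C1 + 2 * C2) * 1 * K := by nlinarith [mul_nonneg hC2 hK0]
        _ ≤ (C1 + 2 * C2) * l ^ (-θ) * K := by gcongr; exact hθ θ h0
    · refine ((h1 t ht.le).2 f g L K hf hg.specBall.finSupp hL hK).mono ?_
      rw [sub_eq_add_neg, dyad_add, show (C1 + 2 * C2) * t ^ (-θ) * (dyad (-(2 * θ)) n * dyad (-1) n) * L * K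
        = (C1 + 2 * C2) * (t ^ (-θ) * dyad (-(2 * θ)) n) * dyad (-1) n * L * K by ring, hlθ, hsq]
      have hK0 := hK.nonneg
      have hL0 := hL.nonneg
      have hs : √l ≤ 1 := Real.sqrt_le_one.2 hl1
      calc C1 * (√l * dyad (-1) n) * L * K ≤ (C1 + 2 * C2) * (1 * dyad (-1) n) * L * K := by
            gcongr; linarith
        _ = (C1 + 2 * C2) * 1 * dyad (-1) n * L * K := by ring
        _ ≤ (C1 + 2 * C2) * l ^ (-θ) * dyad (-1) n * L * K := by gcongr; exact hθ θ h0
  · have hn : n ≠ 0 := by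
      rintro rfl
      simp at hl
      linarith
    refine ⟨fun b K θ _ h2' hb hK => ?_, fun f g L K θ _ h2' hf hg hfg hL hK => ?_⟩
    · refine ((h2 t n ht hn).1 b K hb hK).mono ?_
      rw [mul_assoc (C1 + 2 * C2), hlθ]
      have hK0 := hK.nonneg
      have : l ^ (-2 : ℝ) ≤ l ^ (-θ) := Real.rpow_le_rpow_of_exponent_le hl1.le (by linarith)
      gcongr
      linarith
    · refine ((h2 t n ht hn).2 f g L K hf hg hfg hL hK).mono ?_
      rw [sub_eq_add_neg, dyad_add, show (C1 + 2 * C2) * t ^ (-θ) * (dyad (-(2 * θ)) n * dyad (-1) n) * L * K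
        = (C1 + 2 * C2) * (t ^ (-θ) * dyad (-(2 * θ)) n) * dyad (-1) n * L * K by ring, hlθ, hsq, hd]
      have hK0 := hK.nonneg
      have hL0 := hL.nonneg
      have hs : 1 ≤ √l := Real.one_le_sqrt.2 hl1.le
      have h3 : l ^ (-2 : ℝ) * √l ≤ l ^ (-θ) := by
        rw [Real.sqrt_eq_rpow, ← Real.rpow_add hl0]
        exact Real.rpow_le_rpow_of_exponent_le hl1.le (by linarith)
      have hl2 : 0 < l ^ (-2 : ℝ) := by positivity
      calc C2 * l ^ (-2 : ℝ) * (√l * dyad (-1) n + dyad (-1) n) * L * K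
          ≤ C2 * l ^ (-2 : ℝ) * (√l * dyad (-1) n + √l * dyad (-1) n) * L * K := by
            gcongr; nlinarith
        _ = (2 * C2) * (l ^ (-2 : ℝ) * √l) * dyad (-1) n * L * K := by ring
        _ ≤ (C1 + 2 * C2) * l ^ (-θ) * dyad (-1) n * L * K := by gcongr; linarith

end HeatSymbol

end CGL

namespace CGL
open MeasureTheory FourierTransform SchwartzMap UnitAddTorus

/-! #### Bernstein-type inequalities -/

/-- A multiplier that agrees on the ball of radius `2 ⋅ 2^n` with a dilated smooth function. -/
lemma exists_mult_ball_bound (g : Space → ℂ) (hg : ContDiff ℝ ∞ g) : ∃ C : ℝ, 0 ≤ C ∧ ∀ (n : ℕ) b K,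
    SpecBall (2 * 2 ^ n) b → SupLE b K →
      SupLE (mult (fun k => g (((2:ℝ) ^ n)⁻¹ • toR k)) b) (C * K) := by
  obtain ⟨Φ, hΦ⟩ := exists_schwartz_eq_on_ball g hg
  obtain ⟨C, hC, h⟩ := exists_schwartz_mult_bound Φ
  refine ⟨C, hC, fun n b K hb hK => ?_⟩
  have h1 := (h ((2:ℝ) ^ n)⁻¹ (by positivity)).1 b K hb.finSupp hK
  convert h1 using 1
  funext k
  by_cases hk : b k = 0
  · simp [mult, hk]
  · simp only [mult]
    rw [hΦ]
    have hp : (0:ℝ) < 2 ^ n := by positivity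
    rw [norm_smul, norm_inv, norm_pow, Real.norm_two, inv_mul_le_iff₀ hp]
    linarith [hb k hk]

lemma ev_mult_sum {ι : Type*} (s : Finset ι) (m : ι → Freq → ℂ) {b : Distr} (hb : FinSupp b) (x : Torus) :
    ev (mult (fun k => ∑ i ∈ s, m i k) b) x = ∑ i ∈ s, ev (mult (m i) b) x := by
  rw [← ev_sum fun i _ => hb.mult (m i)]
  congr 1
  funext k
  simp [mult, Finset.sum_mul]

/-- Trigonometric polynomials with spectrum in a ball of radius `2 ⋅ 2^n` are Lipschitz with a
constant of order `2^n`. -/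
lemma exists_lip_bound : ∃ C : ℝ, 0 ≤ C ∧ ∀ (n : ℕ) b K, SpecBall (2 * 2 ^ n) b → SupLE b K →
    LipLE b (C * dyad 1 n * K) := by
  have h0 : ∀ i : Fin 3, ContDiff ℝ ∞ (fun x : Space => ((x i : ℝ) : ℂ)) := fun i =>
    Complex.ofRealCLM.contDiff.comp (EuclideanSpace.proj (𝕜 := ℝ) i).contDiff
  choose C hC h using fun i => exists_mult_ball_bound _ (h0 i)
  refine ⟨2 * Real.pi * ∑ i, C i, by positivity [Finset.sum_nonneg fun i (_ : i ∈ Finset.univ) => hC i],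
    fun n b K hb hK x y => ?_⟩
  have hb' := hb.finSupp
  have hp : (0:ℝ) < 2 ^ n := by positivity
  set m : Freq → ℂ := fun k => ∑ i : Fin 3, ((y i : ℝ) : ℂ) * (((2:ℝ) ^ n : ℝ) : ℂ) *
    ((((((2:ℝ) ^ n)⁻¹ • toR k) i : ℝ)) : ℂ) with hm
  have hmk : ∀ k, m k = ((inner ℝ (toR k) y : ℝ) : ℂ) := fun k => by
    rw [hm, PiLp.inner_apply, Complex.ofReal_sum]
    refine Finset.sum_congr rfl fun i _ => ?_
    simp
    field_simp
  have hbd : ∀ z, ‖ev (mult m b) z‖ ≤ (∑ i, C i) * dyad 1 n * K * ‖y‖ := fun z => by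
    rw [hm, ev_mult_sum _ _ hb', dyad_one, Finset.sum_mul, Finset.sum_mul, Finset.sum_mul]
    refine (norm_sum_le _ _).trans (Finset.sum_le_sum fun i _ => ?_)
    have h1 := h i n b K hb hK z
    have h2 : mult (fun k => ((y i : ℝ) : ℂ) * (((2:ℝ) ^ n : ℝ) : ℂ) *
        ((((((2:ℝ) ^ n)⁻¹ • toR k) i : ℝ)) : ℂ)) b = (((y i * 2 ^ n : ℝ)) : ℂ) •
        mult (fun k => ((((((2:ℝ) ^ n)⁻¹ • toR k) i : ℝ)) : ℂ)) b := by
      funext k; simp [mult]; ring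
    rw [h2, ev_smul, norm_mul, Complex.norm_real, norm_mul, norm_pow, Real.norm_two]
    have h3 : ‖y i‖ ≤ ‖y‖ := PiLp.norm_apply_le y i
    calc ‖y i‖ * 2 ^ n * _ ≤ ‖y‖ * 2 ^ n * (C i * K) := by gcongr
      _ = _ := by ring
  have hline : ∀ s : ℝ, HasDerivAt (fun s : ℝ => ev b (x - toT (s • y)))
      (-(2 * Real.pi * Complex.I) * ev (mult m b) (x - toT (s • y))) s := fun s => by
    have e1 : ∀ k (s : ℝ), mFourier k (x - toT (s • y)) = mFourier k x *
        Complex.exp (s * (-(2 * Real.pi * Complex.I) * m k)) := fun k s => by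
      rw [mFourier_sub, mFourier_neg, mFourier_toT, ← Complex.exp_conj, hmk, inner_smul_right]
      congr 2
      simp only [map_mul, Complex.conj_ofReal, Complex.conj_I, map_ofNat]
      push_cast
      ring
    have e2 : (fun s : ℝ => ev b (x - toT (s • y))) = fun s : ℝ =>
        ∑ k ∈ Set.Finite.toFinset hb', b k * (mFourier k x *
          Complex.exp (s * (-(2 * Real.pi * Complex.I) * m k))) := by
      funext s; rw [hb'.ev_eq]; simp_rw [e1]
    rw [e2, ev_eq_sum (S := Set.Finite.toFinset hb')
      (fun k hk => (Set.Finite.mem_toFinset hb').2 fun h => hk (by simp [mult, h])), Finset.mul_sum]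
    refine HasDerivAt.fun_sum fun k _ => ?_
    rw [e1]
    have e3 : HasDerivAt (fun s : ℝ => (s : ℂ) * (-(2 * Real.pi * Complex.I) * m k))
        (1 * (-(2 * Real.pi * Complex.I) * m k)) s := (Complex.ofRealCLM.hasDerivAt).mul_const _
    have e4 := (e3.cexp.const_mul (mFourier k x)).const_mul (b k)
    refine e4.congr_deriv ?_
    simp only [mult]
    ring
  have hfin := norm_image_sub_le_of_norm_deriv_le_segment_01'
    (C := 2 * Real.pi * ((∑ i, C i) * dyad 1 n * K * ‖y‖))
    (fun s _ => (hline s).hasDerivWithinAt) (fun s _ => by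
      rw [norm_mul, norm_neg, norm_mul, norm_mul, Complex.norm_I, Complex.norm_real, Real.norm_eq_abs,
        abs_of_pos Real.pi_pos, Complex.norm_two, mul_one]
      exact mul_le_mul_of_nonneg_left (hbd _) (by positivity))
  have ht0 : toT 0 = 0 := by funext i; simp [toT]
  simp only [one_smul, zero_smul, ht0, sub_zero] at hfin
  refine hfin.trans (le_of_eq (by ring))

/-- The symbol of the generator of the semigroup, with the opposite sign. -/
def heatSymbol (μ : ℝ) (k : Freq) : ℂ :=
  (Complex.I + (μ : ℂ)) * ((4 * Real.pi ^ 2 * ‖toR k‖ ^ 2 : ℝ) : ℂ) + 1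

lemma hasDerivAt_ev_heat (μ : ℝ) {b : Distr} (hb : FinSupp b) (x : Torus) (s : ℝ) :
    HasDerivAt (fun s : ℝ => ev (heat μ s b) x) (-ev (heat μ s (mult (heatSymbol μ) b)) x) s := by
  have e1 : ∀ (s : ℝ) (a : Distr), (∀ k, a k ≠ 0 → b k ≠ 0) → ev (heat μ s a) x =
      ∑ k ∈ Set.Finite.toFinset hb, Complex.exp (-((s : ℂ) * heatSymbol μ k)) * a k * mFourier k x :=
    fun s a ha => ev_eq_sum (fun k hk => (Set.Finite.mem_toFinset hb).2
      (ha k fun h => hk (by simp [heat, h]))) x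
  rw [e1 s _ (fun k hk h => hk (by simp [mult, h])),
    show (fun s : ℝ => ev (heat μ s b) x) = _ from funext fun s => e1 s b (fun k hk => hk),
    ← Finset.sum_neg_distrib]
  refine HasDerivAt.fun_sum fun k _ => ?_
  have e3 : HasDerivAt (fun s : ℝ => -((s : ℂ) * heatSymbol μ k)) (-(1 * heatSymbol μ k)) s :=
    ((Complex.ofRealCLM.hasDerivAt).mul_const _).neg
  refine ((e3.cexp.mul_const (b k)).mul_const (mFourier k x)).congr_deriv ?_
  simp only [mult]
  ring

lemma exists_heatSymbol_bound (μ : ℝ) : ∃ C : ℝ, 0 ≤ C ∧ ∀ (n : ℕ) b K,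
    SpecBall (2 * 2 ^ n) b → SupLE b K → SupLE (mult (heatSymbol μ) b) (C * 4 ^ n * K) := by
  have hg : ContDiff ℝ ∞ (fun x : Space => ((‖x‖ ^ 2 : ℝ) : ℂ)) :=
    Complex.ofRealCLM.contDiff.comp (contDiff_norm_sq ℝ)
  obtain ⟨C2, hC2, h2⟩ := exists_mult_ball_bound _ hg
  refine ⟨‖heatCoef μ‖ * C2 + 1, by positivity, fun n b K hb hK => ?_⟩
  have hb' := hb.finSupp
  set q : ℂ := heatCoef μ * ((((2:ℝ) ^ n) ^ 2 : ℝ) : ℂ) with hq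
  set m : Distr := mult (fun k => ((‖((2:ℝ) ^ n)⁻¹ • toR k‖ ^ 2 : ℝ) : ℂ)) b with hm
  have hmb : SupLE m (C2 * K) := h2 n b K hb hK
  have e1 : mult (heatSymbol μ) b = q • m + b := by
    funext k
    simp only [hm, hq, mult, Pi.add_apply, Pi.smul_apply, smul_eq_mul, heatSymbol]
    rw [norm_smul, norm_inv, norm_pow, Real.norm_two, heatCoef]
    have h3 : ((2:ℝ) ^ n) ^ 2 * ((((2:ℝ) ^ n)⁻¹ * ‖toR k‖) ^ 2) = ‖toR k‖ ^ 2 := by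
      have : (2:ℝ) ^ n ≠ 0 := by positivity
      field_simp
    rw [← mul_assoc, mul_assoc (_ * _) ((((2:ℝ) ^ n) ^ 2 : ℝ) : ℂ), ← Complex.ofReal_mul, h3]
    push_cast
    ring
  have hqn : ‖q‖ = ‖heatCoef μ‖ * 4 ^ n := by
    rw [hq, norm_mul, Complex.norm_real, Real.norm_eq_abs, abs_of_nonneg (by positivity),
      ← pow_mul, mul_comm n 2, pow_mul, show (2:ℝ) ^ 2 = 4 by norm_num]
  have e2 := (hmb.smul q).add ((hb'.mult _).smul q) hb' hK
  rw [e1]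
  refine e2.mono ?_
  rw [hqn]
  have h4 : (1:ℝ) ≤ 4 ^ n := one_le_pow₀ (by norm_num)
  have h5 := mul_nonneg (sub_nonneg.2 h4) hK.nonneg
  linarith

/-- Continuity of the semigroup at `0` on a dyadic frequency range. -/
lemma exists_heat_sub_bound {μ : ℝ} (hμ : 0 < μ) : ∃ C : ℝ, 0 ≤ C ∧ ∀ (h : ℝ) (n : ℕ) b K δ, 0 < h →
    0 ≤ δ → δ ≤ 1 → SpecBall (2 * 2 ^ n) b → SupLE b K →
    SupLE (heat μ h b - b) (C * h ^ δ * dyad (2 * δ) n * K) := by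
  obtain ⟨C1, hC1, h1⟩ := exists_heat_bound hμ
  obtain ⟨C2, hC2, h2⟩ := exists_heatSymbol_bound μ
  refine ⟨C1 + 1 + C1 * C2, by positivity, fun h n b K δ hh hδ hδ1 hb hK => ?_⟩
  have hK0 := hK.nonneg
  have hb' := hb.finSupp
  set l : ℝ := h * 4 ^ n with hl
  have hl0 : 0 < l := by positivity
  have hlθ : h ^ δ * dyad (2 * δ) n = l ^ δ := by
    have := four_pow_rpow n (-δ)
    rw [neg_neg, mul_neg, neg_neg] at this
    rw [hl, Real.mul_rpow hh.le (by positivity), this]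
  rw [mul_assoc (C1 + 1 + C1 * C2), hlθ]
  rcases le_total 1 l with hl1 | hl1
  · have h3 := (((h1 h hh.le).1 b K hb' hK).sub (hb'.heat h) hb' hK)
    refine h3.mono ?_
    have : 1 ≤ l ^ δ := Real.one_le_rpow hl1 hδ
    calc C1 * K + K ≤ (C1 + 1 + C1 * C2) * 1 * K := by
          nlinarith [mul_nonneg (mul_nonneg hC1 hC2) hK0]
      _ ≤ _ := by gcongr
  · intro x
    have hfin := norm_image_sub_le_of_norm_deriv_le_segment' (a := 0) (b := h)
      (C := C1 * (C2 * 4 ^ n * K))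
      (fun s _ => (hasDerivAt_ev_heat μ hb' x s).hasDerivWithinAt) (fun s hs => by
        rw [norm_neg]
        exact (h1 s hs.1).1 _ _ (hb'.mult _) (h2 n b K hb hK) x) h ⟨hh.le, le_rfl⟩
    have e0 : heat μ 0 b = b := by funext k; simp [heat]
    rw [e0] at hfin
    rw [ev_sub (hb'.heat h) hb']
    refine hfin.trans ?_
    have hll : l ≤ l ^ δ := by
      conv_lhs => rw [← Real.rpow_one l]
      exact Real.rpow_le_rpow_of_exponent_ge hl0 hl1 hδ1
    calc C1 * (C2 * 4 ^ n * K) * (h - 0) = (C1 * C2) * l * K := by rw [hl]; ring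
      _ ≤ (C1 + 1 + C1 * C2) * l ^ δ * K := by gcongr; linarith

/-! #### Littlewood-Paley blocks -/

lemma exists_block_bound (χ : DyadicPartition) : ∃ C : ℝ, 0 ≤ C ∧ ∀ n : ℕ,
    (∀ a K, FinSupp a → SupLE a K → SupLE (block χ n a) (C * K)) ∧
    (∀ f g L K, FinSupp f → FinSupp g → LipLE f L → SupLE g K →
      SupLE (block χ n (conv f g) - conv f (block χ n g)) (C * dyad (-1) n * L * K)) := by
  have c1 : HasCompactSupport (fun x => (χ.low x : ℂ)) := by
    have : HasCompactSupport χ.low := (isCompact_closedBall (0 : Space) (4 / 3)).of_isClosed_subset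
      (isClosed_tsupport _) (χ.low_supp.trans Metric.ball_subset_closedBall)
    exact this.comp_left (g := Complex.ofReal) (by simp)
  have c2 : HasCompactSupport (fun x => (χ.ann x : ℂ)) := by
    have : HasCompactSupport χ.ann := (isCompact_closedBall (0 : Space) (8 / 3)).of_isClosed_subset
      (isClosed_tsupport _) ((χ.ann_supp.trans Set.sdiff_subset).trans Metric.ball_subset_closedBall)
    exact this.comp_left (g := Complex.ofReal) (by simp)
  obtain ⟨C1, hC1, h1⟩ := exists_schwartz_mult_bound
    (c1.toSchwartzMap (Complex.ofRealCLM.contDiff.comp χ.low_smooth))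
  obtain ⟨C2, hC2, h2⟩ := exists_schwartz_mult_bound
    (c2.toSchwartzMap (Complex.ofRealCLM.contDiff.comp χ.ann_smooth))
  refine ⟨C1 + 2 * C2, by positivity, fun n => ?_⟩
  cases n with
  | zero =>
    have h3 := h1 1 zero_le_one
    simp only [one_smul] at h3
    refine ⟨fun a K ha hK => (h3.1 a K ha hK).mono ?_, fun f g L K hf hg hL hK =>
      (h3.2 f g L K hf hg hL hK).mono ?_⟩
    · have := hK.nonneg; gcongr; linarith
    · have := hK.nonneg; have := hL.nonneg
      rw [dyad_zero_right]; gcongr; linarith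
  | succ n =>
    have h3 := h2 ((2:ℝ) ^ n)⁻¹ (by positivity)
    refine ⟨fun a K ha hK => (h3.1 a K ha hK).mono ?_, fun f g L K hf hg hL hK =>
      (h3.2 f g L K hf hg hL hK).mono ?_⟩
    · have := hK.nonneg; gcongr; linarith
    · have := hK.nonneg; have := hL.nonneg
      have h4 : ((2:ℝ) ^ n)⁻¹ = 2 * dyad (-1) (n + 1) := by
        rw [dyad_neg, dyad_one, pow_succ]; field_simp
      have h5 := dyad_pos (-1) (n + 1)
      rw [h4]
      calc C2 * (2 * dyad (-1) (n + 1)) * L * K = (2 * C2) * dyad (-1) (n + 1) * L * K := by ring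
        _ ≤ _ := by gcongr; linarith

lemma weight_spec (χ : DyadicPartition) {n : ℕ} {x : Space} (h : χ.weight n x ≠ 0) :
    ‖x‖ < 4 / 3 * 2 ^ n ∧ (n ≠ 0 → 3 / 8 * 2 ^ n ≤ ‖x‖) := by
  cases n with
  | zero =>
    have h1 := χ.low_supp (subset_tsupport _ h)
    rw [mem_ball_zero_iff] at h1
    simpa using h1
  | succ n =>
    have h1 := χ.ann_supp (subset_tsupport _ h)
    have hp : (0:ℝ) < 2 ^ n := by positivity
    rw [Set.mem_sdiff, mem_ball_zero_iff, mem_ball_zero_iff, norm_smul, norm_inv, norm_pow,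
      Real.norm_two, inv_mul_lt_iff₀ hp, not_lt, le_inv_mul_iff₀ hp] at h1
    rw [pow_succ]
    exact ⟨by linarith [h1.1], fun _ => by linarith [h1.2]⟩

lemma block_spec (χ : DyadicPartition) {n : ℕ} {a : Distr} {k : Freq} (h : block χ n a k ≠ 0) :
    ‖toR k‖ < 4 / 3 * 2 ^ n ∧ (n ≠ 0 → 3 / 8 * 2 ^ n ≤ ‖toR k‖) :=
  weight_spec χ fun h0 => h (by simp [block, h0])

lemma block_specIn (χ : DyadicPartition) (n : ℕ) (a : Distr) : SpecIn n (block χ n a) := by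
  intro k hk
  have h := block_spec χ hk
  have hp : (0:ℝ) < 2 ^ n := by positivity
  exact ⟨by linarith [h.1], fun hn => by linarith [h.2 hn]⟩

lemma block_finSupp (χ : DyadicPartition) (n : ℕ) (a : Distr) : FinSupp (block χ n a) :=
  (block_specIn χ n a).specBall.finSupp

lemma hasSum_weight (χ : DyadicPartition) (x : Space) : HasSum (fun n => χ.weight n x) 1 := by
  refine (hasSum_nat_add_iff' 1).1 ?_
  simpa [DyadicPartition.weight] using χ.sum_eq_one x

lemma sum_weight_eq_one (χ : DyadicPartition) {N : ℕ} (hN : N ≠ 0) {x : Space}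
    (h : ‖x‖ < 3 / 8 * 2 ^ N) : ∑ n ∈ Finset.range N, χ.weight n x = 1 := by
  rw [← (hasSum_weight χ x).tsum_eq]
  refine (tsum_eq_sum fun n hn => ?_).symm
  by_contra h2
  have hn' : N ≤ n := by simpa using hn
  have h3 := (weight_spec χ h2).2 (by omega)
  have h4 : (2:ℝ) ^ N ≤ 2 ^ n := pow_le_pow_right₀ one_le_two hn'
  linarith

end CGL

namespace CGL
open MeasureTheory UnitAddTorus

/-! ### Besov-Hölder bounds -/

/-- `‖Δ_m a‖_{L^∞} ≤ K 2^{-αn}` for all `m = n - 1`; up to the factor `2^α` this means that the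
Besov-Hölder norm of order `α` of `a` is at most `K`. -/
def Bd (χ : DyadicPartition) (α : ℝ) (a : Distr) (K : ℝ) : Prop :=
  ∀ n, SupLE (block χ n a) (K * dyad (-α) n)

variable {χ : DyadicPartition}

lemma block_add (n : ℕ) (a b : Distr) : block χ n (a + b) = block χ n a + block χ n b := by
  funext k; simp [block, mul_add]

lemma block_sub (n : ℕ) (a b : Distr) : block χ n (a - b) = block χ n a - block χ n b := by
  funext k; simp [block, mul_sub]

lemma block_neg (n : ℕ) (a : Distr) : block χ n (-a) = -block χ n a := by
  funext k; simp [block]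

lemma block_smul (n : ℕ) (c : ℂ) (a : Distr) : block χ n (c • a) = c • block χ n a := by
  funext k; simp [block]; ring

lemma block_sum {ι : Type*} (n : ℕ) (s : Finset ι) (f : ι → Distr) :
    block χ n (∑ i ∈ s, f i) = ∑ i ∈ s, block χ n (f i) := by
  funext k; simp [block, Finset.mul_sum]

lemma Bd.nonneg {α : ℝ} {a : Distr} {K : ℝ} (h : Bd χ α a K) : 0 ≤ K :=
  nonneg_of_mul_nonneg_left (h 0).nonneg (dyad_pos _ _)

lemma Bd.mono {α : ℝ} {a : Distr} {K K' : ℝ} (h : Bd χ α a K) (hK : K ≤ K') : Bd χ α a K' :=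
  fun n => (h n).mono (mul_le_mul_of_nonneg_right hK (dyad_pos _ _).le)

lemma Bd.mono_reg {α α' : ℝ} {a : Distr} {K : ℝ} (h : Bd χ α a K) (hα : α' ≤ α) : Bd χ α' a K :=
  fun n => (h n).mono (mul_le_mul_of_nonneg_left (dyad_mono (by linarith) n) h.nonneg)

lemma Bd.add {α : ℝ} {a b : Distr} {K L : ℝ} (h : Bd χ α a K) (h' : Bd χ α b L) :
    Bd χ α (a + b) (K + L) := fun n => by
  rw [block_add, add_mul]
  exact (h n).add (block_finSupp χ n a) (block_finSupp χ n b) (h' n)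

lemma Bd.neg {α : ℝ} {a : Distr} {K : ℝ} (h : Bd χ α a K) : Bd χ α (-a) K := fun n => by
  rw [block_neg]; exact (h n).neg

lemma Bd.sub {α : ℝ} {a b : Distr} {K L : ℝ} (h : Bd χ α a K) (h' : Bd χ α b L) :
    Bd χ α (a - b) (K + L) := by
  rw [sub_eq_add_neg]; exact h.add h'.neg

lemma Bd.smul {α : ℝ} {a : Distr} {K : ℝ} (c : ℂ) (h : Bd χ α a K) : Bd χ α (c • a) (‖c‖ * K) :=
  fun n => by rw [block_smul, mul_assoc]; exact (h n).smul c

lemma bd_zero (α : ℝ) : Bd χ α 0 0 := fun n => by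
  have : block χ n 0 = 0 := by funext k; simp [block]
  rw [this, zero_mul]; exact supLE_zero

/-- Besov-Hölder bounds pass to coefficientwise limits. -/
lemma Bd.of_tendsto {ι : Type*} {l : Filter ι} [l.NeBot] {α K : ℝ} {f : ι → Distr} {a : Distr}
    (h : ∀ᶠ i in l, Bd χ α (f i) K) (hf : ∀ k, Filter.Tendsto (fun i => f i k) l (𝓝 (a k))) :
    Bd χ α a K := fun n x => by
  set S := (finite_freq (2 * 2 ^ n)).toFinset
  have hS : ∀ (b : Distr) (k : Freq), block χ n b k ≠ 0 → k ∈ S := fun b k hk =>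
    (Set.Finite.mem_toFinset _).2 (block_specIn χ n b k hk).1
  have h1 : Filter.Tendsto (fun i => ‖ev (block χ n (f i)) x‖) l (𝓝 ‖ev (block χ n a) x‖) := by
    simp_rw [ev_eq_sum (hS _)]
    exact (tendsto_finsetSum _ fun k _ => ((hf k).const_mul _).mul_const _).norm
  exact le_of_tendsto h1 (h.mono fun i hi => hi n x)

/-! #### Complex conjugation -/

lemma toR_neg (k : Freq) : toR (-k) = -toR k := by
  ext i; simp [toR]

lemma weight_neg (χ : DyadicPartition) (n : ℕ) (x : Space) : χ.weight n (-x) = χ.weight n x := by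
  cases n with
  | zero => exact χ.low_radial _ _ (norm_neg x)
  | succ n => exact χ.ann_radial _ _ (by rw [smul_neg, norm_neg])

lemma block_bar (n : ℕ) (a : Distr) : block χ n (bar a) = bar (block χ n a) := by
  funext k; simp [block, bar, toR_neg, weight_neg]

lemma ev_bar (a : Distr) (x : Torus) : ev (bar a) x = conj (ev a x) := by
  unfold ev
  rw [Complex.conj_tsum, ← (Equiv.neg Freq).tsum_eq]
  refine tsum_congr fun k => ?_
  simp [bar, mFourier_neg]

lemma Bd.bar {α : ℝ} {a : Distr} {K : ℝ} (h : Bd χ α a K) : Bd χ α (bar a) K := fun n x => by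
  rw [block_bar, ev_bar, RCLike.norm_conj]; exact h n x

lemma bar_sub (a b : Distr) : bar (a - b) = bar a - bar b := by funext k; simp [bar]

lemma bar_add (a b : Distr) : bar (a + b) = bar a + bar b := by funext k; simp [bar]

lemma bar_smul (c : ℂ) (a : Distr) : bar (c • a) = conj c • bar a := by funext k; simp [bar]

/-! #### Geometric sums -/

lemma exists_sum_dyad_tail {s : ℝ} (hs : 0 < s) : ∃ C : ℝ, 0 ≤ C ∧ ∀ (m : ℕ) (S : Finset ℕ),
    (∀ i ∈ S, m ≤ i) → ∑ i ∈ S, dyad (-s) i ≤ C * dyad (-s) m := by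
  set r : ℝ := (2 : ℝ) ^ (-s) with hr
  have hr0 : 0 < r := by positivity
  have hr1 : r < 1 := Real.rpow_lt_one_of_one_lt_of_neg one_lt_two (by linarith)
  refine ⟨(1 - r)⁻¹, inv_nonneg.2 (by linarith), fun m S hS => ?_⟩
  have hsum := summable_geometric_of_lt_one hr0.le hr1
  have h1 : ∑ i ∈ S, dyad (-s) i = ∑ i ∈ S.image (fun i => i - m), dyad (-s) m * r ^ i := by
    rw [Finset.sum_image fun i hi j hj h => by
      have := hS i hi; have := hS j hj; have h : i - m = j - m := h; omega]
    refine Finset.sum_congr rfl fun i hi => ?_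
    rw [dyad_eq_pow, dyad_eq_pow, ← hr, ← pow_add, Nat.add_sub_cancel' (hS i hi)]
  rw [h1, ← Finset.mul_sum, mul_comm]
  refine mul_le_mul_of_nonneg_right ?_ (dyad_pos _ _).le
  rw [← tsum_geometric_of_lt_one hr0.le hr1]
  exact hsum.sum_le_tsum _ fun i _ => by positivity

lemma exists_sum_dyad_head {s : ℝ} (hs : 0 < s) : ∃ C : ℝ, 0 ≤ C ∧ ∀ m : ℕ,
    ∑ i ∈ Finset.range m, dyad s i ≤ C * dyad s m := by
  set r : ℝ := (2 : ℝ) ^ s with hr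
  have hr1 : 1 < r := Real.one_lt_rpow one_lt_two hs
  refine ⟨(r - 1)⁻¹, inv_nonneg.2 (by linarith), fun m => ?_⟩
  simp_rw [dyad_eq_pow, ← hr]
  rw [geom_sum_eq (by linarith), div_eq_inv_mul]
  exact mul_le_mul_of_nonneg_left (by linarith) (inv_nonneg.2 (by linarith))

lemma dyad_near (s : ℝ) {i n c : ℕ} (h1 : i ≤ n + c) (h2 : n ≤ i + c) :
    dyad s i ≤ dyad |s| c * dyad s n := by
  rcases le_total 0 s with hs | hs
  · rw [abs_of_nonneg hs, ← dyad_index_add]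
    exact dyad_index_mono hs (by omega)
  · rw [abs_of_nonpos hs, dyad_neg, ← div_eq_inv_mul, le_div_iff₀ (dyad_pos _ _), ← dyad_index_add]
    exact dyad_index_anti hs h2

/-- A sum of terms of size `2^{-si}`, `s > 0`, with spectrum in balls of radius of order `2^i`. -/
lemma exists_ball_sum_bound (χ : DyadicPartition) {s : ℝ} (hs : 0 < s) (c : ℕ) : ∃ C : ℝ, 0 ≤ C ∧
    ∀ (S : Finset ℕ) (f : ℕ → Distr) (K : ℝ), 0 ≤ K → (∀ i ∈ S, SpecBall (2 ^ (c + i)) (f i)) →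
      (∀ i ∈ S, SupLE (f i) (K * dyad (-s) i)) → Bd χ s (∑ i ∈ S, f i) (C * K) := by
  obtain ⟨C1, hC1, h1⟩ := exists_block_bound χ
  obtain ⟨C2, hC2, h2⟩ := exists_sum_dyad_tail hs
  refine ⟨C1 * C2 * dyad s (c + 2), by have := dyad_pos s (c + 2); positivity,
    fun S f K hK hspec hsup n => ?_⟩
  classical
  rw [block_sum]
  have h3 : ∑ i ∈ S, block χ n (f i) = ∑ i ∈ S.filter (fun i => n - (c + 2) ≤ i), block χ n (f i) := by
    refine (Finset.sum_filter_of_ne fun i hi hne => ?_).symm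
    by_contra hlt
    apply hne
    funext k
    by_contra hk
    have hfk : f i k ≠ 0 := fun h => hk (by simp [block, h])
    have h4 := hspec i hi k hfk
    have h5 := (block_spec χ hk).2 (by omega)
    have h6 : (2:ℝ) ^ (c + i + 2) ≤ 2 ^ n := pow_le_pow_right₀ one_le_two (by omega)
    rw [pow_add] at h6
    have : (0:ℝ) < 2 ^ (c + i) := by positivity
    linarith
  rw [h3]
  have h4 := SupLE.sum (s := S.filter (fun i => n - (c + 2) ≤ i)) (f := fun i => block χ n (f i))
    (K := fun i => C1 * (K * dyad (-s) i)) (fun i _ => block_finSupp χ n _)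
    (fun i hi => (h1 n).1 _ _ (hspec i (Finset.mem_filter.1 hi).1).finSupp
      (hsup i (Finset.mem_filter.1 hi).1))
  refine h4.mono ?_
  have h5 := h2 (n - (c + 2)) (S.filter (fun i => n - (c + 2) ≤ i)) fun i hi => (Finset.mem_filter.1 hi).2
  have h6 : dyad (-s) (n - (c + 2)) ≤ dyad s (c + 2) * dyad (-s) n := by
    rw [dyad_neg, dyad_neg, ← div_eq_mul_inv, le_div_iff₀ (dyad_pos _ _), inv_mul_le_iff₀ (dyad_pos _ _),
      ← dyad_index_add]
    exact dyad_index_mono hs.le (by omega)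
  calc ∑ i ∈ S.filter (fun i => n - (c + 2) ≤ i), C1 * (K * dyad (-s) i)
      = C1 * K * ∑ i ∈ S.filter (fun i => n - (c + 2) ≤ i), dyad (-s) i := by
        rw [Finset.mul_sum]; exact Finset.sum_congr rfl fun i _ => by ring
    _ ≤ C1 * K * (C2 * (dyad s (c + 2) * dyad (-s) n)) := by gcongr; exact h5.trans (by gcongr)
    _ = _ := by ring

/-- A sum of terms of size `2^{-si}` with spectrum in dyadic annuli. -/
lemma exists_annulus_sum_bound (χ : DyadicPartition) (s : ℝ) : ∃ C : ℝ, 0 ≤ C ∧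
    ∀ (S : Finset ℕ) (f : ℕ → Distr) (K : ℝ), 0 ≤ K → (∀ i ∈ S, SpecIn i (f i)) →
      (∀ i ∈ S, SupLE (f i) (K * dyad (-s) i)) → Bd χ s (∑ i ∈ S, f i) (C * K) := by
  obtain ⟨C1, hC1, h1⟩ := exists_block_bound χ
  refine ⟨11 * C1 * dyad |s| 5, by have := dyad_pos |s| 5; positivity,
    fun S f K hK hspec hsup n => ?_⟩
  classical
  set U := S.filter (fun i => i ≤ n + 5 ∧ n ≤ i + 5) with hU
  rw [block_sum]
  have h3 : ∑ i ∈ S, block χ n (f i) = ∑ i ∈ U, block χ n (f i) := by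
    refine (Finset.sum_filter_of_ne fun i hi hne => ?_).symm
    by_contra hlt
    apply hne
    funext k
    by_contra hk
    have hfk : f i k ≠ 0 := fun h => hk (by simp [block, h])
    obtain ⟨h4, h4'⟩ := hspec i hi k hfk
    obtain ⟨h5, h5'⟩ := block_spec χ hk
    have hp : (0:ℝ) < 2 ^ i := by positivity
    have hp' : (0:ℝ) < 2 ^ n := by positivity
    rw [not_and_or, not_le, not_le] at hlt
    rcases hlt with h | h
    · have h4' := h4' (by omega)
      have h6 : (2:ℝ) ^ (n + 6) ≤ 2 ^ i := pow_le_pow_right₀ one_le_two (by omega)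
      rw [pow_add] at h6
      linarith
    · have h5' := h5' (by omega)
      have h6 : (2:ℝ) ^ (i + 6) ≤ 2 ^ n := pow_le_pow_right₀ one_le_two (by omega)
      rw [pow_add] at h6
      linarith
  rw [h3]
  have h4 := SupLE.sum (s := U) (f := fun i => block χ n (f i))
    (K := fun _ => C1 * (K * (dyad |s| 5 * dyad (-s) n))) (fun i _ => block_finSupp χ n _)
    (fun i hi => by
      have hi' := Finset.mem_filter.1 hi
      refine ((h1 n).1 _ _ (hspec i hi'.1).specBall.finSupp (hsup i hi'.1)).mono ?_
      have := dyad_near (-s) hi'.2.1 hi'.2.2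
      rw [abs_neg] at this
      gcongr)
  refine h4.mono ?_
  rw [Finset.sum_const, nsmul_eq_mul]
  have hcard : (U.card : ℝ) ≤ 11 := by
    have : U ⊆ Finset.Icc (n - 5) (n + 5) := fun i hi => by
      have hi' := (Finset.mem_filter.1 hi).2
      rw [Finset.mem_Icc]; omega
    have h5 := Finset.card_le_card this
    rw [Nat.card_Icc] at h5
    exact_mod_cast h5.trans (by omega)
  have := dyad_pos |s| 5
  have := dyad_pos (-s) n
  calc (U.card : ℝ) * (C1 * (K * (dyad |s| 5 * dyad (-s) n)))
      ≤ 11 * (C1 * (K * (dyad |s| 5 * dyad (-s) n))) := by gcongr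
    _ = _ := by ring

end CGL

namespace CGL
open MeasureTheory UnitAddTorus
variable {χ : DyadicPartition}

/-! ### Paraproducts and resonant products -/

/-- The low-frequency part `∑_{p + 2 ≤ q} Δ_p a`. -/
def low (χ : DyadicPartition) (q : ℕ) (a : Distr) : Distr := ∑ p ∈ Finset.range (q - 1), block χ p a

/-- The sum of the blocks adjacent to the `i`-th one. -/
def fat (χ : DyadicPartition) (i : ℕ) (a : Distr) : Distr :=
  ∑ j ∈ Finset.Icc (i - 1) (i + 1), block χ j a

lemma conv_add_left {b : Distr} (hb : FinSupp b) (a a' : Distr) :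
    conv (a + a') b = conv a b + conv a' b := by
  funext k
  have hs : ∀ a : Distr, Summable (fun j => a j * b (k - j)) := fun a => by
    refine summable_of_hasFiniteSupport ((Set.Finite.image (fun l => k - l) hb).subset fun j hj => ?_)
    exact ⟨k - j, fun h => hj (by simp [h]), by simp⟩
  simp only [Pi.add_apply, conv]
  rw [← (hs a).tsum_add (hs a')]
  exact tsum_congr fun j => by ring

lemma conv_sub_left {b : Distr} (hb : FinSupp b) (a a' : Distr) :
    conv (a - a') b = conv a b - conv a' b := by
  have h := conv_add_left hb (a - a') a'
  rw [sub_add_cancel] at h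
  rw [h]; abel

lemma conv_zero_left (b : Distr) : conv 0 b = 0 := by funext k; simp [conv]

lemma conv_zero_right (a : Distr) : conv a 0 = 0 := by funext k; simp [conv]

lemma conv_add_right {a : Distr} (ha : FinSupp a) (b c : Distr) :
    conv a (b + c) = conv a b + conv a c := by
  have h := conv_sub_right ha (b + c) c
  rw [add_sub_cancel_right] at h
  rw [h]; abel

lemma conv_sum_left {ι : Type*} {b : Distr} (hb : FinSupp b) (s : Finset ι) (f : ι → Distr) :
    conv (∑ i ∈ s, f i) b = ∑ i ∈ s, conv (f i) b := by
  classical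
  induction s using Finset.induction_on with
  | empty => simp [conv_zero_left]
  | insert i s hi ih => rw [Finset.sum_insert hi, Finset.sum_insert hi, conv_add_left hb, ih]

lemma conv_sum_right {ι : Type*} {a : Distr} (ha : FinSupp a) (s : Finset ι) (f : ι → Distr) :
    conv a (∑ i ∈ s, f i) = ∑ i ∈ s, conv a (f i) := by
  classical
  induction s using Finset.induction_on with
  | empty => simp [conv_zero_right]
  | insert i s hi ih => rw [Finset.sum_insert hi, Finset.sum_insert hi, conv_add_right ha, ih]

lemma SpecBall.mono {r r' : ℝ} {b : Distr} (h : SpecBall r b) (hr : r ≤ r') : SpecBall r' b :=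
  fun k hk => (h k hk).trans_le hr

lemma SpecBall.sum {ι : Type*} {s : Finset ι} {f : ι → Distr} {r : ℝ} (h : ∀ i ∈ s, SpecBall r (f i)) :
    SpecBall r (∑ i ∈ s, f i) := fun k hk => by
  rw [Finset.sum_apply] at hk
  obtain ⟨i, hi, hk'⟩ := Finset.exists_ne_zero_of_sum_ne_zero hk
  exact h i hi k hk'

lemma toR_add (k l : Freq) : toR (k + l) = toR k + toR l := by
  ext i; simp [toR]

lemma conv_spec {a b : Distr} {k : Freq} (h : conv a b k ≠ 0) :
    ∃ j l, a j ≠ 0 ∧ b l ≠ 0 ∧ toR k = toR j + toR l := by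
  obtain ⟨j, h1, h2⟩ := conv_ne_zero h
  exact ⟨j, k - j, h1, h2, by rw [← toR_add, add_sub_cancel]⟩

lemma SpecBall.conv {r r' : ℝ} {a b : Distr} (ha : SpecBall r a) (hb : SpecBall r' b) :
    SpecBall (r + r') (conv a b) := fun k hk => by
  obtain ⟨j, l, h1, h2, h3⟩ := conv_spec hk
  rw [h3]
  exact (norm_add_le _ _).trans_lt (add_lt_add (ha j h1) (hb l h2))

lemma block_specBall (n : ℕ) (a : Distr) : SpecBall (4 / 3 * 2 ^ n) (block χ n a) :=
  fun _ hk => (block_spec χ hk).1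

lemma block_specBall_of_le {n m : ℕ} (h : n ≤ m) (a : Distr) : SpecBall (4 / 3 * 2 ^ m) (block χ n a) :=
  (block_specBall n a).mono (by gcongr; exact one_le_two)

lemma low_specBall (q : ℕ) (a : Distr) : SpecBall (2 ^ q / 3) (low χ q a) := by
  refine SpecBall.sum fun p hp => (block_specBall p a).mono ?_
  have h1 : p + 2 ≤ q := by have := Finset.mem_range.1 hp; omega
  have h2 : (2:ℝ) ^ (p + 2) ≤ 2 ^ q := pow_le_pow_right₀ one_le_two h1
  rw [pow_add] at h2
  linarith

lemma fat_specBall (i : ℕ) (a : Distr) : SpecBall (8 / 3 * 2 ^ i) (fat χ i a) := by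
  refine SpecBall.sum fun j hj => (block_specBall_of_le (Finset.mem_Icc.1 hj).2 a).mono ?_
  rw [pow_succ]; linarith

lemma low_finSupp (q : ℕ) (a : Distr) : FinSupp (low χ q a) := (low_specBall q a).finSupp

lemma fat_finSupp (i : ℕ) (a : Distr) : FinSupp (fat χ i a) := (fat_specBall i a).finSupp

lemma conv_low_spec (q : ℕ) (a b : Distr) : SpecIn q (conv (low χ q a) (block χ q b)) := by
  intro k hk
  obtain ⟨j, l, h1, h2, h3⟩ := conv_spec hk
  have h4 := low_specBall q a j h1
  obtain ⟨h5, h6⟩ := block_spec χ h2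
  have hp : (0:ℝ) < 2 ^ q := by positivity
  rw [h3]
  refine ⟨by linarith [norm_add_le (toR j) (toR l)], fun hq => ?_⟩
  have h6 := h6 hq
  have h7 : ‖toR l‖ ≤ ‖toR j + toR l‖ + ‖toR j‖ := by
    have h8 := norm_sub_le (toR j + toR l) (toR j)
    rwa [add_sub_cancel_left] at h8
  linarith

lemma conv_fat_specBall (i : ℕ) (a b : Distr) : SpecBall (2 ^ (2 + i)) (conv (block χ i a) (fat χ i b)) := by
  refine ((block_specBall i a).conv (fat_specBall i b)).mono ?_
  rw [pow_add]; linarith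

lemma low_sub (q : ℕ) (a b : Distr) : low χ q (a - b) = low χ q a - low χ q b := by
  simp only [low, block_sub, Finset.sum_sub_distrib]

lemma fat_sub (q : ℕ) (a b : Distr) : fat χ q (a - b) = fat χ q a - fat χ q b := by
  simp only [fat, block_sub, Finset.sum_sub_distrib]

/-- Coefficientwise, the paraproduct is a finite sum. -/
lemma para_apply (a b : Distr) {k : Freq} {N : ℕ} (hk : ‖toR k‖ < 2 ^ N / 24) :
    para χ a b k = ∑ q ∈ Finset.range N, conv (low χ q a) (block χ q b) k := by
  classical
  have h0 : ∀ p : {p : ℕ × ℕ // p.1 + 2 ≤ p.2}, N ≤ p.1.2 →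
      conv (block χ p.1.1 a) (block χ p.1.2 b) k = 0 := by
    rintro ⟨⟨p, q⟩, hp⟩ hN
    by_contra h
    obtain ⟨j, l, h1, h2, h3⟩ := conv_spec h
    have h4 := (block_spec χ h1).1
    have hp : p + 2 ≤ q := hp
    have h6 := (block_spec χ h2).2 (show q ≠ 0 by omega)
    have h7 : ‖toR l‖ ≤ ‖toR j + toR l‖ + ‖toR j‖ := by
      have h8 := norm_sub_le (toR j + toR l) (toR j)
      rwa [add_sub_cancel_left] at h8
    rw [← h3] at h7
    have h8 : (2:ℝ) ^ (p + 2) ≤ 2 ^ q := pow_le_pow_right₀ one_le_two hp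
    have h9 : (2:ℝ) ^ N ≤ 2 ^ q := pow_le_pow_right₀ one_le_two hN
    rw [pow_add] at h8
    simp only at h4 h6
    linarith
  set U := ((Finset.range N ×ˢ Finset.range N).subtype fun p : ℕ × ℕ => p.1 + 2 ≤ p.2)
  have h1 : para χ a b k = ∑ p ∈ U, conv (block χ p.1.1 a) (block χ p.1.2 b) k := by
    refine tsum_eq_sum fun p hp => h0 p ?_
    by_contra h
    refine hp (Finset.mem_subtype.2 (Finset.mem_product.2 ⟨?_, ?_⟩))
    · have := p.2; simp only [Finset.mem_range]; omega
    · simp only [Finset.mem_range]; omega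
  rw [h1, Finset.sum_subtype_eq_sum_filter (fun p : ℕ × ℕ => conv (block χ p.1 a) (block χ p.2 b) k),
    Finset.sum_filter, Finset.sum_product_right]
  refine Finset.sum_congr rfl fun q hq => ?_
  rw [low, conv_sum_left (block_finSupp χ q b), Finset.sum_apply, ← Finset.sum_filter]
  refine Finset.sum_congr ?_ fun _ _ => rfl
  ext p
  simp only [Finset.mem_filter, Finset.mem_range] at hq ⊢
  omega

/-- Partial sums of the paraproduct. -/
def paraN (χ : DyadicPartition) (N : ℕ) (a b : Distr) : Distr :=
  ∑ q ∈ Finset.range N, conv (low χ q a) (block χ q b)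

lemma exists_norm_lt_two_pow (x c : ℝ) (hc : 0 < c) : ∃ N₀ : ℕ, ∀ N ≥ N₀, x < 2 ^ N * c := by
  obtain ⟨N₀, h⟩ := pow_unbounded_of_one_lt (x / c) (one_lt_two (α := ℝ))
  refine ⟨N₀, fun N hN => ?_⟩
  rw [div_lt_iff₀ hc] at h
  exact h.trans_le (by gcongr; exact one_le_two)

lemma para_eventually_eq (a b : Distr) (k : Freq) :
    ∀ᶠ N in Filter.atTop, paraN χ N a b k = para χ a b k := by
  obtain ⟨N₀, h⟩ := exists_norm_lt_two_pow ‖toR k‖ (1 / 24) (by norm_num)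
  filter_upwards [Filter.eventually_ge_atTop N₀] with N hN
  rw [para_apply a b (N := N) (by have := h N hN; linarith), paraN, Finset.sum_apply]

lemma tendsto_paraN (a b : Distr) (k : Freq) :
    Filter.Tendsto (fun N => paraN χ N a b k) Filter.atTop (𝓝 (para χ a b k)) :=
  tendsto_const_nhds.congr' ((para_eventually_eq a b k).mono fun _ h => h.symm)

lemma para_sub_left (a a' b : Distr) : para χ (a - a') b = para χ a b - para χ a' b := by
  funext k
  obtain ⟨N, h1, h2, h3⟩ := ((para_eventually_eq (a - a') b k).and
    ((para_eventually_eq a b k).and (para_eventually_eq a' b k))).exists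
  rw [Pi.sub_apply, ← h1, ← h2, ← h3]
  simp only [paraN, low_sub, conv_sub_left (block_finSupp χ _ b), Finset.sum_sub_distrib, Pi.sub_apply]

lemma para_sub_right (a b b' : Distr) : para χ a (b - b') = para χ a b - para χ a b' := by
  funext k
  obtain ⟨N, h1, h2, h3⟩ := ((para_eventually_eq a (b - b') k).and
    ((para_eventually_eq a b k).and (para_eventually_eq a b' k))).exists
  rw [Pi.sub_apply, ← h1, ← h2, ← h3]
  simp only [paraN, block_sub, conv_sub_right (low_finSupp _ a), Finset.sum_sub_distrib, Pi.sub_apply]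

lemma low_supLE {α : ℝ} {a : Distr} {K : ℝ} (h : Bd χ α a K) (q : ℕ) :
    SupLE (low χ q a) (∑ p ∈ Finset.range (q - 1), K * dyad (-α) p) :=
  SupLE.sum (fun p _ => block_finSupp χ p a) fun p _ => h p

lemma exists_low_bound_pos {α : ℝ} (hα : 0 < α) : ∃ C : ℝ, 0 ≤ C ∧ ∀ a K (q : ℕ), Bd χ α a K →
    SupLE (low χ q a) (C * K) := by
  obtain ⟨C, hC, h1⟩ := exists_sum_dyad_tail hα
  refine ⟨C, hC, fun a K q h => (low_supLE h q).mono ?_⟩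
  rw [← Finset.mul_sum, mul_comm]
  have := h1 0 (Finset.range (q - 1)) (fun _ _ => Nat.zero_le _)
  rw [dyad_zero_right, mul_one] at this
  exact mul_le_mul_of_nonneg_right this h.nonneg

lemma exists_low_bound_neg {α : ℝ} (hα : α < 0) : ∃ C : ℝ, 0 ≤ C ∧ ∀ a K (q : ℕ), Bd χ α a K →
    SupLE (low χ q a) (C * K * dyad (-α) q) := by
  obtain ⟨C, hC, h1⟩ := exists_sum_dyad_head (neg_pos.2 hα)
  refine ⟨C, hC, fun a K q h => (low_supLE h q).mono ?_⟩
  rw [← Finset.mul_sum]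
  have h2 : dyad (-α) (q - 1) ≤ dyad (-α) q := dyad_index_mono (by linarith) (by omega)
  have := h.nonneg
  calc K * ∑ i ∈ Finset.range (q - 1), dyad (-α) i ≤ K * (C * dyad (-α) q) := by
        gcongr; exact (h1 _).trans (by gcongr)
    _ = _ := by ring

lemma LipLE.sum {ι : Type*} {s : Finset ι} {f : ι → Distr} {L : ι → ℝ}
    (hf : ∀ i ∈ s, FinSupp (f i)) (h : ∀ i ∈ s, LipLE (f i) (L i)) :
    LipLE (∑ i ∈ s, f i) (∑ i ∈ s, L i) := fun x y => by
  rw [ev_sum hf, ev_sum hf, ← Finset.sum_sub_distrib, Finset.sum_mul]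
  exact (norm_sum_le _ _).trans (Finset.sum_le_sum fun i hi => h i hi x y)

lemma exists_low_lip {α : ℝ} (hα : α < 1) : ∃ C : ℝ, 0 ≤ C ∧ ∀ a K (q : ℕ), Bd χ α a K →
    LipLE (low χ q a) (C * K * dyad (1 - α) q) := by
  obtain ⟨C, hC, h1⟩ := exists_sum_dyad_head (sub_pos.2 hα)
  obtain ⟨C1, hC1, h2⟩ := exists_lip_bound
  refine ⟨C1 * C, by positivity, fun a K q h => ?_⟩
  have h3 : LipLE (low χ q a) (∑ p ∈ Finset.range (q - 1), C1 * dyad 1 p * (K * dyad (-α) p)) :=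
    LipLE.sum (fun p _ => block_finSupp χ p a) fun p _ => h2 p _ _ (block_specIn χ p a).specBall (h p)
  have h4 : dyad (1 - α) (q - 1) ≤ dyad (1 - α) q := dyad_index_mono (by linarith) (by omega)
  have hK := h.nonneg
  intro x y
  refine (h3 x y).trans (mul_le_mul_of_nonneg_right ?_ (norm_nonneg y))
  calc ∑ p ∈ Finset.range (q - 1), C1 * dyad 1 p * (K * dyad (-α) p)
      = C1 * K * ∑ p ∈ Finset.range (q - 1), dyad (1 - α) p := by
        rw [Finset.mul_sum]
        refine Finset.sum_congr rfl fun p _ => ?_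
        rw [sub_eq_add_neg, dyad_add]; ring
    _ ≤ C1 * K * (C * dyad (1 - α) q) := by gcongr; exact (h1 _).trans (by gcongr)
    _ = _ := by ring

lemma exists_para_pos_bound (χ : DyadicPartition) {α : ℝ} (hα : 0 < α) (β : ℝ) : ∃ C : ℝ, 0 ≤ C ∧
    ∀ a b K L, Bd χ α a K → Bd χ β b L → Bd χ β (para χ a b) (C * K * L) := by
  obtain ⟨C1, hC1, h1⟩ := exists_low_bound_pos (χ := χ) hα
  obtain ⟨C2, hC2, h2⟩ := exists_annulus_sum_bound χ β
  refine ⟨C2 * C1, by positivity, fun a b K L ha hb => ?_⟩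
  refine Bd.of_tendsto (Filter.Eventually.of_forall fun N => ?_) (tendsto_paraN a b)
  have hK := ha.nonneg
  have hL := hb.nonneg
  refine (h2 (Finset.range N) _ (C1 * K * L) (by positivity) (fun q _ => conv_low_spec q a b)
    fun q _ => ?_).mono (le_of_eq (by ring))
  refine ((h1 a K q ha).conv (low_finSupp q a) (block_finSupp χ q b) (hb q)).mono (le_of_eq (by ring))

lemma exists_para_neg_bound (χ : DyadicPartition) {α : ℝ} (hα : α < 0) (β : ℝ) : ∃ C : ℝ, 0 ≤ C ∧
    ∀ a b K L, Bd χ α a K → Bd χ β b L → Bd χ (α + β) (para χ a b) (C * K * L) := by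
  obtain ⟨C1, hC1, h1⟩ := exists_low_bound_neg (χ := χ) hα
  obtain ⟨C2, hC2, h2⟩ := exists_annulus_sum_bound χ (α + β)
  refine ⟨C2 * C1, by positivity, fun a b K L ha hb => ?_⟩
  refine Bd.of_tendsto (Filter.Eventually.of_forall fun N => ?_) (tendsto_paraN a b)
  have hK := ha.nonneg
  have hL := hb.nonneg
  refine (h2 (Finset.range N) _ (C1 * K * L) (by positivity) (fun q _ => conv_low_spec q a b)
    fun q _ => ?_).mono (le_of_eq (by ring))
  refine ((h1 a K q ha).conv (low_finSupp q a) (block_finSupp χ q b) (hb q)).mono (le_of_eq ?_)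
  rw [neg_add, dyad_add]; ring

/-! #### The resonant product -/

/-- Partial sums of the resonant product. -/
def resoN (χ : DyadicPartition) (N : ℕ) (a b : Distr) : Distr :=
  ∑ i ∈ Finset.range N, conv (block χ i a) (fat χ i b)

lemma fat_supLE {β : ℝ} {b : Distr} {L : ℝ} (h : Bd χ β b L) (i : ℕ) :
    SupLE (fat χ i b) (3 * dyad |β| 1 * L * dyad (-β) i) := by
  have hL := h.nonneg
  have h1 := SupLE.sum (s := Finset.Icc (i - 1) (i + 1)) (f := fun j => block χ j b)
    (K := fun _ => L * (dyad |β| 1 * dyad (-β) i)) (fun j _ => block_finSupp χ j b) (fun j hj => by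
      have hj' := Finset.mem_Icc.1 hj
      refine (h j).mono ?_
      have := dyad_near (-β) (i := j) (n := i) (c := 1) (by omega) (by omega)
      rw [abs_neg] at this
      gcongr)
  refine h1.mono ?_
  rw [Finset.sum_const, nsmul_eq_mul]
  have hcard : ((Finset.Icc (i - 1) (i + 1)).card : ℝ) ≤ 3 := by
    rw [Nat.card_Icc]; exact_mod_cast (by omega)
  have := dyad_pos |β| 1
  have := dyad_pos (-β) i
  calc _ ≤ 3 * (L * (dyad |β| 1 * dyad (-β) i)) := by gcongr
    _ = _ := by ring

lemma conv_fat_supLE {α β : ℝ} {a b : Distr} {K L : ℝ} (ha : Bd χ α a K) (hb : Bd χ β b L) (i : ℕ) :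
    SupLE (conv (block χ i a) (fat χ i b)) (3 * dyad |β| 1 * K * L * dyad (-(α + β)) i) := by
  refine ((ha i).conv (block_finSupp χ i a) (fat_finSupp i b) (fat_supLE hb i)).mono (le_of_eq ?_)
  rw [neg_add, dyad_add]; ring

lemma tendsto_resoN {α β : ℝ} (hαβ : 0 < α + β) {a b : Distr} {K L : ℝ} (ha : Bd χ α a K)
    (hb : Bd χ β b L) (k : Freq) :
    Filter.Tendsto (fun N => resoN χ N a b k) Filter.atTop (𝓝 (reso χ a b k)) := by
  classical
  have hK := ha.nonneg
  have hL := hb.nonneg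
  set P : ℕ × ℕ → Prop := fun p => p.1 ≤ p.2 + 1 ∧ p.2 ≤ p.1 + 1 with hP
  set f : ℕ × ℕ → ℂ := fun p => conv (block χ p.1 a) (block χ p.2 b) k with hf
  set U : ℕ → Finset {p // P p} := fun N => (Finset.range N ×ˢ Finset.range (N + 1)).subtype P with hU
  have hsumU : ∀ {E : Type} [AddCommMonoid E] (g : ℕ × ℕ → E) (N : ℕ), ∑ p ∈ U N, g p.1
      = ∑ i ∈ Finset.range N, ∑ j ∈ Finset.Icc (i - 1) (i + 1), g (i, j) := by
    intro E _ g N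
    rw [hU, Finset.sum_subtype_eq_sum_filter, Finset.sum_filter, Finset.sum_product]
    refine Finset.sum_congr rfl fun i hi => ?_
    rw [← Finset.sum_filter]
    refine Finset.sum_congr ?_ fun _ _ => rfl
    ext j
    simp only [Finset.mem_filter, Finset.mem_range, Finset.mem_Icc, hP] at hi ⊢
    omega
  have hUm : Monotone U := fun N M h p hp => by
    simp only [hU, Finset.mem_subtype, Finset.mem_product, Finset.mem_range] at hp ⊢
    omega
  have hUt : Filter.Tendsto U Filter.atTop Filter.atTop :=
    Filter.tendsto_atTop_finset_of_monotone hUm fun p => ⟨p.1.1 + 1, by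
      have := p.2
      simp only [hU, Finset.mem_subtype, Finset.mem_product, Finset.mem_range]
      omega⟩
  obtain ⟨C, hC, hgeo⟩ := exists_sum_dyad_tail hαβ
  have hfb : ∀ i j, j ∈ Finset.Icc (i - 1) (i + 1) →
      ‖f (i, j)‖ ≤ K * L * dyad |β| 1 * dyad (-(α + β)) i := fun i j hj => by
    have h1 := ((ha i).conv (block_finSupp χ i a) (block_finSupp χ j b) (hb j)).norm_coeff_le
      ((block_finSupp χ i a).conv (block_finSupp χ j b)) k
    refine h1.trans ?_
    have hj' := Finset.mem_Icc.1 hj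
    have := dyad_near (-β) (i := j) (n := i) (c := 1) (by omega) (by omega)
    rw [abs_neg] at this
    have h0 := dyad_pos (-α) i
    rw [neg_add, dyad_add]
    calc K * dyad (-α) i * (L * dyad (-β) j) ≤ K * dyad (-α) i * (L * (dyad |β| 1 * dyad (-β) i)) := by
          gcongr
      _ = _ := by ring
  have hd := dyad_pos |β| 1
  have hsummable : Summable fun p : {p // P p} => f p.1 := by
    refine Summable.of_norm (summable_of_sum_le (c := 3 * (K * L * dyad |β| 1) * C)
      (fun _ => norm_nonneg _) fun u => ?_)
    obtain ⟨N, hN⟩ := (hUt.eventually (Filter.eventually_ge_atTop u)).exists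
    refine (Finset.sum_le_sum_of_subset_of_nonneg hN fun _ _ _ => norm_nonneg _).trans ?_
    rw [hsumU (fun p => ‖f p‖)]
    calc _ ≤ ∑ i ∈ Finset.range N, 3 * (K * L * dyad |β| 1 * dyad (-(α + β)) i) := by
          refine Finset.sum_le_sum fun i _ => (Finset.sum_le_sum fun j hj => hfb i j hj).trans ?_
          rw [Finset.sum_const, nsmul_eq_mul]
          have hcard : ((Finset.Icc (i - 1) (i + 1)).card : ℝ) ≤ 3 := by
            rw [Nat.card_Icc]; exact_mod_cast (by omega)
          have := dyad_pos (-(α + β)) i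
          gcongr
      _ = 3 * (K * L * dyad |β| 1) * ∑ i ∈ Finset.range N, dyad (-(α + β)) i := by
          rw [Finset.mul_sum]; exact Finset.sum_congr rfl fun i _ => by ring
      _ ≤ 3 * (K * L * dyad |β| 1) * C := by
          have := hgeo 0 (Finset.range N) (fun _ _ => Nat.zero_le _)
          rw [dyad_zero_right, mul_one] at this
          gcongr
  have h1 := hsummable.hasSum.comp hUt
  refine h1.congr fun N => ?_
  simp only [Function.comp]
  rw [hsumU f N, resoN, Finset.sum_apply]
  refine Finset.sum_congr rfl fun i _ => ?_
  rw [fat, conv_sum_right (block_finSupp χ i a), Finset.sum_apply]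

lemma exists_reso_bound (χ : DyadicPartition) {α β : ℝ} (hαβ : 0 < α + β) : ∃ C : ℝ, 0 ≤ C ∧
    ∀ a b K L, Bd χ α a K → Bd χ β b L → Bd χ (α + β) (reso χ a b) (C * K * L) := by
  obtain ⟨C2, hC2, h2⟩ := exists_ball_sum_bound χ hαβ 2
  have hd := dyad_pos |β| 1
  refine ⟨C2 * (3 * dyad |β| 1), by positivity, fun a b K L ha hb => ?_⟩
  refine Bd.of_tendsto (Filter.Eventually.of_forall fun N => ?_) (tendsto_resoN hαβ ha hb)
  have hK := ha.nonneg
  have hL := hb.nonneg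
  exact (h2 (Finset.range N) _ (3 * dyad |β| 1 * K * L) (by positivity)
    (fun q _ => conv_fat_specBall q a b) fun q _ => conv_fat_supLE ha hb q).mono (le_of_eq (by ring))

lemma reso_sub_left {α β : ℝ} (hαβ : 0 < α + β) {a a' b : Distr} {K K' L : ℝ} (ha : Bd χ α a K)
    (ha' : Bd χ α a' K') (hb : Bd χ β b L) : reso χ (a - a') b = reso χ a b - reso χ a' b := by
  funext k
  refine tendsto_nhds_unique (tendsto_resoN hαβ (ha.sub ha') hb k)
    (((tendsto_resoN hαβ ha hb k).sub (tendsto_resoN hαβ ha' hb k)).congr fun N => ?_)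
  simp only [resoN, block_sub, conv_sub_left (fat_finSupp _ b), Finset.sum_sub_distrib, Pi.sub_apply]

lemma reso_sub_right {α β : ℝ} (hαβ : 0 < α + β) {a b b' : Distr} {K L L' : ℝ} (ha : Bd χ α a K)
    (hb : Bd χ β b L) (hb' : Bd χ β b' L') : reso χ a (b - b') = reso χ a b - reso χ a b' := by
  funext k
  refine tendsto_nhds_unique (tendsto_resoN hαβ ha (hb.sub hb') k)
    (((tendsto_resoN hαβ ha hb k).sub (tendsto_resoN hαβ ha hb' k)).congr fun N => ?_)
  simp only [resoN, fat_sub, conv_sub_right (block_finSupp χ _ a), Finset.sum_sub_distrib, Pi.sub_apply]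

end CGL

namespace CGL
open MeasureTheory UnitAddTorus
variable {χ : DyadicPartition}

/-! ### The semigroup on Besov-Hölder spaces -/

lemma block_heat (μ t : ℝ) (n : ℕ) (a : Distr) : block χ n (heat μ t a) = heat μ t (block χ n a) := by
  funext k; simp only [block, heat]; ring

lemma heat_sub (μ t : ℝ) (a b : Distr) : heat μ t (a - b) = heat μ t a - heat μ t b := by
  funext k; simp only [heat, Pi.sub_apply]; ring

lemma heat_sum {ι : Type*} (μ t : ℝ) (s : Finset ι) (f : ι → Distr) :
    heat μ t (∑ i ∈ s, f i) = ∑ i ∈ s, heat μ t (f i) := by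
  funext k; simp [heat, Finset.mul_sum]

/-- The smoothing effect of the semigroup. -/
lemma exists_heat_bd (χ : DyadicPartition) {μ : ℝ} (hμ : 0 < μ) : ∃ C : ℝ, 0 ≤ C ∧
    ∀ t : ℝ, 0 < t → t ≤ 1 → ∀ α γ : ℝ, α ≤ γ → γ ≤ α + 4 → ∀ a K, Bd χ α a K →
      Bd χ γ (heat μ t a) (C * t ^ (-((γ - α) / 2)) * K) := by
  obtain ⟨C, hC, h⟩ := exists_heat_spec_bound hμ
  refine ⟨C, hC, fun t ht ht1 α γ h1 h2 a K ha n => ?_⟩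
  rw [block_heat]
  refine ((h t n ht ht1).1 _ _ ((γ - α) / 2) (by linarith) (by linarith) (block_specIn χ n a)
    (ha n)).mono (le_of_eq ?_)
  rw [show -γ = -(2 * ((γ - α) / 2)) + -α by ring, dyad_add]
  ring

/-- Continuity of the semigroup at time `0` with a loss of regularity. -/
lemma exists_heat_sub_bd (χ : DyadicPartition) {μ : ℝ} (hμ : 0 < μ) : ∃ C : ℝ, 0 ≤ C ∧
    ∀ h : ℝ, 0 < h → ∀ δ : ℝ, 0 ≤ δ → δ ≤ 1 → ∀ (α : ℝ) a K, Bd χ α a K →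
      Bd χ (α - 2 * δ) (heat μ h a - a) (C * h ^ δ * K) := by
  obtain ⟨C, hC, h1⟩ := exists_heat_sub_bound hμ
  refine ⟨C, hC, fun h hh δ h0 hδ α a K ha n => ?_⟩
  rw [block_sub, block_heat]
  refine (h1 h n _ _ δ hh h0 hδ (block_specIn χ n a).specBall (ha n)).mono (le_of_eq ?_)
  rw [show -(α - 2 * δ) = 2 * δ + -α by ring, dyad_add]
  ring

/-- The commutator of the semigroup and the paraproduct. -/
def heatComm (χ : DyadicPartition) (μ t : ℝ) (a b : Distr) : Distr :=
  heat μ t (para χ a b) - para χ a (heat μ t b)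

lemma heatComm_sub_left (μ t : ℝ) (a a' b : Distr) :
    heatComm χ μ t (a - a') b = heatComm χ μ t a b - heatComm χ μ t a' b := by
  simp only [heatComm, para_sub_left, heat_sub]; abel

lemma heatComm_sub_right (μ t : ℝ) (a b b' : Distr) :
    heatComm χ μ t a (b - b') = heatComm χ μ t a b - heatComm χ μ t a b' := by
  simp only [heatComm, para_sub_right, heat_sub]; abel

lemma SpecIn.mult {n : ℕ} {b : Distr} (h : SpecIn n b) (m : Freq → ℂ) : SpecIn n (mult m b) :=
  fun k hk => h k fun h0 => hk (by simp [CGL.mult, h0])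

lemma SpecIn.sub {n : ℕ} {a b : Distr} (h : SpecIn n a) (h' : SpecIn n b) : SpecIn n (a - b) :=
  fun k hk => by
    by_cases h0 : a k = 0
    · exact h' k fun h1 => hk (by simp [h0, h1])
    · exact h k h0

/-- The commutator of the semigroup and the paraproduct by an `α`-Hölder function, `α < 1`, gains
`α` derivatives. -/
lemma exists_heatComm_bd (χ : DyadicPartition) {μ : ℝ} (hμ : 0 < μ) {α : ℝ} (hα : α < 1) (β γ : ℝ)
    (h0 : α + β ≤ γ) (h3 : γ ≤ α + β + 3) : ∃ C : ℝ, 0 ≤ C ∧ ∀ t : ℝ, 0 < t → t ≤ 1 → ∀ a b K L,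
      Bd χ α a K → Bd χ β b L →
      Bd χ γ (heatComm χ μ t a b) (C * t ^ (-((γ - (α + β)) / 2)) * K * L) := by
  obtain ⟨C, hC, h⟩ := exists_heat_spec_bound hμ
  obtain ⟨C1, hC1, h1⟩ := exists_low_lip (χ := χ) hα
  obtain ⟨C2, hC2, h2⟩ := exists_annulus_sum_bound χ γ
  refine ⟨C2 * (C * C1), by positivity, fun t ht ht1 a b K L ha hb => ?_⟩
  have hK := ha.nonneg
  have hL := hb.nonneg
  set θ := (γ - (α + β)) / 2 with hθ
  have htend : ∀ k, Filter.Tendsto (fun N => (∑ q ∈ Finset.range N,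
      (heat μ t (conv (low χ q a) (block χ q b)) - conv (low χ q a) (heat μ t (block χ q b)))) k)
      Filter.atTop (𝓝 (heatComm χ μ t a b k)) := fun k => by
    refine (((tendsto_paraN a b k).const_mul _).sub (tendsto_paraN a (heat μ t b) k)).congr fun N => ?_
    rw [Finset.sum_sub_distrib, ← heat_sum, Pi.sub_apply, paraN, paraN]
    simp only [block_heat]
    rfl
  refine Bd.of_tendsto (Filter.Eventually.of_forall fun N => ?_) htend
  refine (h2 (Finset.range N) _ (C * C1 * t ^ (-θ) * K * L) (by positivity) (fun q _ => ?_)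
    fun q _ => ?_).mono (le_of_eq (by ring))
  · refine ((conv_low_spec q a b).mult _).sub ?_
    have := conv_low_spec (χ := χ) q a (heat μ t b)
    rwa [block_heat] at this
  · refine ((h t q ht ht1).2 _ _ _ _ θ (by linarith) (by linarith) (low_finSupp q a)
      (block_specIn χ q b) (conv_low_spec q a b) (h1 a K q ha) (hb q)).mono (le_of_eq ?_)
    rw [show -γ = (-(2 * θ) - 1) + (1 - α) + -β by rw [hθ]; ring, dyad_add, dyad_add]
    ring

/-! ### Trigonometric polynomials and their blocks -/

lemma eq_of_ev_eq {a b : Distr} (ha : FinSupp a) (hb : FinSupp b) (h : ∀ x, ev a x = ev b x) : a = b := by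
  funext k
  rw [← mFourierCoeff_ev ha, ← mFourierCoeff_ev hb, show ev a = ev b from funext h]

lemma block_eq_zero_of_specIn {n i : ℕ} {f : Distr} (hf : SpecIn i f) (hlt : ¬(i ≤ n + 5 ∧ n ≤ i + 5)) :
    block χ n f = 0 := by
  funext k
  by_contra hk
  have hfk : f k ≠ 0 := fun h => hk (by simp [block, h])
  obtain ⟨h4, h4'⟩ := hf k hfk
  obtain ⟨h5, h5'⟩ := block_spec χ hk
  have hp : (0:ℝ) < 2 ^ i := by positivity
  have hp' : (0:ℝ) < 2 ^ n := by positivity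
  rw [not_and_or, not_le, not_le] at hlt
  rcases hlt with h | h
  · have h4' := h4' (by omega)
    have h6 : (2:ℝ) ^ (n + 6) ≤ 2 ^ i := pow_le_pow_right₀ one_le_two (by omega)
    rw [pow_add] at h6
    linarith
  · have h5' := h5' (by omega)
    have h6 : (2:ℝ) ^ (i + 6) ≤ 2 ^ n := pow_le_pow_right₀ one_le_two (by omega)
    rw [pow_add] at h6
    linarith

lemma FinSupp.exists_specBall {a : Distr} (ha : FinSupp a) : ∃ N₀ : ℕ, ∀ N ≥ N₀, SpecBall (2 ^ N / 24) a := by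
  have h : ∃ R : ℝ, ∀ k, a k ≠ 0 → ‖toR k‖ ≤ R := by
    obtain ⟨R, hR⟩ := (Set.Finite.image (fun k => ‖toR k‖) ha).bddAbove
    exact ⟨R, fun k hk => hR ⟨k, hk, rfl⟩⟩
  obtain ⟨R, hR⟩ := h
  obtain ⟨N₀, h0⟩ := exists_norm_lt_two_pow R (1 / 24) (by norm_num)
  exact ⟨N₀, fun N hN k hk => (hR k hk).trans_lt (by have := h0 N hN; linarith)⟩

lemma FinSupp.exists_block_eq_zero (χ : DyadicPartition) {a : Distr} (ha : FinSupp a) :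
    ∃ N₀ : ℕ, ∀ n ≥ N₀, block χ n a = 0 := by
  obtain ⟨N₀, h⟩ := ha.exists_specBall
  refine ⟨N₀ + 1, fun n hn => ?_⟩
  funext k
  by_contra hk
  have h1 := (block_spec χ hk).2 (by omega)
  have h2 := h n (by omega) k fun h0 => hk (by simp [block, h0])
  have : (0:ℝ) < 2 ^ n := by positivity
  linarith

lemma trunc_apply_eq (a : Distr) {k : Freq} {N : ℕ} (hN : N ≠ 0) (hk : ‖toR k‖ < 2 ^ N / 24) :
    trunc χ N a k = a k := by
  have hp : (0:ℝ) < 2 ^ N := by positivity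
  rw [trunc, Finset.sum_apply]
  simp only [block]
  rw [← Finset.sum_mul, ← Complex.ofReal_sum, sum_weight_eq_one χ hN (by linarith)]
  simp

lemma trunc_finSupp (N : ℕ) (a : Distr) : FinSupp (trunc χ N a) :=
  FinSupp.sum fun n _ => block_finSupp χ n a

lemma FinSupp.exists_trunc_eq (χ : DyadicPartition) {a : Distr} (ha : FinSupp a) :
    ∃ N₀ : ℕ, ∀ n ≥ N₀, trunc χ n a = a := by
  obtain ⟨N₀, h⟩ := ha.exists_specBall
  refine ⟨N₀ + 1, fun n hn => ?_⟩
  funext k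
  by_cases hk : a k = 0
  · simp [trunc, block, hk]
  · exact trunc_apply_eq a (by omega) (h n (by omega) k hk)

lemma trunc_eventually_eq (a : Distr) (k : Freq) : ∀ᶠ N in Filter.atTop, trunc χ N a k = a k := by
  obtain ⟨N₀, h⟩ := exists_norm_lt_two_pow ‖toR k‖ (1 / 24) (by norm_num)
  filter_upwards [Filter.eventually_ge_atTop (N₀ + 1)] with N hN
  exact trunc_apply_eq a (by omega) (by have := h N (by omega); linarith)

lemma FinSupp.exists_bd (χ : DyadicPartition) {a : Distr} (ha : FinSupp a) (α : ℝ) : ∃ K, Bd χ α a K := by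
  obtain ⟨N₀, h⟩ := ha.exists_block_eq_zero χ
  have h1 : ∀ n, ∃ K : ℝ, 0 ≤ K ∧ SupLE (block χ n a) K := fun n => by
    obtain ⟨M, hM⟩ := (isCompact_range (continuous_ev (block_finSupp χ n a))).isBounded.exists_norm_le
    have : SupLE (block χ n a) M := fun x => hM _ ⟨x, rfl⟩
    exact ⟨M, this.nonneg, this⟩
  choose K hK hs using h1
  refine ⟨∑ n ∈ Finset.range N₀, K n * (dyad (-α) n)⁻¹, fun n => ?_⟩
  have h0 : ∀ n, 0 ≤ K n * (dyad (-α) n)⁻¹ := fun n =>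
    mul_nonneg (hK n) (inv_nonneg.2 (dyad_pos _ _).le)
  by_cases hn : n < N₀
  · refine (hs n).mono ?_
    have h2 := Finset.single_le_sum (f := fun n => K n * (dyad (-α) n)⁻¹) (fun i _ => h0 i)
      (Finset.mem_range.2 hn)
    calc K n = K n * (dyad (-α) n)⁻¹ * dyad (-α) n := by field_simp [(dyad_pos (-α) n).ne']
      _ ≤ _ := mul_le_mul_of_nonneg_right h2 (dyad_pos _ _).le
  · rw [h n (by omega)]
    exact supLE_zero.mono (mul_nonneg (Finset.sum_nonneg fun i _ => h0 i) (dyad_pos _ _).le)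

/-- The coefficients are controlled by Besov-Hölder norms. -/
lemma exists_coeff_bound (χ : DyadicPartition) (α : ℝ) (k : Freq) : ∃ C : ℝ, 0 ≤ C ∧ ∀ a K, Bd χ α a K →
    ‖a k‖ ≤ C * K := by
  obtain ⟨N₀, h⟩ := exists_norm_lt_two_pow ‖toR k‖ (1 / 24) (by norm_num)
  refine ⟨∑ n ∈ Finset.range (N₀ + 1), dyad (-α) n, Finset.sum_nonneg fun n _ => (dyad_pos _ _).le,
    fun a K ha => ?_⟩
  rw [← trunc_apply_eq (χ := χ) a (N := N₀ + 1) (by omega) (by have := h (N₀ + 1) (by omega); linarith), trunc,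
    Finset.sum_apply, Finset.sum_mul]
  refine (norm_sum_le _ _).trans (Finset.sum_le_sum fun n _ => ?_)
  rw [mul_comm]
  exact (ha n).norm_coeff_le (block_finSupp χ n a) k

lemma FinSupp.exists_para_eq {b : Distr} (hb : FinSupp b) (a : Distr) :
    ∃ N₀ : ℕ, ∀ N ≥ N₀, para χ a b = paraN χ N a b := by
  obtain ⟨N₀, h⟩ := hb.exists_block_eq_zero χ
  have h1 : ∀ N ≥ N₀, paraN χ N a b = paraN χ N₀ a b := fun N hN => by
    refine (Finset.sum_subset (Finset.range_mono hN) fun q _ hq => ?_).symm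
    rw [h q (by simpa using hq), conv_zero_right]
  refine ⟨N₀, fun N hN => ?_⟩
  funext k
  obtain ⟨M, h2, h3⟩ := ((para_eventually_eq (χ := χ) a b k).and (Filter.eventually_ge_atTop N₀)).exists
  rw [← h2, h1 M h3, h1 N hN]

lemma FinSupp.exists_reso_eq {a b : Distr} (ha : FinSupp a) (hb : FinSupp b) :
    ∃ N₀ : ℕ, ∀ N ≥ N₀, reso χ a b = resoN χ N a b := by
  obtain ⟨N₀, h⟩ := ha.exists_block_eq_zero χ
  have h1 : ∀ N ≥ N₀, resoN χ N a b = resoN χ N₀ a b := fun N hN => by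
    refine (Finset.sum_subset (Finset.range_mono hN) fun q _ hq => ?_).symm
    rw [h q (by simpa using hq), conv_zero_left]
  refine ⟨N₀, fun N hN => ?_⟩
  obtain ⟨K, hK⟩ := ha.exists_bd χ 1
  obtain ⟨L, hL⟩ := hb.exists_bd χ 1
  funext k
  refine tendsto_nhds_unique (tendsto_resoN (by norm_num) hK hL k) (tendsto_const_nhds.congr' ?_)
  filter_upwards [Filter.eventually_ge_atTop N₀] with M hM
  rw [h1 M hM, h1 N hN]

lemma conv_comm (a b : Distr) : conv a b = conv b a := by
  funext k
  rw [conv, conv, ← (Equiv.subLeft k).tsum_eq]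
  refine tsum_congr fun j => ?_
  simp only [Equiv.subLeft_apply, sub_sub_cancel]
  ring

lemma paraN_finSupp (N : ℕ) (a b : Distr) : FinSupp (paraN χ N a b) :=
  FinSupp.sum fun q _ => (low_finSupp q a).conv (block_finSupp χ q b)

lemma resoN_finSupp (N : ℕ) (a b : Distr) : FinSupp (resoN χ N a b) :=
  FinSupp.sum fun q _ => (block_finSupp χ q a).conv (fat_finSupp q b)

/-- For trigonometric polynomials the product is the pointwise product. -/
lemma prod_eq_conv {a b : Distr} (ha : FinSupp a) (hb : FinSupp b) : prod χ a b = conv a b := by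
  classical
  obtain ⟨N₁, h1⟩ := hb.exists_para_eq (χ := χ) a
  obtain ⟨N₂, h2⟩ := ha.exists_para_eq (χ := χ) b
  obtain ⟨N₃, h3⟩ := ha.exists_reso_eq (χ := χ) hb
  obtain ⟨N₄, h4⟩ := ha.exists_trunc_eq χ
  obtain ⟨N₅, h5⟩ := hb.exists_trunc_eq χ
  obtain ⟨N₆, h6⟩ := hb.exists_block_eq_zero χ
  set N := N₁ + N₂ + N₃ + N₄ + N₅ + N₆
  rw [prod, h1 N (by omega), h2 N (by omega), h3 N (by omega)]
  conv_rhs => rw [← h4 N (by omega), ← h5 N (by omega)]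
  have e0 : conv (trunc χ N a) (trunc χ N b) = ∑ p ∈ Finset.range N, ∑ q ∈ Finset.range N,
      conv (block χ p a) (block χ q b) := by
    rw [trunc, conv_sum_left (trunc_finSupp N b)]
    refine Finset.sum_congr rfl fun p _ => ?_
    rw [trunc, conv_sum_right (block_finSupp χ p a)]
  have e1 : paraN χ N a b = ∑ p ∈ Finset.range N, ∑ q ∈ Finset.range N,
      if p + 2 ≤ q then conv (block χ p a) (block χ q b) else 0 := by
    rw [Finset.sum_comm]
    refine Finset.sum_congr rfl fun q hq => ?_
    rw [low, conv_sum_left (block_finSupp χ q b), ← Finset.sum_filter]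
    refine Finset.sum_congr ?_ fun _ _ => rfl
    ext p
    simp only [Finset.mem_filter, Finset.mem_range] at hq ⊢
    omega
  have e2 : paraN χ N b a = ∑ p ∈ Finset.range N, ∑ q ∈ Finset.range N,
      if q + 2 ≤ p then conv (block χ p a) (block χ q b) else 0 := by
    refine Finset.sum_congr rfl fun p hp => ?_
    rw [conv_comm, low, conv_sum_right (block_finSupp χ p a), ← Finset.sum_filter]
    refine Finset.sum_congr ?_ fun _ _ => rfl
    ext q
    simp only [Finset.mem_filter, Finset.mem_range] at hp ⊢
    omega
  have e3 : resoN χ N a b = ∑ p ∈ Finset.range N, ∑ q ∈ Finset.range N,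
      if p ≤ q + 1 ∧ q ≤ p + 1 then conv (block χ p a) (block χ q b) else 0 := by
    refine Finset.sum_congr rfl fun p hp => ?_
    rw [fat, conv_sum_right (block_finSupp χ p a), ← Finset.sum_filter]
    symm
    refine Finset.sum_subset (fun q hq => ?_) fun q hq hq' => ?_
    · simp only [Finset.mem_filter, Finset.mem_range, Finset.mem_Icc] at hq ⊢
      omega
    · simp only [Finset.mem_filter, Finset.mem_range, Finset.mem_Icc] at hp hq hq'
      rw [h6 q (by omega), conv_zero_right]
  rw [e0, e1, e2, e3, ← Finset.sum_add_distrib, ← Finset.sum_add_distrib]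
  refine Finset.sum_congr rfl fun p _ => ?_
  rw [← Finset.sum_add_distrib, ← Finset.sum_add_distrib]
  refine Finset.sum_congr rfl fun q _ => ?_
  rcases lt_trichotomy (p + 1) q with h | h | h
  · rw [if_pos (by omega), if_neg (by omega), if_neg (by omega)]; simp
  · rw [if_neg (by omega), if_pos (by omega), if_neg (by omega)]; simp
  · by_cases h' : q + 2 ≤ p
    · rw [if_neg (by omega), if_neg (by omega), if_pos h']; simp
    · rw [if_neg (by omega), if_pos (by omega), if_neg h']; simp

end CGL

namespace CGL
open MeasureTheory UnitAddTorus
variable {χ : DyadicPartition}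

/-! ### The commutator of the paraproduct and the resonant product -/

lemma para_finSupp {b : Distr} (hb : FinSupp b) (a : Distr) : FinSupp (para χ a b) := by
  obtain ⟨N, h⟩ := hb.exists_para_eq (χ := χ) a
  rw [h N le_rfl]; exact paraN_finSupp N a b

lemma reso_finSupp {a b : Distr} (ha : FinSupp a) (hb : FinSupp b) : FinSupp (reso χ a b) := by
  obtain ⟨N, h⟩ := ha.exists_reso_eq (χ := χ) hb
  rw [h N le_rfl]; exact resoN_finSupp N a b

lemma conv_assoc {a b c : Distr} (ha : FinSupp a) (hb : FinSupp b) (hc : FinSupp c) :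
    conv a (conv b c) = conv (conv a b) c := by
  refine eq_of_ev_eq (ha.conv (hb.conv hc)) ((ha.conv hb).conv hc) fun x => ?_
  rw [ev_conv ha (hb.conv hc), ev_conv hb hc, ev_conv (ha.conv hb) hc, ev_conv ha hb, mul_assoc]

/-- The commutator of the block `Δ_i` and the multiplication by the low-frequency part of `a`, applied
to `Δ_q b`. -/
def blockComm (χ : DyadicPartition) (i q : ℕ) (a b : Distr) : Distr :=
  block χ i (conv (low χ q a) (block χ q b)) - conv (low χ q a) (block χ i (block χ q b))

/-- The part of the commutator coming from the commutators with the low-frequency parts of `a`. -/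
def commLow (χ : DyadicPartition) (N q : ℕ) (a b c : Distr) : Distr :=
  ∑ i ∈ Finset.range N, conv (blockComm χ i q a b) (fat χ i c)

/-- The part of the resonant product of `b` and `c` that involves the `q`-th block of `b`. -/
def resoPiece (χ : DyadicPartition) (N q : ℕ) (b c : Distr) : Distr :=
  ∑ i ∈ Finset.range N, conv (block χ i (block χ q b)) (fat χ i c)

lemma blockComm_finSupp (i q : ℕ) (a b : Distr) : FinSupp (blockComm χ i q a b) :=
  (block_finSupp χ i _).sub ((low_finSupp q a).conv (block_finSupp χ i _))

lemma resoPiece_finSupp (N q : ℕ) (b c : Distr) : FinSupp (resoPiece χ N q b c) :=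
  FinSupp.sum fun i _ => (block_finSupp χ i _).conv (fat_finSupp i c)

/-- Decomposition of the commutator of trigonometric polynomials: the paraproduct is moved through
the blocks `Δ_i`, which leaves the commutators `[Δ_i, S a]` and the high-frequency parts of `a`. -/
lemma commSmooth_eq {a b c : Distr} (ha : FinSupp a) (hb : FinSupp b) (hc : FinSupp c) :
    ∃ N, commSmooth χ a b c = ∑ q ∈ Finset.range N, commLow χ N q a b c
      - ∑ p ∈ Finset.range N, conv (block χ p a)
        (∑ q ∈ (Finset.range N).filter (fun q => q ≤ p + 1), resoPiece χ N q b c) := by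
  classical
  obtain ⟨N₁, h1⟩ := hb.exists_para_eq (χ := χ) a
  obtain ⟨N₂, h2⟩ := (para_finSupp (χ := χ) hb a).exists_reso_eq (χ := χ) hc
  obtain ⟨N₃, h3⟩ := hb.exists_reso_eq (χ := χ) hc
  obtain ⟨N₄, h4⟩ := ha.exists_trunc_eq χ
  obtain ⟨N₅, h5⟩ := hb.exists_trunc_eq χ
  set N := N₁ + N₂ + N₃ + N₄ + N₅
  have fA : ∀ p, FinSupp (block χ p a) := fun p => block_finSupp χ p a
  refine ⟨N, ?_⟩
  have e1 : reso χ (para χ a b) c = ∑ q ∈ Finset.range N, commLow χ N q a b c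
      + ∑ q ∈ Finset.range N, conv (low χ q a) (resoPiece χ N q b c) := by
    rw [h2 N (by omega), resoN, h1 N (by omega), ← Finset.sum_add_distrib]
    simp_rw [paraN, block_sum, conv_sum_left (fat_finSupp _ c)]
    rw [Finset.sum_comm]
    refine Finset.sum_congr rfl fun q _ => ?_
    rw [commLow, resoPiece, conv_sum_right (low_finSupp q a), ← Finset.sum_add_distrib]
    refine Finset.sum_congr rfl fun i _ => ?_
    rw [conv_assoc (low_finSupp q a) (block_finSupp χ i _) (fat_finSupp i c),
      ← conv_add_left (fat_finSupp i c), blockComm, sub_add_cancel]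
  have e2 : prod χ a (reso χ b c) = ∑ q ∈ Finset.range N, conv a (resoPiece χ N q b c) := by
    rw [prod_eq_conv ha (reso_finSupp hb hc), ← conv_sum_right ha]
    congr 1
    rw [h3 N (by omega), resoN]
    simp_rw [resoPiece]
    rw [Finset.sum_comm]
    refine Finset.sum_congr rfl fun i _ => ?_
    rw [← conv_sum_left (fat_finSupp i c), ← block_sum]
    congr 2
    exact (h5 N (by omega)).symm
  have e3 : ∀ q ∈ Finset.range N, a = low χ q a + ∑ p ∈ (Finset.range N).filter (fun p => q ≤ p + 1),
      block χ p a := fun q hq => by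
    conv_lhs => rw [← h4 N (by omega), trunc, ← Finset.sum_filter_add_sum_filter_not (Finset.range N)
      (fun p => p + 1 < q)]
    congr 1
    · refine Finset.sum_congr ?_ fun _ _ => rfl
      ext p
      simp only [Finset.mem_filter, Finset.mem_range] at hq ⊢
      omega
    · refine Finset.sum_congr ?_ fun _ _ => rfl
      ext p
      simp only [Finset.mem_filter, Finset.mem_range] at hq ⊢
      omega
  have e4 : prod χ a (reso χ b c) = ∑ q ∈ Finset.range N, conv (low χ q a) (resoPiece χ N q b c)
      + ∑ p ∈ Finset.range N, conv (block χ p a)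
        (∑ q ∈ (Finset.range N).filter (fun q => q ≤ p + 1), resoPiece χ N q b c) := by
    rw [e2]
    have e5 : ∀ p, conv (block χ p a)
        (∑ q ∈ (Finset.range N).filter (fun q => q ≤ p + 1), resoPiece χ N q b c)
        = ∑ q ∈ Finset.range N, if q ≤ p + 1 then conv (block χ p a) (resoPiece χ N q b c) else 0 :=
      fun p => by rw [conv_sum_right (fA p), Finset.sum_filter]
    simp_rw [e5]
    rw [Finset.sum_comm (s := Finset.range N) (t := Finset.range N), ← Finset.sum_add_distrib]
    refine Finset.sum_congr rfl fun q hq => ?_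
    conv_lhs => rw [e3 q hq, conv_add_left (resoPiece_finSupp N q b c),
      conv_sum_left (resoPiece_finSupp N q b c), Finset.sum_filter]
  rw [commSmooth, e1, e4]
  abel

lemma sum_near_le {N q : ℕ} {f : ℕ → Distr} {B : ℝ} (hB : 0 ≤ B) (hf : ∀ i, FinSupp (f i))
    (h0 : ∀ i, ¬(q ≤ i + 5 ∧ i ≤ q + 5) → f i = 0) (h : ∀ i, q ≤ i + 5 → i ≤ q + 5 → SupLE (f i) B) :
    SupLE (∑ i ∈ Finset.range N, f i) (11 * B) := by
  classical
  set U := (Finset.range N).filter (fun i => q ≤ i + 5 ∧ i ≤ q + 5)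
  have h1 : ∑ i ∈ Finset.range N, f i = ∑ i ∈ U, f i :=
    (Finset.sum_filter_of_ne fun i _ hne => by
      by_contra hlt; exact hne (h0 i hlt)).symm
  rw [h1]
  refine (SupLE.sum (K := fun _ => B) (fun i _ => hf i) fun i hi => ?_).mono ?_
  · have := (Finset.mem_filter.1 hi).2
    exact h i this.1 this.2
  · rw [Finset.sum_const, nsmul_eq_mul]
    have : U ⊆ Finset.Icc (q - 5) (q + 5) := fun i hi => by
      have hi' := (Finset.mem_filter.1 hi).2
      rw [Finset.mem_Icc]; omega
    have h5 := Finset.card_le_card this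
    rw [Nat.card_Icc] at h5
    have : (U.card : ℝ) ≤ 11 := by exact_mod_cast h5.trans (by omega)
    gcongr

lemma sum_near_specBall {N q : ℕ} {f : ℕ → Distr} {r : ℝ}
    (h0 : ∀ i, ¬(q ≤ i + 5 ∧ i ≤ q + 5) → f i = 0)
    (h : ∀ i, q ≤ i + 5 → i ≤ q + 5 → SpecBall r (f i)) :
    SpecBall r (∑ i ∈ Finset.range N, f i) := by
  refine SpecBall.sum fun i _ => ?_
  by_cases hi : q ≤ i + 5 ∧ i ≤ q + 5
  · exact h i hi.1 hi.2
  · rw [h0 i hi]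
    intro k hk
    exact absurd rfl hk

lemma blockComm_eq_zero {i q : ℕ} (a b : Distr) (h : ¬(q ≤ i + 5 ∧ i ≤ q + 5)) : blockComm χ i q a b = 0 := by
  rw [blockComm, block_eq_zero_of_specIn (conv_low_spec q a b) h,
    block_eq_zero_of_specIn (block_specIn χ q b) h, conv_zero_right, sub_zero]

lemma fat_specBall_near {i q : ℕ} (h : i ≤ q + 5) (c : Distr) : SpecBall (86 * 2 ^ q) (fat χ i c) := by
  refine (fat_specBall i c).mono ?_
  have h1 : (2:ℝ) ^ i ≤ 2 ^ (q + 5) := pow_le_pow_right₀ one_le_two h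
  rw [pow_add] at h1
  have : (0:ℝ) < 2 ^ q := by positivity
  linarith

lemma commLow_specBall (N q : ℕ) (a b c : Distr) : SpecBall (2 ^ (7 + q)) (commLow χ N q a b c) := by
  refine sum_near_specBall (q := q) (fun i hi => by rw [blockComm_eq_zero a b hi, conv_zero_left])
    fun i _ h2 => ?_
  have h3 : SpecIn q (blockComm χ i q a b) := by
    refine ((conv_low_spec q a b).mult _).sub ?_
    have h4 : block χ i (block χ q b) = block χ q (block χ i b) := by
      funext k; simp only [block]; ring
    rw [h4]
    exact conv_low_spec q a (block χ i b)
  refine (h3.specBall.conv (fat_specBall_near h2 c)).mono ?_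
  rw [pow_add]
  have : (0:ℝ) < 2 ^ q := by positivity
  linarith

lemma resoPiece_specBall (N q : ℕ) (b c : Distr) : SpecBall (2 ^ (7 + q)) (resoPiece χ N q b c) := by
  refine sum_near_specBall (q := q) (fun i hi => by
    rw [block_eq_zero_of_specIn (block_specIn χ q b) hi, conv_zero_left]) fun i _ h2 => ?_
  have h3 : SpecIn q (block χ i (block χ q b)) := (block_specIn χ q b).mult _
  refine (h3.specBall.conv (fat_specBall_near h2 c)).mono ?_
  rw [pow_add]
  have : (0:ℝ) < 2 ^ q := by positivity
  linarith

lemma fat_supLE_near {γ : ℝ} {c : Distr} {M : ℝ} (hc : Bd χ γ c M) {i q : ℕ} (h1 : q ≤ i + 5)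
    (h2 : i ≤ q + 5) : SupLE (fat χ i c) (3 * dyad |γ| 1 * dyad |γ| 5 * M * dyad (-γ) q) := by
  have hM := hc.nonneg
  refine (fat_supLE hc i).mono ?_
  have h3 := dyad_near (-γ) h2 h1
  rw [abs_neg] at h3
  have := dyad_pos |γ| 1
  calc 3 * dyad |γ| 1 * M * dyad (-γ) i ≤ 3 * dyad |γ| 1 * M * (dyad |γ| 5 * dyad (-γ) q) := by gcongr
    _ = _ := by ring

lemma exists_commLow_supLE (χ : DyadicPartition) {α : ℝ} (hα : α < 1) (β γ : ℝ) : ∃ C : ℝ, 0 ≤ C ∧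
    ∀ N q a b c K L M, Bd χ α a K → Bd χ β b L → Bd χ γ c M →
      SupLE (commLow χ N q a b c) (C * (K * L * M) * dyad (-(α + β + γ)) q) := by
  obtain ⟨C1, hC1, h1⟩ := exists_block_bound χ
  obtain ⟨C2, hC2, h2⟩ := exists_low_lip (χ := χ) hα
  have hd1 := dyad_pos |γ| 1
  have hd2 := dyad_pos |γ| 5
  have hd3 := dyad_pos |(-1 : ℝ)| 5
  refine ⟨11 * (C1 * dyad |(-1 : ℝ)| 5 * C2 * (3 * dyad |γ| 1 * dyad |γ| 5)), by positivity,
    fun N q a b c K L M ha hb hc => ?_⟩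
  have hK := ha.nonneg
  have hL := hb.nonneg
  have hM := hc.nonneg
  have p1 := dyad_pos (1 - α) q
  have p2 := dyad_pos (-β) q
  have p3 := dyad_pos (-γ) q
  have p4 := dyad_pos (-1) q
  refine (sum_near_le (q := q) (B := (C1 * (dyad |(-1 : ℝ)| 5 * dyad (-1) q) * (C2 * K * dyad (1 - α) q) *
    (L * dyad (-β) q)) * (3 * dyad |γ| 1 * dyad |γ| 5 * M * dyad (-γ) q)) (by positivity)
    (fun i => (blockComm_finSupp i q a b).conv (fat_finSupp i c))
    (fun i hi => by rw [blockComm_eq_zero a b hi, conv_zero_left]) fun i h3 h4 => ?_).mono (le_of_eq ?_)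
  · refine SupLE.conv (blockComm_finSupp i q a b) (fat_finSupp i c) ?_ (fat_supLE_near hc h3 h4)
    refine ((h1 i).2 _ _ _ _ (low_finSupp q a) (block_finSupp χ q b) (h2 a K q ha) (hb q)).mono ?_
    have := dyad_near (-1) h4 h3
    gcongr
  · rw [show -(α + β + γ) = -1 + (1 - α) + -β + -γ by ring, dyad_add, dyad_add, dyad_add]
    ring

lemma exists_resoPiece_supLE (χ : DyadicPartition) (β γ : ℝ) : ∃ C : ℝ, 0 ≤ C ∧
    ∀ N q b c L M, Bd χ β b L → Bd χ γ c M →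
      SupLE (resoPiece χ N q b c) (C * (L * M) * dyad (-(β + γ)) q) := by
  obtain ⟨C1, hC1, h1⟩ := exists_block_bound χ
  have hd1 := dyad_pos |γ| 1
  have hd2 := dyad_pos |γ| 5
  refine ⟨11 * (C1 * (3 * dyad |γ| 1 * dyad |γ| 5)), by positivity,
    fun N q b c L M hb hc => ?_⟩
  have hL := hb.nonneg
  have hM := hc.nonneg
  have p2 := dyad_pos (-β) q
  have p3 := dyad_pos (-γ) q
  refine (sum_near_le (q := q) (B := (C1 * (L * dyad (-β) q)) *
    (3 * dyad |γ| 1 * dyad |γ| 5 * M * dyad (-γ) q)) (by positivity)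
    (fun i => (block_finSupp χ i _).conv (fat_finSupp i c)) (fun i hi => by
      rw [block_eq_zero_of_specIn (block_specIn χ q b) hi, conv_zero_left])
    fun i h3 h4 => ?_).mono (le_of_eq ?_)
  · exact SupLE.conv (block_finSupp χ i _) (fat_finSupp i c)
      ((h1 i).1 _ _ (block_finSupp χ q b) (hb q)) (fat_supLE_near hc h3 h4)
  · rw [neg_add, dyad_add]
    ring

/-- The commutator estimate for trigonometric polynomials. -/
lemma exists_commSmooth_bound (χ : DyadicPartition) {α β γ : ℝ} (hα : α < 1) (hβγ : β + γ < 0)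
    (h0 : 0 < α + β + γ) : ∃ C : ℝ, 0 ≤ C ∧ ∀ a b c K L M, FinSupp a → FinSupp b → FinSupp c →
      Bd χ α a K → Bd χ β b L → Bd χ γ c M →
      Bd χ (α + β + γ) (commSmooth χ a b c) (C * (K * L * M)) := by
  obtain ⟨C1, hC1, h1⟩ := exists_commLow_supLE χ hα β γ
  obtain ⟨C2, hC2, h2⟩ := exists_resoPiece_supLE χ β γ
  obtain ⟨C3, hC3, h3⟩ := exists_ball_sum_bound χ h0 7
  obtain ⟨C4, hC4, h4⟩ := exists_ball_sum_bound χ h0 10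
  obtain ⟨C5, hC5, h5⟩ := exists_sum_dyad_head (neg_pos.2 hβγ)
  have hd := dyad_pos (-(β + γ)) 2
  refine ⟨C3 * C1 + C4 * (C2 * C5 * dyad (-(β + γ)) 2), by positivity,
    fun a b c K L M fa fb fc ha hb hc => ?_⟩
  have hK := ha.nonneg
  have hL := hb.nonneg
  have hM := hc.nonneg
  obtain ⟨N, hN⟩ := commSmooth_eq (χ := χ) fa fb fc
  rw [hN]
  have t1 := h3 (Finset.range N) (fun q => commLow χ N q a b c) (C1 * (K * L * M)) (by positivity)
    (fun q _ => commLow_specBall N q a b c) (fun q _ => h1 N q a b c K L M ha hb hc)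
  have t2 := h4 (Finset.range N) (fun p => conv (block χ p a)
    (∑ q ∈ (Finset.range N).filter (fun q => q ≤ p + 1), resoPiece χ N q b c))
    (C2 * C5 * dyad (-(β + γ)) 2 * (K * L * M)) (by positivity) (fun p _ => ?_) (fun p _ => ?_)
  · exact (t1.sub t2).mono (le_of_eq (by ring))
  · have h6 : SpecBall (2 ^ (8 + p)) (∑ q ∈ (Finset.range N).filter (fun q => q ≤ p + 1),
        resoPiece χ N q b c) := by
      refine SpecBall.sum fun q hq => (resoPiece_specBall N q b c).mono ?_
      exact pow_le_pow_right₀ one_le_two (by have := (Finset.mem_filter.1 hq).2; omega)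
    refine ((block_specBall p a).conv h6).mono ?_
    rw [pow_add, pow_add]
    have : (0:ℝ) < 2 ^ p := by positivity
    linarith
  · have h6 : SupLE (∑ q ∈ (Finset.range N).filter (fun q => q ≤ p + 1), resoPiece χ N q b c)
        (C2 * (L * M) * (C5 * (dyad (-(β + γ)) 2 * dyad (-(β + γ)) p))) := by
      refine (SupLE.sum (fun q _ => resoPiece_finSupp N q b c)
        fun q _ => h2 N q b c L M hb hc).mono ?_
      rw [← Finset.mul_sum]
      refine mul_le_mul_of_nonneg_left ?_ (by positivity)
      rw [mul_comm (dyad _ 2), ← dyad_index_add]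
      refine le_trans (Finset.sum_le_sum_of_subset_of_nonneg (t := Finset.range (p + 2)) ?_
        fun _ _ _ => (dyad_pos _ _).le) (h5 (p + 2))
      intro q hq
      have := (Finset.mem_filter.1 hq).2
      rw [Finset.mem_range]; omega
    refine (SupLE.conv (block_finSupp χ p a) (FinSupp.sum fun q _ => resoPiece_finSupp N q b c) (ha p)
      h6).mono (le_of_eq ?_)
    rw [show -(α + β + γ) = -α + -(β + γ) by ring, dyad_add (-α)]
    ring

lemma prod_sub_left {a a' b : Distr} (ha : FinSupp a) (ha' : FinSupp a') (hb : FinSupp b) :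
    prod χ (a - a') b = prod χ a b - prod χ a' b := by
  rw [prod_eq_conv (ha.sub ha') hb, prod_eq_conv ha hb, prod_eq_conv ha' hb, conv_sub_left hb]

lemma reso_sub_left' {a a' b : Distr} (ha : FinSupp a) (ha' : FinSupp a') (hb : FinSupp b) :
    reso χ (a - a') b = reso χ a b - reso χ a' b := by
  obtain ⟨_, h1⟩ := ha.exists_bd χ 1
  obtain ⟨_, h2⟩ := ha'.exists_bd χ 1
  obtain ⟨_, h3⟩ := hb.exists_bd χ 1
  exact reso_sub_left (by norm_num) h1 h2 h3

lemma reso_sub_right' {a b b' : Distr} (ha : FinSupp a) (hb : FinSupp b) (hb' : FinSupp b') :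
    reso χ a (b - b') = reso χ a b - reso χ a b' := by
  obtain ⟨_, h1⟩ := ha.exists_bd χ 1
  obtain ⟨_, h2⟩ := hb.exists_bd χ 1
  obtain ⟨_, h3⟩ := hb'.exists_bd χ 1
  exact reso_sub_right (by norm_num) h1 h2 h3

lemma commSmooth_sub_left {a a' b c : Distr} (ha : FinSupp a) (ha' : FinSupp a') (hb : FinSupp b)
    (hc : FinSupp c) : commSmooth χ (a - a') b c = commSmooth χ a b c - commSmooth χ a' b c := by
  simp only [commSmooth]
  rw [para_sub_left, reso_sub_left' (para_finSupp hb a) (para_finSupp hb a') hc,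
    prod_sub_left ha ha' (reso_finSupp hb hc)]
  abel

lemma commSmooth_sub_mid {a b b' c : Distr} (ha : FinSupp a) (hb : FinSupp b) (hb' : FinSupp b')
    (hc : FinSupp c) : commSmooth χ a (b - b') c = commSmooth χ a b c - commSmooth χ a b' c := by
  simp only [commSmooth]
  rw [para_sub_right, reso_sub_left' (para_finSupp hb a) (para_finSupp hb' a) hc,
    reso_sub_left' hb hb' hc, prod_eq_conv ha ((reso_finSupp hb hc).sub (reso_finSupp hb' hc)),
    prod_eq_conv ha (reso_finSupp hb hc), prod_eq_conv ha (reso_finSupp hb' hc), conv_sub_right ha]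
  abel

lemma commSmooth_sub_right {a b c c' : Distr} (ha : FinSupp a) (hb : FinSupp b) (hc : FinSupp c)
    (hc' : FinSupp c') : commSmooth χ a b (c - c') = commSmooth χ a b c - commSmooth χ a b c' := by
  simp only [commSmooth]
  rw [reso_sub_right' (para_finSupp hb a) hc hc', reso_sub_right' hb hc hc',
    prod_eq_conv ha ((reso_finSupp hb hc).sub (reso_finSupp hb hc')),
    prod_eq_conv ha (reso_finSupp hb hc), prod_eq_conv ha (reso_finSupp hb hc'), conv_sub_right ha]
  abel

/-- The truncations are bounded uniformly and converge with a rate in weaker norms. -/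
lemma exists_trunc_bound (χ : DyadicPartition) (α : ℝ) {ε : ℝ} (hε : 0 ≤ ε) : ∃ C : ℝ, 0 ≤ C ∧
    ∀ a K N n, Bd χ α a K → N ≤ n →
      Bd χ α (trunc χ n a) (C * K) ∧ Bd χ (α - ε) (trunc χ n a - trunc χ N a) (C * K * dyad (-ε) N) := by
  obtain ⟨C1, hC1, h1⟩ := exists_annulus_sum_bound χ α
  obtain ⟨C2, hC2, h2⟩ := exists_annulus_sum_bound χ (α - ε)
  refine ⟨C1 + C2, by positivity, fun a K N n ha hN => ⟨?_, ?_⟩⟩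
  · have hK := ha.nonneg
    refine (h1 (Finset.range n) (fun i => block χ i a) K hK (fun i _ => block_specIn χ i a)
      fun i _ => ha i).mono ?_
    nlinarith
  · have hK := ha.nonneg
    have hd := dyad_pos (-ε) N
    have h3 : trunc χ n a - trunc χ N a = ∑ i ∈ Finset.Ico N n, block χ i a := by
      rw [trunc, trunc, Finset.sum_Ico_eq_sub _ hN]
    rw [h3]
    refine (h2 (Finset.Ico N n) (fun i => block χ i a) (K * dyad (-ε) N) (by positivity)
      (fun i _ => block_specIn χ i a) fun i hi => (ha i).mono ?_).mono ?_
    · have h4 : dyad (-ε) i ≤ dyad (-ε) N := dyad_index_anti (by linarith) (Finset.mem_Ico.1 hi).1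
      have h5 := dyad_pos (-(α - ε)) i
      rw [show -α = -ε + -(α - ε) by ring, dyad_add, ← mul_assoc]
      gcongr
    · rw [mul_assoc]
      have : 0 ≤ K * dyad (-ε) N := by positivity
      nlinarith

lemma tendsto_dyad_neg {ε : ℝ} (hε : 0 < ε) : Filter.Tendsto (fun N => dyad (-ε) N) Filter.atTop (𝓝 0) := by
  simp_rw [dyad_eq_pow]
  exact tendsto_pow_atTop_nhds_zero_of_lt_one (by positivity)
    (Real.rpow_lt_one_of_one_lt_of_neg one_lt_two (by linarith))

/-- The commutator is the limit of its values at truncations. -/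
lemma tendsto_comm {α β γ : ℝ} (hα : α < 1) (hβγ : β + γ < 0) (h0 : 0 < α + β + γ) {a b c : Distr}
    {K L M : ℝ} (ha : Bd χ α a K) (hb : Bd χ β b L) (hc : Bd χ γ c M) (k : Freq) :
    Filter.Tendsto (fun N => commSmooth χ (trunc χ N a) (trunc χ N b) (trunc χ N c) k) Filter.atTop
      (𝓝 (comm χ a b c k)) := by
  set ε := (α + β + γ) / 4 with hεdef
  have hε : 0 < ε := by positivity
  obtain ⟨Ca, hCa, Ta⟩ := exists_trunc_bound χ α hε.le
  obtain ⟨Cb, hCb, Tb⟩ := exists_trunc_bound χ β hε.le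
  obtain ⟨Cc, hCc, Tc⟩ := exists_trunc_bound χ γ hε.le
  obtain ⟨C, hC, h⟩ := exists_commSmooth_bound χ (α := α - ε) (β := β - ε) (γ := γ - ε) (by linarith)
    (by linarith) (by linarith)
  obtain ⟨Ck, hCk, hk⟩ := exists_coeff_bound χ (α - ε + (β - ε) + (γ - ε)) k
  have hK := ha.nonneg
  have hL := hb.nonneg
  have hM := hc.nonneg
  set D := Ck * (C * (Ca * K * (Cb * L) * (Cc * M)) * 3) with hD
  have key : ∀ N n, N ≤ n → dist (commSmooth χ (trunc χ n a) (trunc χ n b) (trunc χ n c) k)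
      (commSmooth χ (trunc χ N a) (trunc χ N b) (trunc χ N c) k) ≤ D * dyad (-ε) N := by
    intro N n hn
    have fa := trunc_finSupp (χ := χ) n a
    have fa' := trunc_finSupp (χ := χ) N a
    have fb := trunc_finSupp (χ := χ) n b
    have fb' := trunc_finSupp (χ := χ) N b
    have fc := trunc_finSupp (χ := χ) n c
    have fc' := trunc_finSupp (χ := χ) N c
    have e : commSmooth χ (trunc χ n a) (trunc χ n b) (trunc χ n c)
        - commSmooth χ (trunc χ N a) (trunc χ N b) (trunc χ N c)
        = commSmooth χ (trunc χ n a - trunc χ N a) (trunc χ n b) (trunc χ n c)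
        + commSmooth χ (trunc χ N a) (trunc χ n b - trunc χ N b) (trunc χ n c)
        + commSmooth χ (trunc χ N a) (trunc χ N b) (trunc χ n c - trunc χ N c) := by
      rw [commSmooth_sub_left fa fa' fb fc, commSmooth_sub_mid fa' fb fb' fc,
        commSmooth_sub_right fa' fb' fc fc']
      abel
    have hε' : α - ε ≤ α := by linarith
    have hεb : β - ε ≤ β := by linarith
    have hεc : γ - ε ≤ γ := by linarith
    have b1 := h _ _ _ _ _ _ (fa.sub fa') fb fc (Ta a K N n ha hn).2 ((Tb b L N n hb hn).1.mono_reg hεb)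
      ((Tc c M N n hc hn).1.mono_reg hεc)
    have b2 := h _ _ _ _ _ _ fa' (fb.sub fb') fc ((Ta a K N N ha le_rfl).1.mono_reg hε')
      (Tb b L N n hb hn).2 ((Tc c M N n hc hn).1.mono_reg hεc)
    have b3 := h _ _ _ _ _ _ fa' fb' (fc.sub fc') ((Ta a K N N ha le_rfl).1.mono_reg hε')
      ((Tb b L N N hb le_rfl).1.mono_reg hεb) (Tc c M N n hc hn).2
    have b4 := hk _ _ ((b1.add b2).add b3)
    rw [← e, Pi.sub_apply] at b4
    rw [dist_eq_norm]
    refine b4.trans (le_of_eq ?_)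
    rw [hD]; ring
  have hcau : CauchySeq (fun N => commSmooth χ (trunc χ N a) (trunc χ N b) (trunc χ N c) k) := by
    refine cauchySeq_of_le_tendsto_0' (fun N => D * dyad (-ε) N) (fun N n hn => ?_) ?_
    · rw [dist_comm]; exact key N n hn
    · simpa using (tendsto_dyad_neg hε).const_mul D
  exact hcau.tendsto_limUnder

/-- The commutator estimate. -/
lemma exists_comm_bound (χ : DyadicPartition) {α β γ : ℝ} (hα : α < 1) (hβγ : β + γ < 0)
    (h0 : 0 < α + β + γ) : ∃ C : ℝ, 0 ≤ C ∧ ∀ a b c K L M, Bd χ α a K → Bd χ β b L → Bd χ γ c M →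
      Bd χ (α + β + γ) (comm χ a b c) (C * (K * L * M)) := by
  obtain ⟨Ca, hCa, Ta⟩ := exists_trunc_bound χ α le_rfl
  obtain ⟨Cb, hCb, Tb⟩ := exists_trunc_bound χ β le_rfl
  obtain ⟨Cc, hCc, Tc⟩ := exists_trunc_bound χ γ le_rfl
  obtain ⟨C, hC, h⟩ := exists_commSmooth_bound χ hα hβγ h0
  refine ⟨C * (Ca * Cb * Cc), by positivity, fun a b c K L M ha hb hc => ?_⟩
  refine Bd.of_tendsto (Filter.Eventually.of_forall fun N => ?_) (tendsto_comm hα hβγ h0 ha hb hc)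
  exact (h _ _ _ _ _ _ (trunc_finSupp N a) (trunc_finSupp N b) (trunc_finSupp N c) (Ta a K N N ha le_rfl).1
    (Tb b L N N hb le_rfl).1 (Tc c M N N hc le_rfl).1).mono (le_of_eq (by ring))

lemma trunc_sub (N : ℕ) (a b : Distr) : trunc χ N (a - b) = trunc χ N a - trunc χ N b := by
  simp only [trunc, block_sub, Finset.sum_sub_distrib]

section CommSub
variable {α β γ : ℝ} (hα : α < 1) (hβγ : β + γ < 0) (h0 : 0 < α + β + γ)
include hα hβγ h0

lemma comm_sub_left {a a' b c : Distr} {K K' L M : ℝ} (ha : Bd χ α a K) (ha' : Bd χ α a' K')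
    (hb : Bd χ β b L) (hc : Bd χ γ c M) : comm χ (a - a') b c = comm χ a b c - comm χ a' b c := by
  funext k
  refine tendsto_nhds_unique (tendsto_comm hα hβγ h0 (ha.sub ha') hb hc k)
    (((tendsto_comm hα hβγ h0 ha hb hc k).sub (tendsto_comm hα hβγ h0 ha' hb hc k)).congr fun N => ?_)
  rw [trunc_sub, commSmooth_sub_left (trunc_finSupp N a) (trunc_finSupp N a') (trunc_finSupp N b)
    (trunc_finSupp N c), Pi.sub_apply]

lemma comm_sub_mid {a b b' c : Distr} {K L L' M : ℝ} (ha : Bd χ α a K) (hb : Bd χ β b L)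
    (hb' : Bd χ β b' L') (hc : Bd χ γ c M) : comm χ a (b - b') c = comm χ a b c - comm χ a b' c := by
  funext k
  refine tendsto_nhds_unique (tendsto_comm hα hβγ h0 ha (hb.sub hb') hc k)
    (((tendsto_comm hα hβγ h0 ha hb hc k).sub (tendsto_comm hα hβγ h0 ha hb' hc k)).congr fun N => ?_)
  rw [trunc_sub, commSmooth_sub_mid (trunc_finSupp N a) (trunc_finSupp N b) (trunc_finSupp N b')
    (trunc_finSupp N c), Pi.sub_apply]

lemma comm_sub_right {a b c c' : Distr} {K L M M' : ℝ} (ha : Bd χ α a K) (hb : Bd χ β b L)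
    (hc : Bd χ γ c M) (hc' : Bd χ γ c' M') : comm χ a b (c - c') = comm χ a b c - comm χ a b c' := by
  funext k
  refine tendsto_nhds_unique (tendsto_comm hα hβγ h0 ha hb (hc.sub hc') k)
    (((tendsto_comm hα hβγ h0 ha hb hc k).sub (tendsto_comm hα hβγ h0 ha hb hc' k)).congr fun N => ?_)
  rw [trunc_sub, commSmooth_sub_right (trunc_finSupp N a) (trunc_finSupp N b) (trunc_finSupp N c)
    (trunc_finSupp N c'), Pi.sub_apply]

end CommSub

end CGL

namespace CGL
open MeasureTheory UnitAddTorus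

variable {χ : DyadicPartition}

/-! ### Uniform bounds for families of distributions and of their differences -/

/-- Interpolation between the regularities `α` and `α - 2η` of a function with parabolic blow-up. -/
lemma Bd.interp {α α₀ η γ t K : ℝ} {a : Distr} (ht : 0 < t) (h0 : α₀ = α - 2 * η)
    (h1 : α₀ ≤ γ) (h2 : γ ≤ α) (hα : Bd χ α a (K * t ^ (-η))) (hα₀ : Bd χ α₀ a K) :
    Bd χ γ a (K * t ^ (-((γ - α₀) / 2))) := by
  intro n
  have hK := hα₀.nonneg
  have e : ∀ s : ℝ, dyad s n = ((4:ℝ) ^ n) ^ (s / 2) := fun s => by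
    rw [dyad, show (4:ℝ) = 2 ^ (2:ℝ) by norm_num, ← Real.rpow_natCast, ← Real.rpow_mul two_pos.le,
      ← Real.rpow_mul two_pos.le]
    congr 1
    ring
  have h4 : (0:ℝ) < 4 ^ n := by positivity
  rcases le_total (t * 4 ^ n) 1 with h | h
  · refine (hα₀ n).mono ?_
    rw [mul_assoc]
    refine mul_le_mul_of_nonneg_left ?_ hK
    have h5 : (t * 4 ^ n) ^ ((γ - α₀) / 2) ≤ 1 := Real.rpow_le_one (by positivity) h (by linarith)
    rw [Real.mul_rpow ht.le h4.le] at h5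
    rw [show -α₀ = (γ - α₀) + -γ by ring, dyad_add, e (γ - α₀), Real.rpow_neg ht.le,
      ← div_eq_inv_mul]
    rw [le_div_iff₀ (by positivity)]
    calc _ = (t ^ ((γ - α₀) / 2) * (4 ^ n) ^ ((γ - α₀) / 2)) * dyad (-γ) n := by ring
      _ ≤ 1 * dyad (-γ) n := by gcongr; exact (dyad_pos _ _).le
      _ = _ := one_mul _
  · refine (hα n).mono ?_
    rw [mul_assoc, mul_assoc]
    refine mul_le_mul_of_nonneg_left ?_ hK
    have h5 : (t * 4 ^ n) ^ (-((α - γ) / 2)) ≤ 1 :=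
      Real.rpow_le_one_of_one_le_of_nonpos h (by linarith)
    rw [Real.mul_rpow ht.le h4.le] at h5
    have h6 : dyad (-(α - γ)) n = (4 ^ n) ^ (-((α - γ) / 2)) := by rw [e]; congr 1; ring
    have h7 : t ^ (-η) = t ^ (-((γ - α₀) / 2)) * t ^ (-((α - γ) / 2)) := by
      rw [← Real.rpow_add ht]; congr 1; linarith
    rw [show -α = -(α - γ) + -γ by ring, dyad_add, h6, h7]
    calc _ = t ^ (-((γ - α₀) / 2)) * dyad (-γ) n *
          (t ^ (-((α - γ) / 2)) * (4 ^ n) ^ (-((α - γ) / 2))) := by ring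
      _ ≤ t ^ (-((γ - α₀) / 2)) * dyad (-γ) n * 1 :=
          mul_le_mul_of_nonneg_left h5 (mul_nonneg (by positivity) (dyad_pos _ _).le)
      _ = _ := mul_one _

/-- The families `A` and `B` are bounded in `C^α` by a multiple of the weight `w`, and their
difference is bounded by the same multiple of `w * D`. -/
def Est (χ : DyadicPartition) {ι : Type*} (α : ℝ) (A B : ι → Distr) (w D : ι → ℝ) : Prop :=
  (∀ i, 0 ≤ w i ∧ 0 ≤ D i) ∧ ∃ C : ℝ, 0 ≤ C ∧ ∀ i, Bd χ α (A i) (C * w i) ∧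
    Bd χ α (B i) (C * w i) ∧ Bd χ α (A i - B i) (C * w i * D i)

section Est
variable {ι : Type*} {α β γ : ℝ} {A A' B B' : ι → Distr} {w w' w'' D : ι → ℝ}

lemma Est.weight_le (h : Est χ α A A' w D) (c : ℝ) (hw : ∀ i, w i ≤ c * w' i)
    (hw' : ∀ i, 0 ≤ w' i) : Est χ α A A' w' D := by
  obtain ⟨h0, C, hC, h1⟩ := h
  refine ⟨fun i => ⟨hw' i, (h0 i).2⟩, C * |c|, by positivity, fun i => ?_⟩
  have h2 : C * w i ≤ C * |c| * w' i := by
    rw [mul_assoc]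
    exact mul_le_mul_of_nonneg_left ((hw i).trans
      (mul_le_mul_of_nonneg_right (le_abs_self c) (hw' i))) hC
  exact ⟨(h1 i).1.mono h2, (h1 i).2.1.mono h2,
    (h1 i).2.2.mono (mul_le_mul_of_nonneg_right h2 (h0 i).2)⟩

lemma Est.mono_reg (h : Est χ α A A' w D) (hβ : β ≤ α) : Est χ β A A' w D := by
  obtain ⟨h0, C, hC, h1⟩ := h
  exact ⟨h0, C, hC, fun i => ⟨(h1 i).1.mono_reg hβ, (h1 i).2.1.mono_reg hβ, (h1 i).2.2.mono_reg hβ⟩⟩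

lemma Est.add (h : Est χ α A A' w D) (h' : Est χ α B B' w D) : Est χ α (A + B) (A' + B') w D := by
  obtain ⟨h0, C, hC, h1⟩ := h
  obtain ⟨-, C', hC', h1'⟩ := h'
  refine ⟨h0, C + C', by positivity, fun i => ⟨?_, ?_, ?_⟩⟩
  · exact ((h1 i).1.add (h1' i).1).mono (le_of_eq (by ring))
  · exact ((h1 i).2.1.add (h1' i).2.1).mono (le_of_eq (by ring))
  · have := ((h1 i).2.2.add (h1' i).2.2).mono (K' := (C + C') * w i * D i) (le_of_eq (by ring))
    rwa [sub_add_sub_comm] at this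

lemma Est.smul (c : ℂ) (h : Est χ α A A' w D) : Est χ α (c • A) (c • A') w D := by
  obtain ⟨h0, C, hC, h1⟩ := h
  refine ⟨h0, ‖c‖ * C, by positivity, fun i => ⟨?_, ?_, ?_⟩⟩
  · exact ((h1 i).1.smul c).mono (le_of_eq (by ring))
  · exact ((h1 i).2.1.smul c).mono (le_of_eq (by ring))
  · have := ((h1 i).2.2.smul c).mono (K' := ‖c‖ * C * w i * D i) (le_of_eq (by ring))
    rwa [smul_sub] at this

lemma Est.neg (h : Est χ α A A' w D) : Est χ α (-A) (-A') w D := by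
  simpa using h.smul (-1)

lemma Est.sub (h : Est χ α A A' w D) (h' : Est χ α B B' w D) : Est χ α (A - B) (A' - B') w D := by
  simpa only [sub_eq_add_neg] using h.add h'.neg

lemma Est.bar (h : Est χ α A A' w D) :
    Est χ α (fun i => bar (A i)) (fun i => bar (A' i)) w D := by
  obtain ⟨h0, C, hC, h1⟩ := h
  exact ⟨h0, C, hC, fun i => ⟨(h1 i).1.bar, (h1 i).2.1.bar, by rw [← bar_sub]; exact (h1 i).2.2.bar⟩⟩

lemma Est.comp {κ : Type*} (h : Est χ α A A' w D) (g : κ → ι) :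
    Est χ α (A ∘ g) (A' ∘ g) (w ∘ g) (D ∘ g) := by
  obtain ⟨h0, C, hC, h1⟩ := h
  exact ⟨fun i => h0 (g i), C, hC, fun i => h1 (g i)⟩

/-- A linear operation maps a bound for two families and their difference to such a bound. -/
lemma Est.linear {P : ι → Distr → Distr} {p : ι → ℝ} (h : Est χ α A A' w D) (hp : ∀ i, 0 ≤ p i)
    (hP : ∃ C : ℝ, 0 ≤ C ∧ ∀ i a K, Bd χ α a K → Bd χ γ (P i a) (C * p i * K))
    (hs : ∀ i a a', P i (a - a') = P i a - P i a') :
    Est χ γ (fun i => P i (A i)) (fun i => P i (A' i)) (fun i => p i * w i) D := by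
  obtain ⟨h0, C, hC, h1⟩ := h
  obtain ⟨C', hC', h2⟩ := hP
  refine ⟨fun i => ⟨mul_nonneg (hp i) (h0 i).1, (h0 i).2⟩, C' * C, by positivity, fun i => ⟨?_, ?_, ?_⟩⟩
  · exact (h2 i _ _ (h1 i).1).mono (le_of_eq (by ring))
  · exact (h2 i _ _ (h1 i).2.1).mono (le_of_eq (by ring))
  · rw [← hs]
    exact (h2 i _ _ (h1 i).2.2).mono (le_of_eq (by ring))

/-- A bilinear operation preserves bounds on two families and their difference, by
`P(a,b) - P(a',b') = P(a-a',b) + P(a',b-b')`. -/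
lemma Est.bilinear {P : ι → Distr → Distr → Distr} {p : ι → ℝ} (h : Est χ α A A' w D)
    (h' : Est χ β B B' w' D) (hp : ∀ i, 0 ≤ p i)
    (hP : ∃ C : ℝ, 0 ≤ C ∧ ∀ i a b K L, Bd χ α a K → Bd χ β b L →
      Bd χ γ (P i a b) (C * p i * K * L))
    (hl : ∀ i a a' b K K' L, Bd χ α a K → Bd χ α a' K' → Bd χ β b L →
      P i (a - a') b = P i a b - P i a' b)
    (hr : ∀ i a b b' K L L', Bd χ α a K → Bd χ β b L → Bd χ β b' L' →
      P i a (b - b') = P i a b - P i a b') :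
    Est χ γ (fun i => P i (A i) (B i)) (fun i => P i (A' i) (B' i)) (fun i => p i * w i * w' i) D := by
  obtain ⟨h0, C, hC, h1⟩ := h
  obtain ⟨h0', C', hC', h1'⟩ := h'
  obtain ⟨C₀, hC₀, h2⟩ := hP
  have hn : ∀ i, 0 ≤ p i * w i * w' i := fun i => mul_nonneg (mul_nonneg (hp i) (h0 i).1) (h0' i).1
  have hD : ∀ i, 0 ≤ D i := fun i => (h0 i).2
  refine ⟨fun i => ⟨hn i, hD i⟩, 2 * (C₀ * C * C'), by positivity, fun i => ⟨?_, ?_, ?_⟩⟩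
  · refine (h2 i _ _ _ _ (h1 i).1 (h1' i).1).mono ?_
    have := mul_nonneg (mul_nonneg (mul_nonneg hC₀ hC) hC') (hn i)
    nlinarith
  · refine (h2 i _ _ _ _ (h1 i).2.1 (h1' i).2.1).mono ?_
    have := mul_nonneg (mul_nonneg (mul_nonneg hC₀ hC) hC') (hn i)
    nlinarith
  · have e : P i (A i) (B i) - P i (A' i) (B' i)
        = P i (A i - A' i) (B i) + P i (A' i) (B i - B' i) := by
      rw [hl i _ _ _ _ _ _ (h1 i).1 (h1 i).2.1 (h1' i).1,
        hr i _ _ _ _ _ _ (h1 i).2.1 (h1' i).1 (h1' i).2.1]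
      abel
    rw [e]
    exact ((h2 i _ _ _ _ (h1 i).2.2 (h1' i).1).add (h2 i _ _ _ _ (h1 i).2.1 (h1' i).2.2)).mono
      (le_of_eq (by ring))

lemma Est.para_pos (h : Est χ α A A' w D) (h' : Est χ β B B' w' D) (hα : 0 < α) :
    Est χ β (fun i => para χ (A i) (B i)) (fun i => para χ (A' i) (B' i)) (fun i => w i * w' i) D := by
  obtain ⟨C, hC, hc⟩ := exists_para_pos_bound χ hα β
  simpa using h.bilinear h' (P := fun _ => para χ) (p := fun _ => 1) (γ := β) (fun _ => zero_le_one)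
    ⟨C, hC, fun i a b K L h1 h2 => by simpa using hc a b K L h1 h2⟩
    (fun i a a' b _ _ _ _ _ _ => para_sub_left a a' b) fun i a b b' _ _ _ _ _ _ => para_sub_right a b b'

lemma Est.para_neg (h : Est χ α A A' w D) (h' : Est χ β B B' w' D) (hα : α < 0) :
    Est χ (α + β) (fun i => para χ (A i) (B i)) (fun i => para χ (A' i) (B' i))
      (fun i => w i * w' i) D := by
  obtain ⟨C, hC, hc⟩ := exists_para_neg_bound χ hα β
  simpa using h.bilinear h' (P := fun _ => para χ) (p := fun _ => 1) (γ := α + β)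
    (fun _ => zero_le_one) ⟨C, hC, fun i a b K L h1 h2 => by simpa using hc a b K L h1 h2⟩
    (fun i a a' b _ _ _ _ _ _ => para_sub_left a a' b) fun i a b b' _ _ _ _ _ _ => para_sub_right a b b'

lemma Est.reso (h : Est χ α A A' w D) (h' : Est χ β B B' w' D) (hαβ : 0 < α + β) :
    Est χ (α + β) (fun i => reso χ (A i) (B i)) (fun i => reso χ (A' i) (B' i))
      (fun i => w i * w' i) D := by
  obtain ⟨C, hC, hc⟩ := exists_reso_bound χ hαβ
  simpa using h.bilinear h' (P := fun _ => CGL.reso χ) (p := fun _ => 1) (γ := α + β)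
    (fun _ => zero_le_one) ⟨C, hC, fun i a b K L h1 h2 => by simpa using hc a b K L h1 h2⟩
    (fun i a a' b _ _ _ h1 h2 h3 => reso_sub_left hαβ h1 h2 h3)
    fun i a b b' _ _ _ h1 h2 h3 => reso_sub_right hαβ h1 h2 h3

/-- Multiplication by a function of positive regularity `α` preserves the regularity `β ≤ α`. -/
lemma Est.prod (h : Est χ α A A' w D) (h' : Est χ β B B' w' D) (hα : 0 < α) (hβ : β ≠ 0)
    (hβα : β ≤ α) (hαβ : 0 < α + β) :
    Est χ β (fun i => prod χ (A i) (B i)) (fun i => prod χ (A' i) (B' i)) (fun i => w i * w' i) D := by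
  have h1 := h.para_pos h' hα
  have h2 := (h.reso h' hαβ).mono_reg (β := β) (by linarith)
  have h3 : Est χ β (fun i => para χ (B i) (A i)) (fun i => para χ (B' i) (A' i))
      (fun i => w i * w' i) D := by
    rcases lt_or_gt_of_ne hβ with hb | hb
    · simpa only [mul_comm] using (h'.para_neg h hb).mono_reg (β := β) (by linarith)
    · simpa only [mul_comm] using (h'.para_pos h hb).mono_reg (β := β) hβα
  exact (h1.add h2).add h3

lemma Est.comm {C C' : ι → Distr} (h : Est χ α A A' w D) (h' : Est χ β B B' w' D)
    (h'' : Est χ γ C C' w'' D) (hα : α < 1) (hβγ : β + γ < 0) (h0 : 0 < α + β + γ) :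
    Est χ (α + β + γ) (fun i => comm χ (A i) (B i) (C i)) (fun i => comm χ (A' i) (B' i) (C' i))
      (fun i => w i * w' i * w'' i) D := by
  obtain ⟨n1, c1, p1, h1⟩ := h
  obtain ⟨n2, c2, p2, h2⟩ := h'
  obtain ⟨n3, c3, p3, h3⟩ := h''
  obtain ⟨c, p, hc⟩ := exists_comm_bound χ hα hβγ h0
  have hn : ∀ i, 0 ≤ w i * w' i * w'' i := fun i => mul_nonneg (mul_nonneg (n1 i).1 (n2 i).1) (n3 i).1
  have hm : ∀ i, 0 ≤ c * c1 * c2 * c3 * (w i * w' i * w'' i) := fun i => mul_nonneg (by positivity) (hn i)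
  refine ⟨fun i => ⟨hn i, (n1 i).2⟩, 3 * (c * c1 * c2 * c3), by positivity, fun i => ⟨?_, ?_, ?_⟩⟩
  · refine (hc _ _ _ _ _ _ (h1 i).1 (h2 i).1 (h3 i).1).mono ?_
    nlinarith [hm i]
  · refine (hc _ _ _ _ _ _ (h1 i).2.1 (h2 i).2.1 (h3 i).2.1).mono ?_
    nlinarith [hm i]
  · have e : CGL.comm χ (A i) (B i) (C i) - CGL.comm χ (A' i) (B' i) (C' i)
        = CGL.comm χ (A i - A' i) (B i) (C i) + CGL.comm χ (A' i) (B i - B' i) (C i)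
          + CGL.comm χ (A' i) (B' i) (C i - C' i) := by
      rw [comm_sub_left hα hβγ h0 (h1 i).1 (h1 i).2.1 (h2 i).1 (h3 i).1,
        comm_sub_mid hα hβγ h0 (h1 i).2.1 (h2 i).1 (h2 i).2.1 (h3 i).1,
        comm_sub_right hα hβγ h0 (h1 i).2.1 (h2 i).2.1 (h3 i).1 (h3 i).2.1]
      abel
    rw [e]
    exact (((hc _ _ _ _ _ _ (h1 i).2.2 (h2 i).1 (h3 i).1).add
      (hc _ _ _ _ _ _ (h1 i).2.1 (h2 i).2.2 (h3 i).1)).add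
      (hc _ _ _ _ _ _ (h1 i).2.1 (h2 i).2.1 (h3 i).2.2)).mono (le_of_eq (by ring))

lemma Est.heat {μ : ℝ} (hμ : 0 < μ) {τ : ι → ℝ} (hτ : ∀ i, 0 < τ i ∧ τ i ≤ 1)
    (h : Est χ α A A' w D) (h1 : α ≤ γ) (h2 : γ ≤ α + 4) :
    Est χ γ (fun i => heat μ (τ i) (A i)) (fun i => heat μ (τ i) (A' i))
      (fun i => τ i ^ (-((γ - α) / 2)) * w i) D := by
  obtain ⟨C, hC, hc⟩ := exists_heat_bd χ hμ
  exact h.linear (P := fun i => CGL.heat μ (τ i)) (fun i => Real.rpow_nonneg (hτ i).1.le _)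
    ⟨C, hC, fun i a K ha => hc _ (hτ i).1 (hτ i).2 _ _ h1 h2 a K ha⟩ fun i a a' => heat_sub _ _ a a'

lemma Est.heatComm {μ : ℝ} (hμ : 0 < μ) {τ : ι → ℝ} (hτ : ∀ i, 0 < τ i ∧ τ i ≤ 1)
    (h : Est χ α A A' w D) (h' : Est χ β B B' w' D) (hα : α < 1) (h1 : α + β ≤ γ)
    (h2 : γ ≤ α + β + 3) :
    Est χ γ (fun i => heatComm χ μ (τ i) (A i) (B i)) (fun i => heatComm χ μ (τ i) (A' i) (B' i))
      (fun i => τ i ^ (-((γ - (α + β)) / 2)) * w i * w' i) D := by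
  obtain ⟨C, hC, hc⟩ := exists_heatComm_bd χ hμ hα β γ h1 h2
  exact h.bilinear h' (P := fun i => CGL.heatComm χ μ (τ i)) (fun i => Real.rpow_nonneg (hτ i).1.le _)
    ⟨C, hC, fun i a b K L ha hb => hc _ (hτ i).1 (hτ i).2 a b K L ha hb⟩
    (fun i a a' b _ _ _ _ _ _ => heatComm_sub_left _ _ a a' b)
    fun i a b b' _ _ _ _ _ _ => heatComm_sub_right _ _ a b b'

end Est

/-- `Est` with the power weight `t ^ (-a)` at times `t ∈ (0,1]`. -/
def EstT (χ : DyadicPartition) {ι : Type*} (t D : ι → ℝ) (α a : ℝ) (A B : ι → Distr) : Prop :=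
  (∀ i, 0 < t i ∧ t i ≤ 1) ∧ Est χ α A B (fun i => t i ^ (-a)) D

section EstT
variable {ι : Type*} {t D : ι → ℝ} {α β γ a b c : ℝ} {A A' B B' C C' : ι → Distr}

lemma EstT.mono (h : EstT χ t D α a A A') (hβ : β ≤ α) (hb : a ≤ b) : EstT χ t D β b A A' :=
  ⟨h.1, (h.2.mono_reg hβ).weight_le 1 (fun i => by
    rw [one_mul]
    exact Real.rpow_le_rpow_of_exponent_ge (h.1 i).1 (h.1 i).2 (by linarith))
    fun i => Real.rpow_nonneg (h.1 i).1.le _⟩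

lemma EstT.add (h : EstT χ t D α a A A') (h' : EstT χ t D α a B B') :
    EstT χ t D α a (fun i => A i + B i) (fun i => A' i + B' i) := ⟨h.1, h.2.add h'.2⟩

lemma EstT.sub (h : EstT χ t D α a A A') (h' : EstT χ t D α a B B') :
    EstT χ t D α a (fun i => A i - B i) (fun i => A' i - B' i) := ⟨h.1, h.2.sub h'.2⟩

lemma EstT.smul (z : ℂ) (h : EstT χ t D α a A A') :
    EstT χ t D α a (fun i => z • A i) (fun i => z • A' i) := ⟨h.1, h.2.smul z⟩

lemma EstT.bar (h : EstT χ t D α a A A') :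
    EstT χ t D α a (fun i => bar (A i)) (fun i => bar (A' i)) := ⟨h.1, h.2.bar⟩

lemma EstT.of_mul (ht : ∀ i, 0 < t i ∧ t i ≤ 1)
    (h : Est χ α A A' (fun i => t i ^ (-a) * t i ^ (-b)) D) : EstT χ t D α (a + b) A A' :=
  ⟨ht, h.weight_le 1 (fun i => by rw [one_mul, neg_add, Real.rpow_add (ht i).1])
    fun i => Real.rpow_nonneg (ht i).1.le _⟩

lemma EstT.para_pos (h : EstT χ t D α a A A') (h' : EstT χ t D β b B B') (hα : 0 < α) :
    EstT χ t D β (a + b) (fun i => para χ (A i) (B i)) (fun i => para χ (A' i) (B' i)) :=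
  .of_mul h.1 (h.2.para_pos h'.2 hα)

lemma EstT.para_neg (h : EstT χ t D α a A A') (h' : EstT χ t D β b B B') (hα : α < 0) :
    EstT χ t D (α + β) (a + b) (fun i => para χ (A i) (B i)) (fun i => para χ (A' i) (B' i)) :=
  .of_mul h.1 (h.2.para_neg h'.2 hα)

lemma EstT.reso (h : EstT χ t D α a A A') (h' : EstT χ t D β b B B') (hαβ : 0 < α + β) :
    EstT χ t D (α + β) (a + b) (fun i => reso χ (A i) (B i)) (fun i => reso χ (A' i) (B' i)) :=
  .of_mul h.1 (h.2.reso h'.2 hαβ)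

lemma EstT.prod (h : EstT χ t D α a A A') (h' : EstT χ t D β b B B') (hα : 0 < α) (hβ : β ≠ 0)
    (hβα : β ≤ α) (hαβ : 0 < α + β) :
    EstT χ t D β (a + b) (fun i => prod χ (A i) (B i)) (fun i => prod χ (A' i) (B' i)) :=
  .of_mul h.1 (h.2.prod h'.2 hα hβ hβα hαβ)

/-- The product of two functions of regularity `β`, when the weight at a lower regularity `α > 0` is
used for one of the factors. -/
lemma EstT.prod_same (h : EstT χ t D α a A A') (h' : EstT χ t D β b A A')
    (k : EstT χ t D α a B B') (k' : EstT χ t D β b B B') (hα : 0 < α) (hβ : 0 < β) :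
    EstT χ t D β (a + b) (fun i => CGL.prod χ (A i) (B i)) (fun i => CGL.prod χ (A' i) (B' i)) :=
  ((h.para_pos k' hα).add ((h.reso k' (by linarith)).mono (by linarith) le_rfl)).add
    (k.para_pos h' hα)

lemma EstT.comm (h : EstT χ t D α a A A') (h' : EstT χ t D β b B B') (h'' : EstT χ t D γ c C C')
    (hα : α < 1) (hβγ : β + γ < 0) (h0 : 0 < α + β + γ) :
    EstT χ t D (α + β + γ) (a + b + c) (fun i => comm χ (A i) (B i) (C i))
      (fun i => comm χ (A' i) (B' i) (C' i)) :=
  .of_mul h.1 ((h.2.comm h'.2 h''.2 hα hβγ h0).weight_le 1 (fun i => by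
    rw [one_mul, neg_add, Real.rpow_add (h.1 i).1]) fun i =>
      mul_nonneg (Real.rpow_nonneg (h.1 i).1.le _) (Real.rpow_nonneg (h.1 i).1.le _))

end EstT

end CGL

namespace CGL
open MeasureTheory UnitAddTorus

variable {χ : DyadicPartition}

/-! ### Measurability of the operations -/

lemma measurable_tsum_complex {ι X : Type*} [Countable ι] [MeasurableSpace X] {f : ι → X → ℂ}
    (hf : ∀ i, Measurable (f i)) : Measurable fun x => ∑' i, f i x := by
  set S : Set X := {x | ∑' i, ‖f i x‖ₑ ≠ ⊤} with hS
  have hSm : MeasurableSet S := by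
    have : Measurable fun x => ∑' i, ‖f i x‖ₑ := Measurable.tsum fun i => (hf i).enorm
    exact (this (measurableSet_singleton ⊤)).compl
  have hsum : ∀ x, x ∈ S ↔ Summable fun i => f i x := fun x => by
    rw [← summable_norm_iff, hS, Set.mem_ofPred_eq]
    simp only [← ofReal_norm]
    constructor
    · intro h
      have := ENNReal.summable_toReal h
      simpa [ENNReal.toReal_ofReal] using this
    · intro h
      exact h.tsum_ofReal_ne_top
  refine measurable_of_tendsto_metrizable' (Filter.atTop : Filter (Finset ι))
    (f := fun s x => ∑ i ∈ s, S.indicator (f i) x)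
    (fun s => Finset.measurable_sum s fun i _ => (hf i).indicator hSm) ?_
  rw [tendsto_pi_nhds]
  intro x
  by_cases hx : x ∈ S
  · simp only [Set.indicator_of_mem hx]
    exact ((hsum x).1 hx).hasSum
  · rw [tsum_eq_zero_of_not_summable fun h => hx ((hsum x).2 h)]
    simp [Set.indicator_of_notMem hx]

section Measurable
variable {X : Type*} [MeasurableSpace X] {a b c : X → Distr}

lemma measurable_block (n : ℕ) (ha : Measurable a) : Measurable fun x => block χ n (a x) :=
  measurable_pi_iff.2 fun k => ((measurable_pi_iff.1 ha) k).const_mul _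

lemma measurable_conv (ha : Measurable a) (hb : Measurable b) :
    Measurable fun x => conv (a x) (b x) :=
  measurable_pi_iff.2 fun k => measurable_tsum_complex fun j =>
    ((measurable_pi_iff.1 ha) j).mul ((measurable_pi_iff.1 hb) (k - j))

lemma measurable_para (ha : Measurable a) (hb : Measurable b) :
    Measurable fun x => para χ (a x) (b x) :=
  measurable_pi_iff.2 fun k => measurable_tsum_complex fun _ =>
    (measurable_pi_iff.1 (measurable_conv (measurable_block _ ha) (measurable_block _ hb))) k

lemma measurable_reso (ha : Measurable a) (hb : Measurable b) :
    Measurable fun x => reso χ (a x) (b x) :=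
  measurable_pi_iff.2 fun k => measurable_tsum_complex fun _ =>
    (measurable_pi_iff.1 (measurable_conv (measurable_block _ ha) (measurable_block _ hb))) k

lemma measurable_prod (ha : Measurable a) (hb : Measurable b) :
    Measurable fun x => prod χ (a x) (b x) :=
  ((measurable_para ha hb).add (measurable_reso ha hb)).add (measurable_para hb ha)

lemma measurable_trunc (N : ℕ) (ha : Measurable a) : Measurable fun x => trunc χ N (a x) :=
  Finset.measurable_sum _ fun n _ => measurable_block n ha

lemma measurable_comm (ha : Measurable a) (hb : Measurable b) (hc : Measurable c) :
    Measurable fun x => comm χ (a x) (b x) (c x) := by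
  refine measurable_pi_iff.2 fun k => (StronglyMeasurable.limUnder fun N => ?_).measurable
  have ha' := measurable_trunc (χ := χ) N ha
  have hb' := measurable_trunc (χ := χ) N hb
  have hc' := measurable_trunc (χ := χ) N hc
  exact ((measurable_pi_iff.1 ((measurable_reso (measurable_para ha' hb') hc').sub
    (measurable_prod ha' (measurable_reso hb' hc')))) k).stronglyMeasurable

lemma measurable_bar (ha : Measurable a) : Measurable fun x => bar (a x) :=
  measurable_pi_iff.2 fun k => Complex.continuous_conj.measurable.comp ((measurable_pi_iff.1 ha) (-k))

end Measurable

section AEMeasurable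
variable {X : Type*} [MeasurableSpace X] {m : Measure X} {a b c : X → Distr}

lemma aemeasurable_para (ha : AEMeasurable a m) (hb : AEMeasurable b m) :
    AEMeasurable (fun x => para χ (a x) (b x)) m :=
  ⟨fun x => para χ (ha.mk a x) (hb.mk b x), measurable_para ha.measurable_mk hb.measurable_mk, by
    filter_upwards [ha.ae_eq_mk, hb.ae_eq_mk] with x h1 h2
    rw [← h1, ← h2]⟩

lemma aemeasurable_reso (ha : AEMeasurable a m) (hb : AEMeasurable b m) :
    AEMeasurable (fun x => reso χ (a x) (b x)) m :=
  ⟨fun x => reso χ (ha.mk a x) (hb.mk b x), measurable_reso ha.measurable_mk hb.measurable_mk, by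
    filter_upwards [ha.ae_eq_mk, hb.ae_eq_mk] with x h1 h2
    rw [← h1, ← h2]⟩

lemma aemeasurable_prod (ha : AEMeasurable a m) (hb : AEMeasurable b m) :
    AEMeasurable (fun x => prod χ (a x) (b x)) m :=
  ⟨fun x => prod χ (ha.mk a x) (hb.mk b x), measurable_prod ha.measurable_mk hb.measurable_mk, by
    filter_upwards [ha.ae_eq_mk, hb.ae_eq_mk] with x h1 h2
    rw [← h1, ← h2]⟩

lemma aemeasurable_comm (ha : AEMeasurable a m) (hb : AEMeasurable b m) (hc : AEMeasurable c m) :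
    AEMeasurable (fun x => comm χ (a x) (b x) (c x)) m :=
  ⟨fun x => comm χ (ha.mk a x) (hb.mk b x) (hc.mk c x),
    measurable_comm ha.measurable_mk hb.measurable_mk hc.measurable_mk, by
    filter_upwards [ha.ae_eq_mk, hb.ae_eq_mk, hc.ae_eq_mk] with x h1 h2 h3
    rw [← h1, ← h2, ← h3]⟩

lemma aemeasurable_bar (ha : AEMeasurable a m) : AEMeasurable (fun x => bar (a x)) m :=
  (measurable_bar measurable_id).comp_aemeasurable ha

end AEMeasurable

lemma measurable_heat_fun (μ : ℝ) {X : Type*} [MeasurableSpace X] {t : X → ℝ} {a : X → Distr}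
    (ht : Measurable t) (ha : Measurable a) : Measurable fun x => heat μ (t x) (a x) := by
  refine measurable_pi_iff.2 fun k => Measurable.mul ?_ ((measurable_pi_iff.1 ha) k)
  exact Complex.measurable_exp.comp
    ((Complex.measurable_ofReal.comp ht).mul measurable_const).neg

lemma aemeasurable_heat (μ : ℝ) {X : Type*} [MeasurableSpace X] {m : Measure X} {t : X → ℝ}
    {a : X → Distr} (ht : Measurable t) (ha : AEMeasurable a m) :
    AEMeasurable (fun x => heat μ (t x) (a x)) m :=
  ⟨fun x => heat μ (t x) (ha.mk a x), measurable_heat_fun μ ht ha.measurable_mk, by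
    filter_upwards [ha.ae_eq_mk] with x h1
    rw [← h1]⟩

/-! ### Integrals of paths of distributions -/

section Integral
variable {a b α : ℝ} {f : ℝ → Distr} {K : ℝ → ℝ}

lemma integrableOn_coeff (hab : a ≤ b) (hf : AEMeasurable f (volume.restrict (Set.Ioo a b)))
    (hK : IntervalIntegrable K volume a b) (h : ∀ s ∈ Set.Ioo a b, Bd χ α (f s) (K s)) (k : Freq) :
    IntegrableOn (fun s => f s k) (Set.Ioo a b) := by
  obtain ⟨C, hC, hc⟩ := exists_coeff_bound χ α k
  refine Integrable.mono' (((intervalIntegrable_iff_integrableOn_Ioo_of_le hab).1 hK).const_mul C)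
    ((aemeasurable_pi_iff.1 hf) k).aestronglyMeasurable ?_
  filter_upwards [ae_restrict_mem measurableSet_Ioo] with s hs using hc _ _ (h s hs)

/-- The block norms of an integral are at most the integrals of the block norms. -/
lemma Bd.integral (hab : a ≤ b) (hf : AEMeasurable f (volume.restrict (Set.Ioo a b)))
    (hK : IntervalIntegrable K volume a b) (h : ∀ s ∈ Set.Ioo a b, Bd χ α (f s) (K s)) :
    Bd χ α (fun k => ∫ s in a..b, f s k) (∫ s in a..b, K s) := by
  intro n x
  have hi := integrableOn_coeff hab hf hK h
  have hS : ∀ (g : Distr) k, block χ n g k ≠ 0 → k ∈ (finite_freq (2 ^ n * (8 / 3))).toFinset := by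
    intro g k hk
    by_contra h'
    simp only [Set.Finite.mem_toFinset, Set.mem_ofPred_eq, not_lt] at h'
    exact hk (by simp [block, weight_eq_zero χ n _ h'])
  rw [ev_eq_sum (hS _)]
  have e1 : ∑ k ∈ (finite_freq (2 ^ n * (8 / 3))).toFinset,
      block χ n (fun k => ∫ s in a..b, f s k) k * mFourier k x
      = ∫ s in Set.Ioo a b, ev (block χ n (f s)) x := by
    simp only [ev_eq_sum (hS _)]
    rw [integral_finsetSum _ fun k _ => ?_]
    · refine Finset.sum_congr rfl fun k _ => ?_
      simp only [block, intervalIntegral.integral_of_le hab, integral_Ioc_eq_integral_Ioo]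
      rw [integral_mul_const, integral_const_mul]
    · exact ((hi k).const_mul _).mul_const _
  rw [e1, intervalIntegral.integral_of_le hab, integral_Ioc_eq_integral_Ioo, ← integral_mul_const]
  refine norm_integral_le_of_norm_le
    (((intervalIntegrable_iff_integrableOn_Ioo_of_le hab).1 hK).mul_const _) ?_
  filter_upwards [ae_restrict_mem measurableSet_Ioo] with s hs using h s hs n x

lemma heat_integral (μ t : ℝ) :
    heat μ t (fun k => ∫ s in a..b, f s k) = fun k => ∫ s in a..b, heat μ t (f s) k := by
  funext k
  simp only [heat]
  rw [intervalIntegral.integral_const_mul]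

lemma para_integral (c : Distr) (hab : a ≤ b) (hi : ∀ k, IntegrableOn (fun s => f s k) (Set.Ioo a b)) :
    para χ c (fun k => ∫ s in a..b, f s k) = fun k => ∫ s in a..b, para χ c (f s) k := by
  funext k
  obtain ⟨N, hN⟩ := exists_norm_lt_two_pow ‖toR k‖ (1 / 24) (by norm_num)
  have hk : ‖toR k‖ < 2 ^ N / 24 := by have := hN N le_rfl; linarith
  have hS : ∀ q k, low χ q c k ≠ 0 → k ∈ (low_finSupp (χ := χ) q c).toFinset := fun q k hk =>
    (Set.Finite.mem_toFinset _).2 hk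
  simp only [para_apply _ _ hk]
  rw [intervalIntegral.integral_finsetSum fun q _ => ?_]
  · refine Finset.sum_congr rfl fun q _ => ?_
    simp only [conv_eq_sum (hS q)]
    rw [intervalIntegral.integral_finsetSum fun j _ => ?_]
    · refine Finset.sum_congr rfl fun j _ => ?_
      simp only [block]
      rw [← intervalIntegral.integral_const_mul, ← intervalIntegral.integral_const_mul]
    · exact (((intervalIntegrable_iff_integrableOn_Ioo_of_le hab).2 (hi (k - j))).const_mul
        _).const_mul _
  · simp only [conv_eq_sum (hS q)]
    rw [← Finset.sum_fn]
    refine IntervalIntegrable.sum _ fun j _ => ?_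
    exact (((intervalIntegrable_iff_integrableOn_Ioo_of_le hab).2 (hi (k - j))).const_mul
        _).const_mul _

end Integral

end CGL

namespace CGL
open MeasureTheory UnitAddTorus

variable {χ : DyadicPartition}

/-! ### Schauder estimates in time -/

/-- The Beta-type integral over a window `[τ,t]`: on either half of `[0,t]` one of the two singular
factors is harmless. -/
lemma exists_beta_bound {η θ : ℝ} (hη : 0 ≤ η) (hη1 : η < 1) (hθ : 0 ≤ θ) (hθ1 : θ < 1) :
    ∃ C : ℝ, 0 ≤ C ∧ ∀ τ t : ℝ, 0 ≤ τ → τ < t →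
      IntervalIntegrable (fun s => s ^ (-η) * (t - s) ^ (-θ)) volume τ t ∧
      ∫ s in τ..t, s ^ (-η) * (t - s) ^ (-θ) ≤ C * (t ^ (-η) * (t - τ) ^ (1 - θ)) := by
  refine ⟨2 ^ θ / (1 - η) + 2 ^ η / (1 - θ), by
    have : 0 < 1 - η := by linarith
    have : 0 < 1 - θ := by linarith
    positivity, fun τ t hτ ht => ?_⟩
  have ht0 : 0 < t := hτ.trans_lt ht
  have hd : 0 < t - τ := by linarith
  set g : ℝ → ℝ := fun s => (t / 2) ^ (-θ) * s ^ (-η) + (t / 2) ^ (-η) * (t - s) ^ (-θ) with hg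
  have i1 : IntervalIntegrable (fun s : ℝ => s ^ (-η)) volume τ t :=
    intervalIntegral.intervalIntegrable_rpow' (by linarith)
  have i2 : IntervalIntegrable (fun s : ℝ => (t - s) ^ (-θ)) volume τ t := by
    have := (intervalIntegral.intervalIntegrable_rpow' (a := t - τ) (b := 0) (r := -θ)
      (by linarith)).comp_sub_left t
    simpa using this
  have ig : IntervalIntegrable g volume τ t := (i1.const_mul _).add (i2.const_mul _)
  have hle : ∀ s ∈ Set.Ioo τ t, s ^ (-η) * (t - s) ^ (-θ) ≤ g s := by
    intro s hs
    have hs0 : 0 < s := hτ.trans_lt hs.1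
    have hs1 : 0 < t - s := by linarith [hs.2]
    have p1 : 0 ≤ s ^ (-η) := by positivity
    have p2 : 0 ≤ (t - s) ^ (-θ) := by positivity
    have p3 : 0 ≤ (t / 2) ^ (-θ) := by positivity
    have p4 : 0 ≤ (t / 2) ^ (-η) := by positivity
    rcases le_total s (t / 2) with h | h
    · have : (t - s) ^ (-θ) ≤ (t / 2) ^ (-θ) :=
        Real.rpow_le_rpow_of_nonpos (by linarith) (by linarith) (by linarith)
      simp only [hg]
      nlinarith [mul_nonneg p4 p2, mul_le_mul_of_nonneg_left this p1]
    · have : s ^ (-η) ≤ (t / 2) ^ (-η) :=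
        Real.rpow_le_rpow_of_nonpos (by linarith) h (by linarith)
      simp only [hg]
      nlinarith [mul_nonneg p3 p1, mul_le_mul_of_nonneg_right this p2]
  have hint : IntervalIntegrable (fun s => s ^ (-η) * (t - s) ^ (-θ)) volume τ t := by
    rw [intervalIntegrable_iff_integrableOn_Ioo_of_le ht.le] at ig ⊢
    refine Integrable.mono' ig ?_ ?_
    · exact ((measurable_id.pow_const _).mul
        ((measurable_const.sub measurable_id).pow_const _)).aestronglyMeasurable
    · filter_upwards [ae_restrict_mem measurableSet_Ioo] with s hs
      have hs0 : 0 < s := hτ.trans_lt hs.1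
      have hs1 : 0 < t - s := by linarith [hs.2]
      rw [Real.norm_of_nonneg (by positivity)]
      exact hle s hs
  refine ⟨hint, ?_⟩
  refine (intervalIntegral.integral_mono_on_of_le_Ioo ht.le hint ig hle).trans ?_
  rw [hg, intervalIntegral.integral_add (i1.const_mul _) (i2.const_mul _),
    intervalIntegral.integral_const_mul, intervalIntegral.integral_const_mul,
    intervalIntegral.integral_comp_sub_left (fun s => s ^ (-θ)) t, sub_self,
    integral_rpow (Or.inl (by linarith)), integral_rpow (Or.inl (by linarith)), add_mul]
  have e1 : -η + 1 = 1 - η := by ring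
  have e2 : -θ + 1 = 1 - θ := by ring
  rw [e1, e2, Real.zero_rpow (by linarith), sub_zero, Real.div_rpow ht0.le two_pos.le,
    Real.div_rpow ht0.le two_pos.le, Real.rpow_neg two_pos.le, Real.rpow_neg two_pos.le]
  have h1 : t ^ (1 - η) - τ ^ (1 - η) ≤ t ^ (-η) * (t - τ) := by
    have : τ * t ^ (-η) ≤ τ ^ (1 - η) := by
      rcases hτ.eq_or_lt with rfl | hτ'
      · rw [zero_mul, Real.zero_rpow (by linarith)]
      · rw [sub_eq_add_neg, Real.rpow_add hτ', Real.rpow_one]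
        exact mul_le_mul_of_nonneg_left
          (Real.rpow_le_rpow_of_nonpos hτ' ht.le (by linarith)) hτ
    rw [sub_eq_add_neg 1 η, Real.rpow_add ht0, Real.rpow_one, ← sub_eq_add_neg]
    linarith
  have h2 : t ^ (-θ) * (t - τ) ≤ (t - τ) ^ (1 - θ) := by
    rw [sub_eq_add_neg 1 θ, Real.rpow_add hd, Real.rpow_one, mul_comm]
    exact mul_le_mul_of_nonneg_left (Real.rpow_le_rpow_of_nonpos hd (by linarith) (by linarith)) hd.le
  have hη' : 0 < 1 - η := by linarith
  have hθ' : 0 < 1 - θ := by linarith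
  refine add_le_add ?_ (le_of_eq ?_)
  · rw [div_eq_mul_inv _ (2 ^ θ)⁻¹, inv_inv]
    calc _ = 2 ^ θ / (1 - η) * (t ^ (-θ) * (t ^ (1 - η) - τ ^ (1 - η))) := by ring
      _ ≤ 2 ^ θ / (1 - η) * (t ^ (-θ) * (t ^ (-η) * (t - τ))) := by gcongr
      _ = 2 ^ θ / (1 - η) * (t ^ (-η) * (t ^ (-θ) * (t - τ))) := by ring
      _ ≤ _ := by gcongr
  · rw [div_eq_mul_inv _ (2 ^ η)⁻¹, inv_inv]
    ring

/-- Integrals of paths whose norms are controlled by a Beta-type weight. -/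
lemma exists_integral_bd (χ : DyadicPartition) {η θ : ℝ} (hη : 0 ≤ η) (hη1 : η < 1) (hθ : 0 ≤ θ)
    (hθ1 : θ < 1) : ∃ C : ℝ, 0 ≤ C ∧ ∀ (α A τ t : ℝ) (f : ℝ → Distr), 0 ≤ τ → τ < t → 0 ≤ A →
      AEMeasurable f (volume.restrict (Set.Ioo τ t)) →
      (∀ s ∈ Set.Ioo τ t, Bd χ α (f s) (A * (s ^ (-η) * (t - s) ^ (-θ)))) →
      (∀ k, IntegrableOn (fun s => f s k) (Set.Ioo τ t)) ∧
      Bd χ α (fun k => ∫ s in τ..t, f s k) (C * A * (t ^ (-η) * (t - τ) ^ (1 - θ))) := by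
  obtain ⟨C, hC, hc⟩ := exists_beta_bound hη hη1 hθ hθ1
  refine ⟨C, hC, fun α A τ t f hτ ht hA hf h => ?_⟩
  obtain ⟨h1, h2⟩ := hc τ t hτ ht
  have h3 := h1.const_mul A
  refine ⟨integrableOn_coeff ht.le hf h3 h, (Bd.integral ht.le hf h3 h).mono ?_⟩
  rw [intervalIntegral.integral_const_mul]
  calc _ ≤ A * (C * (t ^ (-η) * (t - τ) ^ (1 - θ))) := mul_le_mul_of_nonneg_left h2 hA
    _ = _ := by ring

/-- `∫_0^t P_{t-s} f_s ds`. -/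
def heatInt (μ : ℝ) (f : Path) : Path := fun t k => ∫ s in (0 : ℝ)..t, heat μ (t - s) (f s) k

lemma duhamel_eq (μ : ℝ) (u₀ : Distr) (f : Path) (t : ℝ) :
    duhamel μ u₀ f t = heat μ t u₀ + heatInt μ f t := rfl

lemma heat_heat (μ s t : ℝ) (a : Distr) : heat μ s (heat μ t a) = heat μ (s + t) a := by
  funext k
  simp only [heat]
  rw [← mul_assoc, ← Complex.exp_add]
  congr 2
  push_cast
  ring

lemma heat_zero_time (μ : ℝ) (a : Distr) : heat μ 0 a = a := by
  funext k
  simp [heat]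

lemma heat_zero (μ t : ℝ) : heat μ t 0 = 0 := by
  funext k
  simp [heat]

lemma heatInt_zero (μ : ℝ) (f : Path) : heatInt μ f 0 = 0 := by
  funext k
  simp [heatInt]

/-- Quantitative membership in `L_T^{η,α,δ}`. -/
structure LB (χ : DyadicPartition) (T η α δ : ℝ) (u : Path) (K : ℝ) : Prop where
  pt : ∀ t, 0 < t → t ≤ T → Bd χ α (u t) (K * t ^ (-η))
  base : ∀ t, 0 ≤ t → t ≤ T → Bd χ (α - 2 * η) (u t) K
  hold : ∀ s t, 0 < s → s < t → t ≤ T → Bd χ (α - 2 * δ) (u t - u s) (K * (s ^ (-η) * (t - s) ^ δ))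

section LB
variable {T η α δ K L : ℝ} {u v : Path}

lemma LB.mono (h : LB χ T η α δ u K) (hK : K ≤ L) : LB χ T η α δ u L where
  pt t h1 h2 := (h.pt t h1 h2).mono (by gcongr)
  base t h1 h2 := (h.base t h1 h2).mono hK
  hold s t h1 h2 h3 := (h.hold s t h1 h2 h3).mono (by
    have : 0 < t - s := by linarith
    gcongr)

lemma LB.add (h : LB χ T η α δ u K) (h' : LB χ T η α δ v L) : LB χ T η α δ (u + v) (K + L) where
  pt t h1 h2 := ((h.pt t h1 h2).add (h'.pt t h1 h2)).mono (le_of_eq (by ring))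
  base t h1 h2 := (h.base t h1 h2).add (h'.base t h1 h2)
  hold s t h1 h2 h3 := by
    have := ((h.hold s t h1 h2 h3).add (h'.hold s t h1 h2 h3)).mono
      (K' := (K + L) * (s ^ (-η) * (t - s) ^ δ)) (le_of_eq (by ring))
    rwa [sub_add_sub_comm] at this

lemma LB.neg (h : LB χ T η α δ u K) : LB χ T η α δ (-u) K where
  pt t h1 h2 := (h.pt t h1 h2).neg
  base t h1 h2 := (h.base t h1 h2).neg
  hold s t h1 h2 h3 := by
    have := (h.hold s t h1 h2 h3).neg
    rw [neg_sub'] at this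
    exact this

lemma LB.sub (h : LB χ T η α δ u K) (h' : LB χ T η α δ v L) : LB χ T η α δ (u - v) (K + L) := by
  simpa only [sub_eq_add_neg] using h.add h'.neg

lemma LB.congr (h : LB χ T η α δ u K) (he : ∀ t, 0 ≤ t → t ≤ T → v t = u t) :
    LB χ T η α δ v K where
  pt t h1 h2 := by rw [he t h1.le h2]; exact h.pt t h1 h2
  base t h1 h2 := by rw [he t h1 h2]; exact h.base t h1 h2
  hold s t h1 h2 h3 := by
    rw [he t (by linarith) h3, he s h1.le (by linarith)]; exact h.hold s t h1 h2 h3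

lemma LB.restrict {T' : ℝ} (h : LB χ T η α δ u K) (hT : T' ≤ T) : LB χ T' η α δ u K where
  pt t h1 h2 := h.pt t h1 (h2.trans hT)
  base t h1 h2 := h.base t h1 (h2.trans hT)
  hold s t h1 h2 h3 := h.hold s t h1 h2 (h3.trans hT)

end LB

/-- The contribution of the initial value to the mild formulation. -/
lemma exists_heat_lb (χ : DyadicPartition) {μ : ℝ} (hμ : 0 < μ) {η α δ : ℝ} (hη : 0 ≤ η)
    (hη2 : η ≤ 2) (hδ : 0 ≤ δ) (hδ1 : δ ≤ 1) : ∃ C : ℝ, 0 ≤ C ∧ ∀ (T : ℝ) (a : Distr) (K : ℝ), T ≤ 1 →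
      Bd χ (α - 2 * η) a K → LB χ T η α δ (fun t => heat μ t a) (C * K) := by
  obtain ⟨C, hC, hc⟩ := exists_heat_bd χ hμ
  obtain ⟨C', hC', hc'⟩ := exists_heat_sub_bd χ hμ
  refine ⟨C + 1 + C' * C, by positivity, fun T a K hT ha => ?_⟩
  have hK := ha.nonneg
  have hpt : ∀ t, 0 < t → t ≤ T → Bd χ α (heat μ t a) (C * K * t ^ (-η)) := fun t h1 h2 =>
    (hc t h1 (h2.trans hT) _ α (by linarith) (by linarith) a K ha).mono (le_of_eq (by
      rw [show (α - (α - 2 * η)) / 2 = η by ring]; ring))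
  constructor
  · intro t h1 h2
    exact (hpt t h1 h2).mono (by gcongr; nlinarith [mul_nonneg hC' hC])
  · intro t h1 h2
    rcases h1.eq_or_lt with rfl | h1
    · rw [heat_zero_time]
      exact ha.mono (by nlinarith [mul_nonneg hC' hC, mul_nonneg hC hK, mul_nonneg (mul_nonneg hC' hC) hK])
    · refine (hc t h1 (h2.trans hT) _ _ le_rfl (by linarith) a K ha).mono ?_
      simp only [sub_self, zero_div, neg_zero, Real.rpow_zero]
      nlinarith [mul_nonneg hC' hC, mul_nonneg hC hK, mul_nonneg (mul_nonneg hC' hC) hK]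
  · intro s t h1 h2 h3
    have hd : 0 < t - s := by linarith
    have := hc' (t - s) hd δ hδ hδ1 α _ _ (hpt s h1 (by linarith))
    rw [heat_heat, sub_add_cancel] at this
    refine this.mono ?_
    calc _ = C' * C * K * (s ^ (-η) * (t - s) ^ δ) := by ring
      _ ≤ _ := by gcongr; linarith

section HeatInt
variable {μ η β γ : ℝ}

/-- The smoothing of the semigroup integrated over the part of `[s₀,t]` on which the forcing does not
vanish, which has length at most `min (t - s₀) h`. -/
lemma exists_window_bd (χ : DyadicPartition) (hμ : 0 < μ) (hη : 0 ≤ η) (hη1 : η < 1) (hβγ : β ≤ γ)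
    (hγ : γ < β + 2) : ∃ C : ℝ, 0 ≤ C ∧ ∀ (f : Path) (A τ h s₀ t : ℝ), 0 ≤ A → 0 ≤ τ → 0 < h →
      0 ≤ s₀ → s₀ < t → t ≤ 1 → t ≤ τ + h → AEMeasurable f (volume.restrict (Set.Ioo 0 t)) →
      (∀ s ∈ Set.Ioo 0 t, Bd χ β (f s) (A * s ^ (-η))) → (∀ s ∈ Set.Ioo 0 τ, f s = 0) →
      (∀ k, IntegrableOn (fun s => heat μ (t - s) (f s) k) (Set.Ioo s₀ t)) ∧
      Bd χ γ (fun k => ∫ s in s₀..t, heat μ (t - s) (f s) k)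
        (C * A * (t ^ (-η) * (min (t - s₀) h) ^ (1 - (γ - β) / 2))) := by
  obtain ⟨C, hC, hc⟩ := exists_heat_bd χ hμ
  obtain ⟨C', hC', hc'⟩ := exists_integral_bd χ hη hη1 (θ := (γ - β) / 2) (by linarith) (by linarith)
  refine ⟨C' * C, by positivity, fun f A τ h s₀ t hA hτ hh hs₀ ht ht1 hth hf hb hz => ?_⟩
  have ht0 : 0 < t := hs₀.trans_lt ht
  have key : ∀ σ, 0 ≤ σ → σ < t →
      (∀ k, IntegrableOn (fun s => heat μ (t - s) (f s) k) (Set.Ioo σ t)) ∧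
      Bd χ γ (fun k => ∫ s in σ..t, heat μ (t - s) (f s) k)
        (C' * C * A * (t ^ (-η) * (t - σ) ^ (1 - (γ - β) / 2))) := by
    intro σ h0 h1
    have hm : AEMeasurable (fun s => heat μ (t - s) (f s)) (volume.restrict (Set.Ioo σ t)) :=
      aemeasurable_heat μ (measurable_const.sub measurable_id)
        (hf.mono_measure (Measure.restrict_mono (Set.Ioo_subset_Ioo h0 le_rfl) le_rfl))
    have := hc' γ (C * A) σ t _ h0 h1 (by positivity) hm (fun s hs => by
      have hs0 : 0 < s := h0.trans_lt hs.1
      have h2 := hc (t - s) (by linarith [hs.2]) (by linarith) β γ hβγ (by linarith) _ _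
        (hb s ⟨hs0, hs.2⟩)
      exact h2.mono (le_of_eq (by ring)))
    rwa [← mul_assoc C' C A] at this
  have hmin : 0 ≤ min (t - s₀) h := le_min (by linarith) hh.le
  refine ⟨(key s₀ hs₀ ht).1, ?_⟩
  rcases le_total τ s₀ with h1 | h1
  · refine (key s₀ hs₀ ht).2.mono (le_of_eq ?_)
    rw [min_eq_left (by linarith)]
  · rcases lt_or_ge τ t with h2 | h2
    · have e : (fun k => ∫ s in s₀..t, heat μ (t - s) (f s) k)
          = fun k => ∫ s in τ..t, heat μ (t - s) (f s) k := by
        funext k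
        have i1 := (intervalIntegrable_iff_integrableOn_Ioo_of_le ht.le).2 ((key s₀ hs₀ ht).1 k)
        rw [← intervalIntegral.integral_add_adjacent_intervals (b := τ)
          (i1.mono_set (by
            rw [Set.uIcc_of_le h1, Set.uIcc_of_le ht.le]; exact Set.Icc_subset_Icc le_rfl h2.le))
          (i1.mono_set (by
            rw [Set.uIcc_of_le h2.le, Set.uIcc_of_le ht.le]; exact Set.Icc_subset_Icc h1 le_rfl))]
        rw [intervalIntegral.integral_of_le h1, integral_Ioc_eq_integral_Ioo,
          setIntegral_congr_fun (g := fun _ => 0) measurableSet_Ioo fun s hs => by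
            simp only [hz s ⟨hs₀.trans_lt hs.1, hs.2⟩, heat_zero, Pi.zero_apply]]
        simp
      rw [e]
      refine (key τ hτ h2).2.mono ?_
      have : t - τ ≤ min (t - s₀) h := le_min (by linarith) (by linarith)
      have : 0 ≤ t - τ := by linarith
      have : 0 ≤ 1 - (γ - β) / 2 := by linarith
      gcongr
    · have e : (fun k => ∫ s in s₀..t, heat μ (t - s) (f s) k) = 0 := by
        funext k
        rw [intervalIntegral.integral_of_le ht.le, integral_Ioc_eq_integral_Ioo,
          setIntegral_congr_fun (g := fun _ => 0) measurableSet_Ioo fun s hs => by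
            simp only [hz s ⟨hs₀.trans_lt hs.1, hs.2.trans_le h2⟩, heat_zero, Pi.zero_apply]]
        simp
      rw [e]
      exact (bd_zero γ).mono (by positivity)

lemma heatInt_sub_time {f : Path} {s t : ℝ} (hs : 0 ≤ s) (hst : s ≤ t)
    (hi : ∀ k, IntegrableOn (fun r => heat μ (t - r) (f r) k) (Set.Ioo 0 t)) :
    heatInt μ f t - heatInt μ f s = (fun k => ∫ r in s..t, heat μ (t - r) (f r) k)
      + (heat μ (t - s) (heatInt μ f s) - heatInt μ f s) := by
  have e : heat μ (t - s) (heatInt μ f s) = fun k => ∫ r in (0:ℝ)..s, heat μ (t - r) (f r) k := by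
    unfold heatInt
    rw [heat_integral]
    simp only [heat_heat, sub_add_sub_cancel]
  rw [e, ← add_sub_assoc]
  congr 1
  funext k
  have i1 := (intervalIntegrable_iff_integrableOn_Ioo_of_le (hs.trans hst)).2 (hi k)
  rw [Pi.add_apply, add_comm, intervalIntegral.integral_add_adjacent_intervals
    (i1.mono_set (by
      rw [Set.uIcc_of_le hs, Set.uIcc_of_le (hs.trans hst)]; exact Set.Icc_subset_Icc le_rfl hst))
    (i1.mono_set (by
      rw [Set.uIcc_of_le hst, Set.uIcc_of_le (hs.trans hst)]; exact Set.Icc_subset_Icc hs le_rfl))]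
  rfl

/-- The Schauder estimate for forcing that vanishes before time `τ`, on `[0,T]` with `T ≤ τ + h`. -/
lemma exists_heatInt_lb (χ : DyadicPartition) (hμ : 0 < μ) (hη : 0 ≤ η) (hη1 : η < 1) {α δ : ℝ}
    (hδ : 0 ≤ δ) (hδ1 : δ ≤ 1) (h1 : α < β + 2) (h2 : β ≤ α - 2 * η) (h3 : β ≤ α - 2 * δ) :
    ∃ C : ℝ, 0 ≤ C ∧ ∀ (f : Path) (A τ h T : ℝ), 0 ≤ A → 0 ≤ τ → 0 < h → T ≤ 1 → T ≤ τ + h →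
      AEMeasurable f (volume.restrict (Set.Ioo 0 T)) →
      (∀ s ∈ Set.Ioo 0 T, Bd χ β (f s) (A * s ^ (-η))) → (∀ s ∈ Set.Ioo 0 τ, f s = 0) →
      LB χ T η α δ (heatInt μ f) (C * A * h ^ (1 - (α - β) / 2)) := by
  obtain ⟨C₁, hC₁, hc₁⟩ := exists_window_bd χ hμ hη hη1 (γ := α) (β := β) (by linarith) (by linarith)
  obtain ⟨C₂, hC₂, hc₂⟩ := exists_window_bd χ hμ hη hη1 (γ := α - 2 * η) (β := β) h2 (by linarith)
  obtain ⟨C₃, hC₃, hc₃⟩ := exists_window_bd χ hμ hη hη1 (γ := α - 2 * δ) (β := β) h3 (by linarith)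
  obtain ⟨C₄, hC₄, hc₄⟩ := exists_heat_sub_bd χ hμ
  refine ⟨C₁ + C₂ + C₃ + C₄ * C₁, by positivity, fun f A τ h T hA hτ hh hT hTh hf hb hz => ?_⟩
  set ε : ℝ := 1 - (α - β) / 2 with hε
  have hε0 : 0 < ε := by rw [hε]; linarith
  have hf' : ∀ t ≤ T, AEMeasurable f (volume.restrict (Set.Ioo 0 t)) := fun t ht =>
    hf.mono_measure (Measure.restrict_mono (Set.Ioo_subset_Ioo le_rfl ht) le_rfl)
  have hb' : ∀ t ≤ T, ∀ s ∈ Set.Ioo 0 t, Bd χ β (f s) (A * s ^ (-η)) := fun t ht s hs =>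
    hb s ⟨hs.1, hs.2.trans_le ht⟩
  have hhε : 0 ≤ A * h ^ ε := by positivity
  have hpt : ∀ t, 0 < t → t ≤ T → Bd χ α (heatInt μ f t) (C₁ * A * h ^ ε * t ^ (-η)) := by
    intro t ht htT
    refine (hc₁ f A τ h 0 t hA hτ hh le_rfl ht (htT.trans hT) (htT.trans hTh) (hf' t htT)
      (hb' t htT) hz).2.mono ?_
    have : (min (t - 0) h) ^ ε ≤ h ^ ε :=
      Real.rpow_le_rpow (le_min (by linarith) hh.le) (min_le_right _ _) hε0.le
    calc _ ≤ C₁ * A * (t ^ (-η) * h ^ ε) := by gcongr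
      _ = _ := by ring
  constructor
  · intro t ht htT
    refine (hpt t ht htT).mono ?_
    gcongr
    nlinarith [mul_nonneg hC₄ hC₁]
  · intro t ht htT
    rcases ht.eq_or_lt with rfl | ht
    · rw [heatInt_zero]
      exact (bd_zero _).mono (by positivity)
    · refine (hc₂ f A τ h 0 t hA hτ hh le_rfl ht (htT.trans hT) (htT.trans hTh) (hf' t htT)
        (hb' t htT) hz).2.mono ?_
      have hm : 0 < min t h := lt_min ht hh
      rw [sub_zero, show 1 - (α - 2 * η - β) / 2 = η + ε by rw [hε]; ring, Real.rpow_add hm,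
        Real.rpow_neg ht.le]
      have e1 : min t h ^ η ≤ t ^ η := Real.rpow_le_rpow hm.le (min_le_left _ _) hη
      have e2 : min t h ^ ε ≤ h ^ ε := Real.rpow_le_rpow hm.le (min_le_right _ _) hε0.le
      have e3 : (t ^ η)⁻¹ * (min t h ^ η * min t h ^ ε) ≤ h ^ ε := by
        rw [← mul_assoc]
        calc _ ≤ 1 * h ^ ε := by
              gcongr
              exact inv_mul_le_one_of_le₀ e1 (by positivity)
          _ = _ := one_mul _
      calc _ ≤ C₂ * A * h ^ ε := by gcongr
        _ ≤ _ := by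
          rw [mul_assoc, mul_assoc]
          exact mul_le_mul_of_nonneg_right (by nlinarith [mul_nonneg hC₄ hC₁]) hhε
  · intro s t hs hst htT
    have hd : 0 < t - s := by linarith
    have ht : 0 < t := by linarith
    have hi := (hc₁ f A τ h 0 t hA hτ hh le_rfl ht (htT.trans hT) (htT.trans hTh) (hf' t htT)
      (hb' t htT) hz).1
    rw [heatInt_sub_time hs.le hst.le hi]
    have b1 := (hc₃ f A τ h s t hA hτ hh hs.le hst (htT.trans hT) (htT.trans hTh) (hf' t htT)
      (hb' t htT) hz).2
    have b2 := hc₄ (t - s) hd δ hδ hδ1 α _ _ (hpt s hs (by linarith))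
    refine (b1.add b2).mono ?_
    have hm : 0 < min (t - s) h := lt_min hd hh
    rw [show 1 - (α - 2 * δ - β) / 2 = δ + ε by rw [hε]; ring, Real.rpow_add hm]
    have e1 : min (t - s) h ^ δ ≤ (t - s) ^ δ := Real.rpow_le_rpow hm.le (min_le_left _ _) hδ
    have e2 : min (t - s) h ^ ε ≤ h ^ ε := Real.rpow_le_rpow hm.le (min_le_right _ _) hε0.le
    have e3 : t ^ (-η) ≤ s ^ (-η) := Real.rpow_le_rpow_of_nonpos hs hst.le (by linarith)
    have e4 : t ^ (-η) * (min (t - s) h ^ δ * min (t - s) h ^ ε) ≤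
        s ^ (-η) * ((t - s) ^ δ * h ^ ε) := by gcongr
    calc _ ≤ C₃ * A * (s ^ (-η) * ((t - s) ^ δ * h ^ ε))
          + C₄ * (t - s) ^ δ * (C₁ * A * h ^ ε * s ^ (-η)) := by gcongr
      _ = (C₃ + C₄ * C₁) * (A * h ^ ε) * (s ^ (-η) * (t - s) ^ δ) := by ring
      _ ≤ (C₁ + C₂ + C₃ + C₄ * C₁) * (A * h ^ ε) * (s ^ (-η) * (t - s) ^ δ) := by
        gcongr
        linarith
      _ = _ := by ring

end HeatInt

end CGL

namespace CGL
open MeasureTheory UnitAddTorus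

variable {χ : DyadicPartition}

/-! ### Smooth functions have rapidly decaying Fourier coefficients -/

attribute [local instance] circleMeasureSpace isProbabilityMeasure_circle

local instance : Measure.IsAddHaarMeasure (volume : Measure UnitAddCircle) :=
  inferInstanceAs (Measure.IsAddHaarMeasure AddCircle.haarAddCircle)

/-- The projection `ℝ³ → (ℝ/ℤ)³` on functions. -/
def toTorus (x : Fin 3 → ℝ) : Torus := fun i => (x i : UnitAddCircle)

lemma toTorus_surjective : Function.Surjective toTorus := fun t => by
  choose x hx using fun i => QuotientAddGroup.mk_surjective (t i)
  exact ⟨x, funext hx⟩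

lemma isOpenQuotientMap_toTorus : IsOpenQuotientMap toTorus :=
  IsOpenQuotientMap.piMap fun _ => QuotientAddGroup.isOpenQuotientMap_mk

/-- The translation of the torus along a coordinate axis. -/
def shift (i : Fin 3) (h : ℝ) : Torus := Pi.single i (h : UnitAddCircle)

lemma toTorus_add_shift (x : Fin 3 → ℝ) (i : Fin 3) (h : ℝ) :
    toTorus x + shift i h = toTorus (x + h • Pi.single i 1) := by
  funext j
  rcases eq_or_ne j i with rfl | hj
  · simp [toTorus, shift]
  · simp [toTorus, shift, hj]

/-- The partial derivative of a function on the torus. -/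
def pderiv (i : Fin 3) (f : Torus → ℂ) : Torus → ℂ :=
  fun t => deriv (fun h : ℝ => f (t + shift i h)) 0

lemma IsSmooth.continuous {f : Torus → ℂ} (hf : IsSmooth f) : Continuous f :=
  isOpenQuotientMap_toTorus.isQuotientMap.continuous_iff.2 (ContDiff.continuous hf)

lemma IsSmooth.exists_norm_le {f : Torus → ℂ} (hf : IsSmooth f) : ∃ M, ∀ t, ‖f t‖ ≤ M := by
  obtain ⟨M, hM⟩ := (isCompact_range hf.continuous).isBounded.exists_norm_le
  exact ⟨M, fun t => hM _ ⟨t, rfl⟩⟩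

lemma IsSmooth.hasDerivAt_lift {f : Torus → ℂ} (hf : IsSmooth f) (i : Fin 3) (x : Fin 3 → ℝ) :
    HasDerivAt (fun h : ℝ => f (toTorus x + shift i h))
      (fderiv ℝ (fun y => f (toTorus y)) x (Pi.single i 1)) 0 := by
  have h1 : HasFDerivAt (fun y => f (toTorus y)) (fderiv ℝ (fun y => f (toTorus y)) x)
      (x + (0:ℝ) • Pi.single i 1) := by
    rw [zero_smul, add_zero]
    exact (hf.differentiable (by simp) x).hasFDerivAt
  have h2 : HasDerivAt (fun h : ℝ => x + h • (Pi.single i 1 : Fin 3 → ℝ)) (Pi.single i 1) 0 := by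
    simpa using ((hasDerivAt_id (0:ℝ)).smul_const (Pi.single i 1 : Fin 3 → ℝ)).const_add x
  simpa only [toTorus_add_shift, Function.comp_def] using h1.comp_hasDerivAt 0 h2

lemma IsSmooth.pderiv_toTorus {f : Torus → ℂ} (hf : IsSmooth f) (i : Fin 3) (x : Fin 3 → ℝ) :
    pderiv i f (toTorus x) = fderiv ℝ (fun y => f (toTorus y)) x (Pi.single i 1) :=
  (hf.hasDerivAt_lift i x).deriv

lemma IsSmooth.pderiv {f : Torus → ℂ} (hf : IsSmooth f) (i : Fin 3) : IsSmooth (pderiv i f) := by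
  have h : ContDiff ℝ ∞ fun x => fderiv ℝ (fun y => f (toTorus y)) x (Pi.single i 1) :=
    (ContDiff.fderiv_right (m := ∞) hf (by simp)).clm_apply contDiff_const
  have e : (fun x : Fin 3 → ℝ => CGL.pderiv i f (toTorus x)) = _ := funext (hf.pderiv_toTorus i)
  rw [← e] at h
  exact h

lemma IsSmooth.hasDerivAt {f : Torus → ℂ} (hf : IsSmooth f) (i : Fin 3) (t : Torus) (h : ℝ) :
    HasDerivAt (fun h : ℝ => f (t + shift i h)) (CGL.pderiv i f (t + shift i h)) h := by
  obtain ⟨x, hx⟩ := toTorus_surjective (t + shift i h)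
  have h1 := hf.hasDerivAt_lift i x
  rw [← hf.pderiv_toTorus, hx] at h1
  have h2 : HasDerivAt (fun r : ℝ => r - h) 1 h := (hasDerivAt_id h).sub_const h
  rw [← sub_self h] at h1
  have h3 := HasDerivAt.scomp (h := fun r : ℝ => r - h) h h1 h2
  rw [one_smul] at h3
  refine h3.congr_of_eventuallyEq (Filter.Eventually.of_forall fun r => ?_)
  simp only [Function.comp_def, add_assoc]
  congr 2
  simp only [shift, ← Pi.single_add]
  congr 1
  rw [← AddCircle.coe_add]
  congr 1
  ring

lemma mFourier_shift (k : Freq) (i : Fin 3) (h : ℝ) :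
    mFourier k (shift i h) = fourier (k i) (h : UnitAddCircle) := by
  simp only [mFourier, ContinuousMap.coe_mk, shift]
  rw [Finset.prod_eq_single i]
  · simp
  · intro j _ hj
    simp [hj]
  · simp

/-- Differentiation multiplies the `k`-th Fourier coefficient by `2πi kᵢ`: the translates of `f` have
coefficients `exp (2πi kᵢ h) f̂(k)`. -/
lemma IsSmooth.mFourierCoeff_pderiv {f : Torus → ℂ} (hf : IsSmooth f) (i : Fin 3) (k : Freq) :
    mFourierCoeff (CGL.pderiv i f) k = 2 * Real.pi * Complex.I * k i * mFourierCoeff f k := by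
  obtain ⟨M, hM⟩ := (hf.pderiv i).exists_norm_le
  obtain ⟨M', hM'⟩ := hf.exists_norm_le
  have hc := hf.continuous
  have hc' := (hf.pderiv i).continuous
  have h1 := hasDerivAt_integral_of_dominated_loc_of_deriv_le (μ := (volume : Measure Torus))
    (F := fun (h : ℝ) t => mFourier (-k) t * f (t + shift i h)) (x₀ := 0) (s := Set.univ)
    (F' := fun (h : ℝ) t => mFourier (-k) t * CGL.pderiv i f (t + shift i h)) (bound := fun _ => M)
    Filter.univ_mem
    (Filter.Eventually.of_forall fun h => by
      have : Continuous fun t => mFourier (-k) t * f (t + shift i h) := by fun_prop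
      exact this.aestronglyMeasurable)
    (by
      have h0 : Continuous fun t => mFourier (-k) t * f (t + shift i 0) := by fun_prop
      refine Integrable.mono' (integrable_const M') h0.aestronglyMeasurable
        (Filter.Eventually.of_forall fun t => ?_)
      rw [norm_mul, norm_mFourier_apply, one_mul]
      exact hM' _)
    (by
      have h0 : Continuous fun t => mFourier (-k) t * CGL.pderiv i f (t + shift i 0) := by fun_prop
      exact h0.aestronglyMeasurable)
    (Filter.Eventually.of_forall fun t h _ => by
      rw [norm_mul, norm_mFourier_apply, one_mul]
      exact hM _)
    (integrable_const M)
    (Filter.Eventually.of_forall fun t h _ => (hf.hasDerivAt i t h).const_mul _)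
  have e : ∀ h : ℝ, ∫ t : Torus, mFourier (-k) t * f (t + shift i h)
      = fourier (k i) (h : UnitAddCircle) * mFourierCoeff f k := by
    intro h
    rw [← mFourier_shift, mFourierCoeff,
      ← integral_add_right_eq_self (fun t => mFourier (-k) t • f t) (shift i h), ← integral_const_mul]
    refine integral_congr_ae (Filter.Eventually.of_forall fun t => ?_)
    have h2 := mFourier_sub (-k) (t + shift i h) (shift i h)
    rw [add_sub_cancel_right, neg_neg] at h2
    simp only [h2, smul_eq_mul]
    ring
  have h2 := h1.2
  simp only [e] at h2
  have h3 := ((hasDerivAt_fourier (T := 1) (k i) 0).mul_const (mFourierCoeff f k))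
  have h4 := h2.unique h3
  have h5 : shift i 0 = 0 := by
    funext j; simp [shift]
  simp only [h5, add_zero] at h4
  simp only [mFourierCoeff, smul_eq_mul] at h4 ⊢
  rw [h4]
  simp

lemma IsSmooth.exists_coeff_le {f : Torus → ℂ} (hf : IsSmooth f) (i : Fin 3) (m : ℕ) :
    ∃ M, ∀ k : Freq, |(k i : ℝ)| ^ m * ‖mFourierCoeff f k‖ ≤ M := by
  induction m generalizing f with
  | zero =>
    obtain ⟨M, hM⟩ := hf.exists_norm_le
    refine ⟨M, fun k => ?_⟩
    rw [pow_zero, one_mul, mFourierCoeff]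
    refine (norm_integral_le_of_norm_le_const (C := M) (Filter.Eventually.of_forall fun t => ?_)).trans ?_
    · rw [norm_smul, norm_mFourier_apply, one_mul]
      exact hM t
    · simp
  | succ m ih =>
    obtain ⟨M, hM⟩ := ih (hf.pderiv i)
    refine ⟨M, fun k => (le_trans ?_ (hM k))⟩
    rw [hf.mFourierCoeff_pderiv, norm_mul, pow_succ, mul_assoc]
    refine mul_le_mul_of_nonneg_left (mul_le_mul_of_nonneg_right ?_ (norm_nonneg _)) (by positivity)
    rw [norm_mul, norm_mul, norm_mul, Complex.norm_I, Complex.norm_intCast, Complex.norm_real,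
      Complex.norm_ofNat, Real.norm_of_nonneg Real.pi_pos.le]
    have := Real.pi_gt_three
    nlinarith [abs_nonneg (k i : ℝ)]

/-- Smooth functions have finite Besov-Hölder norms. -/
lemma IsSmooth.exists_bd {f : Torus → ℂ} (hf : IsSmooth f) (χ : DyadicPartition) :
    ∃ K, Bd χ 3 (mFourierCoeff f) K := by
  choose M hM using fun i => hf.exists_coeff_le i 6
  obtain ⟨M₀, hM₀⟩ := hf.exists_coeff_le 0 0
  set A : ℝ := |M₀| + ∑ i, |M i| with hA
  have hA0 : 0 ≤ A := add_nonneg (abs_nonneg _) (Finset.sum_nonneg fun _ _ => abs_nonneg _)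
  have hco : ∀ n k, block χ n (mFourierCoeff f) k ≠ 0 →
      ‖block χ n (mFourierCoeff f) k‖ ≤ A * 8 ^ 6 * (2 ^ (6 * n))⁻¹ := by
    intro n k hk
    have h1 : ‖block χ n (mFourierCoeff f) k‖ ≤ ‖mFourierCoeff f k‖ := by
      rw [block, norm_mul, Complex.norm_real, Real.norm_eq_abs]
      have h2 : χ.weight n (toR k) ∈ Set.Icc (0:ℝ) 1 := by
        cases n with
        | zero => exact χ.low_mem _
        | succ n => exact χ.ann_mem _
      rw [abs_of_nonneg h2.1]
      exact mul_le_of_le_one_left (norm_nonneg _) h2.2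
    refine h1.trans ?_
    rcases eq_or_ne n 0 with rfl | hn
    · have h2 := hM₀ k
      simp only [pow_zero, one_mul, mul_zero, inv_one, mul_one] at h2 ⊢
      have : M₀ ≤ A := (le_abs_self _).trans
        (le_add_of_nonneg_right (Finset.sum_nonneg fun _ _ => abs_nonneg _))
      linarith
    · have h2 := (block_spec χ hk).2 hn
      obtain ⟨i, hi⟩ : ∃ i, (2:ℝ) ^ n / 8 ≤ |(k i : ℝ)| := by
        by_contra h'
        push Not at h'
        have h3 : ‖toR k‖ ^ 2 = ∑ i, (k i : ℝ) ^ 2 := by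
          rw [EuclideanSpace.norm_sq_eq]
          simp [toR]
        have h4 : ‖toR k‖ ^ 2 ≤ 3 * (2 ^ n / 8) ^ 2 := by
          rw [h3]
          refine (Finset.sum_le_sum (g := fun _ => ((2:ℝ) ^ n / 8) ^ 2) fun i _ => ?_).trans (by simp)
          rw [← sq_abs]
          exact pow_le_pow_left₀ (abs_nonneg _) (h' i).le 2
        have h5 : (0:ℝ) < 2 ^ n := by positivity
        nlinarith
      have h3 : M i ≤ A := by
        have := Finset.single_le_sum (f := fun i => |M i|) (fun _ _ => abs_nonneg _) (Finset.mem_univ i)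
        linarith [le_abs_self (M i), abs_nonneg M₀]
      have h4 := (hM i k).trans h3
      have h5 : ((2:ℝ) ^ n / 8) ^ 6 * ‖mFourierCoeff f k‖ ≤ A :=
        le_trans (mul_le_mul_of_nonneg_right (pow_le_pow_left₀ (by positivity) hi 6) (norm_nonneg _)) h4
      have h6 : (2:ℝ) ^ (6 * n) = (2 ^ n) ^ 6 := by rw [mul_comm, pow_mul]
      rw [h6, ← div_eq_mul_inv, le_div_iff₀ (by positivity)]
      rw [div_pow] at h5
      have h7 : (2 ^ n) ^ 6 / 8 ^ 6 * ‖mFourierCoeff f k‖ * 8 ^ 6 ≤ A * 8 ^ 6 := by gcongr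
      calc _ = (2 ^ n) ^ 6 / 8 ^ 6 * ‖mFourierCoeff f k‖ * 8 ^ 6 := by ring
        _ ≤ _ := h7
  refine ⟨A * 8 ^ 6 * 2 ^ 9, fun n x => ?_⟩
  set S : Finset Freq := Finset.Icc (fun _ => -(2:ℤ) ^ (n + 1)) (fun _ => (2:ℤ) ^ (n + 1)) with hS
  have hmem : ∀ k, block χ n (mFourierCoeff f) k ≠ 0 → k ∈ S := by
    intro k hk
    have h1 := (block_spec χ hk).1
    have h2 : ∀ i, |(k i : ℝ)| ≤ 2 ^ (n + 1) := fun i => by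
      have h3 : ‖(toR k) i‖ ≤ ‖toR k‖ := PiLp.norm_apply_le (toR k) i
      have h4 : ‖(toR k) i‖ = |(k i : ℝ)| := rfl
      rw [h4] at h3
      rw [pow_succ]
      have : (0:ℝ) < 2 ^ n := by positivity
      nlinarith
    rw [hS, Finset.mem_Icc]
    refine ⟨fun i => ?_, fun i => ?_⟩
    · have := (abs_le.1 (h2 i)).1
      exact_mod_cast this
    · have := (abs_le.1 (h2 i)).2
      exact_mod_cast this
  rw [ev_eq_sum hmem]
  refine (norm_sum_le_of_le S (f := fun k => block χ n (mFourierCoeff f) k * mFourier k x)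
    (n := fun _ => A * 8 ^ 6 * (2 ^ (6 * n))⁻¹) fun k _ => ?_).trans ?_
  · rw [norm_mul, norm_mFourier_apply, mul_one]
    by_cases hk : block χ n (mFourierCoeff f) k = 0
    · rw [hk, norm_zero]; positivity
    · exact hco n k hk
  · rw [Finset.sum_const, nsmul_eq_mul]
    have hcard : (S.card : ℝ) ≤ 2 ^ (3 * n) * 2 ^ 9 := by
      have h1 : S.card = (2 ^ (n + 2) + 1) ^ 3 := by
        rw [hS, Pi.card_Icc]
        simp only [Int.card_Icc, Finset.prod_const, Finset.card_univ, Fintype.card_fin]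
        congr 1
        have : (2:ℤ) ^ (n + 1) + 1 - -2 ^ (n + 1) = ((2 ^ (n + 2) + 1 : ℕ) : ℤ) := by
          push_cast; ring
        rw [this, Int.toNat_natCast]
      rw [h1]
      push_cast
      have h2 : (2:ℝ) ^ (n + 2) + 1 ≤ 2 ^ (n + 3) := by
        have : (1:ℝ) ≤ 2 ^ (n + 2) := one_le_pow₀ one_le_two
        rw [pow_succ 2 (n + 2)]
        linarith
      calc ((2:ℝ) ^ (n + 2) + 1) ^ 3 ≤ (2 ^ (n + 3)) ^ 3 := by gcongr
        _ = _ := by rw [← pow_mul, ← pow_add]; congr 1; ring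
    have h3 : dyad (-3) n = (2 ^ (3 * n))⁻¹ := by
      rw [dyad_eq_pow, Real.rpow_neg two_pos.le, inv_pow, pow_mul]
      norm_num
    rw [h3]
    have h4 : (0:ℝ) < 2 ^ (3 * n) := by positivity
    have h5 : (2:ℝ) ^ (6 * n) = 2 ^ (3 * n) * 2 ^ (3 * n) := by rw [← pow_add]; congr 1; ring
    calc _ ≤ 2 ^ (3 * n) * 2 ^ 9 * (A * 8 ^ 6 * (2 ^ (6 * n))⁻¹) := by gcongr
      _ = _ := by rw [h5]; field_simp

end CGL

namespace CGL
open MeasureTheory UnitAddTorus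

variable {χ : DyadicPartition}

/-! ### The norms and the spaces in terms of real bounds -/

lemma bnorm_le_iff {α K : ℝ} (hK : 0 ≤ K) {a : Distr} :
    bnorm χ α a ≤ ENNReal.ofReal K ↔ Bd χ α a (2 ^ α * K) := by
  have h2 : (0:ℝ) < 2 ^ α := by positivity
  simp only [bnorm, iSup_le_iff, ENNReal.mul_iSup, Bd, SupLE, blockFun_eq_ev]
  refine forall_congr' fun n => forall_congr' fun x => ?_
  have hp : (0:ℝ) < 2 ^ (((n : ℝ) - 1) * α) := by positivity
  rw [← ofReal_norm, ← ENNReal.ofReal_mul hp.le, ENNReal.ofReal_le_ofReal_iff hK]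
  have e : (2:ℝ) ^ (((n : ℝ) - 1) * α) = dyad α n / 2 ^ α := by
    rw [dyad, ← Real.rpow_sub two_pos]; congr 1; ring
  rw [e, dyad_neg, ← div_eq_mul_inv, le_div_iff₀ (dyad_pos _ _), div_mul_eq_mul_div, div_le_iff₀ h2]
  constructor <;> intro h <;> linarith

lemma bnorm_le_of_bd {α K : ℝ} {a : Distr} (h : Bd χ α a K) :
    bnorm χ α a ≤ ENNReal.ofReal (2 ^ (-α) * K) := by
  have h2 : (0:ℝ) < 2 ^ α := by positivity
  have hK := h.nonneg
  rw [bnorm_le_iff (by positivity), ← mul_assoc, ← Real.rpow_add two_pos]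
  simpa using h

lemma eq_zero_of_bd {α : ℝ} {a : Distr} (h : ∀ ε : ℝ, 0 < ε → Bd χ α a ε) : a = 0 := by
  funext k
  obtain ⟨C, hC, hc⟩ := exists_coeff_bound χ α k
  rw [Pi.zero_apply, ← norm_le_zero_iff]
  refine le_of_forall_pos_le_add fun ε hε => ?_
  refine (hc a _ (h (ε / (C + 1)) (by positivity))).trans ?_
  rw [zero_add, ← mul_div_assoc, div_le_iff₀ (by positivity)]
  nlinarith

lemma isSmooth_ev {a : Distr} (ha : FinSupp a) : IsSmooth (ev a) := by
  have e : (fun x : Fin 3 → ℝ => ev a (fun i => (x i : UnitAddCircle)))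
      = fun x => ∑ k ∈ ha.toFinset, a k * ∏ i, Complex.exp (2 * Real.pi * Complex.I * k i * x i / (1:ℝ)) := by
    funext x
    rw [ha.ev_eq]
    simp only [mFourier, ContinuousMap.coe_mk, fourier_coe_apply]
  unfold IsSmooth
  rw [e]
  have h1 : ∀ i : Fin 3, ContDiff ℝ ∞ fun x : Fin 3 → ℝ => ((x i : ℝ) : ℂ) := fun i =>
    Complex.ofRealCLM.contDiff.comp (contDiff_apply ℝ ℝ i)
  refine ContDiff.sum fun k _ => contDiff_const.mul (contDiff_prod fun i _ => ?_)
  exact ((contDiff_const.mul (h1 i)).div_const _).cexp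

lemma FinSupp.memC {a : Distr} (ha : FinSupp a) (α : ℝ) : MemC χ α a := fun ε _ =>
  ⟨ev a, isSmooth_ev ha, by
    rw [show mFourierCoeff (ev a) = a from funext (mFourierCoeff_ev ha), sub_self, bnorm_zero]
    exact zero_le⟩

lemma MemC.of_approx {α : ℝ} {a : Distr} (h : ∀ ε : ℝ, 0 < ε → ∃ b, MemC χ α b ∧ Bd χ α (a - b) ε) :
    MemC χ α a := by
  intro ε hε
  have h2 : (0:ℝ) < 2 ^ α := by positivity
  obtain ⟨b, hb, hab⟩ := h (2 ^ α * (ε / 2)) (by positivity)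
  obtain ⟨f, hf, hbf⟩ := hb (ε / 2) (by positivity)
  refine ⟨f, hf, ?_⟩
  rw [← bnorm_le_iff (by positivity)] at hab
  have := bnorm_add_le χ α (a - b) (b - mFourierCoeff f)
  rw [sub_add_sub_cancel] at this
  refine this.trans ((add_le_add hab hbf).trans (le_of_eq ?_))
  rw [← ENNReal.ofReal_add (by positivity) (by positivity), add_halves]

/-- Trigonometric polynomials approximate an element of `C^{α'}` in `C^α` for `α < α'`. -/
lemma Bd.exists_finSupp {α α' K : ℝ} {a : Distr} (h : Bd χ α' a K) (hα : α < α') {ε : ℝ}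
    (hε : 0 < ε) : ∃ b, FinSupp b ∧ Bd χ α (a - b) ε := by
  obtain ⟨C, hC, hc⟩ := exists_trunc_bound χ α' (ε := α' - α) (by linarith)
  have h1 : Filter.Tendsto (fun N => C * K * dyad (-(α' - α)) N) Filter.atTop (𝓝 (C * K * 0)) :=
    (tendsto_dyad_neg (by linarith)).const_mul _
  rw [mul_zero] at h1
  obtain ⟨N, hN⟩ := (h1.eventually (ge_mem_nhds hε)).exists
  refine ⟨trunc χ N a, trunc_finSupp N a, ?_⟩
  refine Bd.mono ?_ hN
  refine Bd.of_tendsto (l := Filter.atTop) (f := fun n => trunc χ n a - trunc χ N a) ?_ fun k => ?_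
  · filter_upwards [Filter.eventually_ge_atTop N] with n hn
    have := (hc a K N n h hn).2
    rwa [sub_sub_cancel] at this
  · refine Filter.Tendsto.sub_const ?_ _
    exact tendsto_const_nhds.congr' ((trunc_eventually_eq a k).mono fun n hn => hn.symm)

lemma MemC.of_bd {α α' K : ℝ} {a : Distr} (h : Bd χ α' a K) (hα : α < α') : MemC χ α a :=
  MemC.of_approx fun _ hε =>
    let ⟨b, hb, hab⟩ := h.exists_finSupp hα hε
    ⟨b, hb.memC α, hab⟩

lemma MemC.exists_smooth {α : ℝ} {a : Distr} (h : MemC χ α a) {ε : ℝ} (hε : 0 < ε) :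
    ∃ b, (∃ K, Bd χ 3 b K) ∧ Bd χ α (a - b) ε := by
  obtain ⟨f, hf, haf⟩ := h (2 ^ (-α) * ε) (by positivity)
  refine ⟨mFourierCoeff f, hf.exists_bd χ, ?_⟩
  rw [bnorm_le_iff (by positivity), ← mul_assoc, ← Real.rpow_add two_pos] at haf
  simpa using haf

lemma MemC.exists_bd {α : ℝ} {a : Distr} (h : MemC χ α a) (hα : α ≤ 3) : ∃ K, Bd χ α a K := by
  obtain ⟨b, ⟨K, hK⟩, hb⟩ := h.exists_smooth one_pos
  refine ⟨1 + K, ?_⟩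
  have := hb.add (hK.mono_reg hα)
  rwa [sub_add_cancel] at this

lemma MemC.bnorm_lt_top {α : ℝ} {a : Distr} (h : MemC χ α a) (hα : α ≤ 3) : bnorm χ α a < ⊤ := by
  obtain ⟨K, hK⟩ := h.exists_bd hα
  exact (bnorm_le_of_bd hK).trans_lt ENNReal.ofReal_lt_top

lemma MemC.mono {α β : ℝ} {a : Distr} (h : MemC χ α a) (hβ : β ≤ α) : MemC χ β a := by
  rcases hβ.eq_or_lt with rfl | hβ
  · exact h
  · intro ε hε
    obtain ⟨f, hf, haf⟩ := h (2 ^ (-α) * (2 ^ β * ε)) (by positivity)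
    refine ⟨f, hf, ?_⟩
    rw [bnorm_le_iff (by positivity), ← mul_assoc, ← Real.rpow_add two_pos, add_neg_cancel,
      Real.rpow_zero, one_mul] at haf
    rw [bnorm_le_iff hε.le]
    exact haf.mono_reg hβ.le

/-- Strong continuity of the semigroup at time `0`. -/
lemma MemC.eventually_heat {μ : ℝ} (hμ : 0 < μ) {α : ℝ} (hα : α < 2) {a : Distr} (h : MemC χ α a)
    {ε : ℝ} (hε : 0 < ε) : ∃ h₀ : ℝ, 0 < h₀ ∧ ∀ t, 0 ≤ t → t ≤ h₀ → Bd χ α (heat μ t a - a) ε := by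
  obtain ⟨C, hC, hc⟩ := exists_heat_bd χ hμ
  obtain ⟨C', hC', hc'⟩ := exists_heat_sub_bd χ hμ
  obtain ⟨b, ⟨K, hK⟩, hb⟩ := h.exists_smooth (ε := ε / (2 * (C + 1))) (by positivity)
  have hK0 := hK.nonneg
  have hρ : 0 < ε / (2 * (C' * K + 1)) := by positivity
  refine ⟨min 1 ((ε / (2 * (C' * K + 1))) ^ (2:ℝ)), lt_min one_pos (by positivity), fun t ht0 ht => ?_⟩
  rcases ht0.eq_or_lt with rfl | ht0
  · rw [heat_zero_time, sub_self]; exact (bd_zero α).mono hε.le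
  have h1 := hc t ht0 (ht.trans (min_le_left _ _)) α α le_rfl (by linarith) _ _ hb
  have h2 := hc' t ht0 (1 / 2) (by norm_num) (by norm_num) (α + 1) _ _
    (hK.mono_reg (show α + 1 ≤ 3 by linarith))
  rw [show α + 1 - 2 * (1 / 2) = α by ring] at h2
  have h3 := (h1.sub hb).add h2
  have e : heat μ t (a - b) - (a - b) + (heat μ t b - b) = heat μ t a - a := by
    rw [heat_sub]; abel
  rw [e] at h3
  refine h3.mono ?_
  have h4 : t ^ (1 / 2 : ℝ) ≤ ε / (2 * (C' * K + 1)) := by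
    have := Real.rpow_le_rpow ht0.le (ht.trans (min_le_right _ _)) (z := 1 / 2) (by norm_num)
    rw [← Real.rpow_mul hρ.le] at this
    simpa using this
  simp only [sub_self, zero_div, neg_zero, Real.rpow_zero, mul_one]
  have h5 : C * (ε / (2 * (C + 1))) + ε / (2 * (C + 1)) = ε / 2 := by field_simp
  have h6 : C' * t ^ (1 / 2 : ℝ) * K ≤ ε / 2 := by
    calc _ ≤ C' * (ε / (2 * (C' * K + 1))) * K := by gcongr
      _ = ε / 2 * ((C' * K) / (C' * K + 1)) := by field_simp
      _ ≤ ε / 2 * 1 := by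
        gcongr
        exact div_le_one_of_le₀ (by linarith) (by positivity)
      _ = _ := mul_one _
  linarith

/-! ### Continuous paths -/

lemma contPath_iff {S : Set ℝ} {α : ℝ} {u : Path} : ContPath χ S α u ↔ (∀ t ∈ S, MemC χ α (u t)) ∧
    ∀ t ∈ S, ∀ ε : ℝ, 0 < ε → ∀ᶠ s in 𝓝[S] t, Bd χ α (u s - u t) ε := by
  refine and_congr_right fun _ => forall₂_congr fun t _ => ?_
  rw [ENNReal.tendsto_nhds_zero]
  constructor
  · intro h ε hε
    filter_upwards [h (ENNReal.ofReal (2 ^ (-α) * ε)) (by positivity)] with s hs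
    rw [bnorm_le_iff (by positivity), ← mul_assoc, ← Real.rpow_add two_pos] at hs
    simpa using hs
  · intro h ε hε
    rcases eq_or_ne ε ⊤ with rfl | hε'
    · exact Filter.Eventually.of_forall fun _ => le_top
    · have h0 : 0 < ε.toReal := ENNReal.toReal_pos hε.ne' hε'
      filter_upwards [h (2 ^ α * ε.toReal) (by positivity)] with s hs
      rw [← bnorm_le_iff h0.le, ENNReal.ofReal_toReal hε'] at hs
      exact hs

lemma continuousOn_coeff {S : Set ℝ} {α : ℝ} {u : Path}
    (h : ∀ t ∈ S, ∀ ε : ℝ, 0 < ε → ∀ᶠ s in 𝓝[S] t, Bd χ α (u s - u t) ε) (k : Freq) :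
    ContinuousOn (fun t => u t k) S := by
  obtain ⟨C, hC, hc⟩ := exists_coeff_bound χ α k
  intro t ht
  rw [ContinuousWithinAt, Metric.tendsto_nhds]
  intro ε hε
  filter_upwards [h t ht (ε / (C + 1)) (by positivity)] with s hs
  rw [dist_eq_norm]
  refine (hc _ _ hs).trans_lt ?_
  rw [← mul_div_assoc, div_lt_iff₀ (by positivity)]
  nlinarith

lemma aemeasurable_of_continuousOn {S : Set ℝ} (hS : MeasurableSet S) {u : Path}
    (h : ∀ k, ContinuousOn (fun t => u t k) S) : AEMeasurable u (volume.restrict S) :=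
  aemeasurable_pi_iff.2 fun k => (h k).aemeasurable hS

lemma ContPath.exists_bd {T α : ℝ} {u : Path} (h : ContPath χ (Set.Icc 0 T) α u) (hα : α ≤ 3) :
    ∃ K : ℝ, ∀ t ∈ Set.Icc 0 T, Bd χ α (u t) K := by
  rw [contPath_iff] at h
  refine isCompact_Icc.induction_on (p := fun S => ∃ K : ℝ, ∀ t ∈ S, Bd χ α (u t) K)
    ⟨0, by simp⟩ (fun S S' hS ⟨K, hK⟩ => ⟨K, fun t ht => hK t (hS ht)⟩)
    (fun S S' ⟨K, hK⟩ ⟨L, hL⟩ => ⟨max K L, fun t ht => ?_⟩) fun t ht => ?_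
  · rcases ht with ht | ht
    · exact (hK t ht).mono (le_max_left _ _)
    · exact (hL t ht).mono (le_max_right _ _)
  · obtain ⟨K, hK⟩ := (h.1 t ht).exists_bd hα
    refine ⟨_, h.2 t ht 1 one_pos, 1 + K, fun s hs => ?_⟩
    have := Bd.add (show Bd χ α (u s - u t) 1 from hs) hK
    rwa [sub_add_cancel] at this

/-- A bound in `C^{α'}` together with smallness in some weaker space gives smallness in `C^α`. -/
lemma exists_bd_small (χ : DyadicPartition) {α α' : ℝ} (hα : α < α') (β K : ℝ) {ε : ℝ} (hε : 0 < ε) :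
    ∃ ρ : ℝ, 0 < ρ ∧ ∀ a, Bd χ α' a K → Bd χ β a ρ → Bd χ α a ε := by
  have h1 : Filter.Tendsto (fun N => K * dyad (-(α' - α)) N) Filter.atTop (𝓝 (K * 0)) :=
    (tendsto_dyad_neg (by linarith)).const_mul _
  rw [mul_zero] at h1
  obtain ⟨N, hN⟩ := Filter.eventually_atTop.1 (h1.eventually (ge_mem_nhds hε))
  refine ⟨ε * dyad (-|α - β|) N, mul_pos hε (dyad_pos _ _), fun a ha hb n => ?_⟩
  rcases le_total N n with h | h
  · refine (ha n).mono ?_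
    rw [show -α' = -(α' - α) + -α by ring, dyad_add, ← mul_assoc]
    exact mul_le_mul_of_nonneg_right (hN n h) (dyad_pos _ _).le
  · refine (hb n).mono ?_
    rw [show -β = (α - β) + -α by ring, dyad_add, ← mul_assoc]
    refine mul_le_mul_of_nonneg_right ?_ (dyad_pos _ _).le
    have h2 : dyad (α - β) n ≤ dyad |α - β| N :=
      (dyad_mono (le_abs_self _) n).trans (dyad_index_mono (abs_nonneg _) h)
    rw [mul_assoc]
    refine mul_le_of_le_one_right hε.le ?_
    rw [dyad_neg, inv_mul_le_iff₀ (dyad_pos _ _), mul_one]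
    exact h2

section LB
variable {T η α δ K : ℝ} {u : Path}

lemma LB.eventually_bd (h : LB χ T η α δ u K) (hη : 0 ≤ η) (hδ : 0 < δ) {t : ℝ}
    (ht : t ∈ Set.Ioc 0 T) {ε : ℝ} (hε : 0 < ε) :
    ∀ᶠ s in 𝓝[Set.Ioc 0 T] t, Bd χ (α - 2 * δ) (u s - u t) ε := by
  have ht0 := ht.1
  have hK := (h.base t ht0.le ht.2).nonneg
  have h1 : Filter.Tendsto (fun s => K * ((t / 2) ^ (-η) * |s - t| ^ δ)) (𝓝 t) (𝓝 0) := by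
    have : Continuous fun s => K * ((t / 2) ^ (-η) * |s - t| ^ δ) :=
      continuous_const.mul (continuous_const.mul
        ((continuous_id.sub continuous_const).abs.rpow_const fun _ => Or.inr hδ.le))
    simpa [Real.zero_rpow hδ.ne'] using this.tendsto t
  filter_upwards [self_mem_nhdsWithin, mem_nhdsWithin_of_mem_nhds (h1.eventually (ge_mem_nhds hε)),
    mem_nhdsWithin_of_mem_nhds (Ioi_mem_nhds (show t / 2 < t by linarith))] with s hs h2 h3
  have h3 : t / 2 < s := h3
  have aux : ∀ r, t / 2 ≤ r → r ^ (-η) ≤ (t / 2) ^ (-η) := fun r hr =>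
    Real.rpow_le_rpow_of_nonpos (by linarith) hr (by linarith)
  rcases lt_trichotomy s t with h4 | rfl | h4
  · have := (h.hold s t hs.1 h4 ht.2).neg
    rw [neg_sub] at this
    refine this.mono (le_trans ?_ h2)
    rw [abs_sub_comm, abs_of_pos (by linarith)]
    exact mul_le_mul_of_nonneg_left (mul_le_mul_of_nonneg_right (aux s h3.le)
      (Real.rpow_nonneg (by linarith) _)) hK
  · rw [sub_self]; exact (bd_zero _).mono hε.le
  · refine (h.hold t s ht0 h4 hs.2).mono (le_trans ?_ h2)
    rw [abs_of_pos (by linarith)]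
    exact mul_le_mul_of_nonneg_left (mul_le_mul_of_nonneg_right (aux t (by linarith))
      (Real.rpow_nonneg (by linarith) _)) hK

lemma LB.aemeasurable (h : LB χ T η α δ u K) (hη : 0 ≤ η) (hδ : 0 < δ) :
    AEMeasurable u (volume.restrict (Set.Ioo 0 T)) :=
  (aemeasurable_of_continuousOn measurableSet_Ioc
    (continuousOn_coeff fun _ ht _ hε => h.eventually_bd hη hδ ht hε)).mono_measure
    (Measure.restrict_mono Set.Ioo_subset_Ioc_self le_rfl)

lemma LB.lExpNorm_le (h : LB χ T η α δ u K) (hK : 0 ≤ K) : lExpNorm χ T η α δ u ≤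
    ENNReal.ofReal ((2 ^ (-α) + 2 ^ (-(α - 2 * η)) + 2 ^ (-(α - 2 * δ))) * K) := by
  rw [add_mul, add_mul, ENNReal.ofReal_add (by positivity) (by positivity),
    ENNReal.ofReal_add (by positivity) (by positivity)]
  refine add_le_add (add_le_add ?_ ?_) ?_
  · refine iSup₂_le fun t ht => ?_
    have ht0 := ht.1
    refine (mul_le_mul_right (bnorm_le_of_bd (h.pt t ht.1 ht.2)) _).trans (le_of_eq ?_)
    rw [← ENNReal.ofReal_mul (by positivity), Real.rpow_neg ht.1.le]
    congr 1
    have : 0 < t ^ η := by positivity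
    field_simp
  · exact iSup₂_le fun t ht => bnorm_le_of_bd (h.base t ht.1 ht.2)
  · refine iSup_le fun s => iSup_le fun t => iSup_le fun hst => ?_
    obtain ⟨hs, hst, ht⟩ := hst
    have hd : 0 < t - s := by linarith
    have p1 : 0 < s ^ η := by positivity
    have p2 : 0 < (t - s) ^ δ := by positivity
    refine (mul_le_mul_right (ENNReal.div_le_div_right (bnorm_le_of_bd (h.hold s t hs hst ht)) _)
      _).trans (le_of_eq ?_)
    rw [← ENNReal.ofReal_div_of_pos p2, ← ENNReal.ofReal_mul p1.le, Real.rpow_neg hs.le]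
    congr 1
    field_simp

lemma MemLExp.exists_lb (h : MemLExp χ T η α δ u) (hα : α - 2 * η ≤ 3) :
    ∃ K, LB χ T η α δ u K := by
  obtain ⟨⟨-, h1⟩, h2, ⟨-, h3⟩⟩ := h
  obtain ⟨K₂, hK₂⟩ := h2.exists_bd hα
  set K₁ := 2 ^ α * (expNorm χ T η α u).toReal with hK₁
  set K₃ := 2 ^ (α - 2 * δ) * (expHolderNorm χ T η δ (α - 2 * δ) u).toReal with hK₃
  have p₁ : 0 ≤ K₁ := by positivity
  have p₃ : 0 ≤ K₃ := by positivity
  refine ⟨K₁ + |K₂| + K₃, ⟨fun t ht htT => ?_, fun t ht htT => ?_, fun s t hs hst ht => ?_⟩⟩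
  · have h4 : ENNReal.ofReal (t ^ η) * bnorm χ α (u t) ≤ expNorm χ T η α u :=
      le_iSup₂ (f := fun t (_ : t ∈ Set.Ioc (0:ℝ) T) => ENNReal.ofReal (t ^ η) * bnorm χ α (u t)) t
        ⟨ht, htT⟩
    have hp : 0 < t ^ η := by positivity
    rw [mul_comm, ← ENNReal.ofReal_toReal h1.ne,
      ← ENNReal.le_div_iff_mul_le (Or.inl (by simp [hp])) (Or.inl ENNReal.ofReal_ne_top),
      ← ENNReal.ofReal_div_of_pos hp, bnorm_le_iff (by positivity)] at h4
    refine h4.mono ?_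
    rw [Real.rpow_neg ht.le, ← mul_div_assoc, div_eq_mul_inv, ← hK₁]
    gcongr
    linarith [abs_nonneg K₂]
  · exact (hK₂ t ⟨ht, htT⟩).mono (by linarith [le_abs_self K₂])
  · have h4 : ENNReal.ofReal (s ^ η) * (bnorm χ (α - 2 * δ) (u t - u s) / ENNReal.ofReal ((t - s) ^ δ))
        ≤ expHolderNorm χ T η δ (α - 2 * δ) u :=
      le_iSup_of_le s (le_iSup_of_le t (le_iSup_of_le ⟨hs, hst, ht⟩ le_rfl))
    have hd : 0 < t - s := by linarith
    have p1 : 0 < s ^ η := by positivity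
    have p2 : 0 < (t - s) ^ δ := by positivity
    rw [mul_comm, ← ENNReal.ofReal_toReal h3.ne,
      ← ENNReal.le_div_iff_mul_le (Or.inl (by simp [p1])) (Or.inl ENNReal.ofReal_ne_top),
      ← ENNReal.ofReal_div_of_pos p1, ENNReal.div_le_iff_le_mul (by simp [p2]) (by simp),
      ← ENNReal.ofReal_mul (by positivity), bnorm_le_iff (by positivity)] at h4
    refine h4.mono ?_
    rw [Real.rpow_neg hs.le]
    calc _ = K₃ * ((s ^ η)⁻¹ * (t - s) ^ δ) := by rw [hK₃]; ring
      _ ≤ _ := by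
        gcongr
        linarith [abs_nonneg K₂]

/-- Membership in `L_T^{η,α,δ}` from the bounds, some additional regularity at positive times and
continuity at time `0`. -/
lemma LB.memLExp (h : LB χ T η α δ u K) (hT : 0 < T) (hη : 0 ≤ η) (hδ : 0 < δ) {α' K' σ : ℝ}
    (hα : α < α') (hσ : 0 ≤ σ) (h' : ∀ t, 0 < t → t ≤ T → Bd χ α' (u t) (K' * t ^ (-σ)))
    (h0 : MemC χ (α - 2 * η) (u 0))
    (hc : ∀ ε : ℝ, 0 < ε → ∃ h₀ : ℝ, 0 < h₀ ∧ ∀ t, 0 ≤ t → t ≤ h₀ → t ≤ T →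
      Bd χ (α - 2 * η) (u t - u 0) ε) : MemLExp χ T η α δ u := by
  have hK : 0 ≤ K := (h.base 0 le_rfl hT.le).nonneg
  have hK' : 0 ≤ K' := by
    have := (h' T hT le_rfl).nonneg
    by_contra hneg
    push Not at hneg
    have : 0 < T ^ (-σ) := by positivity
    nlinarith
  have c1 : ContPath χ (Set.Ioc 0 T) α u := by
    refine contPath_iff.2 ⟨fun t ht => .of_bd (h' t ht.1 ht.2) hα, fun t ht ε hε => ?_⟩
    have ht0 := ht.1
    obtain ⟨ρ, hρ, hs⟩ := exists_bd_small χ hα (α - 2 * δ) (K' * (t / 2) ^ (-σ) + K' * (t / 2) ^ (-σ)) hε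
    filter_upwards [self_mem_nhdsWithin, h.eventually_bd hη hδ ht hρ,
      mem_nhdsWithin_of_mem_nhds (Ioi_mem_nhds (show t / 2 < t by linarith))] with s hs' h2 h3
    have h3 : t / 2 < s := h3
    have aux : ∀ r, t / 2 ≤ r → K' * r ^ (-σ) ≤ K' * (t / 2) ^ (-σ) := fun r hr =>
      mul_le_mul_of_nonneg_left
        (Real.rpow_le_rpow_of_nonpos (by linarith) hr (by linarith)) hK'
    exact hs _ (((h' s hs'.1 hs'.2).mono (aux s h3.le)).sub ((h' t ht.1 ht.2).mono (aux t (by linarith)))) h2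
  have hfin : lExpNorm χ T η α δ u < ⊤ := (h.lExpNorm_le hK).trans_lt ENNReal.ofReal_lt_top
  have c1' := contPath_iff.1 c1
  have cmono : ∀ β ≤ α, ContPath χ (Set.Ioc 0 T) β u := fun β hβ =>
    contPath_iff.2 ⟨fun t ht => (c1'.1 t ht).mono hβ, fun t ht ε hε =>
      (c1'.2 t ht ε hε).mono fun s hs => hs.mono_reg hβ⟩
  refine ⟨⟨c1, lt_of_le_of_lt ?_ hfin⟩, contPath_iff.2 ⟨fun t ht => ?_, fun t ht ε hε => ?_⟩,
    ⟨cmono _ (by linarith), lt_of_le_of_lt ?_ hfin⟩⟩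
  · exact le_self_add.trans le_self_add
  · rcases ht.1.eq_or_lt with rfl | h1
    · exact h0
    · exact (c1'.1 t ⟨h1, ht.2⟩).mono (by linarith)
  · rcases ht.1.eq_or_lt with rfl | h1
    · obtain ⟨h₀, hh₀, hb⟩ := hc ε hε
      filter_upwards [self_mem_nhdsWithin, mem_nhdsWithin_of_mem_nhds (Iio_mem_nhds hh₀)] with s hs hs'
      exact hb s hs.1 (le_of_lt hs') hs.2
    · have h2 := (cmono (α - 2 * η) (by linarith))
      have h3 := (contPath_iff.1 h2).2 t ⟨h1, ht.2⟩ ε hε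
      rw [Filter.Eventually, mem_nhdsWithin_iff_exists_mem_nhds_inter] at h3 ⊢
      obtain ⟨U, hU, hU'⟩ := h3
      refine ⟨U ∩ Set.Ioi 0, Filter.inter_mem hU (Ioi_mem_nhds h1), fun s hs => hU' ⟨hs.1.1, hs.1.2, hs.2.2⟩⟩
  · exact le_add_self

end LB

end CGL

namespace CGL
open MeasureTheory UnitAddTorus

variable {χ : DyadicPartition}

/-! ### The commutator between the paraproduct and the Duhamel integral -/

lemma para_add_left (a a' b : Distr) : para χ (a + a') b = para χ a b + para χ a' b := by
  have h := para_sub_left (χ := χ) (a + a') a' b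
  rw [add_sub_cancel_right] at h
  rw [h, sub_add_cancel]

lemma integrableOn_para {a b : ℝ} {f : ℝ → Distr} (c : Distr)
    (hi : ∀ k, IntegrableOn (fun s => f s k) (Set.Ioo a b)) (k : Freq) :
    IntegrableOn (fun s => para χ c (f s) k) (Set.Ioo a b) := by
  obtain ⟨N, hN⟩ := exists_norm_lt_two_pow ‖toR k‖ (1 / 24) (by norm_num)
  have hk : ‖toR k‖ < 2 ^ N / 24 := by have := hN N le_rfl; linarith
  have hS : ∀ q k, low χ q c k ≠ 0 → k ∈ (low_finSupp (χ := χ) q c).toFinset := fun q k hk =>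
    (Set.Finite.mem_toFinset _).2 hk
  simp only [para_apply _ _ hk, conv_eq_sum (hS _)]
  refine integrable_finsetSum _ fun q _ => integrable_finsetSum _ fun j _ => ?_
  exact ((hi (k - j)).const_mul _).const_mul _

section Remainder
variable {ι : Type*} {t D : ι → ℝ} {α β : ℝ}

/-- The pairs of an index `i` and a time `s` before the time `t i`. -/
abbrev Before (t : ι → ℝ) : Type _ := {p : ι × ℝ // 0 < p.2 ∧ p.2 < t p.1}

/-- The weight `s ^ (-η) (t - s) ^ (-θ)`. -/
def betaWeight (t : ι → ℝ) (η θ : ℝ) (p : Before t) : ℝ := p.1.2 ^ (-η) * (t p.1.1 - p.1.2) ^ (-θ)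

lemma betaWeight_nonneg (η θ : ℝ) (p : Before t) : 0 ≤ betaWeight t η θ p :=
  mul_nonneg (Real.rpow_nonneg p.2.1.le _) (Real.rpow_nonneg (sub_nonneg.2 p.2.2.le) _)

lemma betaWeight_mono (ht : ∀ i, 0 < t i ∧ t i ≤ 1) {η η' θ θ' : ℝ} (hη : η ≤ η') (hθ : θ ≤ θ')
    (p : Before t) : betaWeight t η θ p ≤ betaWeight t η' θ' p := by
  have h1 := p.2.1
  have h2 := p.2.2
  have h3 := (ht p.1.1).2
  exact mul_le_mul (Real.rpow_le_rpow_of_exponent_ge h1 (by linarith) (by linarith))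
    (Real.rpow_le_rpow_of_exponent_ge (by linarith) (by linarith) (by linarith))
    (Real.rpow_nonneg (by linarith) _) (Real.rpow_nonneg h1.le _)

lemma Est.integral {A A' : ι → ℝ → Distr} {η θ : ℝ} (ht : ∀ i, 0 < t i ∧ t i ≤ 1)
    (hD : ∀ i, 0 ≤ D i) (hη : 0 ≤ η) (hη1 : η < 1) (hθ : 0 ≤ θ) (hθ1 : θ < 1)
    (h : Est χ α (fun p : Before t => A p.1.1 p.1.2) (fun p => A' p.1.1 p.1.2) (betaWeight t η θ)
      (fun p => D p.1.1))
    (hm : ∀ i, AEMeasurable (A i) (volume.restrict (Set.Ioo 0 (t i))))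
    (hm' : ∀ i, AEMeasurable (A' i) (volume.restrict (Set.Ioo 0 (t i)))) :
    EstT χ t D α (η + θ - 1) (fun i k => ∫ s in (0:ℝ)..t i, A i s k)
      (fun i k => ∫ s in (0:ℝ)..t i, A' i s k) := by
  obtain ⟨-, C, hC, h1⟩ := h
  obtain ⟨C', hC', h2⟩ := exists_integral_bd χ hη hη1 hθ hθ1
  have e : ∀ i, t i ^ (-η) * (t i - 0) ^ (1 - θ) = t i ^ (-(η + θ - 1)) := fun i => by
    rw [sub_zero, ← Real.rpow_add (ht i).1]; congr 1; ring
  have k1 := fun i => h2 α C 0 (t i) (A i) le_rfl (ht i).1 hC (hm i)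
    fun s hs => (h1 ⟨(i, s), hs⟩).1
  have k2 := fun i => h2 α C 0 (t i) (A' i) le_rfl (ht i).1 hC (hm' i)
    fun s hs => (h1 ⟨(i, s), hs⟩).2.1
  have k3 := fun i => h2 α (C * D i) 0 (t i) (fun s => A i s - A' i s) le_rfl (ht i).1
    (mul_nonneg hC (hD i)) ((hm i).sub (hm' i))
    fun s hs => (h1 ⟨(i, s), hs⟩).2.2.mono (le_of_eq (by simp only [betaWeight]; ring))
  refine ⟨ht, fun i => ⟨Real.rpow_nonneg (ht i).1.le _, hD i⟩, C' * C, by positivity,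
    fun i => ⟨?_, ?_, ?_⟩⟩
  · have := (k1 i).2
    rwa [e] at this
  · have := (k2 i).2
    rwa [e] at this
  · have e2 : ((fun k => ∫ s in (0:ℝ)..t i, A i s k) - fun k => ∫ s in (0:ℝ)..t i, A' i s k)
        = fun k => ∫ s in (0:ℝ)..t i, (A i s - A' i s) k := by
      funext k
      rw [Pi.sub_apply, ← intervalIntegral.integral_sub
        ((intervalIntegrable_iff_integrableOn_Ioo_of_le (ht i).1.le).2 ((k1 i).1 k))
        ((intervalIntegrable_iff_integrableOn_Ioo_of_le (ht i).1.le).2 ((k2 i).1 k))]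
      rfl
    rw [e2]
    have := (k3 i).2
    rw [e] at this
    exact this.mono (le_of_eq (by ring))

/-- Time regularity of the first factor compensates the singularity of the smoothed second one. -/
lemma est_para_increment {μ : ℝ} (hμ : 0 < μ) {A A' B B' : Before t → Distr} {γ η η' θ δ : ℝ}
    (ht : ∀ i, 0 < t i ∧ t i ≤ 1) (hα : α < 0)
    (hA : Est χ α A A' (fun p => p.1.2 ^ (-η) * (t p.1.1 - p.1.2) ^ δ) (fun p => D p.1.1))
    (hB : Est χ β B B' (fun _ => 1) (fun p => D p.1.1))
    (h1 : β ≤ γ - α) (h2 : γ - α ≤ β + 4) (hη : η ≤ η') (hθ : (γ - α - β) / 2 - δ ≤ θ) :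
    Est χ γ (fun p => para χ (A p) (heat μ (t p.1.1 - p.1.2) (B p)))
      (fun p => para χ (A' p) (heat μ (t p.1.1 - p.1.2) (B' p))) (betaWeight t η' θ)
      (fun p => D p.1.1) := by
  have k1 := hB.heat (γ := γ - α) hμ (τ := fun p : Before t => t p.1.1 - p.1.2)
    (fun p => ⟨by linarith [p.2.2], by linarith [p.2.1, (ht p.1.1).2]⟩) h1 h2
  have k2 := (hA.para_neg k1 hα).mono_reg (β := γ) (by linarith)
  refine k2.weight_le 1 (fun p => ?_) (betaWeight_nonneg _ _)
  rw [one_mul]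
  refine le_trans (le_of_eq ?_) (betaWeight_mono ht hη hθ p)
  have hd : 0 < t p.1.1 - p.1.2 := by linarith [p.2.2]
  rw [betaWeight, mul_one, mul_assoc, ← Real.rpow_add hd]
  congr 2
  ring

lemma aemeasurable_remainder (μ : ℝ) (g z : ι → Path)
    (hg : ∀ i, AEMeasurable (g i) (volume.restrict (Set.Ioo 0 (t i))))
    (hz : ∀ i, AEMeasurable (z i) (volume.restrict (Set.Ioo 0 (t i)))) (i : ι) :
    AEMeasurable (fun s => para χ (g i (t i) - g i s) (heat μ (t i - s) (z i s))
      - heatComm χ μ (t i - s) (g i s) (z i s)) (volume.restrict (Set.Ioo 0 (t i))) := by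
  have hh := aemeasurable_heat μ (measurable_const.sub measurable_id) (hz i) (t := fun s => t i - s)
  refine (aemeasurable_para (aemeasurable_const.sub (hg i)) hh).sub ?_
  exact (aemeasurable_heat μ (measurable_const.sub measurable_id)
    (aemeasurable_para (hg i) (hz i))).sub (aemeasurable_para (hg i) hh)

/-- Freezing `g` at the final time `T` in `I(0, g ≺ z)_T` leaves the increments of `g` and the
commutators of the semigroup with paraproducts by `g`. -/
lemma remainder_eq {μ : ℝ} (hμ : 0 < μ) {γ η θ : ℝ} {T : ℝ} (hT : 0 < T ∧ T ≤ 1) (hη : 0 ≤ η)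
    (hη1 : η < 1) (hθ : 0 ≤ θ) (hθ1 : θ < 1) (g z : Path) (y : Distr) (C C' : ℝ) (hC : 0 ≤ C)
    (hz : ∀ s ∈ Set.Ioo 0 T, Bd χ β (z s) C)
    (hJ : ∀ s ∈ Set.Ioo 0 T, Bd χ γ (para χ (g T - g s) (heat μ (T - s) (z s))
        - heatComm χ μ (T - s) (g s) (z s)) (C' * (s ^ (-η) * (T - s) ^ (-θ))))
    (hC' : 0 ≤ C')
    (hzm : AEMeasurable z (volume.restrict (Set.Ioo 0 T)))
    (hJm : AEMeasurable (fun s => para χ (g T - g s) (heat μ (T - s) (z s))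
        - heatComm χ μ (T - s) (g s) (z s)) (volume.restrict (Set.Ioo 0 T))) :
    para χ (g T) (duhamel μ y z T) - heatInt μ (fun s => para χ (g s) (z s)) T
      = para χ (g T) (heat μ T y) + fun k => ∫ s in (0:ℝ)..T,
        (para χ (g T - g s) (heat μ (T - s) (z s))
          - heatComm χ μ (T - s) (g s) (z s)) k := by
  obtain ⟨Cw, -, hw⟩ := exists_window_bd χ hμ le_rfl one_pos (β := β) (γ := β) le_rfl (by linarith)
  obtain ⟨Ci, -, hi⟩ := exists_integral_bd χ hη hη1 hθ hθ1
  have i1 := (hw z C 0 T 0 T hC le_rfl hT.1 le_rfl hT.1 hT.2 (by linarith) hzm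
    (fun s hs => (hz s hs).mono (by simp)) (by simp)).1
  have i2 := integrableOn_para (χ := χ) (g T) i1
  have i3 := (hi γ C' 0 T _ le_rfl hT.1 hC' hJm hJ).1
  have e1 : ∀ s, heat μ (T - s) (para χ (g s) (z s)) = para χ (g T) (heat μ (T - s) (z s))
      - (para χ (g T - g s) (heat μ (T - s) (z s)) - heatComm χ μ (T - s) (g s) (z s)) := by
    intro s
    rw [para_sub_left, heatComm]
    abel
  have e2 : para χ (g T) (duhamel μ y z T) = para χ (g T) (heat μ T y)
      + para χ (g T) (heatInt μ z T) := by
    have := para_sub_right (χ := χ) (g T) (duhamel μ y z T) (heat μ T y)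
    rw [duhamel_eq, add_sub_cancel_left] at this
    rw [duhamel_eq, this]
    abel
  rw [e2, add_sub_assoc]
  congr 1
  have e3 : para χ (g T) (heatInt μ z T)
      = fun k => ∫ s in (0:ℝ)..T, para χ (g T) (heat μ (T - s) (z s)) k :=
    para_integral (g T) hT.1.le i1
  rw [e3]
  funext k
  have hle := hT.1.le
  simp only [heatInt, e1, Pi.sub_apply] at i3 ⊢
  rw [intervalIntegral.integral_sub
    ((intervalIntegrable_iff_integrableOn_Ioo_of_le hle).2 (i2 k))
    ((intervalIntegrable_iff_integrableOn_Ioo_of_le hle).2 (i3 k))]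
  simp only [sub_sub_cancel]

/-- The paracontrolled remainder `f_t ≺ I(y,x)_t - I(0, f ≺ x)_t` is bounded in terms of the increments
of `f` and of the commutators `[P_{t-s}, f_s ≺]`. -/
lemma estT_remainder {μ : ℝ} (hμ : 0 < μ) {f f' x x' : ι → Path} {y y' : ι → Distr} {γ η θ : ℝ}
    (ht : ∀ i, 0 < t i ∧ t i ≤ 1) (hD : ∀ i, 0 ≤ D i) (hη : 0 ≤ η) (hη1 : η < 1) (hθ : 0 ≤ θ)
    (hθ1 : θ < 1)
    (hx : Est χ β (fun p : Before t => x p.1.1 p.1.2) (fun p => x' p.1.1 p.1.2) (fun _ => 1)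
      (fun p => D p.1.1))
    (h1 : Est χ γ (fun p : Before t => para χ (f p.1.1 (t p.1.1) - f p.1.1 p.1.2)
        (heat μ (t p.1.1 - p.1.2) (x p.1.1 p.1.2)))
      (fun p => para χ (f' p.1.1 (t p.1.1) - f' p.1.1 p.1.2)
        (heat μ (t p.1.1 - p.1.2) (x' p.1.1 p.1.2))) (betaWeight t η θ) (fun p => D p.1.1))
    (h2 : Est χ γ (fun p : Before t => heatComm χ μ (t p.1.1 - p.1.2) (f p.1.1 p.1.2) (x p.1.1 p.1.2))
      (fun p => heatComm χ μ (t p.1.1 - p.1.2) (f' p.1.1 p.1.2) (x' p.1.1 p.1.2))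
      (betaWeight t η θ) (fun p => D p.1.1))
    (h3 : EstT χ t D γ η (fun i => para χ (f i (t i)) (heat μ (t i) (y i)))
      (fun i => para χ (f' i (t i)) (heat μ (t i) (y' i))))
    (hf : ∀ i, AEMeasurable (f i) (volume.restrict (Set.Ioo 0 (t i))))
    (hf' : ∀ i, AEMeasurable (f' i) (volume.restrict (Set.Ioo 0 (t i))))
    (hxm : ∀ i, AEMeasurable (x i) (volume.restrict (Set.Ioo 0 (t i))))
    (hxm' : ∀ i, AEMeasurable (x' i) (volume.restrict (Set.Ioo 0 (t i)))) :
    EstT χ t D γ η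
      (fun i => para χ (f i (t i)) (duhamel μ (y i) (x i) (t i))
        - heatInt μ (fun s => para χ (f i s) (x i s)) (t i))
      (fun i => para χ (f' i (t i)) (duhamel μ (y' i) (x' i) (t i))
        - heatInt μ (fun s => para χ (f' i s) (x' i s)) (t i)) := by
  have hJ := h1.sub h2
  have meas := aemeasurable_remainder (χ := χ) (t := t) μ
  have hI := Est.integral (A := fun i s => para χ (f i (t i) - f i s) (heat μ (t i - s) (x i s))
      - heatComm χ μ (t i - s) (f i s) (x i s))
    (A' := fun i s => para χ (f' i (t i) - f' i s) (heat μ (t i - s) (x' i s))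
      - heatComm χ μ (t i - s) (f' i s) (x' i s)) ht hD hη hη1 hθ hθ1 hJ (meas f x hf hxm) (meas f' x' hf' hxm')
  obtain ⟨-, C, hC, hx1⟩ := hx
  obtain ⟨-, C', hC', hJ1⟩ := hJ
  have e1 := fun i => remainder_eq hμ (ht i) hη hη1 hθ hθ1 (f i) (x i) (y i) C C' hC
    (fun s hs => (hx1 ⟨(i, s), hs⟩).1.mono (by simp)) (fun s hs => (hJ1 ⟨(i, s), hs⟩).1) hC' (hxm i)
    (meas f x hf hxm i)
  have e2 := fun i => remainder_eq hμ (ht i) hη hη1 hθ hθ1 (f' i) (x' i) (y' i) C C' hC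
    (fun s hs => (hx1 ⟨(i, s), hs⟩).2.1.mono (by simp)) (fun s hs => (hJ1 ⟨(i, s), hs⟩).2.1) hC' (hxm' i)
    (meas f' x' hf' hxm' i)
  simp only [e1, e2]
  exact h3.add (hI.mono le_rfl (by linarith))

end Remainder

/-! ### The nonlinearities -/

section Nonlinear
variable {ι : Type*} {t D : ι → ℝ} {κ κ' : ℝ} {x x' : Label → ι → Distr} {u u' w w' c c' : ι → Distr}

/-- The forcing `F` lies in `C^{-1-κ}`: the weight `t^{-(5/6-κ')}` dominates that of `u` in `C^κ`. -/
lemma estT_F (hκ : 0 < κ) (hκκ' : κ < κ') (hκ' : κ' < 1 / 18) (ν : ℂ)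
    (hx : ∀ l : Label, EstT χ t D (l.reg κ) 0 (x l) (x' l))
    (hu : EstT χ t D κ ((κ + 2 / 3 - κ') / 2) u u') :
    EstT χ t D (-1 - κ) (5 / 6 - κ') (fun i => F χ ν (fun l => x l i) (u i))
      (fun i => F χ ν (fun l => x' l i) (u' i)) := by
  have W := hx .IAAB
  have AB := hx .AB
  have AA := hx .AA
  simp only [Label.reg] at W AB AA
  have hf := ((W.smul (-ν)).mono (β := κ) (b := (κ + 2 / 3 - κ') / 2) (by linarith) (by linarith)).add hu
  have hfb := ((W.bar.smul (-conj ν)).mono (β := κ) (b := (κ + 2 / 3 - κ') / 2) (by linarith)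
    (by linarith)).add hu.bar
  exact ((((hf.para_pos AB hκ).smul 2).add (hfb.para_pos AA hκ)).smul (-ν)).mono le_rfl (by linarith)

/-- All terms of `G` are of regularity `-1/2 - 2κ` with the blow-up of `w`. -/
lemma estT_nonlinear (hκ : 0 < κ) (hκκ' : κ < κ') (hκ' : κ' < 1 / 18) (ν : ℂ)
    (hx : ∀ l : Label, EstT χ t D (l.reg κ) 0 (x l) (x' l))
    (hu : EstT χ t D κ ((κ + 2 / 3 - κ') / 2) u u')
    (hu2 : EstT χ t D (1 / 2 + 2 * κ) ((7 / 6 + 2 * κ - κ') / 2) u u')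
    (hw : EstT χ t D (3 / 2 - 2 * κ') (1 - κ' + κ) w w')
    (hc : EstT χ t D (1 + 2 * κ) (1 - κ' + κ) c c') :
    EstT χ t D (-1 / 2 - 2 * κ) (1 - κ' + κ)
      (fun i => G1 χ ν (u i) + G2 χ ν (fun l => x l i) (u i) + G3 χ ν (fun l => x l i) (u i)
        + G4 χ ν (fun l => x l i) + G5 χ ν (fun l => x l i) (u i) + G6 χ ν (fun l => x l i) (c i)
        + G7 χ ν (fun l => x l i) (w i) + G8 χ ν (fun l => x l i) (u i))
      (fun i => G1 χ ν (u' i) + G2 χ ν (fun l => x' l i) (u' i) + G3 χ ν (fun l => x' l i) (u' i)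
        + G4 χ ν (fun l => x' l i) + G5 χ ν (fun l => x' l i) (u' i) + G6 χ ν (fun l => x' l i) (c' i)
        + G7 χ ν (fun l => x' l i) (w' i) + G8 χ ν (fun l => x' l i) (u' i)) := by
  have Z := hx .A
  have W := hx .IAAB
  have AB := hx .AB
  have AA := hx .AA
  have IAA := hx .IAA
  have IAB := hx .IAB
  have WA := hx .IAABoA
  have WB := hx .IAABoB
  have AAoAB := hx .IAAoAB
  have AAoBB := hx .IAAoBB
  have ABoAB := hx .IABoAB
  have ABoBB := hx .IABoBB
  have WoAB := hx .IAABoAB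
  have WoBB := hx .IAABoBB
  simp only [Label.reg] at Z W AB AA IAA IAB WA WB AAoAB AAoBB ABoAB ABoBB WoAB WoBB
  have p2 : 0 < 1 / 2 - κ := by linarith
  -- the products with `Z`
  have hWZ : EstT χ t D (-1 / 2 - κ) 0 (fun i => WZ χ (fun l => x l i)) (fun i => WZ χ (fun l => x' l i)) :=
    (((W.para_pos Z p2).mono (by linarith) (by linarith)).add
      ((Z.para_neg W (by linarith)).mono (by linarith) (by linarith))).add
      (WA.mono (by linarith) (by linarith))
  have hWZb : EstT χ t D (-1 / 2 - κ) 0 (fun i => WZbar χ (fun l => x l i))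
      (fun i => WZbar χ (fun l => x' l i)) :=
    (((W.para_pos Z.bar p2).mono (by linarith) (by linarith)).add
      ((Z.bar.para_neg W (by linarith)).mono (by linarith) (by linarith))).add
      (WB.mono (by linarith) (by linarith))
  have WW : ∀ {A A' B B' : ι → Distr}, EstT χ t D (1 / 2 - κ) 0 A A' → EstT χ t D (1 / 2 - κ) 0 B B' →
      EstT χ t D (1 / 2 - κ) 0 (fun i => prod χ (A i) (B i)) (fun i => prod χ (A' i) (B' i)) :=
    fun hA hB => (hA.prod hB p2 (by linarith) le_rfl (by linarith)).mono le_rfl (by linarith)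
  have WK : ∀ {A A' B B' : ι → Distr}, EstT χ t D (1 / 2 - κ) 0 A A' → EstT χ t D (-κ) 0 B B' →
      EstT χ t D (-1 / 2 - 2 * κ) 0 (fun i => prod χ (A i) (B i)) (fun i => prod χ (A' i) (B' i)) :=
    fun hA hB => (hA.prod hB p2 (by linarith) (by linarith) (by linarith)).mono (by linarith)
      (by linarith)
  -- the terms of the form `W (W ⊙ Z) + R + W ≺ ⋯` in the products of three factors
  have WWZ : ∀ {A A' B B' : ι → Distr}, EstT χ t D (1 / 2 - κ) 0 A A' →
      EstT χ t D (-1 / 2 - κ) 0 B B' → EstT χ t D (-1 / 2 - 2 * κ) 0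
      (fun i => para χ (para χ (A i) (B i)) (x .IAAB i) + para χ (x .IAAB i) (para χ (A i) (B i)))
      (fun i => para χ (para χ (A' i) (B' i)) (x' .IAAB i) + para χ (x' .IAAB i) (para χ (A' i) (B' i))) :=
    fun hA hB =>
      ((((hA.para_pos hB p2).para_neg W (by linarith)).mono (by linarith) (by linarith))).add
        ((W.para_pos (hA.para_pos hB p2) p2).mono (by linarith) (by linarith))
  have WZW : ∀ {A A' B B' C C' : ι → Distr}, EstT χ t D (1 / 2 - κ) 0 A A' →
      EstT χ t D (-1 / 2 - κ) 0 B B' → EstT χ t D (1 / 2 - κ) 0 C C' → EstT χ t D (-1 / 2 - 2 * κ) 0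
      (fun i => prod χ (A i) (para χ (B i) (C i))) (fun i => prod χ (A' i) (para χ (B' i) (C' i))) :=
    fun hA hB hC => (hA.prod (hB.para_neg hC (by linarith)) p2 (by linarith) (by linarith)
      (by linarith)).mono (by linarith) (by linarith)
  have cWZW : ∀ {A A' B B' : ι → Distr}, EstT χ t D (1 / 2 - κ) 0 A A' →
      EstT χ t D (-1 / 2 - κ) 0 B B' → EstT χ t D (-1 / 2 - 2 * κ) 0
      (fun i => comm χ (A i) (B i) (x .IAAB i)) (fun i => comm χ (A' i) (B' i) (x' .IAAB i)) :=
    fun hA hB => (hA.comm hB W (by linarith) (by linarith) (by linarith)).mono (by linarith)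
      (by linarith)
  have hWWZb : EstT χ t D (-1 / 2 - 2 * κ) 0 (fun i => WWZbar χ (fun l => x l i))
      (fun i => WWZbar χ (fun l => x' l i)) :=
    ((((WK W WB).smul 2).add (cWZW W Z.bar)).add (WWZ W Z.bar)).add (WZW W Z.bar W)
  have hWWbZ : EstT χ t D (-1 / 2 - 2 * κ) 0 (fun i => WWbarZ χ (fun l => x l i))
      (fun i => WWbarZ χ (fun l => x' l i)) :=
    ((((WK W.bar WA).add (WK W WB.bar)).add (cWZW W.bar Z)).add (WWZ W.bar Z)).add (WZW W Z W.bar)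
  have cW : ∀ {A A' B B' C C' : ι → Distr}, EstT χ t D (1 / 2 - κ) 0 A A' →
      EstT χ t D (1 - κ) 0 B B' → EstT χ t D (-1 - κ) 0 C C' → EstT χ t D (-1 / 2 - 2 * κ) 0
      (fun i => comm χ (A i) (B i) (C i)) (fun i => comm χ (A' i) (B' i) (C' i)) :=
    fun hA hB hC => (hA.comm hB hC (by linarith) (by linarith) (by linarith)).mono (by linarith)
      (by linarith)
  have cU : ∀ {A A' B B' C C' : ι → Distr}, EstT χ t D (1 / 2 + 2 * κ) ((7 / 6 + 2 * κ - κ') / 2) A A' →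
      EstT χ t D (1 - κ) 0 B B' → EstT χ t D (-1 - κ) 0 C C' →
      EstT χ t D (-1 / 2 - 2 * κ) (1 - κ' + κ)
      (fun i => comm χ (A i) (B i) (C i)) (fun i => comm χ (A' i) (B' i) (C' i)) :=
    fun hA hB hC => (hA.comm hB hC (by linarith) (by linarith) (by linarith)).mono (by linarith)
      (by linarith)
  have low : ∀ {α : ℝ} {A A' : ι → Distr}, -1 / 2 - 2 * κ ≤ α → EstT χ t D α 0 A A' →
      EstT χ t D (-1 / 2 - 2 * κ) 0 A A' := fun h hA => hA.mono h le_rfl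
  have g1 : EstT χ t D (-1 / 2 - 2 * κ) (1 - κ' + κ) (fun i => G1 χ ν (u i)) (fun i => G1 χ ν (u' i)) :=
    (((hu.prod hu hκ hκ.ne' le_rfl (by linarith)).prod hu.bar hκ hκ.ne' le_rfl (by linarith)).smul
      (-ν)).mono (by linarith) (by linarith)
  have g2 : EstT χ t D (-1 / 2 - 2 * κ) (1 - κ' + κ) (fun i => G2 χ ν (fun l => x l i) (u i))
      (fun i => G2 χ ν (fun l => x' l i) (u' i)) := by
    have q1 := Z.bar.sub ((W.bar.smul (conj ν)).mono (β := -1 / 2 - κ) (by linarith) le_rfl)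
    have q2 := Z.sub ((W.smul ν).mono (β := -1 / 2 - κ) (by linarith) le_rfl)
    have r1 := hu.prod_same hu2 hu hu2 hκ (by linarith)
    have r2 := hu.prod_same hu2 hu.bar hu2.bar hκ (by linarith)
    have s1 := r1.prod q1 (by linarith) (by linarith) (by linarith) (by linarith)
    have s2 := r2.prod q2 (by linarith) (by linarith) (by linarith) (by linarith)
    exact ((s1.add (s2.smul 2)).smul (-ν)).mono (by linarith) (by linarith)
  have g3 : EstT χ t D (-1 / 2 - 2 * κ) (1 - κ' + κ) (fun i => G3 χ ν (fun l => x l i) (u i))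
      (fun i => G3 χ ν (fun l => x' l i) (u' i)) := by
    have up : ∀ {α : ℝ} {A A' : ι → Distr} (z : ℂ), -1 / 2 - κ ≤ α → EstT χ t D α 0 A A' →
      EstT χ t D (-1 / 2 - κ) 0 (fun i => z • A i) (fun i => z • A' i) := fun z h hA =>
        (hA.smul z).mono h le_rfl
    have q1 := ((((up (2 * ν * conj ν) (by linarith) (WW W W.bar)).sub (up (2 * ν) le_rfl hWZb)).sub
      (up (2 * conj ν) le_rfl hWZb.bar)).sub (up (4 * ν) (by linarith) ABoAB)).sub
      (up (conj ν) (by linarith) AAoBB.bar)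
    have q2 := (((up (ν ^ 2) (by linarith) (WW W W)).sub (up (2 * ν) le_rfl hWZ)).sub
      (up (2 * conj ν) (by linarith) ABoBB.bar)).sub (up (2 * ν) (by linarith) AAoAB)
    have s1 := hu2.prod q1 (by linarith) (by linarith) (by linarith) (by linarith)
    have s2 := hu2.bar.prod q2 (by linarith) (by linarith) (by linarith) (by linarith)
    exact (((s1.add s2).smul (-ν)).mono (by linarith) (by linarith)).add
      ((hu.smul (ν + 1)).mono (by linarith) (by linarith))
  have g4 : EstT χ t D (-1 / 2 - 2 * κ) (1 - κ' + κ) (fun i => G4 χ ν (fun l => x l i))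
      (fun i => G4 χ ν (fun l => x' l i)) := by
    have q := ((((((((((((((low (by linarith) ((WW (WW W W) W.bar).smul (-(ν ^ 2 * conj ν)))).add
      (hWWZb.smul (ν ^ 2))).add (hWWbZ.smul (2 * ν * conj ν))).add
      ((WK W ABoAB).smul (4 * ν ^ 2))).add ((cW W IAB AB).smul (4 * ν ^ 2))).add
      ((WK W.bar ABoBB.bar).smul (2 * conj ν ^ 2))).add
      ((cW W.bar IAB.bar AA).smul (2 * conj ν ^ 2))).add
      ((WK W.bar AAoAB).smul (2 * ν * conj ν))).add
      ((cW W.bar IAA AB).smul (2 * ν * conj ν))).add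
      ((WK W AAoBB.bar).smul (ν * conj ν))).add
      ((cW W IAA.bar AA).smul (ν * conj ν))).sub
      (low (by linarith) (WoAB.smul (2 * ν)))).sub
      (((AB.para_neg W (by linarith)).smul (2 * ν)).mono (β := -1 / 2 - 2 * κ) (b := 0)
        (by linarith) (by linarith))).sub
      (low (by linarith) (WoBB.bar.smul (conj ν)))).sub
      (((AA.para_neg W.bar (by linarith)).smul (conj ν)).mono (β := -1 / 2 - 2 * κ) (b := 0)
        (by linarith) (by linarith))
    have q' := (low (by linarith) Z).sub (low (by linarith) (W.smul ν))
    exact ((q.smul (-ν)).add (q'.smul (ν + 1))).mono le_rfl (by linarith)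
  have g5 : EstT χ t D (-1 / 2 - 2 * κ) (1 - κ' + κ) (fun i => G5 χ ν (fun l => x l i) (u i))
      (fun i => G5 χ ν (fun l => x' l i) (u' i)) :=
    (((((cU hu2 IAB AB).smul (-(4 * ν))).sub ((cU hu2.bar IAA AB).smul (2 * ν))).sub
      ((cU hu2.bar IAB.bar AA).smul (2 * conj ν))).sub ((cU hu2 IAA.bar AA).smul (conj ν))).smul (-ν)
  have g6 : EstT χ t D (-1 / 2 - 2 * κ) (1 - κ' + κ) (fun i => G6 χ ν (fun l => x l i) (c i))
      (fun i => G6 χ ν (fun l => x' l i) (c' i)) :=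
    ((((hc.reso AB (by linarith)).smul 2).add (hc.bar.reso AA (by linarith))).smul (-ν)).mono
      (by linarith) (by linarith)
  have g7 : EstT χ t D (-1 / 2 - 2 * κ) (1 - κ' + κ) (fun i => G7 χ ν (fun l => x l i) (w i))
      (fun i => G7 χ ν (fun l => x' l i) (w' i)) :=
    ((((hw.reso AB (by linarith)).smul 2).add (hw.bar.reso AA (by linarith))).smul (-ν)).mono
      (by linarith) (by linarith)
  have g8 : EstT χ t D (-1 / 2 - 2 * κ) (1 - κ' + κ) (fun i => G8 χ ν (fun l => x l i) (u i))
      (fun i => G8 χ ν (fun l => x' l i) (u' i)) :=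
    ((((AB.para_neg hu2 (by linarith)).smul 2).add (AA.para_neg hu2.bar (by linarith))).smul
      (-ν)).mono (by linarith) (by linarith)
  exact ((((((g1.add g2).add g3).add g4).add g5).add g6).add g7).add g8

end Nonlinear

end CGL

namespace CGL
open MeasureTheory UnitAddTorus

variable {χ : DyadicPartition}

/-! ### Uniform estimates for the system -/

/-- Quantitative form of the bounds on a driving vector on `[0,1]`. -/
structure XB (χ : DyadicPartition) (κ : ℝ) (X : Label → Path) (K : ℝ) : Prop where
  reg : ∀ (l : Label) (t : ℝ), 0 ≤ t → t ≤ 1 → Bd χ (l.reg κ) (X l t) K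
  hold : ∀ s t, 0 ≤ s → s < t → t ≤ 1 → Bd χ (1 / 2 - κ - 2 * (1 / 4 - κ / 2))
    (X .IAAB t - X .IAAB s) (K * (t - s) ^ (1 / 4 - κ / 2))

/-- The arguments of the fixed point map `M` except `w₀`. -/
structure Dat where
  v₀ : Distr
  X : Label → Path
  v : Path
  w : Path

/-- The path `-νW + v + w`, the paracontrolled derivative of the solution. -/
def Dat.f (ν : ℂ) (d : Dat) : Path := fun s => -ν • d.X .IAAB s + (d.v s + d.w s)

/-- The forcing of the first equation. -/
def Dat.F (χ : DyadicPartition) (ν : ℂ) (d : Dat) : Path :=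
  fun s => CGL.F χ ν (fun l => d.X l s) (d.v s + d.w s)

/-- The value of `com` along the data. -/
def Dat.com (χ : DyadicPartition) (μ : ℝ) (ν : ℂ) (d : Dat) : Path :=
  CGL.com χ μ ν d.v₀ d.X d.v d.w

/-- The forcing of the second equation. -/
def Dat.G (χ : DyadicPartition) (μ : ℝ) (ν : ℂ) (d : Dat) : Path :=
  CGL.G χ μ ν d.v₀ d.X d.v d.w

/-- The data are bounded by `R` on `[0,T]`, the paths are measurable, and the constraints
`I(X_0, X) = IX` on `IAA` and `IAB` hold. -/
structure Dat.Ok (χ : DyadicPartition) (μ κ κ' R T : ℝ) (d : Dat) : Prop where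
  v₀ : Bd χ (-2 / 3 + κ') d.v₀ R
  X : XB χ κ d.X R
  meas : ∀ l, AEMeasurable (d.X l) (volume.restrict (Set.Ioo 0 1))
  aa : ∀ t ∈ Set.Icc (0 : ℝ) 1, duhamel μ (d.X .IAA 0) (d.X .AA) t = d.X .IAA t
  ab : ∀ t ∈ Set.Icc (0 : ℝ) 1, duhamel μ (d.X .IAB 0) (d.X .AB) t = d.X .IAB t
  v : LB χ T (5 / 6 - κ') (1 - κ') (1 - κ' / 2) d.v R
  w : LB χ T (1 - κ' + κ) (3 / 2 - 2 * κ') (1 - κ') d.w R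

/-- Two data bounded by `R` at distance at most `D`. -/
structure Pair (χ : DyadicPartition) (μ κ κ' R : ℝ) where
  a : Dat
  b : Dat
  T : ℝ
  D : ℝ
  hT : 0 < T ∧ T ≤ 1
  hD : 0 ≤ D
  oka : a.Ok χ μ κ κ' R T
  okb : b.Ok χ μ κ κ' R T
  dv₀ : Bd χ (-2 / 3 + κ') (a.v₀ - b.v₀) D
  dX : XB χ κ (a.X - b.X) D
  dv : LB χ T (5 / 6 - κ') (1 - κ') (1 - κ' / 2) (a.v - b.v) D
  dw : LB χ T (1 - κ' + κ) (3 / 2 - 2 * κ') (1 - κ') (a.w - b.w) D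

/-- A pair of data and a time of its interval. -/
abbrev Timed (χ : DyadicPartition) (μ κ κ' R : ℝ) : Type :=
  {p : Pair χ μ κ κ' R × ℝ // 0 < p.2 ∧ p.2 ≤ p.1.T}

section System
variable {μ κ κ' R : ℝ}

/-- The time component. -/
def Timed.t (j : Timed χ μ κ κ' R) : ℝ := j.1.2

/-- The distance of the two data. -/
def Timed.D (j : Timed χ μ κ κ' R) : ℝ := j.1.1.D

lemma Timed.time_mem (j : Timed χ μ κ κ' R) : 0 < j.t ∧ j.t ≤ 1 :=
  ⟨j.2.1, j.2.2.trans j.1.1.hT.2⟩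

lemma Timed.dist_nonneg (j : Timed χ μ κ κ' R) : 0 ≤ j.D := j.1.1.hD

/-- The first of the two data. -/
def Timed.a (j : Timed χ μ κ κ' R) : Dat := j.1.1.a

/-- The second of the two data. -/
def Timed.b (j : Timed χ μ κ κ' R) : Dat := j.1.1.b

/-- A bound by `R` costs only a constant in `Est`, so `D` need only control the difference. -/
lemma est_of_bd {ι : Type*} {α R : ℝ} {A B : ι → Distr} {w D : ι → ℝ} (hw : ∀ i, 0 ≤ w i)
    (hD : ∀ i, 0 ≤ D i) (hA : ∀ i, Bd χ α (A i) (R * w i)) (hB : ∀ i, Bd χ α (B i) (R * w i))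
    (hAB : ∀ i, Bd χ α (A i - B i) (D i * w i)) : Est χ α A B w D := by
  refine ⟨fun i => ⟨hw i, hD i⟩, |R| + 1, by positivity, fun i => ⟨(hA i).mono ?_, (hB i).mono ?_,
    (hAB i).mono ?_⟩⟩
  · have := hw i
    gcongr
    linarith [le_abs_self R]
  · have := hw i
    gcongr
    linarith [le_abs_self R]
  · nlinarith [mul_nonneg (hw i) (hD i), mul_nonneg (abs_nonneg R) (mul_nonneg (hw i) (hD i))]

lemma estT_driver (l : Label) : EstT χ (Timed.t (χ := χ) (μ := μ) (κ := κ) (κ' := κ') (R := R)) Timed.D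
    (l.reg κ) 0 (fun j => j.a.X l j.t) (fun j => j.b.X l j.t) :=
  have key : ∀ (a : Distr) (K t : ℝ), Bd χ (l.reg κ) a K → Bd χ (l.reg κ) a (K * t ^ (-(0 : ℝ))) :=
    fun a K t h => by simpa using h
  ⟨Timed.time_mem, est_of_bd (R := R) (fun j => Real.rpow_nonneg j.time_mem.1.le _) Timed.dist_nonneg
    (fun j => key _ _ _ (j.1.1.oka.X.reg l j.t j.time_mem.1.le j.time_mem.2))
    (fun j => key _ _ _ (j.1.1.okb.X.reg l j.t j.time_mem.1.le j.time_mem.2))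
    (fun j => key _ _ _ (j.1.1.dX.reg l j.t j.time_mem.1.le j.time_mem.2))⟩

lemma estT_v {γ : ℝ} (h1 : -2 / 3 + κ' ≤ γ) (h2 : γ ≤ 1 - κ') :
    EstT χ (Timed.t (χ := χ) (μ := μ) (κ := κ) (κ' := κ') (R := R)) Timed.D
    γ ((γ + 2 / 3 - κ') / 2) (fun j => j.a.v j.t) (fun j => j.b.v j.t) := by
  have key : ∀ (u : Path) (T K t : ℝ), LB χ T (5 / 6 - κ') (1 - κ') (1 - κ' / 2) u K → 0 < t → t ≤ T →
      Bd χ γ (u t) (K * t ^ (-((γ + 2 / 3 - κ') / 2))) := fun u T K t h h3 h4 => by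
    have := (h.pt t h3 h4).interp h3 rfl (γ := γ) (by linarith) h2 (h.base t h3.le h4)
    rwa [show γ - (1 - κ' - 2 * (5 / 6 - κ')) = γ + 2 / 3 - κ' by ring] at this
  exact ⟨Timed.time_mem, est_of_bd (R := R) (fun j => Real.rpow_nonneg j.time_mem.1.le _)
    Timed.dist_nonneg (fun j => key j.a.v j.1.1.T R j.t j.1.1.oka.v j.2.1 j.2.2)
    (fun j => key j.b.v j.1.1.T R j.t j.1.1.okb.v j.2.1 j.2.2)
    (fun j => key (j.a.v - j.b.v) j.1.1.T j.D j.t j.1.1.dv j.2.1 j.2.2)⟩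

lemma estT_w {γ : ℝ} (h1 : -1 / 2 - 2 * κ ≤ γ) (h2 : γ ≤ 3 / 2 - 2 * κ') :
    EstT χ (Timed.t (χ := χ) (μ := μ) (κ := κ) (κ' := κ') (R := R)) Timed.D
    γ ((γ + 1 / 2 + 2 * κ) / 2) (fun j => j.a.w j.t) (fun j => j.b.w j.t) := by
  have key : ∀ (u : Path) (T K t : ℝ), LB χ T (1 - κ' + κ) (3 / 2 - 2 * κ') (1 - κ') u K → 0 < t →
      t ≤ T → Bd χ γ (u t) (K * t ^ (-((γ + 1 / 2 + 2 * κ) / 2))) := fun u T K t h h3 h4 => by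
    have := (h.pt t h3 h4).interp h3 rfl (γ := γ) (by linarith) h2 (h.base t h3.le h4)
    rwa [show γ - (3 / 2 - 2 * κ' - 2 * (1 - κ' + κ)) = γ + 1 / 2 + 2 * κ by ring] at this
  exact ⟨Timed.time_mem, est_of_bd (R := R) (fun j => Real.rpow_nonneg j.time_mem.1.le _)
    Timed.dist_nonneg (fun j => key j.a.w j.1.1.T R j.t j.1.1.oka.w j.2.1 j.2.2)
    (fun j => key j.b.w j.1.1.T R j.t j.1.1.okb.w j.2.1 j.2.2)
    (fun j => key (j.a.w - j.b.w) j.1.1.T j.D j.t j.1.1.dw j.2.1 j.2.2)⟩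

lemma estT_u (hκκ' : κ < κ') (hκ' : κ' < 1 / 18) {γ : ℝ} (h1 : -1 / 2 - 2 * κ ≤ γ) (h2 : γ ≤ 1 - κ') :
    EstT χ (Timed.t (χ := χ) (μ := μ) (κ := κ) (κ' := κ') (R := R)) Timed.D
    γ ((γ + 2 / 3 - κ') / 2) (fun j => j.a.v j.t + j.a.w j.t) (fun j => j.b.v j.t + j.b.w j.t) :=
  (estT_v (by linarith) h2).add ((estT_w h1 (by linarith)).mono le_rfl (by linarith))

lemma estT_f (ν : ℂ) (hκ : 0 < κ) (hκκ' : κ < κ') (hκ' : κ' < 1 / 18) {γ : ℝ} (h1 : 0 ≤ γ)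
    (h2 : γ ≤ 1 / 2 - κ) : EstT χ (Timed.t (χ := χ) (μ := μ) (κ := κ) (κ' := κ') (R := R)) Timed.D
    γ ((γ + 2 / 3 - κ') / 2) (fun j => j.a.f ν j.t) (fun j => j.b.f ν j.t) :=
  (((estT_driver .IAAB).smul (-ν)).mono (by simpa [Label.reg] using h2) (by linarith)).add
    (estT_u hκκ' hκ' (by linarith) (by linarith))

/-! #### Increments in time -/

/-- The data at the earlier time of a pair of times. -/
def earlier (p : Before (Timed.t (χ := χ) (μ := μ) (κ := κ) (κ' := κ') (R := R))) : Timed χ μ κ κ' R :=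
  ⟨(p.1.1.1.1, p.1.2), p.2.1, p.2.2.le.trans p.1.1.2.2⟩

lemma est_incr_driver (hκ : 0 < κ) : Est χ (-κ)
    (fun p : Before (Timed.t (χ := χ) (μ := μ) (κ := κ) (κ' := κ') (R := R)) =>
      p.1.1.a.X .IAAB p.1.1.t - p.1.1.a.X .IAAB p.1.2)
    (fun p => p.1.1.b.X .IAAB p.1.1.t - p.1.1.b.X .IAAB p.1.2)
    (fun p => p.1.2 ^ (-(0:ℝ)) * (p.1.1.t - p.1.2) ^ (1 / 4 - κ / 2)) (fun p => p.1.1.D) := by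
  have key : ∀ (X : Label → Path) (K s t : ℝ), XB χ κ X K → 0 < s → s < t → t ≤ 1 →
      Bd χ (-κ) (X .IAAB t - X .IAAB s) (K * (s ^ (-(0:ℝ)) * (t - s) ^ (1 / 4 - κ / 2))) :=
    fun X K s t h h1 h2 h3 => by simpa using (h.hold s t h1.le h2 h3).mono_reg (by linarith)
  refine est_of_bd (R := R) (fun p => mul_nonneg (Real.rpow_nonneg p.2.1.le _)
    (Real.rpow_nonneg (sub_nonneg.2 p.2.2.le) _)) (fun p => p.1.1.dist_nonneg)
    (fun p => key _ _ _ _ p.1.1.1.1.oka.X p.2.1 p.2.2 p.1.1.time_mem.2)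
    (fun p => key _ _ _ _ p.1.1.1.1.okb.X p.2.1 p.2.2 p.1.1.time_mem.2) fun p => ?_
  have := key _ _ _ _ p.1.1.1.1.dX p.2.1 p.2.2 p.1.1.time_mem.2
  simp only [Pi.sub_apply] at this
  rwa [sub_sub_sub_comm] at this

lemma est_incr_v : Est χ (-1)
    (fun p : Before (Timed.t (χ := χ) (μ := μ) (κ := κ) (κ' := κ') (R := R)) =>
      p.1.1.a.v p.1.1.t - p.1.1.a.v p.1.2)
    (fun p => p.1.1.b.v p.1.1.t - p.1.1.b.v p.1.2)
    (fun p => p.1.2 ^ (-(5 / 6 - κ')) * (p.1.1.t - p.1.2) ^ (1 - κ' / 2)) (fun p => p.1.1.D) := by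
  have e : 1 - κ' - 2 * (1 - κ' / 2) = -1 := by ring
  refine est_of_bd (R := R) (fun p => mul_nonneg (Real.rpow_nonneg p.2.1.le _)
    (Real.rpow_nonneg (sub_nonneg.2 p.2.2.le) _)) (fun p => p.1.1.dist_nonneg)
    (fun p => by have := p.1.1.1.1.oka.v.hold _ _ p.2.1 p.2.2 p.1.1.2.2; rwa [e] at this)
    (fun p => by have := p.1.1.1.1.okb.v.hold _ _ p.2.1 p.2.2 p.1.1.2.2; rwa [e] at this) fun p => ?_
  have := p.1.1.1.1.dv.hold _ _ p.2.1 p.2.2 p.1.1.2.2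
  simp only [Pi.sub_apply] at this
  rwa [e, sub_sub_sub_comm] at this

lemma est_incr_w : Est χ (-1 / 2)
    (fun p : Before (Timed.t (χ := χ) (μ := μ) (κ := κ) (κ' := κ') (R := R)) =>
      p.1.1.a.w p.1.1.t - p.1.1.a.w p.1.2)
    (fun p => p.1.1.b.w p.1.1.t - p.1.1.b.w p.1.2)
    (fun p => p.1.2 ^ (-(1 - κ' + κ)) * (p.1.1.t - p.1.2) ^ (1 - κ')) (fun p => p.1.1.D) := by
  have e : 3 / 2 - 2 * κ' - 2 * (1 - κ') = -1 / 2 := by ring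
  refine est_of_bd (R := R) (fun p => mul_nonneg (Real.rpow_nonneg p.2.1.le _)
    (Real.rpow_nonneg (sub_nonneg.2 p.2.2.le) _)) (fun p => p.1.1.dist_nonneg)
    (fun p => by have := p.1.1.1.1.oka.w.hold _ _ p.2.1 p.2.2 p.1.1.2.2; rwa [e] at this)
    (fun p => by have := p.1.1.1.1.okb.w.hold _ _ p.2.1 p.2.2 p.1.1.2.2; rwa [e] at this) fun p => ?_
  have := p.1.1.1.1.dw.hold _ _ p.2.1 p.2.2 p.1.1.2.2
  simp only [Pi.sub_apply] at this
  rwa [e, sub_sub_sub_comm] at this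

lemma est_earlier_driver {l : Label} (hl : l.reg κ = -1 - κ) : Est χ (-1 - κ)
    (fun p : Before (Timed.t (χ := χ) (μ := μ) (κ := κ) (κ' := κ') (R := R)) => p.1.1.a.X l p.1.2)
    (fun p => p.1.1.b.X l p.1.2) (fun _ => 1) (fun p => p.1.1.D) := by
  have h := (estT_driver (χ := χ) (μ := μ) (κ := κ) (κ' := κ') (R := R) l).2.comp earlier
  rw [hl] at h
  exact h.weight_le 1 (fun p => by simp) fun _ => zero_le_one

lemma est_para_incr_sum (hμ : 0 < μ) (hκ : 0 < κ) (hκκ' : κ < κ') (hκ' : κ' < 1 / 18)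
    {a a' b b' c c' x x' : Before (Timed.t (χ := χ) (μ := μ) (κ := κ) (κ' := κ') (R := R)) → Distr}
    (ha : Est χ (-κ) a a'
      (fun p => p.1.2 ^ (-(0:ℝ)) * (p.1.1.t - p.1.2) ^ (1 / 4 - κ / 2)) (fun p => p.1.1.D))
    (hb : Est χ (-1) b b'
      (fun p => p.1.2 ^ (-(5 / 6 - κ')) * (p.1.1.t - p.1.2) ^ (1 - κ' / 2)) (fun p => p.1.1.D))
    (hc : Est χ (-1 / 2) c c'
      (fun p => p.1.2 ^ (-(1 - κ' + κ)) * (p.1.1.t - p.1.2) ^ (1 - κ')) (fun p => p.1.1.D))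
    (hx : Est χ (-1 - κ) x x' (fun _ => 1) (fun p => p.1.1.D)) :
    Est χ (1 + 2 * κ) (fun p => para χ (a p + (b p + c p)) (heat μ (p.1.1.t - p.1.2) (x p)))
      (fun p => para χ (a' p + (b' p + c' p)) (heat μ (p.1.1.t - p.1.2) (x' p)))
      (betaWeight Timed.t (1 - κ' + κ) (9 / 10)) (fun p => p.1.1.D) := by
  simp only [para_add_left]
  exact (est_para_increment hμ Timed.time_mem (by linarith) ha hx (by linarith) (by linarith)
    (by linarith) (by linarith)).add ((est_para_increment hμ Timed.time_mem (by linarith) hb hx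
    (by linarith) (by linarith) (by linarith) (by linarith)).add
    (est_para_increment hμ Timed.time_mem (by linarith) hc hx (by linarith) (by linarith)
    (by linarith) (by linarith)))

lemma est_heatComm_earlier (hμ : 0 < μ) (hκ : 0 < κ) (hκκ' : κ < κ') (hκ' : κ' < 1 / 18)
    {f f' : Timed χ μ κ κ' R → Distr}
    {x x' : Before (Timed.t (χ := χ) (μ := μ) (κ := κ) (κ' := κ') (R := R)) → Distr}
    (hf : EstT χ Timed.t Timed.D (1 / 2 - κ) ((1 / 2 - κ + 2 / 3 - κ') / 2) f f')
    (hx : Est χ (-1 - κ) x x' (fun _ => 1) (fun p => p.1.1.D)) :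
    Est χ (1 + 2 * κ) (fun p => heatComm χ μ (p.1.1.t - p.1.2) (f (earlier p)) (x p))
      (fun p => heatComm χ μ (p.1.1.t - p.1.2) (f' (earlier p)) (x' p))
      (betaWeight Timed.t (1 - κ' + κ) (9 / 10)) (fun p => p.1.1.D) := by
  have h1 := hf.2.comp earlier
  have h2 := Est.heatComm (γ := 1 + 2 * κ) hμ
    (τ := fun p : Before (Timed.t (χ := χ) (μ := μ) (κ := κ) (κ' := κ') (R := R)) => p.1.1.t - p.1.2)
    (fun p => ⟨by linarith [p.2.2], by linarith [p.2.1, p.1.1.time_mem.2]⟩) h1 hx (by linarith)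
    (by linarith) (by linarith)
  refine h2.weight_le 1 (fun p => ?_) (betaWeight_nonneg _ _)
  rw [one_mul, mul_one, mul_comm]
  exact betaWeight_mono Timed.time_mem (η := (1 / 2 - κ + 2 / 3 - κ') / 2) (by linarith)
    (by linarith) p

lemma aemeasurable_f {d : Dat} {T : ℝ} (ν : ℂ) (hκ : 0 < κ) (hκκ' : κ < κ') (hκ' : κ' < 1 / 18)
    (hT : T ≤ 1) (h : d.Ok χ μ κ κ' R T) : AEMeasurable (d.f ν) (volume.restrict (Set.Ioo 0 T)) := by
  have hX := (h.meas .IAAB).mono_measure (Measure.restrict_mono (Set.Ioo_subset_Ioo le_rfl hT) le_rfl)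
  exact (hX.const_smul (-ν)).add ((h.v.aemeasurable (by linarith) (by linarith)).add
    (h.w.aemeasurable (by linarith) (by linarith)))

lemma estT_heat_driver (hμ : 0 < μ) (hκ : 0 < κ) (hκκ' : κ < κ') (hκ' : κ' < 1 / 18) {l : Label}
    (hl : l.reg κ = 1 - κ) {f f' : Timed χ μ κ κ' R → Distr}
    (hf : EstT χ Timed.t Timed.D κ ((κ + 2 / 3 - κ') / 2) f f') :
    EstT χ Timed.t Timed.D (1 + 2 * κ) (1 - κ' + κ)
      (fun j => para χ (f j) (heat μ j.t (j.a.X l 0))) (fun j => para χ (f' j) (heat μ j.t (j.b.X l 0))) := by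
  have h1 : Est χ (1 - κ) (fun j : Timed χ μ κ κ' R => j.a.X l 0) (fun j => j.b.X l 0) (fun _ => 1)
      Timed.D := by
    refine est_of_bd (R := R) (fun _ => zero_le_one) Timed.dist_nonneg (fun j => ?_) (fun j => ?_)
      fun j => ?_
    · rw [mul_one, ← hl]
      exact j.1.1.oka.X.reg l 0 le_rfl zero_le_one
    · rw [mul_one, ← hl]
      exact j.1.1.okb.X.reg l 0 le_rfl zero_le_one
    · rw [mul_one, ← hl]
      exact j.1.1.dX.reg l 0 le_rfl zero_le_one
  have h2 := h1.heat (γ := 1 + 2 * κ) hμ Timed.time_mem (by linarith) (by linarith)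
  simp only [mul_one] at h2
  exact (hf.para_pos ⟨Timed.time_mem, h2⟩ hκ).mono le_rfl (by linarith)

/-- The remainder of the paracontrolled expansion for a factor `f` built from `-νW + v + w`. -/
lemma estT_remainder_of (hμ : 0 < μ) (hκ : 0 < κ) (hκκ' : κ < κ') (hκ' : κ' < 1 / 18)
    {f f' : Timed χ μ κ κ' R → Path} {l l' : Label} (hl : l.reg κ = -1 - κ) (hl' : l'.reg κ = 1 - κ)
    {a a' b b' c c' : Before (Timed.t (χ := χ) (μ := μ) (κ := κ) (κ' := κ') (R := R)) → Distr}
    (ha : Est χ (-κ) a a'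
      (fun p => p.1.2 ^ (-(0:ℝ)) * (p.1.1.t - p.1.2) ^ (1 / 4 - κ / 2)) (fun p => p.1.1.D))
    (hb : Est χ (-1) b b'
      (fun p => p.1.2 ^ (-(5 / 6 - κ')) * (p.1.1.t - p.1.2) ^ (1 - κ' / 2)) (fun p => p.1.1.D))
    (hc : Est χ (-1 / 2) c c'
      (fun p => p.1.2 ^ (-(1 - κ' + κ)) * (p.1.1.t - p.1.2) ^ (1 - κ')) (fun p => p.1.1.D))
    (e : ∀ p : Before (Timed.t (χ := χ) (μ := μ) (κ := κ) (κ' := κ') (R := R)),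
      f p.1.1 p.1.1.t - f p.1.1 p.1.2 = a p + (b p + c p))
    (e' : ∀ p : Before (Timed.t (χ := χ) (μ := μ) (κ := κ) (κ' := κ') (R := R)),
      f' p.1.1 p.1.1.t - f' p.1.1 p.1.2 = a' p + (b' p + c' p))
    (he : ∀ p : Before (Timed.t (χ := χ) (μ := μ) (κ := κ) (κ' := κ') (R := R)),
      f (earlier p) = f p.1.1)
    (he' : ∀ p : Before (Timed.t (χ := χ) (μ := μ) (κ := κ) (κ' := κ') (R := R)),
      f' (earlier p) = f' p.1.1)
    (hf : ∀ γ, 0 ≤ γ → γ ≤ 1 / 2 - κ → EstT χ Timed.t Timed.D γ ((γ + 2 / 3 - κ') / 2)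
      (fun j => f j j.t) (fun j => f' j j.t))
    (hm : ∀ j, AEMeasurable (f j) (volume.restrict (Set.Ioo 0 j.t)))
    (hm' : ∀ j, AEMeasurable (f' j) (volume.restrict (Set.Ioo 0 j.t))) :
    EstT χ Timed.t Timed.D (1 + 2 * κ) (1 - κ' + κ)
      (fun j => para χ (f j j.t) (duhamel μ (j.a.X l' 0) (j.a.X l) j.t)
        - heatInt μ (fun s => para χ (f j s) (j.a.X l s)) j.t)
      (fun j => para χ (f' j j.t) (duhamel μ (j.b.X l' 0) (j.b.X l) j.t)
        - heatInt μ (fun s => para χ (f' j s) (j.b.X l s)) j.t) := by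
  have hx := est_earlier_driver (χ := χ) (μ := μ) (κ' := κ') (R := R) hl
  have h1 := est_para_incr_sum hμ hκ hκκ' hκ' ha hb hc hx
  simp only [← e, ← e'] at h1
  have h2 := est_heatComm_earlier (f := fun j => f j j.t) (f' := fun j => f' j j.t) hμ hκ hκκ' hκ'
    (hf (1 / 2 - κ) (by linarith) le_rfl) hx
  have et : ∀ p : Before (Timed.t (χ := χ) (μ := μ) (κ := κ) (κ' := κ') (R := R)),
      (earlier p).t = p.1.2 := fun _ => rfl
  simp only [he, he', et] at h2
  have hX : ∀ j : Timed χ μ κ κ' R, Set.Ioo 0 j.t ⊆ Set.Ioo 0 1 := fun j =>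
    Set.Ioo_subset_Ioo le_rfl j.time_mem.2
  exact estT_remainder (f := f) (f' := f') (x := fun j => j.a.X l) (x' := fun j => j.b.X l)
    (y := fun j => j.a.X l' 0) (y' := fun j => j.b.X l' 0) hμ Timed.time_mem
    Timed.dist_nonneg (by linarith) (by linarith) (by norm_num)
    (by norm_num) hx h1 h2 (estT_heat_driver hμ hκ hκκ' hκ' hl' (hf κ hκ.le (by linarith))) hm hm'
    (fun j => (j.1.1.oka.meas l).mono_measure (Measure.restrict_mono (hX j) le_rfl))
    (fun j => (j.1.1.okb.meas l).mono_measure (Measure.restrict_mono (hX j) le_rfl))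

end System

end CGL

namespace CGL
open MeasureTheory UnitAddTorus

variable {χ : DyadicPartition}

section Forcing
variable {μ κ κ' R : ℝ}

/-- The remainder of the paracontrolled expansion of `I(0, f ≺ x)` with `f = -νW + v + w`. -/
lemma estT_remainder_AB (hμ : 0 < μ) (hκ : 0 < κ) (hκκ' : κ < κ') (hκ' : κ' < 1 / 18) (ν : ℂ) :
    EstT χ (Timed.t (χ := χ) (μ := μ) (κ := κ) (κ' := κ') (R := R)) Timed.D (1 + 2 * κ) (1 - κ' + κ)
      (fun j => para χ (j.a.f ν j.t) (duhamel μ (j.a.X .IAB 0) (j.a.X .AB) j.t)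
        - heatInt μ (fun s => para χ (j.a.f ν s) (j.a.X .AB s)) j.t)
      (fun j => para χ (j.b.f ν j.t) (duhamel μ (j.b.X .IAB 0) (j.b.X .AB) j.t)
        - heatInt μ (fun s => para χ (j.b.f ν s) (j.b.X .AB s)) j.t) := by
  refine estT_remainder_of (f := fun j => j.a.f ν) (f' := fun j => j.b.f ν) hμ hκ hκκ' hκ' rfl rfl
    ((est_incr_driver hκ).smul (-ν)) est_incr_v est_incr_w (fun p => ?_) (fun p => ?_)
    (fun _ => rfl) (fun _ => rfl) (fun γ h1 h2 => estT_f ν hκ hκκ' hκ' h1 h2) (fun j => ?_)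
    (fun j => ?_)
  · simp only [Dat.f, Pi.smul_apply, smul_sub]; abel
  · simp only [Dat.f, Pi.smul_apply, smul_sub]; abel
  · exact (aemeasurable_f ν hκ hκκ' hκ' j.1.1.hT.2 j.1.1.oka).mono_measure
      (Measure.restrict_mono (Set.Ioo_subset_Ioo le_rfl j.2.2) le_rfl)
  · exact (aemeasurable_f ν hκ hκκ' hκ' j.1.1.hT.2 j.1.1.okb).mono_measure
      (Measure.restrict_mono (Set.Ioo_subset_Ioo le_rfl j.2.2) le_rfl)

/-- The remainder of the paracontrolled expansion for the conjugate factor. -/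
lemma estT_remainder_AA (hμ : 0 < μ) (hκ : 0 < κ) (hκκ' : κ < κ') (hκ' : κ' < 1 / 18) (ν : ℂ) :
    EstT χ (Timed.t (χ := χ) (μ := μ) (κ := κ) (κ' := κ') (R := R)) Timed.D (1 + 2 * κ) (1 - κ' + κ)
      (fun j => para χ (bar (j.a.f ν j.t)) (duhamel μ (j.a.X .IAA 0) (j.a.X .AA) j.t)
        - heatInt μ (fun s => para χ (bar (j.a.f ν s)) (j.a.X .AA s)) j.t)
      (fun j => para χ (bar (j.b.f ν j.t)) (duhamel μ (j.b.X .IAA 0) (j.b.X .AA) j.t)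
        - heatInt μ (fun s => para χ (bar (j.b.f ν s)) (j.b.X .AA s)) j.t) := by
  refine estT_remainder_of (f := fun j s => bar (j.a.f ν s)) (f' := fun j s => bar (j.b.f ν s)) hμ hκ
    hκκ' hκ' rfl rfl
    ((est_incr_driver hκ).smul (-ν)).bar est_incr_v.bar est_incr_w.bar (fun p => ?_) (fun p => ?_)
    (fun _ => rfl) (fun _ => rfl) (fun γ h1 h2 => (estT_f ν hκ hκκ' hκ' h1 h2).bar) (fun j => ?_)
    (fun j => ?_)
  · rw [← bar_sub, ← bar_add, ← bar_add]
    simp only [Dat.f, Pi.smul_apply, smul_sub]; congr 1; abel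
  · rw [← bar_sub, ← bar_add, ← bar_add]
    simp only [Dat.f, Pi.smul_apply, smul_sub]; congr 1; abel
  · exact aemeasurable_bar ((aemeasurable_f ν hκ hκκ' hκ' j.1.1.hT.2 j.1.1.oka).mono_measure
      (Measure.restrict_mono (Set.Ioo_subset_Ioo le_rfl j.2.2) le_rfl))
  · exact aemeasurable_bar ((aemeasurable_f ν hκ hκκ' hκ' j.1.1.hT.2 j.1.1.okb).mono_measure
      (Measure.restrict_mono (Set.Ioo_subset_Ioo le_rfl j.2.2) le_rfl))

lemma estT_base (hμ : 0 < μ) (hκ : 0 < κ) (hκκ' : κ < κ') (hκ' : κ' < 1 / 18) :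
    EstT χ (Timed.t (χ := χ) (μ := μ) (κ := κ) (κ' := κ') (R := R)) Timed.D (1 + 2 * κ) (1 - κ' + κ)
      (fun j => heat μ j.t j.a.v₀) (fun j => heat μ j.t j.b.v₀) := by
  have h1 : Est χ (-2 / 3 + κ') (fun j : Timed χ μ κ κ' R => j.a.v₀) (fun j => j.b.v₀) (fun _ => 1)
      Timed.D := by
    refine est_of_bd (R := R) (fun _ => zero_le_one) Timed.dist_nonneg (fun j => ?_) (fun j => ?_)
      fun j => ?_
    · rw [mul_one]; exact j.1.1.oka.v₀
    · rw [mul_one]; exact j.1.1.okb.v₀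
    · rw [mul_one]; exact j.1.1.dv₀
  have h2 := h1.heat (γ := 1 + 2 * κ) hμ Timed.time_mem (by linarith) (by linarith)
  simp only [mul_one] at h2
  exact EstT.mono ⟨Timed.time_mem, h2⟩ le_rfl (by linarith)

/-- Integrability of the integrand of the Duhamel integral. -/
lemma integrableOn_heat (hμ : 0 < μ) {β η A t : ℝ} {f : Path} (hη : 0 ≤ η) (hη1 : η < 1) (hA : 0 ≤ A)
    (ht : 0 < t ∧ t ≤ 1) (hm : AEMeasurable f (volume.restrict (Set.Ioo 0 t)))
    (hf : ∀ s ∈ Set.Ioo 0 t, Bd χ β (f s) (A * s ^ (-η))) (k : Freq) :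
    IntegrableOn (fun s => heat μ (t - s) (f s) k) (Set.Ioo 0 t) := by
  obtain ⟨C, -, hw⟩ := exists_window_bd χ hμ hη hη1 (β := β) (γ := β) le_rfl (by linarith)
  exact (hw f A 0 t 0 t hA le_rfl ht.1 le_rfl ht.1 ht.2 (by linarith) hm hf (by simp)).1 k

lemma heatInt_sub (hμ : 0 < μ) {β η A t : ℝ} {f g : Path} (hη : 0 ≤ η) (hη1 : η < 1) (hA : 0 ≤ A)
    (ht : 0 ≤ t ∧ t ≤ 1) (hmf : AEMeasurable f (volume.restrict (Set.Ioo 0 t)))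
    (hmg : AEMeasurable g (volume.restrict (Set.Ioo 0 t)))
    (hf : ∀ s ∈ Set.Ioo 0 t, Bd χ β (f s) (A * s ^ (-η)))
    (hg : ∀ s ∈ Set.Ioo 0 t, Bd χ β (g s) (A * s ^ (-η))) :
    heatInt μ f t - heatInt μ g t = heatInt μ (f - g) t := by
  rcases ht.1.eq_or_lt with rfl | h0
  · simp [heatInt_zero]
  funext k
  simp only [heatInt, Pi.sub_apply]
  rw [← intervalIntegral.integral_sub
    ((intervalIntegrable_iff_integrableOn_Ioo_of_le h0.le).2
      (integrableOn_heat hμ hη hη1 hA ⟨h0, ht.2⟩ hmf hf k))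
    ((intervalIntegrable_iff_integrableOn_Ioo_of_le h0.le).2
      (integrableOn_heat hμ hη hη1 hA ⟨h0, ht.2⟩ hmg hg k))]
  simp only [heat_sub, Pi.sub_apply]

lemma heatInt_add {f g : Path} {t : ℝ} (ht : 0 ≤ t)
    (hf : ∀ k, IntegrableOn (fun s => heat μ (t - s) (f s) k) (Set.Ioo 0 t))
    (hg : ∀ k, IntegrableOn (fun s => heat μ (t - s) (g s) k) (Set.Ioo 0 t)) :
    heatInt μ (f + g) t = heatInt μ f t + heatInt μ g t := by
  funext k
  simp only [heatInt, Pi.add_apply]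
  rw [← intervalIntegral.integral_add
    ((intervalIntegrable_iff_integrableOn_Ioo_of_le ht).2 (hf k))
    ((intervalIntegrable_iff_integrableOn_Ioo_of_le ht).2 (hg k))]
  simp [heat, mul_add]

lemma heatInt_smul (c : ℂ) (f : Path) (t : ℝ) : heatInt μ (c • f) t = c • heatInt μ f t := by
  funext k
  simp only [heatInt, Pi.smul_apply, smul_eq_mul]
  rw [← intervalIntegral.integral_const_mul]
  congr 1
  funext s
  simp only [heat, Pi.smul_apply, smul_eq_mul]
  ring

lemma Dat.F_eq (ν : ℂ) (d : Dat) : d.F χ ν = -ν • ((2 : ℂ) • (fun s => para χ (d.f ν s) (d.X .AB s))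
    + fun s => para χ (bar (d.f ν s)) (d.X .AA s)) := by
  funext s
  simp only [Dat.F, CGL.F, Dat.f, Pi.smul_apply, Pi.add_apply, bar_add, bar_smul, map_neg]

/-- The constraints on `IAA` and `IAB` turn both paraproducts in `com` into remainders, which are
more regular than their two constituents. -/
lemma Dat.com_eq (ν : ℂ) (d : Dat) {t : ℝ} (h0 : 0 ≤ t)
    (haa : duhamel μ (d.X .IAA 0) (d.X .AA) t = d.X .IAA t)
    (hab : duhamel μ (d.X .IAB 0) (d.X .AB) t = d.X .IAB t)
    (hf : ∀ k, IntegrableOn (fun s => heat μ (t - s) (para χ (d.f ν s) (d.X .AB s)) k) (Set.Ioo 0 t))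
    (hg : ∀ k, IntegrableOn (fun s => heat μ (t - s) (para χ (bar (d.f ν s)) (d.X .AA s)) k)
      (Set.Ioo 0 t)) :
    d.com χ μ ν t = heat μ t d.v₀ + ν • ((2 : ℂ) • (para χ (d.f ν t) (duhamel μ (d.X .IAB 0) (d.X .AB) t)
        - heatInt μ (fun s => para χ (d.f ν s) (d.X .AB s)) t)
      + (para χ (bar (d.f ν t)) (duhamel μ (d.X .IAA 0) (d.X .AA) t)
        - heatInt μ (fun s => para χ (bar (d.f ν s)) (d.X .AA s)) t)) := by
  have h1 : d.com χ μ ν t = heat μ t d.v₀ + heatInt μ (d.F χ ν) t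
      + ν • ((2 : ℂ) • para χ (d.f ν t) (d.X .IAB t) + para χ (bar (d.f ν t)) (d.X .IAA t)) := by
    simp only [Dat.com, CGL.com, M1, duhamel_eq, Dat.f, bar_add, bar_smul, map_neg, add_assoc]
    rfl
  rw [h1, Dat.F_eq, heatInt_smul, heatInt_add h0 (fun k => ?_) hg, heatInt_smul, haa, hab]
  · simp only [smul_add, smul_sub, neg_smul]
    abel
  · have := (hf k).const_mul 2
    refine this.congr (.of_forall fun s => ?_)
    simp only [heat, Pi.smul_apply, smul_eq_mul]
    ring

lemma XB.zero : XB χ κ 0 0 where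
  reg _ _ _ _ := bd_zero _
  hold s t _ _ _ := by simpa using bd_zero _

lemma LB.zero {T η α δ : ℝ} : LB χ T η α δ 0 0 where
  pt _ _ _ := by simpa using bd_zero _
  base _ _ _ := bd_zero _
  hold _ _ _ _ _ := by simpa using bd_zero _

/-- Bounded data as a pair at distance zero. -/
def Dat.Ok.diag {T : ℝ} {d : Dat} (h : d.Ok χ μ κ κ' R T) (hT : 0 < T ∧ T ≤ 1) : Pair χ μ κ κ' R where
  a := d
  b := d
  T := T
  D := 0
  hT := hT
  hD := le_rfl
  oka := h
  okb := h
  dv₀ := by rw [sub_self]; exact bd_zero _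
  dX := by rw [sub_self]; exact XB.zero
  dv := by rw [sub_self]; exact LB.zero
  dw := by rw [sub_self]; exact LB.zero

/-- `com(v,w)` is of regularity `1 + 2κ`, although both of its terms are only of regularity
`1 - κ`. -/
lemma estT_com (hμ : 0 < μ) (hκ : 0 < κ) (hκκ' : κ < κ') (hκ' : κ' < 1 / 18) (ν : ℂ) :
    EstT χ (Timed.t (χ := χ) (μ := μ) (κ := κ) (κ' := κ') (R := R)) Timed.D (1 + 2 * κ) (1 - κ' + κ)
      (fun j => j.a.com χ μ ν j.t) (fun j => j.b.com χ μ ν j.t) := by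
  have hf := estT_f (χ := χ) (μ := μ) (R := R) ν hκ hκκ' hκ' hκ.le (by linarith)
  obtain ⟨-, -, C₁, hC₁, hc₁⟩ := hf.para_pos (estT_driver .AB) hκ
  obtain ⟨-, -, C₂, hC₂, hc₂⟩ := hf.bar.para_pos (estT_driver .AA) hκ
  have key : ∀ (d : Dat) (T t : ℝ), d.Ok χ μ κ κ' R T → 0 < T ∧ T ≤ 1 → 0 < t → t ≤ T →
      d.com χ μ ν t = heat μ t d.v₀ + ν • ((2 : ℂ) • (para χ (d.f ν t) (duhamel μ (d.X .IAB 0) (d.X .AB) t)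
        - heatInt μ (fun s => para χ (d.f ν s) (d.X .AB s)) t)
      + (para χ (bar (d.f ν t)) (duhamel μ (d.X .IAA 0) (d.X .AA) t)
        - heatInt μ (fun s => para χ (bar (d.f ν s)) (d.X .AA s)) t)) := by
    intro d T t h hT h0 ht
    have hI : Set.Ioo 0 t ⊆ Set.Ioo 0 T := Set.Ioo_subset_Ioo le_rfl ht
    have hm := aemeasurable_f ν hκ hκκ' hκ' hT.2 h
    have hX := fun l => (h.meas l).mono_measure
      (Measure.restrict_mono (hI.trans (Set.Ioo_subset_Ioo le_rfl hT.2)) le_rfl)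
    have hm' := hm.mono_measure (Measure.restrict_mono hI le_rfl)
    exact d.com_eq ν h0.le (h.aa t ⟨h0.le, ht.trans hT.2⟩) (h.ab t ⟨h0.le, ht.trans hT.2⟩)
      (integrableOn_heat (A := C₁) (η := (κ + 2 / 3 - κ') / 2 + 0) hμ (by linarith) (by linarith) hC₁
        ⟨h0, ht.trans hT.2⟩ (aemeasurable_para hm' (hX .AB))
        fun s hs => (hc₁ ⟨(h.diag hT, s), hs.1, hs.2.le.trans ht⟩).1)
      (integrableOn_heat (A := C₂) (η := (κ + 2 / 3 - κ') / 2 + 0) hμ (by linarith) (by linarith) hC₂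
        ⟨h0, ht.trans hT.2⟩ (aemeasurable_para (aemeasurable_bar hm') (hX .AA))
        fun s hs => (hc₂ ⟨(h.diag hT, s), hs.1, hs.2.le.trans ht⟩).1)
  have e1 : (fun j : Timed χ μ κ κ' R => j.a.com χ μ ν j.t) = _ :=
    funext fun j => key j.a j.1.1.T j.t j.1.1.oka j.1.1.hT j.2.1 j.2.2
  have e2 : (fun j : Timed χ μ κ κ' R => j.b.com χ μ ν j.t) = _ :=
    funext fun j => key j.b j.1.1.T j.t j.1.1.okb j.1.1.hT j.2.1 j.2.2
  rw [e1, e2]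
  exact (estT_base hμ hκ hκκ' hκ').add ((((estT_remainder_AB hμ hκ hκκ' hκ' ν).smul 2).add
    (estT_remainder_AA hμ hκ hκκ' hκ' ν)).smul ν)

lemma estT_forcing_v (hκ : 0 < κ) (hκκ' : κ < κ') (hκ' : κ' < 1 / 18) (ν : ℂ) :
    EstT χ (Timed.t (χ := χ) (μ := μ) (κ := κ) (κ' := κ') (R := R)) Timed.D (-1 - κ) (5 / 6 - κ')
      (fun j => j.a.F χ ν j.t) (fun j => j.b.F χ ν j.t) := by
  have h1 : ∀ l : Label, EstT χ (Timed.t (χ := χ) (μ := μ) (κ := κ) (κ' := κ') (R := R)) Timed.D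
      (l.reg κ) 0 ((fun l j => j.a.X l j.t) l) ((fun l j => j.b.X l j.t) l) := fun l => estT_driver l
  have h2 := estT_u (χ := χ) (μ := μ) (R := R) hκκ' hκ' (γ := κ) (by linarith) (by linarith)
  have h3 := estT_F hκ hκκ' hκ' ν h1 h2
  exact h3

lemma estT_forcing_w (hμ : 0 < μ) (hκ : 0 < κ) (hκκ' : κ < κ') (hκ' : κ' < 1 / 18) (ν : ℂ) :
    EstT χ (Timed.t (χ := χ) (μ := μ) (κ := κ) (κ' := κ') (R := R)) Timed.D (-1 / 2 - 2 * κ)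
      (1 - κ' + κ) (fun j => j.a.G χ μ ν j.t) (fun j => j.b.G χ μ ν j.t) := by
  have h1 : ∀ l : Label, EstT χ (Timed.t (χ := χ) (μ := μ) (κ := κ) (κ' := κ') (R := R)) Timed.D
      (l.reg κ) 0 ((fun l j => j.a.X l j.t) l) ((fun l j => j.b.X l j.t) l) := fun l => estT_driver l
  have h2 := estT_u (χ := χ) (μ := μ) (R := R) hκκ' hκ' (γ := κ) (by linarith) (by linarith)
  have h3 := (estT_u (χ := χ) (μ := μ) (R := R) hκκ' hκ' (γ := 1 / 2 + 2 * κ) (by linarith)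
    (by linarith)).mono (b := (7 / 6 + 2 * κ - κ') / 2) le_rfl (by linarith)
  have h4 := (estT_w (χ := χ) (μ := μ) (κ := κ) (R := R) (γ := 3 / 2 - 2 * κ') (by linarith)
    le_rfl).mono (b := 1 - κ' + κ) le_rfl (by linarith)
  have h5 := estT_nonlinear hκ hκκ' hκ' ν h1 h2 h3 h4 (estT_com hμ hκ hκκ' hκ' ν)
  exact h5

end Forcing

end CGL

namespace CGL
open MeasureTheory UnitAddTorus

variable {χ : DyadicPartition}

section Forcing
variable {μ κ κ' R T : ℝ}

/-! #### Measurability of the forcing -/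

lemma aemeasurable_nonlinear {m : Measure ℝ} (ν : ℂ) {x : Label → Path} {u c w : Path} (hx : ∀ l, AEMeasurable (x l) m)
    (hu : AEMeasurable u m) (hw : AEMeasurable w m) (hc : AEMeasurable c m) :
    AEMeasurable (fun s => G1 χ ν (u s) + G2 χ ν (fun l => x l s) (u s) + G3 χ ν (fun l => x l s) (u s)
      + G4 χ ν (fun l => x l s) + G5 χ ν (fun l => x l s) (u s) + G6 χ ν (fun l => x l s) (c s)
      + G7 χ ν (fun l => x l s) (w s) + G8 χ ν (fun l => x l s) (u s)) m := by
  unfold G1 G2 G3 G4 G5 G6 G7 G8 WZ WZbar WWZbar WWbarZ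
  have hadd : ∀ {a b : Path}, AEMeasurable a m → AEMeasurable b m →
      AEMeasurable (fun s => a s + b s) m := fun ha hb => ha.add hb
  have hsub : ∀ {a b : Path}, AEMeasurable a m → AEMeasurable b m →
      AEMeasurable (fun s => a s - b s) m := fun ha hb => ha.sub hb
  have hsmul : ∀ (z : ℂ) {a : Path}, AEMeasurable a m → AEMeasurable (fun s => z • a s) m :=
    fun z _ ha => ha.const_smul z
  have hprod : ∀ {a b : Path}, AEMeasurable a m → AEMeasurable b m →
      AEMeasurable (fun s => prod χ (a s) (b s)) m := fun ha hb => aemeasurable_prod ha hb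
  repeat' with_reducible first
    | exact hx _
    | exact hu
    | exact hw
    | exact hc
    | apply hadd
    | apply hsub
    | apply hsmul
    | apply aemeasurable_bar
    | apply aemeasurable_para
    | apply aemeasurable_reso
    | apply hprod
    | apply aemeasurable_comm

lemma duhamel_zero (t : ℝ) : duhamel μ 0 (fun _ => 0) t = 0 := by
  funext k
  simp [duhamel, heat]

/-- The Schauder estimate for the difference of two mild integrals whose forcings agree up to the
time `τ`. -/
lemma exists_duhamel_lb (χ : DyadicPartition) (hμ : 0 < μ) {α β η δ : ℝ} (hη : 0 ≤ η) (hη1 : η < 1)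
    (hδ : 0 ≤ δ) (hδ1 : δ ≤ 1) (h1 : α < β + 2) (h2 : β ≤ α - 2 * η) (h3 : β ≤ α - 2 * δ) :
    ∃ C : ℝ, 0 ≤ C ∧ ∀ (f g : Path) (a b : Distr) (A A' E τ h T : ℝ), 0 ≤ A → 0 ≤ A' → 0 ≤ τ → 0 < h →
      T ≤ 1 → T ≤ τ + h → AEMeasurable f (volume.restrict (Set.Ioo 0 T)) →
      AEMeasurable g (volume.restrict (Set.Ioo 0 T)) →
      (∀ s ∈ Set.Ioo 0 T, Bd χ β (f s) (A' * s ^ (-η))) →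
      (∀ s ∈ Set.Ioo 0 T, Bd χ β (g s) (A' * s ^ (-η))) →
      (∀ s ∈ Set.Ioo 0 T, Bd χ β (f s - g s) (A * s ^ (-η))) → (∀ s ∈ Set.Ioo 0 τ, f s = g s) →
      Bd χ (α - 2 * η) (a - b) E →
      LB χ T η α δ (duhamel μ a f - duhamel μ b g) (C * E + C * A * h ^ (1 - (α - β) / 2)) := by
  obtain ⟨C₁, hC₁, hc₁⟩ := exists_heat_lb χ hμ (α := α) hη (by linarith) hδ hδ1
  obtain ⟨C₂, hC₂, hc₂⟩ := exists_heatInt_lb χ hμ hη hη1 hδ hδ1 h1 h2 h3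
  refine ⟨max C₁ C₂, le_max_of_le_left hC₁, fun f g a b A A' E τ h T hA hA' hτ hh hT hTh hf hg bf bg
    bfg hfg hab => ?_⟩
  have hE := hab.nonneg
  have k1 := (hc₁ T (a - b) E hT hab).mono (mul_le_mul_of_nonneg_right (le_max_left C₁ C₂) hE)
  have k2 := (hc₂ (f - g) A τ h T hA hτ hh hT hTh (hf.sub hg) bfg
    (fun s hs => sub_eq_zero.2 (hfg s hs))).mono (L := max C₁ C₂ * A * h ^ (1 - (α - β) / 2)) (by
      gcongr
      exact le_max_right _ _)
  refine (k1.add k2).congr fun t ht0 ht => ?_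
  have hI := Measure.restrict_mono (Set.Ioo_subset_Ioo (le_refl (0:ℝ)) ht) (le_refl (volume : Measure ℝ))
  have e := heatInt_sub hμ hη hη1 hA' ⟨ht0, ht.trans hT⟩ (hf.mono_measure hI) (hg.mono_measure hI)
    (fun s hs => bf s ⟨hs.1, hs.2.trans_le ht⟩) (fun s hs => bg s ⟨hs.1, hs.2.trans_le ht⟩)
  simp only [Pi.sub_apply, Pi.add_apply, duhamel_eq, heat_sub, ← e]
  abel

lemma Dat.Ok.aemeasurable_F (ν : ℂ) (hκ : 0 < κ) (hκκ' : κ < κ') (hκ' : κ' < 1 / 18) (hT : T ≤ 1)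
    {d : Dat} (h : d.Ok χ μ κ κ' R T) : AEMeasurable (d.F χ ν) (volume.restrict (Set.Ioo 0 T)) := by
  have hm := aemeasurable_f ν hκ hκκ' hκ' hT h
  have hX := fun l => (h.meas l).mono_measure
    (Measure.restrict_mono (Set.Ioo_subset_Ioo (le_refl (0:ℝ)) hT) (le_refl (volume : Measure ℝ)))
  rw [Dat.F_eq]
  exact (((aemeasurable_para hm (hX .AB)).const_smul (2 : ℂ)).add
    (aemeasurable_para (aemeasurable_bar hm) (hX .AA))).const_smul (-ν)

/-- The first component of the fixed point map is a contraction on short time intervals; the small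
factor only depends on the length of the interval after the time up to which the data agree. -/
lemma exists_map_v (χ : DyadicPartition) (hμ : 0 < μ) (hκ : 0 < κ) (hκκ' : κ < κ') (hκ' : κ' < 1 / 18)
    (ν : ℂ) : ∃ C : ℝ, 0 ≤ C ∧ ∀ R, ∃ K : ℝ, 0 ≤ K ∧
      (∀ (T B : ℝ) (d : Dat), 0 < T → T ≤ 1 → d.Ok χ μ κ κ' R T → Bd χ (-2 / 3 + κ') d.v₀ B →
        LB χ T (5 / 6 - κ') (1 - κ') (1 - κ' / 2) (duhamel μ d.v₀ (d.F χ ν))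
          (C * B + K * T ^ ((κ' - κ) / 2))) ∧
      ∀ (p : Pair χ μ κ κ' R) (E τ h : ℝ), 0 ≤ τ → 0 < h → p.T ≤ τ + h →
        Bd χ (-2 / 3 + κ') (p.a.v₀ - p.b.v₀) E → (∀ s ∈ Set.Ioo 0 τ, p.a.F χ ν s = p.b.F χ ν s) →
        LB χ p.T (5 / 6 - κ') (1 - κ') (1 - κ' / 2)
          (duhamel μ p.a.v₀ (p.a.F χ ν) - duhamel μ p.b.v₀ (p.b.F χ ν))
          (C * E + K * p.D * h ^ ((κ' - κ) / 2)) := by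
  obtain ⟨C, hC, hc⟩ := exists_duhamel_lb χ hμ (α := 1 - κ') (β := -1 - κ) (η := 5 / 6 - κ')
    (δ := 1 - κ' / 2) (by linarith) (by linarith) (by linarith) (by linarith) (by linarith)
    (by linarith) (by linarith)
  rw [show 1 - (1 - κ' - (-1 - κ)) / 2 = (κ' - κ) / 2 by ring,
    show 1 - κ' - 2 * (5 / 6 - κ') = -2 / 3 + κ' by ring] at hc
  refine ⟨C, hC, fun R => ?_⟩
  obtain ⟨-, -, A, hA, bA⟩ := estT_forcing_v (χ := χ) (μ := μ) (R := R) hκ hκκ' hκ' ν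
  refine ⟨C * A, by positivity, fun T B d h0 hT hd hB => ?_, fun p E τ h hτ hh hTh hE hF => ?_⟩
  · have hb := fun s (hs : s ∈ Set.Ioo 0 T) => (bA ⟨(hd.diag ⟨h0, hT⟩, s), hs.1, hs.2.le⟩).1
    have := hc (d.F χ ν) (fun _ => 0) d.v₀ 0 A A B 0 T T hA hA le_rfl h0 hT (by linarith)
      (hd.aemeasurable_F ν hκ hκκ' hκ' hT) aemeasurable_const hb
      (fun s hs => (bd_zero _).mono (mul_nonneg hA (Real.rpow_nonneg hs.1.le _)))
      (fun s hs => by rw [sub_zero]; exact hb s hs) (by simp) (by rwa [sub_zero])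
    exact this.congr fun t _ _ => by simp [duhamel_zero]
  · refine (hc (p.a.F χ ν) (p.b.F χ ν) p.a.v₀ p.b.v₀ (A * p.D) A E τ h p.T (mul_nonneg hA p.hD) hA hτ hh
      p.hT.2 hTh (p.oka.aemeasurable_F ν hκ hκκ' hκ' p.hT.2)
      (p.okb.aemeasurable_F ν hκ hκκ' hκ' p.hT.2) (fun s hs => (bA ⟨(p, s), hs.1, hs.2.le⟩).1)
      (fun s hs => (bA ⟨(p, s), hs.1, hs.2.le⟩).2.1) (fun s hs => ?_) hF hE).mono
      (le_of_eq (by ring))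
    exact (bA ⟨(p, s), hs.1, hs.2.le⟩).2.2.mono (le_of_eq (by simp only [Timed.t, Timed.D]; ring))

lemma Dat.Ok.aemeasurable_G (hμ : 0 < μ) (ν : ℂ) (hκ : 0 < κ) (hκκ' : κ < κ') (hκ' : κ' < 1 / 18)
    (h0 : 0 < T) (hT : T ≤ 1) {d : Dat} (h : d.Ok χ μ κ κ' R T) :
    AEMeasurable (d.G χ μ ν) (volume.restrict (Set.Ioo 0 T)) := by
  obtain ⟨C, -, hC⟩ := exists_map_v χ hμ hκ hκκ' hκ' ν
  obtain ⟨K, -, hK, -⟩ := hC R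
  have hM := (hK T R d h0 hT h h.v₀).aemeasurable (by linarith) (by linarith)
  have hX := fun l => (h.meas l).mono_measure
    (Measure.restrict_mono (Set.Ioo_subset_Ioo (le_refl (0:ℝ)) hT) (le_refl (volume : Measure ℝ)))
  have hv := h.v.aemeasurable (by linarith) (by linarith)
  have hw := h.w.aemeasurable (by linarith) (by linarith)
  have hc : AEMeasurable (d.com χ μ ν) (volume.restrict (Set.Ioo 0 T)) :=
    hM.add (((((aemeasurable_para ((((hX .IAAB).const_smul (-ν)).add hv).add hw) (hX .IAB)).const_smul
      (2 : ℂ))).add (aemeasurable_para (((aemeasurable_bar (hX .IAAB)).const_smul (-conj ν)).add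
      (aemeasurable_bar hv) |>.add (aemeasurable_bar hw)) (hX .IAA))).const_smul ν)
  exact aemeasurable_nonlinear (u := fun s => d.v s + d.w s) ν hX (hv.add hw) hw hc

/-- The second component of the fixed point map is a contraction on short time intervals. -/
lemma exists_map_w (χ : DyadicPartition) (hμ : 0 < μ) (hκ : 0 < κ) (hκκ' : κ < κ') (hκ' : κ' < 1 / 18)
    (ν : ℂ) : ∃ C : ℝ, 0 ≤ C ∧ ∀ R, ∃ K : ℝ, 0 ≤ K ∧
      (∀ (T B : ℝ) (d : Dat) (w₀ : Distr), 0 < T → T ≤ 1 → d.Ok χ μ κ κ' R T →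
        Bd χ (-1 / 2 - 2 * κ) w₀ B →
        LB χ T (1 - κ' + κ) (3 / 2 - 2 * κ') (1 - κ') (duhamel μ w₀ (d.G χ μ ν))
          (C * B + K * T ^ (κ' - κ))) ∧
      ∀ (p : Pair χ μ κ κ' R) (w₀ w₀' : Distr) (E τ h : ℝ), 0 ≤ τ → 0 < h → p.T ≤ τ + h →
        Bd χ (-1 / 2 - 2 * κ) (w₀ - w₀') E → (∀ s ∈ Set.Ioo 0 τ, p.a.G χ μ ν s = p.b.G χ μ ν s) →
        LB χ p.T (1 - κ' + κ) (3 / 2 - 2 * κ') (1 - κ')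
          (duhamel μ w₀ (p.a.G χ μ ν) - duhamel μ w₀' (p.b.G χ μ ν))
          (C * E + K * p.D * h ^ (κ' - κ)) := by
  obtain ⟨C, hC, hc⟩ := exists_duhamel_lb χ hμ (α := 3 / 2 - 2 * κ') (β := -1 / 2 - 2 * κ)
    (η := 1 - κ' + κ) (δ := 1 - κ') (by linarith) (by linarith) (by linarith) (by linarith)
    (by linarith) (by linarith) (by linarith)
  rw [show 1 - (3 / 2 - 2 * κ' - (-1 / 2 - 2 * κ)) / 2 = κ' - κ by ring,
    show 3 / 2 - 2 * κ' - 2 * (1 - κ' + κ) = -1 / 2 - 2 * κ by ring] at hc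
  refine ⟨C, hC, fun R => ?_⟩
  obtain ⟨-, -, A, hA, bA⟩ := estT_forcing_w (χ := χ) (μ := μ) (R := R) hμ hκ hκκ' hκ' ν
  refine ⟨C * A, by positivity, fun T B d w₀ h0 hT hd hB => ?_,
    fun p w₀ w₀' E τ h hτ hh hTh hE hF => ?_⟩
  · have hb := fun s (hs : s ∈ Set.Ioo 0 T) => (bA ⟨(hd.diag ⟨h0, hT⟩, s), hs.1, hs.2.le⟩).1
    have := hc (d.G χ μ ν) (fun _ => 0) w₀ 0 A A B 0 T T hA hA le_rfl h0 hT (by linarith)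
      (hd.aemeasurable_G hμ ν hκ hκκ' hκ' h0 hT) aemeasurable_const hb
      (fun s hs => (bd_zero _).mono (mul_nonneg hA (Real.rpow_nonneg hs.1.le _)))
      (fun s hs => by rw [sub_zero]; exact hb s hs) (by simp) (by rwa [sub_zero])
    exact this.congr fun t _ _ => by simp [duhamel_zero]
  · refine (hc (p.a.G χ μ ν) (p.b.G χ μ ν) w₀ w₀' (A * p.D) A E τ h p.T (mul_nonneg hA p.hD) hA hτ hh
      p.hT.2 hTh (p.oka.aemeasurable_G hμ ν hκ hκκ' hκ' p.hT.1 p.hT.2)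
      (p.okb.aemeasurable_G hμ ν hκ hκκ' hκ' p.hT.1 p.hT.2)
      (fun s hs => (bA ⟨(p, s), hs.1, hs.2.le⟩).1)
      (fun s hs => (bA ⟨(p, s), hs.1, hs.2.le⟩).2.1) (fun s hs => ?_) hF hE).mono
      (le_of_eq (by ring))
    exact (bA ⟨(p, s), hs.1, hs.2.le⟩).2.2.mono (le_of_eq (by simp only [Timed.t, Timed.D]; ring))

end Forcing

end CGL

namespace CGL
open MeasureTheory UnitAddTorus

variable {χ : DyadicPartition}

/-! ### The fixed point argument -/

/-- A sequence of paths whose increments decay geometrically converges. -/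
lemma LB.exists_limit {T η α δ D : ℝ} {u : ℕ → Path}
    (h : ∀ n, LB χ T η α δ (u (n + 1) - u n) (D / 2 ^ n)) :
    ∃ v : Path, ∀ n, LB χ T η α δ (v - u n) (2 * D / 2 ^ n) := by
  have htel : ∀ n k, LB χ T η α δ (u (n + k) - u n) (2 * D / 2 ^ n - 2 * D / 2 ^ (n + k)) := by
    intro n k
    induction k with
    | zero => simpa using LB.zero
    | succ k ih =>
      have := ih.add (h (n + k))
      rw [add_comm, sub_add_sub_cancel] at this
      refine this.mono (le_of_eq ?_)
      rw [← add_assoc, pow_succ]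
      field_simp
      ring
  have hD : 0 ≤ T → 0 ≤ D := fun hT => by simpa using ((h 0).base 0 le_rfl hT).nonneg
  have hlim : ∀ t, 0 ≤ t → t ≤ T → ∀ k, Filter.Tendsto (fun n => u n t k) Filter.atTop
      (𝓝 (Filter.limUnder Filter.atTop fun n => u n t k)) := by
    intro t h0 ht k
    obtain ⟨C, hC, hc⟩ := exists_coeff_bound χ (α - 2 * η) k
    refine CauchySeq.tendsto_limUnder (cauchySeq_of_le_geometric (1 / 2) (C * D) (by norm_num) fun n => ?_)
    rw [dist_comm, dist_eq_norm]
    refine (hc _ _ ((h n).base t h0 ht)).trans (le_of_eq ?_)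
    rw [div_pow, one_pow]
    ring
  refine ⟨fun t k => Filter.limUnder Filter.atTop fun n => u n t k, fun n => ?_⟩
  have hev : ∀ᶠ m in Filter.atTop, LB χ T η α δ (u m - u n) (2 * D / 2 ^ n) := by
    filter_upwards [Filter.eventually_ge_atTop n] with m hm
    obtain ⟨k, rfl⟩ := Nat.exists_eq_add_of_le hm
    by_cases hT : 0 ≤ T
    · have := hD hT
      exact (htel n k).mono (by linarith [show 0 ≤ 2 * D / 2 ^ (n + k) by positivity])
    · exact ⟨fun t h1 h2 => by linarith, fun t h1 h2 => by linarith, fun s t h1 h2 h3 => by linarith⟩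
  refine ⟨fun t h1 h2 => ?_, fun t h1 h2 => ?_, fun s t h1 h2 h3 => ?_⟩
  · exact Bd.of_tendsto (hev.mono fun m hm => hm.pt t h1 h2)
      fun k => (hlim t h1.le h2 k).sub_const _
  · exact Bd.of_tendsto (hev.mono fun m hm => hm.base t h1 h2)
      fun k => (hlim t h1 h2 k).sub_const _
  · exact Bd.of_tendsto (hev.mono fun m hm => hm.hold s t h1 h2 h3)
      fun k => ((hlim t (by linarith) h3 k).sub_const _).sub
        ((hlim s h1.le (by linarith) k).sub_const _)

/-- Quantitative membership in `D_T^{κ,κ'}`. -/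
structure DB (χ : DyadicPartition) (κ κ' T : ℝ) (v w : Path) (K : ℝ) : Prop where
  v : LB χ T (5 / 6 - κ') (1 - κ') (1 - κ' / 2) v K
  w : LB χ T (1 - κ' + κ) (3 / 2 - 2 * κ') (1 - κ') w K

/-- Initial values and driving vector. -/
structure Data where
  v₀ : Distr
  w₀ : Distr
  X : Label → Path

/-- The data are bounded by `N`, the driving paths are measurable, and the constraints
`I(X_0, X) = IX` on `IAA` and `IAB` hold. -/
structure Data.Ok (χ : DyadicPartition) (μ κ κ' N : ℝ) (p : Data) : Prop where
  v₀ : Bd χ (-2 / 3 + κ') p.v₀ N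
  w₀ : Bd χ (-1 / 2 - 2 * κ) p.w₀ N
  X : XB χ κ p.X N
  meas : ∀ l, AEMeasurable (p.X l) (volume.restrict (Set.Ioo 0 1))
  aa : ∀ t ∈ Set.Icc (0 : ℝ) 1, duhamel μ (p.X .IAA 0) (p.X .AA) t = p.X .IAA t
  ab : ∀ t ∈ Set.Icc (0 : ℝ) 1, duhamel μ (p.X .IAB 0) (p.X .AB) t = p.X .IAB t

/-- The data are at distance at most `E`. -/
structure Data.Near (χ : DyadicPartition) (κ κ' E : ℝ) (p q : Data) : Prop where
  v₀ : Bd χ (-2 / 3 + κ') (p.v₀ - q.v₀) E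
  w₀ : Bd χ (-1 / 2 - 2 * κ) (p.w₀ - q.w₀) E
  X : XB χ κ (p.X - q.X) E

/-- The first component of the fixed point map. -/
def Data.M1 (χ : DyadicPartition) (μ : ℝ) (ν : ℂ) (p : Data) (v w : Path) : Path :=
  CGL.M1 χ μ ν p.v₀ p.X v w

/-- The second component of the fixed point map. -/
def Data.M2 (χ : DyadicPartition) (μ : ℝ) (ν : ℂ) (p : Data) (v w : Path) : Path :=
  CGL.M2 χ μ ν p.v₀ p.w₀ p.X v w

section FixedPoint
variable {μ κ κ' T K L N R : ℝ} {v w v' w' : Path} {p q : Data}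

lemma DB.mono (h : DB χ κ κ' T v w K) (hK : K ≤ L) : DB χ κ κ' T v w L := ⟨h.v.mono hK, h.w.mono hK⟩

lemma DB.sub (h : DB χ κ κ' T v w K) (h' : DB χ κ κ' T v' w' L) :
    DB χ κ κ' T (v - v') (w - w') (K + L) := ⟨h.v.sub h'.v, h.w.sub h'.w⟩

lemma DB.zero : DB χ κ κ' T 0 0 0 := ⟨LB.zero, LB.zero⟩

lemma DB.restrict {T' : ℝ} (h : DB χ κ κ' T v w K) (hT : T' ≤ T) : DB χ κ κ' T' v w K :=
  ⟨h.v.restrict hT, h.w.restrict hT⟩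

lemma DB.congr (h : DB χ κ κ' T v w K) (hv : ∀ t ∈ Set.Icc 0 T, v' t = v t)
    (hw : ∀ t ∈ Set.Icc 0 T, w' t = w t) : DB χ κ κ' T v' w' K :=
  ⟨h.v.congr fun t h0 h1 => hv t ⟨h0, h1⟩, h.w.congr fun t h0 h1 => hw t ⟨h0, h1⟩⟩

lemma DB.nonneg (h : DB χ κ κ' T v w K) (hT : 0 ≤ T) : 0 ≤ K := (h.v.base 0 le_rfl hT).nonneg

lemma DB.eq_zero (h : ∀ ε : ℝ, 0 < ε → DB χ κ κ' T v w ε) :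
    ∀ t ∈ Set.Icc 0 T, v t = 0 ∧ w t = 0 := fun t ht =>
  ⟨eq_zero_of_bd fun ε hε => (h ε hε).v.base t ht.1 ht.2,
    eq_zero_of_bd fun ε hε => (h ε hε).w.base t ht.1 ht.2⟩

/-- An estimate that improves itself by a contraction. -/
lemma DB.of_contraction {a : ℝ} (ha : 0 ≤ a) (h0 : DB χ κ κ' T v w K)
    (h : ∀ L, DB χ κ κ' T v w L → DB χ κ κ' T v w (a + L / 2)) {ε : ℝ} (hε : 0 < ε) :
    DB χ κ κ' T v w (2 * a + ε) := by
  have key : ∀ n : ℕ, DB χ κ κ' T v w (2 * a + K * (1 / 2) ^ n) := by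
    intro n
    induction n with
    | zero => exact h0.mono (by simpa using ha)
    | succ n ih =>
      refine (h _ ih).mono (le_of_eq ?_)
      rw [pow_succ]
      ring
  have h1 : Filter.Tendsto (fun n : ℕ => K * (1 / 2 : ℝ) ^ n) Filter.atTop (𝓝 (K * 0)) :=
    (tendsto_pow_atTop_nhds_zero_of_lt_one (by norm_num) (by norm_num)).const_mul K
  rw [mul_zero] at h1
  obtain ⟨n, hn⟩ := (h1.eventually (ge_mem_nhds hε)).exists
  exact (key n).mono (by linarith)

lemma Data.Ok.dat (h : p.Ok χ μ κ κ' N) (hN : N ≤ R) (hv : DB χ κ κ' T v w R) :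
    Dat.Ok χ μ κ κ' R T ⟨p.v₀, p.X, v, w⟩ where
  v₀ := h.v₀.mono hN
  X := ⟨fun l t h0 h1 => (h.X.reg l t h0 h1).mono hN, fun s t h0 h1 h2 => (h.X.hold s t h0 h1 h2).mono
    (mul_le_mul_of_nonneg_right hN (Real.rpow_nonneg (sub_nonneg.2 h1.le) _))⟩
  meas := h.meas
  aa := h.aa
  ab := h.ab
  v := hv.v
  w := hv.w

lemma XB.mono {X : Label → Path} (h : XB χ κ X K) (hK : K ≤ L) : XB χ κ X L where
  reg l t h0 h1 := (h.reg l t h0 h1).mono hK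
  hold s t h0 h1 h2 := (h.hold s t h0 h1 h2).mono
    (mul_le_mul_of_nonneg_right hK (Real.rpow_nonneg (sub_nonneg.2 h1.le) _))

lemma Data.Near.refl (p : Data) : p.Near χ κ κ' 0 p where
  v₀ := by rw [sub_self]; exact bd_zero _
  w₀ := by rw [sub_self]; exact bd_zero _
  X := by rw [sub_self]; exact XB.zero

/-- The forcings only depend on the past. -/
lemma forcing_congr (μ : ℝ) (ν : ℂ) (v₀ : Distr) (X : Label → Path) {τ : ℝ}
    (h : ∀ s ∈ Set.Ioo 0 τ, v s = v' s ∧ w s = w' s) : ∀ s ∈ Set.Ioo 0 τ,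
      Dat.F χ ν ⟨v₀, X, v, w⟩ s = Dat.F χ ν ⟨v₀, X, v', w'⟩ s ∧
      Dat.G χ μ ν ⟨v₀, X, v, w⟩ s = Dat.G χ μ ν ⟨v₀, X, v', w'⟩ s := by
  intro s hs
  obtain ⟨h1, h2⟩ := h s hs
  refine ⟨by simp only [Dat.F, h1, h2], ?_⟩
  have h3 : CGL.M1 χ μ ν v₀ X v w s = CGL.M1 χ μ ν v₀ X v' w' s := by
    funext k
    simp only [CGL.M1, duhamel]
    congr 1
    refine intervalIntegral.integral_congr_Ioo_of_le hs.1.le fun r hr => ?_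
    obtain ⟨h4, h5⟩ := h r ⟨hr.1, hr.2.trans hs.2⟩
    simp only [h4, h5]
  simp only [Dat.G, CGL.G, CGL.com, h1, h2, h3]

/-- The fixed point map is a contraction on short time intervals. -/
lemma exists_map_db (χ : DyadicPartition) (hμ : 0 < μ) (hκ : 0 < κ) (hκκ' : κ < κ') (hκ' : κ' < 1 / 18)
    (ν : ℂ) : ∃ C : ℝ, 0 ≤ C ∧ ∀ R, ∃ K : ℝ, 0 ≤ K ∧
      (∀ (T B : ℝ) (p : Data) (v w : Path), 0 < T → T ≤ 1 → p.Ok χ μ κ κ' R → DB χ κ κ' T v w R →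
        Bd χ (-2 / 3 + κ') p.v₀ B → Bd χ (-1 / 2 - 2 * κ) p.w₀ B →
        DB χ κ κ' T (p.M1 χ μ ν v w) (p.M2 χ μ ν v w) (C * B + K * T ^ ((κ' - κ) / 2))) ∧
      ∀ (T E D τ h : ℝ) (p q : Data) (v w v' w' : Path), 0 < T → T ≤ 1 → 0 ≤ τ → 0 < h → h ≤ 1 →
        T ≤ τ + h → p.Ok χ μ κ κ' R → q.Ok χ μ κ κ' R → DB χ κ κ' T v w R → DB χ κ κ' T v' w' R →
        p.Near χ κ κ' E q → DB χ κ κ' T (v - v') (w - w') D →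
        (τ = 0 ∨ p = q ∧ ∀ s ∈ Set.Ioo 0 τ, v s = v' s ∧ w s = w' s) →
        DB χ κ κ' T (p.M1 χ μ ν v w - q.M1 χ μ ν v' w') (p.M2 χ μ ν v w - q.M2 χ μ ν v' w')
          (C * E + K * (E + D) * h ^ ((κ' - κ) / 2)) := by
  obtain ⟨C₁, hC₁, h1⟩ := exists_map_v χ hμ hκ hκκ' hκ' ν
  obtain ⟨C₂, hC₂, h2⟩ := exists_map_w χ hμ hκ hκκ' hκ' ν
  refine ⟨max C₁ C₂, le_max_of_le_left hC₁, fun R => ?_⟩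
  obtain ⟨K₁, hK₁, h1, h1'⟩ := h1 R
  obtain ⟨K₂, hK₂, h2, h2'⟩ := h2 R
  have hpow : ∀ h : ℝ, 0 < h → h ≤ 1 → h ^ (κ' - κ) ≤ h ^ ((κ' - κ) / 2) := fun h h0 h1 =>
    Real.rpow_le_rpow_of_exponent_ge h0 h1 (by linarith)
  have hC₁' := le_max_left C₁ C₂
  have hC₂' := le_max_right C₁ C₂
  have hK₁' := le_max_left K₁ K₂
  have hK₂' := le_max_right K₁ K₂
  refine ⟨max K₁ K₂, le_max_of_le_left hK₁, fun T B p v w h0 hT hp hv hB hB' => ⟨?_, ?_⟩,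
    fun T E D τ h p q v w v' w' h0 hT hτ hh hh1 hTh hp hq hv hv' hpq hD hpast => ?_⟩
  · have hB0 := hB.nonneg
    refine (h1 T B ⟨p.v₀, p.X, v, w⟩ h0 hT (hp.dat le_rfl hv) hB).mono ?_
    gcongr
  · have hB0 := hB.nonneg
    refine (h2 T B ⟨p.v₀, p.X, v, w⟩ p.w₀ h0 hT (hp.dat le_rfl hv) hB').mono ?_
    have := hpow T h0 hT
    gcongr
  · have hE := hpq.v₀.nonneg
    have hD0 := hD.nonneg h0.le
    let P : Pair χ μ κ κ' R :=
      { a := ⟨p.v₀, p.X, v, w⟩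
        b := ⟨q.v₀, q.X, v', w'⟩
        T := T
        D := E + D
        hT := ⟨h0, hT⟩
        hD := by positivity
        oka := hp.dat le_rfl hv
        okb := hq.dat le_rfl hv'
        dv₀ := hpq.v₀.mono (by linarith)
        dX := hpq.X.mono (by linarith)
        dv := hD.v.mono (by linarith)
        dw := hD.w.mono (by linarith) }
    have hF : ∀ s ∈ Set.Ioo 0 τ, P.a.F χ ν s = P.b.F χ ν s ∧ P.a.G χ μ ν s = P.b.G χ μ ν s := by
      rcases hpast with rfl | ⟨rfl, hpast⟩
      · simp
      · exact forcing_congr μ ν p.v₀ p.X hpast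
    refine ⟨(h1' P E τ h hτ hh hTh hpq.v₀ fun s hs => (hF s hs).1).mono ?_,
      (h2' P p.w₀ q.w₀ E τ h hτ hh hTh hpq.w₀ fun s hs => (hF s hs).2).mono ?_⟩
    · change C₁ * E + K₁ * (E + D) * _ ≤ _
      gcongr
    · change C₂ * E + K₂ * (E + D) * _ ≤ _
      have := hpow h hh hh1
      gcongr

/-- `(v,w)` is a fixed point on `[0,T]`. -/
def Data.IsFixed (χ : DyadicPartition) (μ : ℝ) (ν : ℂ) (T : ℝ) (p : Data) (v w : Path) : Prop :=
  ∀ t ∈ Set.Icc 0 T, v t = p.M1 χ μ ν v w t ∧ w t = p.M2 χ μ ν v w t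

lemma Data.IsFixed.restrict {ν : ℂ} {T' : ℝ} (h : p.IsFixed χ μ ν T v w) (hT : T' ≤ T) :
    p.IsFixed χ μ ν T' v w := fun t ht => h t ⟨ht.1, ht.2.trans hT⟩

lemma Data.IsFixed.sub_db {ν : ℂ} (h : p.IsFixed χ μ ν T v w) (h' : q.IsFixed χ μ ν T v' w')
    (hM : DB χ κ κ' T (p.M1 χ μ ν v w - q.M1 χ μ ν v' w') (p.M2 χ μ ν v w - q.M2 χ μ ν v' w') K) :
    DB χ κ κ' T (v - v') (w - w') K :=
  hM.congr (fun t ht => by rw [Pi.sub_apply, Pi.sub_apply, ← (h t ht).1, ← (h' t ht).1])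
    fun t ht => by rw [Pi.sub_apply, Pi.sub_apply, ← (h t ht).2, ← (h' t ht).2]

lemma Data.Ok.mono (h : p.Ok χ μ κ κ' N) (hN : N ≤ R) : p.Ok χ μ κ κ' R where
  v₀ := h.v₀.mono hN
  w₀ := h.w₀.mono hN
  X := h.X.mono hN
  meas := h.meas
  aa := h.aa
  ab := h.ab

lemma exists_small_rpow {ε K : ℝ} (hε : 0 < ε) (hK : 0 ≤ K) :
    ∃ h : ℝ, 0 < h ∧ h ≤ 1 ∧ ∀ t, 0 < t → t ≤ h → K * t ^ ε ≤ 1 / 2 := by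
  refine ⟨min 1 ((1 / (2 * (K + 1))) ^ (1 / ε)), lt_min one_pos (by positivity), min_le_left _ _,
    fun t h0 ht => ?_⟩
  have h1 : t ^ ε ≤ 1 / (2 * (K + 1)) := by
    refine (Real.rpow_le_rpow h0.le (ht.trans (min_le_right _ _)) hε.le).trans (le_of_eq ?_)
    rw [← Real.rpow_mul (by positivity), one_div_mul_cancel hε.ne', Real.rpow_one]
  refine (mul_le_mul_of_nonneg_left h1 hK).trans ?_
  rw [mul_one_div, div_le_iff₀ (by positivity)]
  linarith

/-- Two fixed points agree. They may be large, so the contraction is used on short windows, the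
lengths of which depend on their size. -/
lemma Data.IsFixed.unique (hμ : 0 < μ) (hκ : 0 < κ) (hκκ' : κ < κ') (hκ' : κ' < 1 / 18) {ν : ℂ}
    (hT0 : 0 < T) (hT : T ≤ 1) (hp : p.Ok χ μ κ κ' N) (hv : DB χ κ κ' T v w K)
    (hv' : DB χ κ κ' T v' w' L) (h : p.IsFixed χ μ ν T v w) (h' : p.IsFixed χ μ ν T v' w') :
    ∀ t ∈ Set.Icc 0 T, v t = v' t ∧ w t = w' t := by
  obtain ⟨C, hC, hc⟩ := exists_map_db χ hμ hκ hκκ' hκ' ν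
  set R := max N (max K L)
  obtain ⟨M, hM, -, hm⟩ := hc R
  obtain ⟨δ, hδ, hδ1, hsmall⟩ := exists_small_rpow (ε := (κ' - κ) / 2) (by linarith) hM
  have hp' : p.Ok χ μ κ κ' R := hp.mono (le_max_left _ _)
  have hvR := hv.mono (L := R) ((le_max_left _ _).trans (le_max_right _ _))
  have hvR' := hv'.mono (L := R) ((le_max_right _ _).trans (le_max_right _ _))
  have step : ∀ τ T', 0 ≤ τ → 0 < T' → T' ≤ T → T' ≤ τ + δ →
      (τ = 0 ∨ ∀ s ∈ Set.Ioo 0 τ, v s = v' s ∧ w s = w' s) →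
      ∀ t ∈ Set.Icc 0 T', v t = v' t ∧ w t = w' t := by
    intro τ T' hτ h0 hT' hTδ hpast
    have hz := DB.eq_zero (χ := χ) (κ := κ) (κ' := κ') (T := T') (v := v - v') (w := w - w') fun ε hε => by
      have := DB.of_contraction (a := 0) le_rfl ((hvR.sub hvR').restrict hT') (fun D hD => ?_) hε
      · simpa using this
      · have hD0 := hD.nonneg h0.le
        refine ((h.restrict hT').sub_db (h'.restrict hT') (hm T' 0 D τ δ p p v w v' w' h0
          (hT'.trans hT) hτ hδ hδ1 hTδ hp' hp' (hvR.restrict hT') (hvR'.restrict hT')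
          (Data.Near.refl p) hD (hpast.imp_right fun h => ⟨rfl, h⟩))).mono ?_
        have := hsmall δ hδ le_rfl
        nlinarith
    exact fun t ht => ⟨sub_eq_zero.1 (hz t ht).1, sub_eq_zero.1 (hz t ht).2⟩
  have key : ∀ j : ℕ, ∀ t ∈ Set.Icc 0 (min ((j + 1) * δ) T), v t = v' t ∧ w t = w' t := by
    intro j
    induction j with
    | zero =>
      exact step 0 _ le_rfl (lt_min (by positivity) hT0) (min_le_right _ _)
        ((min_le_left _ _).trans (by simp)) (.inl rfl)
    | succ j ih =>
      refine step (min ((j + 1) * δ) T) _ (le_min (by positivity) hT0.le)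
        (lt_min (by positivity) hT0) (min_le_right _ _) ?_ (.inr fun s hs => ih s ⟨hs.1.le, hs.2.le⟩)
      rcases le_total ((j + 1) * δ) T with hj | hj
      · rw [min_eq_left hj]
        refine (min_le_left _ _).trans (le_of_eq ?_)
        push_cast
        ring
      · rw [min_eq_right hj]
        exact (min_le_right _ _).trans (by linarith)
  obtain ⟨j, hj⟩ := exists_nat_gt (T / δ)
  have := key j
  rwa [min_eq_right] at this
  rw [div_lt_iff₀ hδ] at hj
  nlinarith

/-- Local existence, together with the stability of small fixed points. -/
lemma exists_local_solution (χ : DyadicPartition) (hμ : 0 < μ) (hκ : 0 < κ) (hκκ' : κ < κ')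
    (hκ' : κ' < 1 / 18) (ν : ℂ) : ∃ C : ℝ, 0 ≤ C ∧ ∀ N, 0 ≤ N → ∃ T₀ : ℝ, 0 < T₀ ∧ T₀ ≤ 1 ∧
      (∀ (T : ℝ) (p : Data), 0 < T → T ≤ T₀ → p.Ok χ μ κ κ' N → ∃ v w, p.IsFixed χ μ ν T v w ∧
        DB χ κ κ' T v w (C * N + N + 1) ∧
        ∀ B, Bd χ (-2 / 3 + κ') p.v₀ B → Bd χ (-1 / 2 - 2 * κ) p.w₀ B →
          DB χ κ κ' T v w (C * B + 1)) ∧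
      ∀ (T E : ℝ) (p q : Data) (v w v' w' : Path), 0 < T → T ≤ T₀ → 0 < E → p.Ok χ μ κ κ' N →
        q.Ok χ μ κ κ' N → p.IsFixed χ μ ν T v w → q.IsFixed χ μ ν T v' w' →
        DB χ κ κ' T v w (C * N + N + 1) → DB χ κ κ' T v' w' (C * N + N + 1) → p.Near χ κ κ' E q →
        DB χ κ κ' T (v - v') (w - w') ((2 * C + 2) * E) := by
  obtain ⟨C, hC, hc⟩ := exists_map_db χ hμ hκ hκκ' hκ' ν
  refine ⟨C, hC, fun N hN => ?_⟩
  set R := C * N + N + 1 with hR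
  have hNR : N ≤ R := by nlinarith
  have hR0 : 0 ≤ R := by linarith
  -- the first iterate vanishes, so the limit of the iterates lies in the ball of radius `4 R`
  obtain ⟨K, hK, hs, hd⟩ := hc (4 * R)
  have hR4 : R ≤ 4 * R := by linarith
  obtain ⟨T₀, hT₀, hT₁, hsmall⟩ := exists_small_rpow (ε := (κ' - κ) / 2) (by linarith) hK
  refine ⟨T₀, hT₀, hT₁, fun T p h0 hT hp => ?_,
    fun T E p q v w v' w' h0 hT hE hp hq hv hv' hb hb' hpq => ?_⟩
  · have hTs := hsmall T h0 hT
    have hp' := hp.mono (hNR.trans hR4)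
    let u : ℕ → Path × Path := fun n =>
      (fun u : Path × Path => (p.M1 χ μ ν u.1 u.2, p.M2 χ μ ν u.1 u.2))^[n] (0, 0)
    have hu : ∀ n, u (n + 1) = (p.M1 χ μ ν (u n).1 (u n).2, p.M2 χ μ ν (u n).1 (u n).2) := fun n =>
      Function.iterate_succ_apply' _ _ _
    have hu1 : ∀ n, (u (n + 1)).1 = p.M1 χ μ ν (u n).1 (u n).2 := fun n => by rw [hu]
    have hu2 : ∀ n, (u (n + 1)).2 = p.M2 χ μ ν (u n).1 (u n).2 := fun n => by rw [hu]
    have hball : ∀ n, DB χ κ κ' T (u n).1 (u n).2 R := by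
      intro n
      induction n with
      | zero => exact DB.zero.mono hR0
      | succ n ih =>
        rw [hu]
        refine (hs T N p _ _ h0 (hT.trans hT₁) hp' (ih.mono hR4) hp.v₀ hp.w₀).mono ?_
        linarith
    have hM : ∀ (D : ℝ) (v w v' w' : Path), DB χ κ κ' T v w (4 * R) →
        DB χ κ κ' T v' w' (4 * R) → DB χ κ κ' T (v - v') (w - w') D →
        DB χ κ κ' T (p.M1 χ μ ν v w - p.M1 χ μ ν v' w') (p.M2 χ μ ν v w - p.M2 χ μ ν v' w') (D / 2) := by
      intro D v w v' w' h1 h2 h3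
      have hD0 := h3.nonneg h0.le
      refine (hd T 0 D 0 T p p v w v' w' h0 (hT.trans hT₁) le_rfl h0 (hT.trans hT₁) (by simp) hp' hp'
        h1 h2 (Data.Near.refl p) h3 (.inl rfl)).mono ?_
      nlinarith
    have hinc : ∀ n, DB χ κ κ' T ((u (n + 1)).1 - (u n).1) ((u (n + 1)).2 - (u n).2)
        (2 * R / 2 ^ n) := by
      intro n
      induction n with
      | zero => exact ((hball 1).sub (hball 0)).mono (le_of_eq (by ring))
      | succ n ih =>
        have := hM _ _ _ _ _ ((hball (n + 1)).mono hR4) ((hball n).mono hR4) ih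
        rw [← hu1, ← hu2, ← hu1, ← hu2] at this
        refine this.mono (le_of_eq ?_)
        rw [pow_succ]
        field_simp
    obtain ⟨v, hv⟩ := LB.exists_limit (u := fun n => (u n).1) fun n => (hinc n).v
    obtain ⟨w, hw⟩ := LB.exists_limit (u := fun n => (u n).2) fun n => (hinc n).w
    have hlim : ∀ n, DB χ κ κ' T (v - (u n).1) (w - (u n).2) (2 * (2 * R) / 2 ^ n) := fun n =>
      ⟨hv n, hw n⟩
    have hvw : DB χ κ κ' T v w (4 * R) := by
      have h0 := hlim 0
      rw [show u 0 = (0, 0) from rfl, sub_zero, sub_zero] at h0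
      exact h0.mono (le_of_eq (by ring))
    have hz := DB.eq_zero (χ := χ) (κ := κ) (κ' := κ') (T := T) (v := v - p.M1 χ μ ν v w)
      (w := w - p.M2 χ μ ν v w) fun ε hε => by
        have ht : Filter.Tendsto (fun n : ℕ => 4 * R * (1 / 2 : ℝ) ^ n) Filter.atTop (𝓝 (4 * R * 0)) :=
          (tendsto_pow_atTop_nhds_zero_of_lt_one (by norm_num) (by norm_num)).const_mul _
        rw [mul_zero] at ht
        obtain ⟨n, hn⟩ := (ht.eventually (ge_mem_nhds hε)).exists
        have h1 := hM _ _ _ _ _ hvw ((hball n).mono hR4) (hlim n)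
        rw [← hu1, ← hu2] at h1
        have h2 := (hlim (n + 1)).sub h1
        rw [sub_sub_sub_cancel_right, sub_sub_sub_cancel_right] at h2
        refine h2.mono (le_trans (le_of_eq ?_) hn)
        rw [pow_succ, div_pow, one_pow]
        field_simp
        ring
    have hfix : p.IsFixed χ μ ν T v w := fun t ht =>
      ⟨sub_eq_zero.1 (hz t ht).1, sub_eq_zero.1 (hz t ht).2⟩
    have hbd : ∀ B, Bd χ (-2 / 3 + κ') p.v₀ B → Bd χ (-1 / 2 - 2 * κ) p.w₀ B →
        DB χ κ κ' T v w (C * B + 1) := fun B hB hB' =>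
      ((hs T B p v w h0 (hT.trans hT₁) hp' hvw hB hB').mono (by linarith)).congr
        (fun t ht => (hfix t ht).1) fun t ht => (hfix t ht).2
    exact ⟨v, w, hfix, (hbd N hp.v₀ hp.w₀).mono (by linarith), hbd⟩
  · have hTs := hsmall T h0 hT
    refine (DB.of_contraction (a := C * E + E / 2) (ε := E) (by positivity) (hb.sub hb')
      (fun D hD => ?_) hE).mono (le_of_eq (by ring))
    have hD0 := hD.nonneg h0.le
    refine (hv.sub_db hv' (hd T E D 0 T p q v w v' w' h0 (hT.trans hT₁) le_rfl h0 (hT.trans hT₁)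
      (by simp) (hp.mono (hNR.trans hR4)) (hq.mono (hNR.trans hR4))
      (hb.mono hR4) (hb'.mono hR4) hpq hD (.inl rfl))).mono ?_
    nlinarith

end FixedPoint

end CGL

namespace CGL
open MeasureTheory UnitAddTorus

variable {χ : DyadicPartition}

/-! ### From the estimates to the function spaces -/

section Spaces
variable {μ κ κ' T K N R : ℝ} {v w : Path} {p : Data}

/-- Mild integrals belong to `L_T^{η,α,δ}`: at positive times they are slightly more regular than
required, and the forcing does not contribute at time `0`. -/
lemma LB.memLExp_of_duhamel (hμ : 0 < μ) {α β η δ A : ℝ} {u f : Path} {a : Distr} (hη : 0 ≤ η)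
    (hη1 : η < 1) (hδ : 0 < δ) (hδ1 : δ ≤ 1) (h1 : α < β + 2) (h2 : β ≤ α - 2 * η)
    (h3 : β ≤ α - 2 * δ) (hT0 : 0 < T) (hT : T ≤ 1) (hA : 0 ≤ A) (hα : α - 2 * η < 2)
    (hf : AEMeasurable f (volume.restrict (Set.Ioo 0 T)))
    (bf : ∀ s ∈ Set.Ioo 0 T, Bd χ β (f s) (A * s ^ (-η))) (ha : MemC χ (α - 2 * η) a)
    (hu : ∀ t ∈ Set.Icc 0 T, u t = duhamel μ a f t) (h : LB χ T η α δ u K) :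
    MemLExp χ T η α δ u := by
  obtain ⟨B, hB⟩ := ha.exists_bd (by linarith)
  have hB0 := hB.nonneg
  obtain ⟨C₁, hC₁, hc₁⟩ := exists_heat_bd χ hμ
  -- `γ` is an exponent between `α` and `β + 2`
  set γ := (α + (β + 2)) / 2 with hγ
  obtain ⟨C₂, hC₂, hc₂⟩ := exists_window_bd χ hμ hη hη1 (γ := γ) (β := β) (by linarith) (by linarith)
  obtain ⟨C₃, hC₃, hc₃⟩ := exists_heatInt_lb χ hμ hη hη1 hδ.le hδ1 h1 h2 h3
  have hm : ∀ t ≤ T, AEMeasurable f (volume.restrict (Set.Ioo 0 t)) := fun t ht =>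
    hf.mono_measure (Measure.restrict_mono (Set.Ioo_subset_Ioo le_rfl ht) le_rfl)
  have u0 : u 0 = a := by
    rw [hu 0 ⟨le_rfl, hT0.le⟩, duhamel_eq, heat_zero_time, heatInt_zero, add_zero]
  refine h.memLExp hT0 hη hδ (α' := γ) (K' := C₁ * B + C₂ * A) (σ := (γ - (α - 2 * η)) / 2)
    (by linarith) (by linarith) (fun t h0 ht => ?_) (by rwa [u0]) fun ε hε => ?_
  · rw [hu t ⟨h0.le, ht⟩, duhamel_eq]
    have k1 := hc₁ t h0 (ht.trans hT) (α - 2 * η) γ (by linarith) (by linarith) a B hB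
    have k2 := (hc₂ f A 0 t 0 t hA le_rfl h0 le_rfl h0 (ht.trans hT) (by linarith) (hm t ht)
      (fun s hs => bf s ⟨hs.1, hs.2.trans_le ht⟩) (by simp)).2
    rw [sub_zero, min_self, ← Real.rpow_add h0] at k2
    have k3 : t ^ (-η + (1 - (γ - β) / 2)) ≤ t ^ (-((γ - (α - 2 * η)) / 2)) :=
      Real.rpow_le_rpow_of_exponent_ge h0 (ht.trans hT) (by linarith)
    refine (k1.add k2).mono ?_
    have := mul_le_mul_of_nonneg_left k3 (mul_nonneg hC₂ hA)
    linarith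
  · obtain ⟨h₀, hh₀, hb⟩ := ha.eventually_heat hμ hα (half_pos hε)
    have he : 0 < 1 - (α - β) / 2 := by linarith
    have hlim : Filter.Tendsto (fun t : ℝ => C₃ * A * t ^ (1 - (α - β) / 2)) (𝓝 0) (𝓝 0) := by
      have : Continuous fun t : ℝ => C₃ * A * t ^ (1 - (α - β) / 2) :=
        continuous_const.mul (Real.continuous_rpow_const he.le)
      simpa [Real.zero_rpow he.ne'] using this.tendsto 0
    obtain ⟨r, hr, hrb⟩ := Metric.eventually_nhds_iff.1 (hlim.eventually (ge_mem_nhds (half_pos hε)))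
    refine ⟨min h₀ (r / 2), lt_min hh₀ (by positivity), fun t h0 ht htT => ?_⟩
    rw [u0, hu t ⟨h0, htT⟩, duhamel_eq, add_sub_right_comm, ← add_halves ε]
    refine (hb t h0 (ht.trans (min_le_left _ _))).add ?_
    rcases h0.eq_or_lt with rfl | h0
    · rw [heatInt_zero]
      exact (bd_zero _).mono (by linarith)
    · refine ((hc₃ f A 0 t t hA le_rfl h0 (htT.trans hT) (by linarith) (hm t htT)
        (fun s hs => bf s ⟨hs.1, hs.2.trans_le htT⟩) (by simp)).base t h0.le le_rfl).mono (hrb ?_)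
      rw [dist_zero_right, Real.norm_of_nonneg h0.le]
      linarith [ht.trans (min_le_right _ _)]

lemma Data.IsFixed.isSolution (hμ : 0 < μ) (hκ : 0 < κ) (hκκ' : κ < κ') (hκ' : κ' < 1 / 18) {ν : ℂ}
    (hT0 : 0 < T) (hT : T ≤ 1) (hp : p.Ok χ μ κ κ' N) (hv₀ : MemC χ (-2 / 3 + κ') p.v₀)
    (hw₀ : MemC χ (-1 / 2 - 2 * κ) p.w₀) (h : p.IsFixed χ μ ν T v w) (hb : DB χ κ κ' T v w K) :
    IsSolution χ μ ν κ κ' T p.v₀ p.w₀ p.X v w := by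
  have hd := hp.dat (le_max_left N K) (hb.mono (le_max_right N K))
  refine ⟨⟨?_, ?_⟩, fun t ht => (h t ht).1, fun t ht => (h t ht).2⟩
  · obtain ⟨-, -, A, hA, bA⟩ := estT_forcing_v (χ := χ) (μ := μ) (R := max N K) hκ hκκ' hκ' ν
    refine hb.v.memLExp_of_duhamel (β := -1 - κ) hμ (by linarith) (by linarith) (by linarith)
      (by linarith) (by linarith) (by linarith) (by linarith) hT0 hT hA (by linarith)
      (hd.aemeasurable_F ν hκ hκκ' hκ' hT) (fun s hs => (bA ⟨(hd.diag ⟨hT0, hT⟩, s), hs.1, hs.2.le⟩).1)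
      ?_ fun t ht => (h t ht).1
    rwa [show 1 - κ' - 2 * (5 / 6 - κ') = -2 / 3 + κ' by ring]
  · obtain ⟨-, -, A, hA, bA⟩ := estT_forcing_w (χ := χ) (μ := μ) (R := max N K) hμ hκ hκκ' hκ' ν
    refine hb.w.memLExp_of_duhamel (β := -1 / 2 - 2 * κ) hμ (by linarith) (by linarith) (by linarith)
      (by linarith) (by linarith) (by linarith) (by linarith) hT0 hT hA (by linarith)
      (hd.aemeasurable_G hμ ν hκ hκκ' hκ' hT0 hT)
      (fun s hs => (bA ⟨(hd.diag ⟨hT0, hT⟩, s), hs.1, hs.2.le⟩).1) ?_ fun t ht => (h t ht).2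
    rwa [show 3 / 2 - 2 * κ' - 2 * (1 - κ' + κ) = -1 / 2 - 2 * κ by ring]

lemma MemD.exists_db (hκ : 0 < κ) (hκκ' : κ < κ') (hκ' : κ' < 1 / 18) (h : MemD χ κ κ' T v w) :
    ∃ K, DB χ κ κ' T v w K := by
  obtain ⟨K, hK⟩ := h.1.exists_lb (by linarith)
  obtain ⟨L, hL⟩ := h.2.exists_lb (by linarith)
  exact ⟨max K L, hK.mono (le_max_left _ _), hL.mono (le_max_right _ _)⟩

/-- The constant of comparison between `DB` and `dNorm`. -/
def dConst (κ κ' : ℝ) : ℝ :=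
  (2 ^ (-(1 - κ')) + 2 ^ (-(1 - κ' - 2 * (5 / 6 - κ'))) + 2 ^ (-(1 - κ' - 2 * (1 - κ' / 2)))) +
    (2 ^ (-(3 / 2 - 2 * κ')) + 2 ^ (-(3 / 2 - 2 * κ' - 2 * (1 - κ' + κ)))
      + 2 ^ (-(3 / 2 - 2 * κ' - 2 * (1 - κ'))))

lemma dConst_pos : 0 < dConst κ κ' := by unfold dConst; positivity

lemma DB.dNorm_le (h : DB χ κ κ' T v w K) (hK : 0 ≤ K) :
    dNorm χ κ κ' T v w ≤ ENNReal.ofReal (dConst κ κ' * K) := by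
  rw [dConst, add_mul, ENNReal.ofReal_add (by positivity) (by positivity)]
  exact add_le_add (h.v.lExpNorm_le hK) (h.w.lExpNorm_le hK)

lemma Bd.of_bnorm_le {α : ℝ} {a : Distr} (hα : α ≤ 1) (hK : 0 ≤ K)
    (h : bnorm χ α a ≤ ENNReal.ofReal K) : Bd χ α a (2 * K) := by
  refine ((bnorm_le_iff hK).1 h).mono (mul_le_mul_of_nonneg_right ?_ hK)
  calc (2:ℝ) ^ α ≤ 2 ^ (1:ℝ) := Real.rpow_le_rpow_of_exponent_le one_le_two hα
    _ = 2 := Real.rpow_one 2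

lemma Label.reg_le (hκ : 0 < κ) (l : Label) : l.reg κ ≤ 1 := by
  cases l <;> simp only [Label.reg] <;> linarith

lemma XB.of_driverNorm_le (hκ : 0 < κ) {X : Label → Path} (hK : 0 ≤ K)
    (h : driverNorm χ κ 1 X ≤ ENNReal.ofReal K) : XB χ κ X (2 * K) where
  reg l t h0 h1 := by
    refine Bd.of_bnorm_le (l.reg_le hκ) hK (le_trans ?_ h)
    refine le_trans ?_ le_self_add
    refine le_trans ?_ (Finset.single_le_sum (f := fun l => supNorm χ 1 (Label.reg κ l) (X l))
      (fun _ _ => zero_le) (Finset.mem_univ l))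
    exact le_iSup₂ (f := fun t (_ : t ∈ Set.Icc (0 : ℝ) 1) => bnorm χ (l.reg κ) (X l t)) t ⟨h0, h1⟩
  hold s t h0 h1 h2 := by
    have hd : 0 < (t - s) ^ (1 / 4 - κ / 2) := Real.rpow_pos_of_pos (sub_pos.2 h1) _
    have hst : 0 ≤ s ∧ s < t ∧ t ≤ 1 := ⟨h0, h1, h2⟩
    have k0 : bnorm χ (1 / 2 - κ - 2 * (1 / 4 - κ / 2)) (X .IAAB t - X .IAAB s) /
        ENNReal.ofReal ((t - s) ^ (1 / 4 - κ / 2)) ≤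
        holderNorm χ 1 (1 / 4 - κ / 2) (1 / 2 - κ - 2 * (1 / 4 - κ / 2)) (X .IAAB) :=
      le_iSup_of_le s (le_iSup_of_le t (le_iSup_of_le hst le_rfl))
    have k := k0.trans (le_trans le_add_self h)
    rw [ENNReal.div_le_iff (by simpa using hd) ENNReal.ofReal_ne_top, ← ENNReal.ofReal_mul hK] at k
    exact (Bd.of_bnorm_le (by linarith) (by positivity) k).mono (le_of_eq (by ring))

lemma IsDriver.driverNorm_lt_top (hκ : 0 < κ) {X : Label → Path} (h : IsDriver χ μ κ 1 X) :
    driverNorm χ κ 1 X < ⊤ := by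
  unfold driverNorm
  refine ENNReal.add_lt_top.2 ⟨ENNReal.sum_lt_top.2 fun l _ => ?_, h.2.1.2.2⟩
  obtain ⟨K, hK⟩ := (h.1 l).exists_bd ((l.reg_le hκ).trans (by norm_num))
  exact lt_of_le_of_lt (iSup₂_le fun t ht => bnorm_le_of_bd (hK t ht)) ENNReal.ofReal_lt_top

lemma IsDriver.aemeasurable {X : Label → Path} (h : IsDriver χ μ κ 1 X) (l : Label) :
    AEMeasurable (X l) (volume.restrict (Set.Ioo 0 1)) :=
  (aemeasurable_of_continuousOn measurableSet_Icc
    (continuousOn_coeff (contPath_iff.1 (h.1 l)).2)).mono_measure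
    (Measure.restrict_mono Set.Ioo_subset_Icc_self le_rfl)

end Spaces

end CGL

namespace CGL
open MeasureTheory UnitAddTorus

variable {χ : DyadicPartition}

/-! ### The time of existence -/

section Time
variable {μ κ κ' : ℝ}

/-- The space of initial values and driving vectors. -/
abbrev DataSpace (χ : DyadicPartition) (μ κ κ' : ℝ) : Type :=
  CSpace χ (-2 / 3 + κ') × CSpace χ (-1 / 2 - 2 * κ) × Driver χ μ κ 1

/-- The size of the data. -/
def dataNorm (p : DataSpace χ μ κ κ') : ℝ≥0∞ :=
  bnorm χ (-2 / 3 + κ') p.1.1 + bnorm χ (-1 / 2 - 2 * κ) p.2.1.1 + driverNorm χ κ 1 p.2.2.1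

/-- The underlying initial values and driving vector. -/
def DataSpace.data (p : DataSpace χ μ κ κ') : Data := ⟨p.1.1, p.2.1.1, p.2.2.1⟩

lemma dataNorm_lt_top (hκ : 0 < κ) (hκ' : κ' < 1 / 18) (p : DataSpace χ μ κ κ') : dataNorm p < ⊤ :=
  ENNReal.add_lt_top.2 ⟨ENNReal.add_lt_top.2 ⟨p.1.2.bnorm_lt_top (by linarith),
    p.2.1.2.bnorm_lt_top (by linarith)⟩, p.2.2.2.driverNorm_lt_top hκ⟩

lemma dataNorm_le (p q : DataSpace χ μ κ κ') :
    dataNorm p ≤ dataNorm q + (edist p.1 q.1 + edist p.2.1 q.2.1 + edist p.2.2 q.2.2) := by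
  have h1 := bnorm_add_le χ (-2 / 3 + κ') q.1.1 (p.1.1 - q.1.1)
  have h2 := bnorm_add_le χ (-1 / 2 - 2 * κ) q.2.1.1 (p.2.1.1 - q.2.1.1)
  have h3 := driverNorm_add_le χ κ 1 q.2.2.1 (p.2.2.1 - q.2.2.1)
  rw [add_sub_cancel] at h1 h2 h3
  refine (add_le_add (add_le_add h1 h2) h3).trans (le_of_eq ?_)
  simp only [dataNorm, edist]
  abel

lemma eventually_dataNorm_lt {m : ℝ≥0∞} {q : DataSpace χ μ κ κ'} (hq : dataNorm q < m) :
    ∀ᶠ p in 𝓝 q, dataNorm p < m := by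
  have hc : Continuous fun p : DataSpace χ μ κ κ' =>
      edist p.1 q.1 + edist p.2.1 q.2.1 + edist p.2.2 q.2.2 := by fun_prop
  have h : Filter.Tendsto (fun p : DataSpace χ μ κ κ' =>
      dataNorm q + (edist p.1 q.1 + edist p.2.1 q.2.1 + edist p.2.2 q.2.2)) (𝓝 q) (𝓝 (dataNorm q)) := by
    have := (hc.tendsto q).const_add (dataNorm q)
    simpa using this
  exact (h.eventually (gt_mem_nhds hq)).mono fun p hp => (dataNorm_le p q).trans_lt hp

/-- A continuous time of existence, selected by a partition of unity. -/
lemma exists_continuous_time (hκ : 0 < κ) (hκ' : κ' < 1 / 18) {T₀ : ℕ → ℝ}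
    (h0 : ∀ m, 0 < T₀ m) (h1 : ∀ m, T₀ m ≤ 1) : ∃ T : DataSpace χ μ κ κ' → ℝ, Continuous T ∧
      ∀ p, T p ∈ Set.Ioc (0 : ℝ) 1 ∧ ∃ m : ℕ, dataNorm p < m ∧ T p ≤ T₀ m := by
  have hc : ∀ p : DataSpace χ μ κ κ',
      Convex ℝ {T : ℝ | T ∈ Set.Ioc (0 : ℝ) 1 ∧ ∃ m : ℕ, dataNorm p < m ∧ T ≤ T₀ m} := fun p => by
    refine Set.OrdConnected.convex ⟨fun a ha b hb c hc => ?_⟩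
    obtain ⟨hb1, m, hm, hbm⟩ := hb
    exact ⟨⟨ha.1.1.trans_le hc.1, hc.2.trans hb1.2⟩, m, hm, hc.2.trans hbm⟩
  obtain ⟨g, hg⟩ := exists_continuous_forall_mem_convex_of_local_const hc fun p => by
    obtain ⟨m, hm⟩ := ENNReal.exists_nat_gt (dataNorm_lt_top hκ hκ' p).ne
    exact ⟨T₀ m, (eventually_dataNorm_lt hm).mono fun q hq => ⟨⟨h0 m, h1 m⟩, m, hq, le_rfl⟩⟩
  exact ⟨g, g.continuous, hg⟩

lemma DataSpace.ok (hκ : 0 < κ) (hκ' : κ' < 1 / 18) {p : DataSpace χ μ κ κ'} {m : ℕ}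
    (h : dataNorm p < m) : p.data.Ok χ μ κ κ' (2 * m) := by
  have h' : dataNorm p ≤ ENNReal.ofReal (m : ℝ) := by rw [ENNReal.ofReal_natCast]; exact h.le
  have hm : (0:ℝ) ≤ m := Nat.cast_nonneg m
  exact {
    v₀ := .of_bnorm_le (by linarith) hm ((le_self_add.trans le_self_add).trans h')
    w₀ := .of_bnorm_le (by linarith) hm ((le_add_self.trans le_self_add).trans h')
    X := .of_driverNorm_le hκ hm (le_add_self.trans h')
    meas := p.2.2.2.aemeasurable
    aa := p.2.2.2.2.2.1
    ab := p.2.2.2.2.2.2 }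

lemma DataSpace.near (hκ : 0 < κ) (hκ' : κ' < 1 / 18) {p q : DataSpace χ μ κ κ'} {E : ℝ} (hE : 0 ≤ E)
    (h : edist p q ≤ ENNReal.ofReal E) : p.data.Near χ κ κ' (2 * E) q.data where
  v₀ := .of_bnorm_le (by linarith) hE ((le_max_left (edist p.1 q.1) (edist p.2 q.2)).trans h)
  w₀ := .of_bnorm_le (by linarith) hE
    ((le_max_left (edist p.2.1 q.2.1) (edist p.2.2 q.2.2)).trans
      ((le_max_right (edist p.1 q.1) (edist p.2 q.2)).trans h))
  X := .of_driverNorm_le hκ hE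
    ((le_max_right (edist p.2.1 q.2.1) (edist p.2.2 q.2.2)).trans
      ((le_max_right (edist p.1 q.1) (edist p.2 q.2)).trans h))

/-- Solutions on `[0,T]` agree with small fixed points on `[0,t]`, hence are small. -/
lemma IsSolution.db (hμ : 0 < μ) (hκ : 0 < κ) (hκκ' : κ < κ') (hκ' : κ' < 1 / 18) {ν : ℂ}
    {p : Data} {T t N K : ℝ} {v w v' w' : Path} (h : IsSolution χ μ ν κ κ' T p.v₀ p.w₀ p.X v w)
    (ht0 : 0 < t) (htT : t ≤ T) (hT : t ≤ 1) (hp : p.Ok χ μ κ κ' N) (h' : p.IsFixed χ μ ν t v' w')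
    (hb : DB χ κ κ' t v' w' K) : p.IsFixed χ μ ν t v w ∧ (∀ s ∈ Set.Icc 0 t, v s = v' s ∧ w s = w' s) ∧
      DB χ κ κ' t v w K := by
  obtain ⟨L, hL⟩ := h.1.exists_db hκ hκκ' hκ'
  have hf : p.IsFixed χ μ ν t v w := fun s hs =>
    ⟨h.2.1 s ⟨hs.1, hs.2.trans htT⟩, h.2.2 s ⟨hs.1, hs.2.trans htT⟩⟩
  have he := hf.unique hμ hκ hκκ' hκ' ht0 hT hp (hL.restrict htT) hb h'
  exact ⟨hf, he, hb.congr (fun s hs => (he s hs).1) fun s hs => (he s hs).2⟩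

end Time

end CGL

end

theorem mainTheorem7 (χ : CGL.DyadicPartition) (μ : ℝ) (hμ : 0 < μ) (ν : ℂ) (κ κ' : ℝ)
    (hκ : 0 < κ) (hκκ' : κ < κ') (hκ' : κ' < 1 / 18) :
    ∃ Tst : CGL.CSpace χ (-2 / 3 + κ') × CGL.CSpace χ (-1 / 2 - 2 * κ) × CGL.Driver χ μ κ 1 → ℝ,
      Continuous Tst ∧ (∀ p, Tst p ∈ Set.Ioc (0 : ℝ) 1) ∧
      -- (1) existence, uniqueness and the a priori bound
      (∃ C : ℝ → ℝ → ℝ, (∀ a b, 0 < C a b) ∧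
        ∀ (v₀ : CGL.CSpace χ (-2 / 3 + κ')) (w₀ : CGL.CSpace χ (-1 / 2 - 2 * κ))
          (X : CGL.Driver χ μ κ 1),
          ∃ v w : CGL.Path,
            CGL.IsSolution χ μ ν κ κ' (Tst (v₀, w₀, X)) v₀.1 w₀.1 X.1 v w ∧
            (∀ v' w' : CGL.Path,
              CGL.IsSolution χ μ ν κ κ' (Tst (v₀, w₀, X)) v₀.1 w₀.1 X.1 v' w' →
              Set.EqOn v' v (Set.Icc 0 (Tst (v₀, w₀, X))) ∧
                Set.EqOn w' w (Set.Icc 0 (Tst (v₀, w₀, X)))) ∧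
            CGL.dNorm χ κ κ' (Tst (v₀, w₀, X)) v w ≤
              ENNReal.ofReal (C (Tst (v₀, w₀, X)) (CGL.driverNorm χ κ 1 X.1).toReal) *
                (1 + CGL.bnorm χ (-2 / 3 + κ') v₀.1 + CGL.bnorm χ (-1 / 2 - 2 * κ) w₀.1)) ∧
      -- (2) continuous dependence on the initial data and on the driving vector
      (∀ (v₀ : CGL.CSpace χ (-2 / 3 + κ')) (w₀ : CGL.CSpace χ (-1 / 2 - 2 * κ))
          (X : CGL.Driver χ μ κ 1)
          (v₀s : ℕ → CGL.CSpace χ (-2 / 3 + κ')) (w₀s : ℕ → CGL.CSpace χ (-1 / 2 - 2 * κ))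
          (Xs : ℕ → CGL.Driver χ μ κ 1),
          Filter.Tendsto v₀s Filter.atTop (nhds v₀) →
          Filter.Tendsto w₀s Filter.atTop (nhds w₀) →
          Filter.Tendsto Xs Filter.atTop (nhds X) →
          ∀ (v w : CGL.Path) (vs ws : ℕ → CGL.Path),
            CGL.IsSolution χ μ ν κ κ' (Tst (v₀, w₀, X)) v₀.1 w₀.1 X.1 v w →
            (∀ n, CGL.IsSolution χ μ ν κ κ' (Tst (v₀s n, w₀s n, Xs n))
              (v₀s n).1 (w₀s n).1 (Xs n).1 (vs n) (ws n)) →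
            ∀ t : ℝ, 0 < t → t < Tst (v₀, w₀, X) →
              Filter.Tendsto (fun n => CGL.dNorm χ κ κ' t (vs n - v) (ws n - w))
                Filter.atTop (nhds 0)) := by
  obtain ⟨C, hC, hloc⟩ := CGL.exists_local_solution χ hμ hκ hκκ' hκ' ν
  choose T₀ hT₀ hT₁ hex hst using fun m : ℕ => hloc (2 * m) (by positivity)
  obtain ⟨Tst, hcont, hTst⟩ := CGL.exists_continuous_time (χ := χ) (μ := μ) hκ hκ' hT₀ hT₁
  have hd := CGL.dConst_pos (κ := κ) (κ' := κ')
  refine ⟨Tst, hcont, fun p => (hTst p).1, ⟨fun _ _ => CGL.dConst κ κ' * (2 * C + 1),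
    fun _ _ => by positivity, fun v₀ w₀ X => ?_⟩, ?_⟩
  · obtain ⟨⟨hT, hT1⟩, m, hm, hTm⟩ := hTst (v₀, w₀, X)
    have hok := CGL.DataSpace.ok hκ hκ' hm
    obtain ⟨v, w, hfix, hb, hB⟩ := hex m _ _ hT hTm hok
    refine ⟨v, w, hfix.isSolution hμ hκ hκκ' hκ' hT hT1 hok v₀.2 w₀.2 hb, fun v' w' h' => ?_, ?_⟩
    · have he := (CGL.IsSolution.db (p := CGL.DataSpace.data (v₀, w₀, X)) hμ hκ hκκ' hκ' h' hT le_rfl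
        hT1 hok hfix hb).2.1
      exact ⟨fun t ht => (he t ht).1, fun t ht => (he t ht).2⟩
    · have hv := v₀.2.bnorm_lt_top (by linarith)
      have hw := w₀.2.bnorm_lt_top (by linarith)
      set a := (CGL.bnorm χ (-2 / 3 + κ') v₀.1).toReal with ha
      set b := (CGL.bnorm χ (-1 / 2 - 2 * κ) w₀.1).toReal with hb'
      have ha0 : 0 ≤ a := ENNReal.toReal_nonneg
      have hb0 : 0 ≤ b := ENNReal.toReal_nonneg
      have hva : CGL.bnorm χ (-2 / 3 + κ') v₀.1 = ENNReal.ofReal a := (ENNReal.ofReal_toReal hv.ne).symm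
      have hwb : CGL.bnorm χ (-1 / 2 - 2 * κ) w₀.1 = ENNReal.ofReal b :=
        (ENNReal.ofReal_toReal hw.ne).symm
      have h1 := hB (2 * (a + b))
        ((CGL.Bd.of_bnorm_le (by linarith) ha0 hva.le).mono (by linarith))
        ((CGL.Bd.of_bnorm_le (by linarith) hb0 hwb.le).mono (by linarith))
      refine (h1.dNorm_le (by positivity)).trans ?_
      rw [hva, hwb, ← ENNReal.ofReal_one, ← ENNReal.ofReal_add zero_le_one ha0,
        ← ENNReal.ofReal_add (by positivity) hb0, ← ENNReal.ofReal_mul (by positivity)]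
      refine ENNReal.ofReal_le_ofReal ?_
      rw [mul_assoc]
      refine mul_le_mul_of_nonneg_left ?_ hd.le
      nlinarith
  · intro v₀ w₀ X v₀s w₀s Xs hv₀ hw₀ hX v w vs ws hsol hsols t ht0 htT
    obtain ⟨⟨hT, hT1⟩, m, hm, hTm⟩ := hTst (v₀, w₀, X)
    have ht1 : t ≤ 1 := htT.le.trans hT1
    have htm : t ≤ T₀ m := htT.le.trans hTm
    have hconv : Filter.Tendsto (fun n => (v₀s n, w₀s n, Xs n)) Filter.atTop (nhds (v₀, w₀, X)) :=
      hv₀.prodMk_nhds (hw₀.prodMk_nhds hX)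
    -- the solutions are small on `[0,t]`, as they agree with small fixed points
    have hsmall : ∀ (p : CGL.DataSpace χ μ κ κ') (T : ℝ) (v w : CGL.Path), CGL.dataNorm p < m → t ≤ T →
        CGL.IsSolution χ μ ν κ κ' T p.1.1 p.2.1.1 p.2.2.1 v w →
        (CGL.DataSpace.data p).IsFixed χ μ ν t v w ∧
          CGL.DB χ κ κ' t v w (C * (2 * m) + 2 * m + 1) := by
      intro p T v w hp htT h
      have hok := CGL.DataSpace.ok hκ hκ' hp
      obtain ⟨v', w', hfix, hb, -⟩ := hex m t _ ht0 htm hok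
      have := CGL.IsSolution.db (p := CGL.DataSpace.data p) hμ hκ hκκ' hκ' h ht0 htT ht1 hok hfix hb
      exact ⟨this.1, this.2.2⟩
    obtain ⟨hf, hb⟩ := hsmall (v₀, w₀, X) _ v w hm htT.le hsol
    refine ENNReal.tendsto_nhds_zero.2 fun ε hε => ?_
    obtain ⟨r, hr, hrε⟩ := ENNReal.lt_iff_exists_nnreal_btwn.1 hε
    have hr0 : (0:ℝ) < r := by exact_mod_cast hr
    set E : ℝ := r / (CGL.dConst κ κ' * ((2 * C + 2) * 2)) with hE
    have hE0 : 0 < E := by positivity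
    filter_upwards [hconv.eventually (CGL.eventually_dataNorm_lt hm),
      ((hcont.tendsto _).comp hconv).eventually (lt_mem_nhds htT),
      (EMetric.tendsto_nhds.1 hconv) (ENNReal.ofReal E) (by simpa using hE0)] with n h1 h2 h3
    obtain ⟨hfn, hbn⟩ := hsmall (v₀s n, w₀s n, Xs n) _ (vs n) (ws n) h1 (le_of_lt h2) (hsols n)
    have h4 := hst m t (2 * E) _ _ (vs n) (ws n) v w ht0 htm (by positivity)
      (CGL.DataSpace.ok hκ hκ' h1) (CGL.DataSpace.ok hκ hκ' hm) hfn hf hbn hb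
      (CGL.DataSpace.near hκ hκ' hE0.le h3.le)
    refine (h4.dNorm_le (by positivity)).trans (le_trans (le_of_eq ?_) hrε.le)
    rw [show CGL.dConst κ κ' * ((2 * C + 2) * (2 * E)) = r by rw [hE]; field_simp,
      ENNReal.ofReal_coe_nnreal]
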